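/- There are an absolute constant $c$ and a single randomized algorithm with the following property. Let $n\ge 2$ and $k\ge 1$ be integers, and let $G=(V,E,\ell)$ be a finite simple undirected graph with $n$ vertices, $m$ edges and a real length $\ell(e)>0$ for every edge $e$. Given $n$, $k$ and the adjacency lists of $G$ with the edge lengths (each list in arbitrary order), the algorithm always halts, and its expected running time, over its own coin flips, is at most $$c\,\bigl(k\,n^{1+1/k}\log n+m\log n\bigr).$$ If $G$ contains a cycle, then for every outcome of the coin flips the algorithm outputs (as a sequence of vertices) a simple cycle $C$ of $G$ whose length satisfies $$\ell(C)=\sum_{e\in C}\ell(e)\;\le\;\frac{4k}{3}\,g,$$ where the girth $g$ is the minimum length of a simple cycle of $G$. Running time is counted on a randomized real RAM with memory initialized to zero: a fixed program (independent of $n$, $k$ and $G$) works with words of $O(\log(n+k))$ bits and with real numbers; each of the following takes one step: moving, loading or storing a word or a real, $+,-,\times,\lfloor\cdot/\cdot\rfloor$ and comparison of words, addition, subtraction and comparison of reals, and one fair coin flip. No other operation on reals is available. -/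

import Mathlib

open MeasureTheory

noncomputable section

/-! ## A randomized real RAM

Word cells hold natural numbers below the word capacity `W`; real cells hold real numbers, which
can only be moved, added, subtracted and compared. A program is a fixed finite text in a structured
imperative language. Every elementary instruction and every evaluation of a test costs one step. -/

namespace RealRAM

/-- A configuration: word registers, real registers, word arrays, real arrays, and the infinite
sequence of coin flips that have not been consumed yet. A program mentions finitely many
registers and arrays; each array is an unbounded memory addressed by words. -/
structure State where
  wreg : ℕ → ℕ
  rreg : ℕ → ℝ
  warr : ℕ → ℕ → ℕ
  rarr : ℕ → ℕ → ℝ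
  coins : ℕ → Bool

/-- Word operations. -/
inductive WordOp where
  | add | sub | mul | div

/-- Subtraction is truncated at `0`; division rounds down, and division by `0` gives `0`. -/
def WordOp.eval : WordOp → ℕ → ℕ → ℕ
  | .add, x, y => x + y
  | .sub, x, y => x - y
  | .mul, x, y => x * y
  | .div, x, y => x / y

/-- The elementary instructions; the first index is the destination. -/
inductive Instr where
  /-- do nothing -/
  | skip
  /-- word register `r := c`, for a constant `c` of the program -/
  | wconst (r c : ℕ)
  /-- word register `r := a` -/
  | wmove (r a : ℕ)
  /-- word register `r := a op b`, for word registers `a`, `b` -/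
  | wop (op : WordOp) (r a b : ℕ)
  /-- word register `r := A[i]`, for a word array `A` and a word register `i` -/
  | wload (r A i : ℕ)
  /-- word array `A[i] := r` -/
  | wstore (A i r : ℕ)
  /-- real register `x := y` -/
  | rmove (x y : ℕ)
  /-- real register `x := y + z` -/
  | radd (x y z : ℕ)
  /-- real register `x := y - z` -/
  | rsub (x y z : ℕ)
  /-- real register `x := A[i]`, for a real array `A` and a word register `i` -/
  | rload (x A i : ℕ)
  /-- real array `A[i] := x` -/
  | rstore (A i x : ℕ)
  /-- word register `r :=` the next fair coin flip, `0` or `1` -/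
  | flip (r : ℕ)

/-- The effect of an elementary instruction. -/
def Instr.apply (s : State) : Instr → State
  | .skip => s
  | .wconst r c => { s with wreg := Function.update s.wreg r c }
  | .wmove r a => { s with wreg := Function.update s.wreg r (s.wreg a) }
  | .wop op r a b => { s with wreg := Function.update s.wreg r (op.eval (s.wreg a) (s.wreg b)) }
  | .wload r A i => { s with wreg := Function.update s.wreg r (s.warr A (s.wreg i)) }
  | .wstore A i r =>
      { s with warr := Function.update s.warr A
                (Function.update (s.warr A) (s.wreg i) (s.wreg r)) }
  | .rmove x y => { s with rreg := Function.update s.rreg x (s.rreg y) }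
  | .radd x y z => { s with rreg := Function.update s.rreg x (s.rreg y + s.rreg z) }
  | .rsub x y z => { s with rreg := Function.update s.rreg x (s.rreg y - s.rreg z) }
  | .rload x A i => { s with rreg := Function.update s.rreg x (s.rarr A (s.wreg i)) }
  | .rstore A i x =>
      { s with rarr := Function.update s.rarr A
                (Function.update (s.rarr A) (s.wreg i) (s.rreg x)) }
  | .flip r =>
      { s with wreg := Function.update s.wreg r (s.coins 0).toNat
               coins := fun j => s.coins (j + 1) }

/-- The instruction does not overflow: the word that it computes is below the capacity `W`. -/
def Instr.Fits (W : ℕ) (s : State) : Instr → Prop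
  | .wconst _ c => c < W
  | .wop op _ a b => op.eval (s.wreg a) (s.wreg b) < W
  | .flip _ => 1 < W
  | _ => True

/-- Tests on registers. -/
inductive Test where
  /-- equality of two word registers -/
  | weq (a b : ℕ)
  /-- strict comparison of two word registers -/
  | wlt (a b : ℕ)
  /-- strict comparison of two real registers -/
  | rlt (x y : ℕ)

/-- The test succeeds. -/
def Test.Holds (s : State) : Test → Prop
  | .weq a b => s.wreg a = s.wreg b
  | .wlt a b => s.wreg a < s.wreg b
  | .rlt x y => s.rreg x < s.rreg y

/-- Programs. -/
inductive Prog where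
  | instr (i : Instr)
  | seq (P Q : Prog)
  | ite (b : Test) (P Q : Prog)
  | loop (b : Test) (P : Prog)

/-- `Exec W P s t s'`: with word capacity `W`, the program `P` started in `s` halts in `s'`
after exactly `t` steps, without overflow. (`loop b P` is "while `b` do `P`".) A computation that
overflows gets stuck, so it does not halt. -/
inductive Exec (W : ℕ) : Prog → State → ℕ → State → Prop where
  | instr (i : Instr) (s : State) (h : i.Fits W s) : Exec W (.instr i) s 1 (i.apply s)
  | seq {P Q : Prog} {s s' s'' : State} {t u : ℕ} (hP : Exec W P s t s') (hQ : Exec W Q s' u s'') :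
      Exec W (.seq P Q) s (t + u) s''
  | ite_true {b : Test} {P Q : Prog} {s s' : State} {t : ℕ} (hb : b.Holds s)
      (hP : Exec W P s t s') : Exec W (.ite b P Q) s (t + 1) s'
  | ite_false {b : Test} {P Q : Prog} {s s' : State} {t : ℕ} (hb : ¬ b.Holds s)
      (hQ : Exec W Q s t s') : Exec W (.ite b P Q) s (t + 1) s'
  | loop_false {b : Test} {P : Prog} {s : State} (hb : ¬ b.Holds s) :
      Exec W (.loop b P) s 1 s
  | loop_true {b : Test} {P : Prog} {s s' s'' : State} {t u : ℕ} (hb : b.Holds s)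
      (hP : Exec W P s t s') (hL : Exec W (.loop b P) s' u s'') :
      Exec W (.loop b P) s (t + u + 1) s''

/-- The law of an infinite sequence of independent fair coin flips. -/
def coinMeasure : Measure (ℕ → Bool) :=
  Measure.infinitePi fun _ => (PMF.uniformOfFintype Bool).toMeasure

end RealRAM

/-! ## Weighted graphs -/

namespace WeightedGraph

variable {V : Type*} {G : SimpleGraph V}

/-- The length of a walk: the sum of the lengths of its edges. -/
def walkLength (ℓ : Sym2 V → ℝ) {u v : V} (p : G.Walk u v) : ℝ :=
  (p.edges.map ℓ).sum

/-- The weighted girth: the least length of a simple cycle (on a graph with a cycle). -/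
def girth (G : SimpleGraph V) (ℓ : Sym2 V → ℝ) : ℝ :=
  sInf {x : ℝ | ∃ (v : V) (C : G.Walk v v), C.IsCycle ∧ walkLength ℓ C = x}

/-- `nbrs` lists, for every vertex, its neighbours without repetition, in an arbitrary order. -/
structure IsAdjacencyList (G : SimpleGraph V) (nbrs : V → List V) : Prop where
  nodup : ∀ u, (nbrs u).Nodup
  mem_iff : ∀ u v, v ∈ nbrs u ↔ G.Adj u v

/-- The start configuration for a graph on the vertices `0, …, n - 1` and the parameter `k`.
Word registers `0` and `1` hold `n` and `k`. The adjacency lists are concatenated in word array `1`,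
with the corresponding edge lengths in real array `0`; entry `u ≤ n` of word array `0` is the
position in them at which the list of `u` starts (for `u = n`, the total length). All other cells
are `0`. -/
def input (n k : ℕ) (ℓ : Sym2 (Fin n) → ℝ) (nbrs : Fin n → List (Fin n)) (ω : ℕ → Bool) :
    RealRAM.State where
  wreg r := if r = 0 then n else if r = 1 then k else 0
  rreg _ := 0
  warr A i :=
    if A = 0 then
      if i ≤ n then (((List.finRange n).take i).flatMap nbrs).length else 0
    else if A = 1 then
      (((List.finRange n).flatMap nbrs).map Fin.val).getD i 0
    else 0
  rarr A i :=
    if A = 0 then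
      ((List.finRange n).flatMap fun u => (nbrs u).map fun v => ℓ s(u, v)).getD i 0
    else 0
  coins := ω

/-- The configuration `s` presents the closed walk `C` as output: its number of edges in word
register `0`, and its successive vertices in word array `0`. -/
def Outputs {n : ℕ} {G : SimpleGraph (Fin n)} (s : RealRAM.State) {v : Fin n} (C : G.Walk v v) :
    Prop :=
  s.wreg 0 = C.length ∧ ∀ i < C.length, s.warr 0 i = (C.getVert i : ℕ)

end WeightedGraph

end

noncomputable section

set_option linter.unusedSimpArgs false

namespace RealRAM

/-! ### Weakest preconditions with step counts, and frames -/

/-! Every vertex receives a random level below K = `numLevels n k` = min(k, ⌊log₂ n⌋ + 1). It has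
level at least i, for i < K, with probability 2^(-ij), where j = `flipsPerLevel n k` and 2^j is of
the order of n^(1/k). The levels are processed downwards with a bound B, which is the starting value
or an upper bound for the length of the cycle stored so far. From each vertex w of level i a
Dijkstra search is run with two restrictions: it enters x only at a distance below `dh x`, the
recorded distance of x from the levels above i, and only within the radius B / 2. An admissible edge
between two visited vertices that is not a tree edge closes a cycle; it lowers B and ends the
search. The first round of searches also records, for each vertex u, a pivot `pw u`, the nearest
start of a search that reached it. The second round reads the whole list of u in the search from `pw
u` and tries every non-tree edge from u to a visited vertex.

Approximation. Fix a cycle of length g. If a vertex of level at least i is at distance at most δ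
from the cycle and 2(δ + 2g/3) < B still holds after level i, then a vertex of level at least i + 1
is at distance at most δ + 2g/3 (`Net.Step`, `Net.step_of_runs`). Otherwise the search is not pruned
anywhere around the cycle. If no edge is longer than g/3, each edge of the cycle can be traversed
within 2g/3 in one of the two directions, so the whole cycle lies in the search tree, which
`Net.Cyc.exists_nontree` excludes. If some edge has length at least g/3, the argument is run from
one of its ends along the rest of the cycle, of length at most 2g/3; the heavy edge itself is then
tried in the second round and gives B ≤ 2δ + g. Starting with δ = 0 at level 0, K such steps would
produce a vertex of level K, and there is none. Hence B ≤ (4K/3) g at the end (`Net.le_of_steps`).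
The starting value of B is (2K + 1) S, where S is the sum of all list entries. As g ≤ S and 4K/3 <
2K + 1, the bound has been lowered if there is a cycle, so a cycle is stored. `Climb` turns a
closing edge into a simple cycle.

Running time. The lists are sorted by length, and a tournament tree over all entries p holds the
slacks len p - dh (adj p). So the next admissible entry of a list is found in logarithmic time,
however many inadmissible ones are skipped (`wp_findNext`, `wp_advance`). A second tournament tree
is the priority queue. Each event of a search visits a new vertex or is the last one, so a search
costs O(log n) per visited vertex. The visited vertices other than the root lie in the cluster of w,
the set of the vertices closer to w than to all vertices of higher level. The other work is linear
in the input size for each of the at most ⌊log₂ n⌋ + 1 levels, plus logarithmic factors in the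
preparation. This bounds the time for every outcome of the coins (`wp_program`); the only
probabilistic fact is that the cluster sizes sum to at most n K 2^j in expectation
(`lintegral_sum_card_cluster_le`). -/

/-- `P` started in `s` halts, in a number of steps and a final state that satisfy `Q`. -/
def wp (W : ℕ) (P : Prog) (Q : ℕ → State → Prop) (s : State) : Prop :=
  ∃ t s', Exec W P s t s' ∧ Q t s'

def Instr.writesW : Instr → ℕ → Bool
  | .wconst r _, q => r == q
  | .wmove r _, q => r == q
  | .wop _ r _ _, q => r == q
  | .wload r _ _, q => r == q
  | .flip r, q => r == q
  | _, _ => false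

def Instr.writesR : Instr → ℕ → Bool
  | .rmove x _, q => x == q
  | .radd x _ _, q => x == q
  | .rsub x _ _, q => x == q
  | .rload x _ _, q => x == q
  | _, _ => false

def Instr.writesWA : Instr → ℕ → Bool
  | .wstore A _ _, q => A == q
  | _, _ => false

def Instr.writesRA : Instr → ℕ → Bool
  | .rstore A _ _, q => A == q
  | _, _ => false

def Instr.flips : Instr → Bool
  | .flip _ => true
  | _ => false

def Prog.writesW : Prog → ℕ → Bool
  | .instr i, q => i.writesW q
  | .seq P Q, q => P.writesW q || Q.writesW q
  | .ite _ P Q, q => P.writesW q || Q.writesW q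
  | .loop _ P, q => P.writesW q

def Prog.writesR : Prog → ℕ → Bool
  | .instr i, q => i.writesR q
  | .seq P Q, q => P.writesR q || Q.writesR q
  | .ite _ P Q, q => P.writesR q || Q.writesR q
  | .loop _ P, q => P.writesR q

def Prog.writesWA : Prog → ℕ → Bool
  | .instr i, q => i.writesWA q
  | .seq P Q, q => P.writesWA q || Q.writesWA q
  | .ite _ P Q, q => P.writesWA q || Q.writesWA q
  | .loop _ P, q => P.writesWA q

def Prog.writesRA : Prog → ℕ → Bool
  | .instr i, q => i.writesRA q
  | .seq P Q, q => P.writesRA q || Q.writesRA q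
  | .ite _ P Q, q => P.writesRA q || Q.writesRA q
  | .loop _ P, q => P.writesRA q

def Prog.flips : Prog → Bool
  | .instr i => i.flips
  | .seq P Q => P.flips || Q.flips
  | .ite _ P Q => P.flips || Q.flips
  | .loop _ P => P.flips

/-- `s'` agrees with `s` on everything that `P` never writes. -/
structure Frame (P : Prog) (s s' : State) : Prop where
  w : ∀ r, (_ : P.writesW r = false := by rfl) → s'.wreg r = s.wreg r
  r : ∀ r, (_ : P.writesR r = false := by rfl) → s'.rreg r = s.rreg r
  wa : ∀ A, (_ : P.writesWA A = false := by rfl) → s'.warr A = s.warr A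
  ra : ∀ A, (_ : P.writesRA A = false := by rfl) → s'.rarr A = s.rarr A
  coins : (_ : P.flips = false := by rfl) → s'.coins = s.coins

theorem Frame.refl (P : Prog) (s : State) : Frame P s s :=
  ⟨fun _ _ => rfl, fun _ _ => rfl, fun _ _ => rfl, fun _ _ => rfl, fun _ => rfl⟩

theorem Frame.trans {P : Prog} {s s' s'' : State} (h : Frame P s s') (h' : Frame P s' s'') :
    Frame P s s'' :=
  ⟨fun r hr => (h'.w r hr).trans (h.w r hr), fun r hr => (h'.r r hr).trans (h.r r hr),
    fun r hr => (h'.wa r hr).trans (h.wa r hr), fun r hr => (h'.ra r hr).trans (h.ra r hr),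
    fun hr => (h'.coins hr).trans (h.coins hr)⟩

theorem Frame.of_writes {P P' : Prog} {s s' : State} (h : Frame P s s')
    (hw : ∀ r, P'.writesW r = false → P.writesW r = false)
    (hr : ∀ r, P'.writesR r = false → P.writesR r = false)
    (hwa : ∀ r, P'.writesWA r = false → P.writesWA r = false)
    (hra : ∀ r, P'.writesRA r = false → P.writesRA r = false)
    (hc : P'.flips = false → P.flips = false) : Frame P' s s' :=
  ⟨fun r h' => h.w r (hw r h'), fun r h' => h.r r (hr r h'), fun r h' => h.wa r (hwa r h'),
    fun r h' => h.ra r (hra r h'), fun h' => h.coins (hc h')⟩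

theorem Instr.frame (i : Instr) (s : State) : Frame (.instr i) s (i.apply s) := by
  constructor
  · intro q hq
    cases i <;> simp [Prog.writesW, Instr.writesW, Instr.apply] at hq ⊢ <;>
      rw [Function.update_of_ne (Ne.symm hq)]
  · intro q hq
    cases i <;> simp [Prog.writesR, Instr.writesR, Instr.apply] at hq ⊢ <;>
      rw [Function.update_of_ne (Ne.symm hq)]
  · intro q hq
    cases i <;> simp [Prog.writesWA, Instr.writesWA, Instr.apply] at hq ⊢
    rw [Function.update_of_ne (Ne.symm hq)]
  · intro q hq
    cases i <;> simp [Prog.writesRA, Instr.writesRA, Instr.apply] at hq ⊢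
    rw [Function.update_of_ne (Ne.symm hq)]
  · intro hq
    cases i <;> simp [Prog.flips, Instr.flips, Instr.apply] at hq ⊢

/-- A cell that the program text never names as a destination cannot change, whatever the loops do.
For concrete programs the conditions in `Frame` are closed Boolean computations, which `rfl` settles
by default. -/
theorem Exec.frame {W : ℕ} {P : Prog} {s s' : State} {t : ℕ} (h : Exec W P s t s') :
    Frame P s s' := by
  induction h with
  | instr i s h => exact i.frame s
  | seq hP hQ ihP ihQ =>
    refine (ihP.of_writes ?_ ?_ ?_ ?_ ?_).trans (ihQ.of_writes ?_ ?_ ?_ ?_ ?_) <;>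
      simp +contextual [Prog.writesW, Prog.writesR, Prog.writesWA, Prog.writesRA, Prog.flips]
  | ite_true hb hP ih =>
    refine ih.of_writes ?_ ?_ ?_ ?_ ?_ <;>
      simp +contextual [Prog.writesW, Prog.writesR, Prog.writesWA, Prog.writesRA, Prog.flips]
  | ite_false hb hP ih =>
    refine ih.of_writes ?_ ?_ ?_ ?_ ?_ <;>
      simp +contextual [Prog.writesW, Prog.writesR, Prog.writesWA, Prog.writesRA, Prog.flips]
  | loop_false hb => exact Frame.refl _ _
  | loop_true hb hP hL ihP ihL =>
    refine (ihP.of_writes ?_ ?_ ?_ ?_ ?_).trans ihL <;>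
      simp [Prog.writesW, Prog.writesR, Prog.writesWA, Prog.writesRA, Prog.flips]

variable {W : ℕ}

theorem wp.mono {P : Prog} {Q Q' : ℕ → State → Prop} {s : State} (h : wp W P Q s)
    (hQ : ∀ t s', Frame P s s' → Q t s' → Q' t s') : wp W P Q' s := by
  obtain ⟨t, s', he, hq⟩ := h
  exact ⟨t, s', he, hQ t s' he.frame hq⟩

-- This equivalence, `wp_seq` and `wp_ite` turn symbolic execution into rewriting: straight-line
-- code is evaluated by `simp`, and only loops need invariants.
@[simp] theorem wp_instr (i : Instr) (Q : ℕ → State → Prop) (s : State) :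
    wp W (.instr i) Q s ↔ i.Fits W s ∧ Q 1 (i.apply s) := by
  constructor
  · rintro ⟨t, s', he, hq⟩
    cases he with
    | instr i s h => exact ⟨h, hq⟩
  · rintro ⟨h, hq⟩
    exact ⟨1, _, .instr i s h, hq⟩

@[simp] theorem wp_seq (P P' : Prog) (Q : ℕ → State → Prop) (s : State) :
    wp W (.seq P P') Q s ↔ wp W P (fun t s' => wp W P' (fun u => Q (t + u)) s') s := by
  constructor
  · rintro ⟨t, s', he, hq⟩
    cases he with
    | seq h h' => exact ⟨_, _, h, _, _, h', hq⟩
  · rintro ⟨t, s', h, u, s'', h', hq⟩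
    exact ⟨_, _, .seq h h', hq⟩

@[simp] theorem wp_ite (b : Test) (P P' : Prog) (Q : ℕ → State → Prop) (s : State) :
    wp W (.ite b P P') Q s ↔ (b.Holds s → wp W P (fun t => Q (t + 1)) s) ∧
      (¬ b.Holds s → wp W P' (fun t => Q (t + 1)) s) := by
  constructor
  · rintro ⟨t, s', he, hq⟩
    cases he with
    | ite_true hb h => exact ⟨fun _ => ⟨_, _, h, hq⟩, fun h' => absurd hb h'⟩
    | ite_false hb h => exact ⟨fun h' => absurd h' hb, fun _ => ⟨_, _, h, hq⟩⟩
  · rintro ⟨h1, h2⟩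
    by_cases hb : b.Holds s
    · obtain ⟨t, s', h, hq⟩ := h1 hb
      exact ⟨_, _, .ite_true hb h, hq⟩
    · obtain ⟨t, s', h, hq⟩ := h2 hb
      exact ⟨_, _, .ite_false hb h, hq⟩

/-- Loops: the invariant carries a potential that pays for all steps. -/
theorem wp_loop {b : Test} {P : Prog} {s₀ : State} (I : ℕ → State → Prop) (φ : ℕ) (h₀ : I φ s₀)
    (hb : ∀ φ s, I φ s → Frame (.loop b P) s₀ s → b.Holds s →
      wp W P (fun t s' => ∃ φ', I φ' s' ∧ t + 1 + φ' ≤ φ) s) :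
    wp W (.loop b P)
      (fun t s' => ∃ φ', I φ' s' ∧ ¬ b.Holds s' ∧ t + φ' ≤ φ + 1) s₀ := by
  suffices H : ∀ φ s, I φ s → Frame (.loop b P) s₀ s → wp W (.loop b P)
      (fun t s' => ∃ φ', I φ' s' ∧ ¬ b.Holds s' ∧ t + φ' ≤ φ + 1) s from
    H φ s₀ h₀ (Frame.refl _ _)
  intro φ
  -- The potential drops strictly in each round because the test alone costs a step, so termination
  -- and the time bound come from the same induction.
  induction φ using Nat.strong_induction_on with
  | _ φ ih =>
    intro s hI hF
    by_cases hs : b.Holds s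
    · obtain ⟨t, s', he, φ', hI', hφ⟩ := hb φ s hI hF hs
      have hF' : Frame (.loop b P) s s' := he.frame.of_writes (by simp [Prog.writesW])
        (by simp [Prog.writesR]) (by simp [Prog.writesWA]) (by simp [Prog.writesRA])
        (by simp [Prog.flips])
      obtain ⟨u, s'', he', φ'', hI'', hb'', hφ''⟩ := ih φ' (by omega) s' hI' (hF.trans hF')
      exact ⟨_, _, .loop_true hs he he', φ'', hI'', hb'', by omega⟩
    · exact ⟨1, s, .loop_false hs, φ, hI, hs, by omega⟩

/-- A straight line of instructions. -/
def block : List Instr → Prog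
  | [] => .instr .skip
  | [i] => .instr i
  | i :: l => .seq (.instr i) (block l)

theorem wp_block_one (i : Instr) (Q : ℕ → State → Prop) (s : State) :
    wp W (block [i]) Q s ↔ i.Fits W s ∧ Q 1 (i.apply s) := wp_instr _ _ _

theorem wp_block_cons (i i' : Instr) (l : List Instr) (Q : ℕ → State → Prop) (s : State) :
    wp W (block (i :: i' :: l)) Q s ↔
      i.Fits W s ∧ wp W (block (i' :: l)) (fun t => Q (1 + t)) (i.apply s) := by
  simp [block]

/-- Set a word register. -/
def State.setW (s : State) (r v : ℕ) : State := { s with wreg := Function.update s.wreg r v }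

/-- `for r := r to b - 1 do P`; register `3` has to hold `1`. -/
def forTo (r b : ℕ) (P : Prog) : Prog :=
  .loop (.wlt r b) (.seq P (.instr (.wop .add r r 3)))

/-- In each round `+ 2` pays for the test and the increment; the last `+ 1` is the failing test. The
body has to establish the invariant at `s'.setW r (i + 1)` because the counter is incremented after
the body. -/
theorem wp_forTo {r b : ℕ} {P : Prog} {s₀ : State} (I : ℕ → State → Prop) (K : ℕ → ℕ)
    {lo hi : ℕ} (hlo : s₀.wreg r = lo) (hhi : s₀.wreg b = hi) (h1 : s₀.wreg 3 = 1)
    (hle : lo ≤ hi) (hW : hi < W) (hI : I lo s₀)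
    (step : ∀ i s, lo ≤ i → i < hi → s.wreg r = i → Frame (forTo r b P) s₀ s → I i s →
      wp W P (fun t s' => t ≤ K i ∧ I (i + 1) (s'.setW r (i + 1))) s)
    (hr : P.writesW r = false := by rfl) (hb : P.writesW b = false := by rfl)
    (h3 : P.writesW 3 = false := by rfl) (hrb : (r == b) = false := by rfl)
    (hr3 : (r == 3) = false := by rfl) :
    wp W (forTo r b P)
      (fun t s' => t ≤ ∑ i ∈ Finset.Ico lo hi, (K i + 2) + 1 ∧ I hi s' ∧ s'.wreg r = hi) s₀ := by
  have hrb' : b ≠ r := by rintro rfl; simp at hrb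
  have hr3' : 3 ≠ r := by rintro rfl; simp at hr3
  have key := wp_loop (W := W) (b := .wlt r b) (P := .seq P (.instr (.wop .add r r 3))) (s₀ := s₀)
    (fun φ s => ∃ i, lo ≤ i ∧ i ≤ hi ∧ s.wreg r = i ∧ I i s ∧
      φ = ∑ i ∈ Finset.Ico i hi, (K i + 2)) (∑ i ∈ Finset.Ico lo hi, (K i + 2))
    ⟨lo, le_rfl, hle, hlo, hI, rfl⟩ ?_
  · refine wp.mono key ?_
    rintro t s' hF ⟨φ', ⟨i, hi1, hi2, hi3, hi4, hi5⟩, hn, ht⟩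
    have hbb : s'.wreg b = hi := by
      rw [hF.w b (by simp [forTo, Prog.writesW, Instr.writesW, hb, hrb]), hhi]
    have : i = hi := by
      simp only [Test.Holds, hi3, hbb] at hn; omega
    subst this
    exact ⟨by simp at hi5; omega, hi4, hi3⟩
  · rintro φ s ⟨i, hi1, hi2, hi3, hi4, hi5⟩ hF hs
    have hbb : s.wreg b = hi := by
      rw [hF.w b (by simp [Prog.writesW, Instr.writesW, hb, hrb]), hhi]
    have h33 : s.wreg 3 = 1 := by
      rw [hF.w 3 (by simp [Prog.writesW, Instr.writesW, h3, hr3]), h1]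
    simp only [Test.Holds, hi3, hbb] at hs
    simp only [wp_seq]
    refine wp.mono (step i s hi1 hs hi3 hF hi4) ?_
    rintro t s' hF' ⟨ht, hI'⟩
    have e1 : s'.wreg r = i := by rw [hF'.w r hr, hi3]
    have e2 : s'.wreg 3 = 1 := by rw [hF'.w 3 h3, h33]
    simp only [wp_instr, Instr.Fits, WordOp.eval, e1, e2, Instr.apply]
    refine ⟨by omega, _, ⟨i + 1, by omega, by omega, by simp, hI', rfl⟩, ?_⟩
    rw [hi5, Finset.sum_eq_sum_Ico_succ_bot hs]
    omega

end RealRAM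

namespace RealRAM

/-! ### Tournament trees -/

/-- `T` is a tournament tree with leaves `N, …, 2 N - 1` and root `1`. -/
def IsMinTree (N : ℕ) (T : ℕ → ℝ) : Prop :=
  ∀ v, 1 ≤ v → v < N → T v = min (T (2 * v)) (T (2 * v + 1))

/-- The leaves below a node v of height h are those with v 2^h ≤ l < (v + 1) 2^h. Induction on h,
passing to the child whose block contains l. -/
theorem IsMinTree.le_leaf {H : ℕ} {T : ℕ → ℝ} (hT : IsMinTree (2 ^ H) T) :
    ∀ h v l : ℕ, 1 ≤ v → (v + 1) * 2 ^ h ≤ 2 * 2 ^ H → v * 2 ^ h ≤ l → l < (v + 1) * 2 ^ h →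
      T v ≤ T l := by
  intro h
  induction h with
  | zero =>
    intro v l _ _ h1 h2
    have : l = v := by simp at h1 h2; omega
    rw [this]
  | succ h ih =>
    intro v l hv hb h1 h2
    have hp : 0 < 2 ^ h := by positivity
    rw [pow_succ] at hb h1 h2
    have hvN : v < 2 ^ H := by nlinarith
    rw [hT v hv hvN]
    by_cases hl : l < (2 * v + 1) * 2 ^ h
    · exact (min_le_left _ _).trans (ih (2 * v) l (by omega) (by nlinarith) (by nlinarith) hl)
    · exact (min_le_right _ _).trans
        (ih (2 * v + 1) l (by omega) (by nlinarith) (by nlinarith) (by nlinarith))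

theorem IsMinTree.root_le {H : ℕ} {T : ℕ → ℝ} (hT : IsMinTree (2 ^ H) T) {p : ℕ}
    (hp : p < 2 ^ H) : T 1 ≤ T (2 ^ H + p) :=
  hT.le_leaf H 1 _ le_rfl (by omega) (by omega) (by omega)

/-- Set the leaf with number `40` to the real register `20`. -/
def heapUpdate : Prog :=
  .seq (block [.wop .add 41 6 40, .rstore 2 41 20])
    (.loop (.wlt 3 41) (.seq (block [.wop .div 41 41 4, .wop .add 42 41 41, .rload 21 2 42,
      .wop .add 42 42 3, .rload 22 2 42]) (.ite (.rlt 22 21) (block [.rstore 2 41 22])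
        (block [.rstore 2 41 21]))))

variable {W H : ℕ}

/-- While v walks from the changed leaf to the root, the minimum condition can fail only at proper
ancestors of v, and each round repairs the lowest of them. -/
theorem wp_heapUpdate {s : State} (h3 : s.wreg 3 = 1) (h4 : s.wreg 4 = 2) (h6 : s.wreg 6 = 2 ^ H)
    (hW : 4 * 2 ^ H + 8 ≤ W) (hT : IsMinTree (2 ^ H) (s.rarr 2)) (hx : s.wreg 40 < 2 ^ H) :
    wp W heapUpdate (fun t s' => t ≤ 10 * H + 3 ∧ IsMinTree (2 ^ H) (s'.rarr 2) ∧
      ∀ p < 2 ^ H, s'.rarr 2 (2 ^ H + p) =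
        if p = s.wreg 40 then s.rreg 20 else s.rarr 2 (2 ^ H + p)) s := by
  set x := s.wreg 40 with hxdef
  simp only [wp_seq, wp_ite, wp_block_one, wp_block_cons, Instr.Fits, Instr.apply, WordOp.eval,
    Test.Holds, Function.update_apply, Nat.reduceEqDiff, OfNat.ofNat_ne_zero, OfNat.zero_ne_ofNat,
    OfNat.ofNat_ne_one, OfNat.one_ne_ofNat, one_ne_zero, zero_ne_one, reduceIte, true_and,
    heapUpdate, h6, ← hxdef]
  refine ⟨by omega, ?_⟩
  set s₁ : State := _
  change wp W _ _ s₁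
  have a3 : s₁.wreg 3 = 1 := by simp [s₁, h3]
  have a4 : s₁.wreg 4 = 2 := by simp [s₁, h4]
  refine wp.mono (wp_loop (fun φ s' => ∃ v, s'.wreg 41 = v ∧ 1 ≤ v ∧ v < 2 * 2 ^ H ∧
    φ = 10 * Nat.log 2 v ∧
    (∀ u, 1 ≤ u → u < 2 ^ H →
      s'.rarr 2 u = min (s'.rarr 2 (2 * u)) (s'.rarr 2 (2 * u + 1)) ∨ ∃ e, u = v / 2 ^ (e + 1)) ∧
    ∀ p < 2 ^ H, s'.rarr 2 (2 ^ H + p) =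
      if p = x then s.rreg 20 else s.rarr 2 (2 ^ H + p)) (10 * H) ?_ ?_) ?_
  · refine ⟨2 ^ H + x, by simp [s₁], by have := Nat.one_le_two_pow (n := H); omega, by omega, ?_,
      ?_, ?_⟩
    · congr 1
      rw [Nat.log_eq_of_pow_le_of_lt_pow (m := H)] <;> (try rw [pow_succ]) <;> omega
    · intro u hu hu'
      by_cases hc : u = (2 ^ H + x) / 2
      · exact .inr ⟨0, by simpa using hc⟩
      · refine .inl ?_
        have := hT u hu hu'
        simp only [s₁, Function.update_self]
        rw [Function.update_of_ne (by omega), Function.update_of_ne (by omega),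
          Function.update_of_ne (by omega), this]
    · intro p hp
      simp only [s₁, Function.update_self, Function.update_apply]
      simp
  · rintro φ s' ⟨v, hv, hv1, hv2, rfl, hA, hB⟩ hF hs
    have b3 : s'.wreg 3 = 1 := by rw [hF.w 3, a3]
    have b4 : s'.wreg 4 = 2 := by rw [hF.w 4, a4]
    simp only [Test.Holds, hv, b3] at hs
    have hlog : Nat.log 2 v = Nat.log 2 (v / 2) + 1 := by
      rw [Nat.log_div_base]
      have : 1 ≤ Nat.log 2 v := Nat.log_pos (by norm_num) (by omega)
      omega
    simp only [wp_seq, wp_ite, wp_block_one, wp_block_cons, Instr.Fits, Instr.apply,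
      WordOp.eval, Test.Holds, Function.update_apply, Nat.reduceEqDiff, OfNat.ofNat_ne_zero,
      OfNat.zero_ne_ofNat, OfNat.ofNat_ne_one, OfNat.one_ne_ofNat, one_ne_zero, zero_ne_one,
      reduceIte, true_and, hv, b3, b4]
    refine ⟨by omega, by omega, by omega, ?_⟩
    -- Both branches store the minimum of the two children at v / 2; this common part moves the
    -- invariant from v to v / 2.
    have fin : ∀ m, m = min (s'.rarr 2 (v / 2 + v / 2)) (s'.rarr 2 (v / 2 + v / 2 + 1)) →
        (∀ u, 1 ≤ u → u < 2 ^ H → Function.update (s'.rarr 2) (v / 2) m u =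
            min (Function.update (s'.rarr 2) (v / 2) m (2 * u))
              (Function.update (s'.rarr 2) (v / 2) m (2 * u + 1)) ∨
            ∃ e, u = v / 2 / 2 ^ (e + 1)) ∧
          ∀ p < 2 ^ H, Function.update (s'.rarr 2) (v / 2) m (2 ^ H + p) =
            if p = x then s.rreg 20 else s.rarr 2 (2 ^ H + p) := by
      intro m hm
      refine ⟨fun u hu hu' => ?_, fun p hp => ?_⟩
      · by_cases h1 : u = v / 2
        · refine .inl ?_
          subst h1
          rw [Function.update_self, Function.update_of_ne (by omega),
            Function.update_of_ne (by omega), hm, two_mul]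
        · by_cases h2 : u = v / 2 / 2
          · exact .inr ⟨0, by simpa using h2⟩
          · rcases hA u hu hu' with h | ⟨e, he⟩
            · refine .inl ?_
              rw [Function.update_of_ne h1, Function.update_of_ne (by omega),
                Function.update_of_ne (by omega), h]
            · rcases e with _ | e
              · simp at he; omega
              · refine .inr ⟨e, ?_⟩
                rw [he, Nat.div_div_eq_div_mul, pow_succ' 2 (e + 1)]
      · rw [Function.update_of_ne (by omega), hB p hp]
    constructor
    · intro hlt
      exact ⟨_, ⟨_, rfl, by omega, by omega, rfl,
        by simpa only [Function.update_apply] using fin _ (by rw [min_eq_right hlt.le])⟩, by omega⟩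
    · intro hlt
      exact ⟨_, ⟨_, rfl, by omega, by omega, rfl,
        by simpa only [Function.update_apply] using fin _ (by rw [min_eq_left (not_lt.1 hlt)])⟩,
        by omega⟩
  · rintro t s' hF ⟨φ', ⟨v, hv, hv1, hv2, rfl, hA, hB⟩, hn, ht⟩
    have b3 : s'.wreg 3 = 1 := by rw [hF.w 3, a3]
    simp only [Test.Holds, hv, b3] at hn
    have : v = 1 := by omega
    subst this
    refine ⟨by simp at ht; omega, fun u hu hu' => ?_, hB⟩
    rcases hA u hu hu' with h | ⟨e, he⟩
    · exact h
    -- The root has no proper ancestors: 1 / 2^(e + 1) = 0, and u is at least 1.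
    · rw [Nat.div_eq_of_lt (Nat.one_lt_two_pow (by omega))] at he
      omega

/-- Find a least leaf and put its number into `40`. -/
def heapMin : Prog :=
  .seq (block [.wmove 41 3])
    (.seq (.loop (.wlt 41 6) (.seq (block [.wop .add 41 41 41, .rload 21 2 41, .wop .add 42 41 3,
      .rload 22 2 42]) (.ite (.rlt 22 21) (block [.wmove 41 42]) (block [.skip]))))
      (block [.wop .sub 40 41 6]))

theorem wp_heapMin {s : State} (h3 : s.wreg 3 = 1) (h6 : s.wreg 6 = 2 ^ H)
    (hW : 4 * 2 ^ H + 8 ≤ W) (hT : IsMinTree (2 ^ H) (s.rarr 2)) :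
    wp W heapMin (fun t s' => t ≤ 7 * H + 3 ∧ s'.wreg 40 < 2 ^ H ∧
      s.rarr 2 (2 ^ H + s'.wreg 40) = s.rarr 2 1) s := by
  simp only [wp_seq, wp_ite, wp_block_one, wp_block_cons, Instr.Fits, Instr.apply, WordOp.eval,
    Test.Holds, Function.update_apply, Nat.reduceEqDiff, OfNat.ofNat_ne_zero, OfNat.zero_ne_ofNat,
    OfNat.ofNat_ne_one, OfNat.one_ne_ofNat, one_ne_zero, zero_ne_one, reduceIte, true_and,
    heapMin, h3]
  set s₁ : State := _
  change wp W _ _ s₁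
  have a3 : s₁.wreg 3 = 1 := by simp [s₁, h3]
  have a6 : s₁.wreg 6 = 2 ^ H := by simp [s₁, h6]
  have aT : s₁.rarr 2 = s.rarr 2 := rfl
  refine wp.mono (wp_loop (fun φ s' => ∃ v e, s'.wreg 41 = v ∧ e ≤ H ∧ 2 ^ e ≤ v ∧ v < 2 * 2 ^ e ∧
    φ = 7 * (H - e) ∧ s.rarr 2 v = s.rarr 2 1) (7 * H) ?_ ?_) ?_
  · exact ⟨1, 0, by simp [s₁], by omega, by simp, by simp, by simp, rfl⟩
  · rintro φ s' ⟨v, e, hv, he, hv1, hv2, rfl, hA⟩ hF hs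
    have b3 : s'.wreg 3 = 1 := by rw [hF.w 3, a3]
    have b6 : s'.wreg 6 = 2 ^ H := by rw [hF.w 6, a6]
    have bT : s'.rarr 2 = s.rarr 2 := by rw [hF.ra 2, aT]
    simp only [Test.Holds, hv, b6] at hs
    have hlt : e < H := by
      rcases he.lt_or_eq with h | rfl
      · exact h
      · omega
    have hpos : 1 ≤ v := le_trans Nat.one_le_two_pow hv1
    have hmin := hT v hpos hs
    simp only [wp_seq, wp_ite, wp_block_one, wp_block_cons, Instr.Fits, Instr.apply,
      WordOp.eval, Test.Holds, Function.update_apply, Nat.reduceEqDiff, OfNat.ofNat_ne_zero,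
      OfNat.zero_ne_ofNat, OfNat.ofNat_ne_one, OfNat.one_ne_ofNat, one_ne_zero, zero_ne_one,
      reduceIte, true_and, hv, b3, bT]
    refine ⟨by omega, by omega, ?_, ?_⟩
    · intro hlt'
      refine ⟨_, ⟨_, e + 1, rfl, by omega, by rw [pow_succ]; omega, by rw [pow_succ]; omega, rfl, ?_⟩,
        by omega⟩
      rw [← hA, hmin, two_mul, min_eq_right hlt'.le]
    · intro hlt'
      refine ⟨_, ⟨_, e + 1, rfl, by omega, by rw [pow_succ]; omega, by rw [pow_succ]; omega, rfl, ?_⟩,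
        by omega⟩
      rw [← hA, hmin, two_mul, min_eq_left (not_lt.1 hlt')]
  · rintro t s' hF ⟨φ', ⟨v, e, hv, he, hv1, hv2, rfl, hA⟩, hn, ht⟩
    have b6 : s'.wreg 6 = 2 ^ H := by rw [hF.w 6, a6]
    simp only [Test.Holds, hv, b6] at hn
    have : 2 ^ e ≤ 2 ^ H := Nat.pow_le_pow_right (by norm_num) he
    simp only [wp_seq, wp_ite, wp_block_one, wp_block_cons, Instr.Fits, Instr.apply,
      WordOp.eval, Test.Holds, Function.update_apply, Nat.reduceEqDiff, OfNat.ofNat_ne_zero,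
      OfNat.zero_ne_ofNat, OfNat.ofNat_ne_one, OfNat.one_ne_ofNat, one_ne_zero, zero_ne_one,
      reduceIte, true_and, hv, b6]
    refine ⟨by omega, by omega, by omega, ?_⟩
    rw [show 2 ^ H + (v - 2 ^ H) = v by omega, hA]

def findNextDescend : Prog :=
  .loop (.wlt 51 6) (.seq (block [.wop .add 51 51 51, .rload 26 3 51, .radd 26 26 25])
    (.ite (.rlt 26 0) (block [.skip]) (block [.wop .add 51 51 3])))

/-- Find the first leaf of the tree in the real array `3`, from the leaf with number `50` on, whose
value plus the real register `25` is negative; put its number into `50`. -/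
def findNext : Prog :=
  .seq (block [.wop .add 51 6 50, .wmove 53 2])
  (.seq (.loop (.weq 53 2) (.seq (block [.rload 26 3 51, .radd 26 26 25])
    (.ite (.rlt 26 0) (block [.wmove 53 3])
      (.seq (block [.wop .add 51 51 3, .wop .div 52 51 4, .wop .add 54 52 52])
        (.ite (.weq 54 51) (block [.wmove 51 52]) (block [.skip]))))))
  (.seq findNextDescend (block [.wop .sub 50 51 6])))

/-- The block of v contains a good leaf, and no leaf from x up to that block is good. If the left
child is not good, its whole block is bad and the minimum at v is attained on the right, so both
properties pass to the chosen child. -/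
theorem wp_findNextDescend {s : State} {x v h : ℕ} {T : ℕ → ℝ} {d : ℝ} (h3 : s.wreg 3 = 1)
    (h6 : s.wreg 6 = 2 ^ H) (h0 : s.rreg 0 = 0) (hT₀ : s.rarr 3 = T) (hd : s.rreg 25 = d)
    (hW : 4 * 2 ^ H + 8 ≤ W) (hT : IsMinTree (2 ^ H) T) (hv : s.wreg 51 = v) (hv1 : 1 ≤ v)
    (hlo : 2 ^ H + x ≤ v * 2 ^ h) (hvb : (v + 1) * 2 ^ h ≤ 2 * 2 ^ H)
    (hbad : ∀ p, x ≤ p → 2 ^ H + p < v * 2 ^ h → ¬ T (2 ^ H + p) + d < 0) (hg : T v + d < 0) :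
    wp W findNextDescend (fun t s' => t ≤ 6 * h + 1 ∧ 2 ^ H + x ≤ s'.wreg 51 ∧
      s'.wreg 51 < 2 * 2 ^ H ∧ T (2 ^ H + (s'.wreg 51 - 2 ^ H)) + d < 0 ∧
      ∀ p, x ≤ p → p < s'.wreg 51 - 2 ^ H → ¬ T (2 ^ H + p) + d < 0) s := by
  refine wp.mono (wp_loop (fun φ s'' => ∃ v h, s''.wreg 51 = v ∧ 1 ≤ v ∧ φ = 6 * h ∧
    2 ^ H + x ≤ v * 2 ^ h ∧ 
    (∀ p, x ≤ p → 2 ^ H + p < v * 2 ^ h → ¬ T (2 ^ H + p) + d < 0) ∧ T v + d < 0 ∧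
    (v + 1) * 2 ^ h ≤ 2 * 2 ^ H) (6 * h) ⟨v, h, hv, hv1, rfl, hlo, hbad, hg, hvb⟩ ?_) ?_
  · clear hv hv1 hlo hvb hbad hg
    rintro φ s'' ⟨v, h, hv, hv1, rfl, hlo, hbad, hg, hvb⟩ hF' hs
    have c3 : s''.wreg 3 = 1 := by rw [hF'.w 3, h3]
    have c6 : s''.wreg 6 = 2 ^ H := by rw [hF'.w 6, h6]
    have c0 : s''.rreg 0 = 0 := by rw [hF'.r 0, h0]
    have cT : s''.rarr 3 = T := by rw [hF'.ra 3, hT₀]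
    have cd : s''.rreg 25 = d := by rw [hF'.r 25, hd]
    simp only [Test.Holds, hv, c6] at hs
    obtain ⟨h, rfl⟩ : ∃ h', h = h' + 1 := by
      rcases h with _ | h
      · simp at hlo; omega
      · exact ⟨h, rfl⟩
    have hmin := hT v hv1 hs
    have e1 : (v + v) * 2 ^ h = v * 2 ^ (h + 1) := by ring
    have e2 : (v + v + 1) * 2 ^ h + 2 ^ h = (v + 1) * 2 ^ (h + 1) := by ring
    have e3 : (v + v + 1) * 2 ^ h = (v + v) * 2 ^ h + 2 ^ h := by ring
    have e4 : (v + v + 1 + 1) * 2 ^ h = (v + 1) * 2 ^ (h + 1) := by ring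
    simp only [wp_seq, wp_ite, wp_block_one, wp_block_cons, Instr.Fits, Instr.apply,
      WordOp.eval, Test.Holds, Function.update_apply, Nat.reduceEqDiff, OfNat.ofNat_ne_zero,
      OfNat.zero_ne_ofNat, OfNat.ofNat_ne_one, OfNat.one_ne_ofNat, one_ne_zero, zero_ne_one,
      reduceIte, true_and, hv, c3, c0, cT, cd]
    refine ⟨by omega, ?_, ?_⟩
    · intro hlt
      exact ⟨_, ⟨_, h, rfl, by omega, rfl, by omega, fun p h1 h2 => hbad p h1 (by omega), hlt,
        by linarith [Nat.zero_le (2 ^ h)]⟩, by omega⟩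
    · intro hge
      refine ⟨by omega, _, ⟨_, h, rfl, by omega, rfl, by linarith [Nat.zero_le (2 ^ h)],
        fun p h1 h2 => ?_, ?_, by linarith⟩, by omega⟩
      · by_cases h3 : 2 ^ H + p < v * 2 ^ (h + 1)
        · exact hbad p h1 h3
        · have := hT.le_leaf h (v + v) (2 ^ H + p) (by omega) (by omega) (by omega) h2
          linarith
      · rcases min_choice (T (2 * v)) (T (2 * v + 1)) with h' | h'
        · rw [h', two_mul] at hmin
          linarith
        · rw [h', two_mul] at hmin
          rwa [← hmin]
  · rintro u s'' hF' ⟨φ', ⟨v', h', hv', hv1', rfl, hlo', hbad', hg', hvb'⟩, hn', ht'⟩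
    have c6 : s''.wreg 6 = 2 ^ H := by rw [hF'.w 6, h6]
    simp only [Test.Holds, hv', c6] at hn'
    have h'0 : h' = 0 := by
      rcases h' with _ | h'
      · rfl
      · exfalso
        have : 1 ≤ 2 ^ h' := Nat.one_le_two_pow
        rw [pow_succ] at hvb'
        nlinarith
    subst h'0
    have e : 2 ^ H + (v' - 2 ^ H) = v' := by omega
    simp only [pow_zero, mul_one] at *
    rw [hv', e]
    exact ⟨by omega, by omega, by omega, hg', fun p h1 h2 => hbad' p h1 (by omega)⟩

-- Climb, then descend. During the climb the block of v starts right after the leaves already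
-- rejected. If its minimum is not good, v + 1 is next, and when v + 1 is even its parent can be
-- taken instead, since the block of the parent starts at the same leaf. The good leaf M keeps the
-- climb inside the tree.
set_option maxHeartbeats 1000000 in
theorem wp_findNext {s : State} {M : ℕ} (h2 : s.wreg 2 = 0) (h3 : s.wreg 3 = 1)
    (h4 : s.wreg 4 = 2) (h6 : s.wreg 6 = 2 ^ H) (h0 : s.rreg 0 = 0)
    (hW : 4 * 2 ^ H + 8 ≤ W) (hT : IsMinTree (2 ^ H) (s.rarr 3)) (hx : s.wreg 50 ≤ M)
    (hM : M < 2 ^ H) (hM' : s.rarr 3 (2 ^ H + M) + s.rreg 25 < 0) :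
    wp W findNext (fun t s' => t ≤ 30 * H + 30 ∧ s.wreg 50 ≤ s'.wreg 50 ∧ s'.wreg 50 ≤ M ∧
      s.rarr 3 (2 ^ H + s'.wreg 50) + s.rreg 25 < 0 ∧
      ∀ p, s.wreg 50 ≤ p → p < s'.wreg 50 → ¬ s.rarr 3 (2 ^ H + p) + s.rreg 25 < 0) s := by
  set x := s.wreg 50 with hxdef
  set d := s.rreg 25 with hddef
  set T := s.rarr 3 with hTdef
  simp only [wp_seq, wp_ite, wp_block_one, wp_block_cons, Instr.Fits, Instr.apply, WordOp.eval,
    Test.Holds, Function.update_apply, Nat.reduceEqDiff, OfNat.ofNat_ne_zero, OfNat.zero_ne_ofNat,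
    OfNat.ofNat_ne_one, OfNat.one_ne_ofNat, one_ne_zero, zero_ne_one, reduceIte, true_and,
    findNext, h6, h2, ← hxdef]
  refine ⟨by omega, ?_⟩
  set s₁ : State := _
  change wp W _ _ s₁
  have a2 : s₁.wreg 2 = 0 := by simp [s₁, h2]
  have a3 : s₁.wreg 3 = 1 := by simp [s₁, h3]
  have a4 : s₁.wreg 4 = 2 := by simp [s₁, h4]
  have a6 : s₁.wreg 6 = 2 ^ H := by simp [s₁, h6]
  have a0 : s₁.rreg 0 = 0 := by simp [s₁, h0]
  have aT : s₁.rarr 3 = T := rfl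
  have ad : s₁.rreg 25 = d := rfl
  refine wp.mono (wp_loop (fun φ s' => ∃ v h f, s'.wreg 51 = v ∧ s'.wreg 53 = f ∧ f ≤ 1 ∧ h ≤ H ∧
    1 ≤ v ∧ 2 ^ H + x ≤ v * 2 ^ h ∧ v * 2 ^ h ≤ 2 ^ H + M ∧
    (∀ p, x ≤ p → 2 ^ H + p < v * 2 ^ h → ¬ T (2 ^ H + p) + d < 0) ∧
    (f = 1 → T v + d < 0) ∧
    -- An even v becomes the odd v + 1 at the same height. An odd v gains one height, worth 2, and
    -- loses at most 1 if the new node is even. The term `1 - f` pays for the round that raises the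
    -- flag.
    φ = 10 * (2 * (H - h) + (if v % 2 = 0 then 1 else 0) + (1 - f))) 
    (10 * (2 * (H - 0) + (if (2 ^ H + x) % 2 = 0 then 1 else 0) + (1 - 0))) ?_ ?_) ?_
  · refine ⟨2 ^ H + x, 0, 0, by simp [s₁], by simp [s₁], by omega, by omega, ?_, by simp,
      by simp; omega, fun p hp hp' => by simp at hp'; omega, by simp, rfl⟩
    have := Nat.one_le_two_pow (n := H); omega
  · rintro φ s' ⟨v, h, f, hv, hf, hf1, hh, hv1, hlo, hhi, hbad, hgood, rfl⟩ hF hs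
    have b2 : s'.wreg 2 = 0 := by rw [hF.w 2, a2]
    have b3 : s'.wreg 3 = 1 := by rw [hF.w 3, a3]
    have b4 : s'.wreg 4 = 2 := by rw [hF.w 4, a4]
    have b0 : s'.rreg 0 = 0 := by rw [hF.r 0, a0]
    have bT : s'.rarr 3 = T := by rw [hF.ra 3, aT]
    have bd : s'.rreg 25 = d := by rw [hF.r 25, ad]
    simp only [Test.Holds, hf, b2] at hs
    subst hs
    have hp : 0 < 2 ^ h := by positivity
    have hpw : 2 ^ H = 2 ^ (H - h) * 2 ^ h := by rw [← pow_add]; congr 1; omega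
    have hvlt : v + 1 ≤ 2 * 2 ^ (H - h) := by
      by_contra hc
      have : 2 * 2 ^ (H - h) * 2 ^ h ≤ v * 2 ^ h := Nat.mul_le_mul_right _ (by omega)
      rw [mul_assoc, ← hpw] at this
      omega
    have hvb : (v + 1) * 2 ^ h ≤ 2 * 2 ^ H := by
      rw [hpw, ← mul_assoc]; exact Nat.mul_le_mul_right _ hvlt
    have hvW : v + 1 ≤ 2 * 2 ^ H := le_trans (Nat.le_mul_of_pos_right _ hp) hvb
    simp only [wp_seq, wp_ite, wp_block_one, wp_block_cons, Instr.Fits, Instr.apply,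
      WordOp.eval, Test.Holds, Function.update_apply, Nat.reduceEqDiff, OfNat.ofNat_ne_zero,
      OfNat.zero_ne_ofNat, OfNat.ofNat_ne_one, OfNat.one_ne_ofNat, one_ne_zero, zero_ne_one,
      reduceIte, true_and, hv, b3, b4, b0, bT, bd]
    constructor
    · intro hlt
      exact ⟨_, ⟨v, h, 1, rfl, rfl, le_rfl, hh, hv1, hlo, hhi, hbad, fun _ => hlt, rfl⟩, by omega⟩
    · intro hge
      have hsub : ∀ l, v * 2 ^ h ≤ l → l < (v + 1) * 2 ^ h → ¬ T l + d < 0 := by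
        intro l h1 h2
        have := hT.le_leaf h v l hv1 hvb h1 h2
        linarith
      have hM2 : (v + 1) * 2 ^ h ≤ 2 ^ H + M := by
        by_contra hc
        exact hsub _ hhi (by omega) hM'
      have hbad' : ∀ p, x ≤ p → 2 ^ H + p < (v + 1) * 2 ^ h → ¬ T (2 ^ H + p) + d < 0 := by
        intro p h1 h2
        by_cases h3 : 2 ^ H + p < v * 2 ^ h
        · exact hbad p h1 h3
        · exact hsub _ (by omega) h2
      have hlo' : 2 ^ H + x ≤ (v + 1) * 2 ^ h := by nlinarith
      have hfl : s'.wreg 53 = 0 := hf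
      refine ⟨by omega, by omega, by omega, ?_, ?_⟩
      · intro hev
        have e : (v + 1) / 2 * 2 ^ (h + 1) = (v + 1) * 2 ^ h := by
          rw [pow_succ, mul_comm (2 ^ h) 2, ← mul_assoc]; congr 1; omega
        -- At height H the node is the root, and the next block would start beyond the good leaf M.
        have hhH : h < H := by
          rcases hh.lt_or_eq with h' | rfl
          · exact h'
          · simp at hvlt
            have : v = 1 := by omega
            subst this
            omega
        refine ⟨_, ⟨_, h + 1, 0, rfl, hfl, by omega, by omega, by omega, by rw [e]; omega,
          by rw [e]; omega, by rw [e]; exact hbad', by simp, rfl⟩, ?_⟩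
        split_ifs <;> omega
      · intro hev
        refine ⟨_, ⟨_, h, 0, rfl, hfl, by omega, by omega, by omega, hlo', hM2, hbad', by simp,
          rfl⟩, ?_⟩
        have : v % 2 = 0 := by omega
        have h' : ¬ (v + 1) % 2 = 0 := by omega
        simp only [this, h', if_true, if_false]
        omega
  · rintro t s' hF ⟨φ', ⟨v, h, f, hv, hf, hf1, hh, hv1, hlo, hhi, hbad, hgood, rfl⟩, hn, ht⟩
    have b2 : s'.wreg 2 = 0 := by rw [hF.w 2, a2]
    have b3 : s'.wreg 3 = 1 := by rw [hF.w 3, a3]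
    have b6 : s'.wreg 6 = 2 ^ H := by rw [hF.w 6, a6]
    have b0 : s'.rreg 0 = 0 := by rw [hF.r 0, a0]
    have bT : s'.rarr 3 = T := by rw [hF.ra 3, aT]
    have bd : s'.rreg 25 = d := by rw [hF.r 25, ad]
    simp only [Test.Holds, hf, b2] at hn
    have hg := hgood (by omega)
    have hvb : (v + 1) * 2 ^ h ≤ 2 * 2 ^ H := by
      have hpw : 2 ^ H = 2 ^ (H - h) * 2 ^ h := by rw [← pow_add]; congr 1; omega
      have hvlt : v + 1 ≤ 2 * 2 ^ (H - h) := by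
        by_contra hc
        have : 2 * 2 ^ (H - h) * 2 ^ h ≤ v * 2 ^ h := Nat.mul_le_mul_right _ (by omega)
        rw [mul_assoc, ← hpw] at this
        omega
      rw [hpw, ← mul_assoc]; exact Nat.mul_le_mul_right _ hvlt
    refine wp.mono (wp_findNextDescend (x := x) (T := T) (d := d) b3 b6 b0 bT bd hW hT hv hv1 hlo
      hvb hbad hg) ?_
    rintro u s'' hF' ⟨hu, hge, hlt, hgd, hbd⟩
    have c6 : s''.wreg 6 = 2 ^ H := by rw [hF'.w 6, b6]
    simp only [wp_seq, wp_ite, wp_block_one, wp_block_cons, Instr.Fits, Instr.apply,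
      WordOp.eval, Test.Holds, Function.update_apply, Nat.reduceEqDiff, OfNat.ofNat_ne_zero,
      OfNat.zero_ne_ofNat, OfNat.ofNat_ne_one, OfNat.one_ne_ofNat, one_ne_zero, zero_ne_one,
      reduceIte, true_and, c6]
    refine ⟨by omega, ?_, by omega, ?_, hgd, hbd⟩
    · split_ifs at ht <;> omega
    · by_contra hc
      exact hbd M hx (by omega) hM'

end RealRAM

/-! ### Networks: finite graphs with edge lengths on an initial segment of `ℕ` -/

/-- A graph with positive edge lengths on the vertices `0, …, n - 1`. -/
structure Net where
  n : ℕ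
  Adj : ℕ → ℕ → Prop
  len : ℕ → ℕ → ℝ
  symm : ∀ {x y}, Adj x y → Adj y x
  lt : ∀ {x y}, Adj x y → x < n
  irrefl : ∀ x, ¬ Adj x x
  len_symm : ∀ x y, len x y = len y x
  pos : ∀ {x y}, Adj x y → 0 < len x y

namespace Net

/-- There is a walk of length `r` from `x` to `y`. -/
inductive Walk (G : Net) (x : ℕ) : ℕ → ℝ → Prop
  | nil : Walk G x x 0
  | snoc {y z : ℕ} {r : ℝ} (h : Walk G x y r) (e : G.Adj y z) : Walk G x z (r + G.len y z)

variable {G : Net}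

theorem Walk.trans {x y z : ℕ} {r q : ℝ} (h : G.Walk x y r) (h' : G.Walk y z q) :
    G.Walk x z (r + q) := by
  induction h' with
  | nil => simpa using h
  | snoc _ e ih => rw [← add_assoc]; exact ih.snoc e

theorem Walk.single {x y : ℕ} (e : G.Adj x y) : G.Walk x y (G.len x y) := by
  simpa using (Walk.nil (G := G) (x := x)).snoc e

theorem Walk.symm {x y : ℕ} {r : ℝ} (h : G.Walk x y r) : G.Walk y x r := by
  induction h with
  | nil => exact .nil
  | @snoc y z r _ e ih =>
    rw [add_comm, G.len_symm]
    exact (Walk.single (G.symm e)).trans ih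

theorem Walk.nonneg {x y : ℕ} {r : ℝ} (h : G.Walk x y r) : 0 ≤ r := by
  induction h with
  | nil => exact le_rfl
  | snoc _ e ih => have := G.pos e; linarith

theorem Walk.lt {x y : ℕ} {r : ℝ} (h : G.Walk x y r) (hx : x < G.n) : y < G.n := by
  cases h with
  | nil => exact hx
  | snoc _ e => exact G.lt (G.symm e)

/-- Some vertex of level at least `i` is at distance at most `r` from `x`. -/
def Near (G : Net) (lev : ℕ → ℕ) (i x : ℕ) (r : ℝ) : Prop :=
  ∃ a < G.n, i ≤ lev a ∧ ∃ r' ≤ r, G.Walk a x r'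

variable {lev : ℕ → ℕ} {i : ℕ}

theorem Near.trans {x y : ℕ} {r q : ℝ} (h : G.Near lev i x r) (h' : G.Walk x y q) :
    G.Near lev i y (r + q) := by
  obtain ⟨a, ha, hi, r', hr, hw⟩ := h
  exact ⟨a, ha, hi, r' + q, by linarith, hw.trans h'⟩

theorem Near.mono {x : ℕ} {r q : ℝ} (h : G.Near lev i x r) (hq : r ≤ q) : G.Near lev i x q := by
  obtain ⟨a, ha, hi, r', hr, hw⟩ := h
  exact ⟨a, ha, hi, r', hr.trans hq, hw⟩

/-! ### Trees of pruned searches -/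

/-- The outcome of a pruned Dijkstra search from `w`: a tree of visited vertices `x`, with parents
`par x` and tree distances `d x`, that is closed, up to the radius `B / 2`, under the edges that
`dh` admits, none of which closes a cycle. -/
structure IsRun (G : Net) (dh : ℕ → ℝ) (w : ℕ) (B : ℝ) (vis : ℕ → Prop) (par : ℕ → ℕ)
    (d : ℕ → ℝ) : Prop where
  root : vis w
  d_root : d w = 0
  par_root : par w = w
  walk : ∀ x, vis x → G.Walk w x (d x)
  tree : ∀ x, vis x → x ≠ w →
    vis (par x) ∧ G.Adj (par x) x ∧ d x = d (par x) + G.len (par x) x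
  closed : ∀ x y, vis x → G.Adj x y → d x + G.len x y < dh y → 2 * (d x + G.len x y) < B →
    vis y ∧ (par y = x ∨ par x = y)

theorem IsRun.mono {dh : ℕ → ℝ} {w : ℕ} {B B' : ℝ} {vis : ℕ → Prop} {par : ℕ → ℕ} {d : ℕ → ℝ}
    (h : G.IsRun dh w B vis par d) (hB : B' ≤ B) : G.IsRun dh w B' vis par d :=
  { h with closed := fun x y hx hxy h1 h2 => h.closed x y hx hxy h1 (h2.trans_le hB) }

section Run

variable {dh : ℕ → ℝ} {w : ℕ} {B : ℝ} {vis : ℕ → Prop} {par : ℕ → ℕ} {d : ℕ → ℝ}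

theorem IsRun.d_lt (h : G.IsRun dh w B vis par d) {x : ℕ} (hx : vis x) (hxw : x ≠ w) :
    d (par x) < d x := by
  obtain ⟨_, he, hd⟩ := h.tree x hx hxw
  have := G.pos he
  linarith

theorem IsRun.d_lt_of_par (h : G.IsRun dh w B vis par d) {x y : ℕ} (hy : vis y)
    (hxy : G.Adj x y) (hp : par y = x) : d x < d y := by
  subst hp
  refine h.d_lt hy ?_
  rintro rfl
  rw [h.par_root] at hxy
  exact G.irrefl _ hxy

theorem IsRun.d_le (h : G.IsRun dh w B vis par d) {x y : ℕ} (hx : vis x) (hy : vis y)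
    (hxy : G.Adj x y) (hp : par y = x ∨ par x = y) : d y ≤ d x + G.len x y := by
  rcases hp with rfl | hp
  · by_cases hyw : y = w
    · subst hyw
      rw [h.par_root] at hxy
      exact absurd hxy (G.irrefl _)
    · exact (h.tree y hy hyw).2.2.le
  · have := h.d_lt_of_par hx (G.symm hxy) hp
    have := G.pos hxy
    linarith

/-- Follow the walk. As long as its edges are admissible, the search visits the next vertex at a
distance that does not exceed the length walked. At the first inadmissible edge, `dh` at its head is
at most that length, so `hdh` yields a vertex of higher level near by; this nearness is then carried
to the end of the walk. -/
theorem IsRun.reach (h : G.IsRun dh w B vis par d)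
    (hdh : ∀ x r, x < G.n → dh x ≤ r → 2 * r < B → G.Near lev (i + 1) x r)
    {x y : ℕ} {l q : ℝ} (hx : vis x) (hl : d x ≤ l) (hw : G.Walk x y q) (hB : 2 * (l + q) < B) :
    (vis y ∧ d y ≤ l + q) ∨ G.Near lev (i + 1) y (l + q) := by
  induction hw with
  | nil => left; simpa using ⟨hx, hl⟩
  | @snoc y z q hw e ih =>
    have hpos := G.pos e
    rcases ih (by linarith) with ⟨hy, hdy⟩ | hn
    · by_cases hlt : d y + G.len y z < dh z
      · obtain ⟨hz, hp⟩ := h.closed y z hy e hlt (by linarith)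
        left
        exact ⟨hz, by linarith [h.d_le hy hz e hp]⟩
      · right
        exact hdh z _ (G.lt (G.symm e)) (by linarith) hB
    · right
      rw [← add_assoc]
      exact hn.trans (Walk.single e)

/-- A refinement of `IsRun.reach` that watches one edge of a walk: it belongs to the tree, in one
direction or the other, unless a vertex of higher level is near the end of the walk. -/
theorem IsRun.along (h : G.IsRun dh w B vis par d)
    (hdh : ∀ x r, x < G.n → dh x ≤ r → 2 * r < B → G.Near lev (i + 1) x r)
    {b x y b' : ℕ} {δ r q : ℝ} (hb : vis b) (hδ : d b ≤ δ) (hbx : G.Walk b x r)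
    (hxy : G.Adj x y) (hyb : G.Walk y b' q) (hB : 2 * (δ + r + G.len x y + q) < B) :
    (vis x ∧ vis y ∧ d y ≤ δ + r + G.len x y ∧ (par y = x ∨ par x = y)) ∨
      G.Near lev (i + 1) b' (δ + r + G.len x y + q) := by
  have hpos := G.pos hxy
  have hq := hyb.nonneg
  rcases h.reach hdh hb hδ hbx (by linarith) with ⟨hx, hdx⟩ | hn
  · by_cases hlt : d x + G.len x y < dh y
    · obtain ⟨hy, hp⟩ := h.closed x y hx hxy hlt (by linarith)
      exact .inl ⟨hx, hy, by linarith [h.d_le hx hy hxy hp], hp⟩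
    · exact .inr ((hdh y (δ + r + G.len x y) (G.lt (G.symm hxy)) (by linarith)
        (by linarith)).trans hyb)
  · exact .inr ((hn.trans (Walk.single hxy)).trans hyb)

end Run

/-! ### Periodic cycles -/

/-- A simple cycle with `m` vertices, traversed periodically. -/
structure Cyc (G : Net) (c : ℕ → ℕ) (m : ℕ) : Prop where
  three : 3 ≤ m
  per : ∀ i, c (i + m) = c i
  adj : ∀ i, G.Adj (c i) (c (i + 1))
  inj : ∀ i < m, ∀ j < m, c i = c j → i = j

/-- The length of the first `i` steps along `c`. -/
def pathLen (G : Net) (c : ℕ → ℕ) (i : ℕ) : ℝ :=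
  ∑ t ∈ Finset.range i, G.len (c t) (c (t + 1))

theorem pathLen_succ (c : ℕ → ℕ) (i : ℕ) :
    G.pathLen c (i + 1) = G.pathLen c i + G.len (c i) (c (i + 1)) :=
  Finset.sum_range_succ _ _

section Cyc

variable {c : ℕ → ℕ} {m : ℕ}

theorem Cyc.mod (hc : G.Cyc c m) (i : ℕ) : c (i % m) = c i := by
  conv_rhs => rw [← Nat.mod_add_div i m]
  induction i / m with
  | zero => simp
  | succ k ih => rw [Nat.mul_succ, ← add_assoc, hc.per, ih]

theorem Cyc.pathLen_add (hc : G.Cyc c m) (i : ℕ) :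
    G.pathLen c (i + m) = G.pathLen c i + G.pathLen c m := by
  induction i with
  | zero => simp [pathLen]
  | succ i ih =>
    have e : i + 1 + m = i + m + 1 := by omega
    rw [e, pathLen_succ, ih, pathLen_succ, hc.per, ← e, hc.per]
    ring

theorem Cyc.walk (hc : G.Cyc c m) {i j : ℕ} (hij : i ≤ j) :
    G.Walk (c i) (c j) (G.pathLen c j - G.pathLen c i) := by
  induction j, hij using Nat.le_induction with
  | base => simpa using Walk.nil
  | succ j _ ih =>
    have := ih.snoc (hc.adj j)
    rw [pathLen_succ]
    convert this using 1
    ring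

theorem Cyc.lt (hc : G.Cyc c m) (i : ℕ) : c i < G.n := G.lt (hc.adj i)

/-- Allows the traversal to start at any vertex of the cycle, so that `Cyc.walk` needs indices in
increasing order only. -/
theorem Cyc.exists_shift (hc : G.Cyc c m) (s i : ℕ) :
    ∃ t, s ≤ t ∧ t < s + m ∧ c t = c i ∧ c (t + 1) = c (i + 1) := by
  have hm : 0 < m := by have := hc.three; omega
  have h1 := Nat.mod_lt (i + s * m - s) hm
  have h2 : s ≤ s * m := Nat.le_mul_of_pos_right _ hm
  have key : (s + (i + s * m - s) % m) % m = i % m := by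
    rw [Nat.add_mod_mod, show s + (i + s * m - s) = i + s * m by omega,
      Nat.add_mul_mod_self_right]
  refine ⟨s + (i + s * m - s) % m, by omega, by omega, ?_, ?_⟩
  · rw [← hc.mod, key, hc.mod]
  · rw [← hc.mod, Nat.add_mod, key, ← Nat.add_mod, hc.mod]

/-- A cycle is not contained in a tree. -/
theorem Cyc.exists_nontree (hc : G.Cyc c m) {dh : ℕ → ℝ} {w : ℕ} {B : ℝ} {vis : ℕ → Prop}
    {par : ℕ → ℕ} {d : ℕ → ℝ} (h : G.IsRun dh w B vis par d) (hv : ∀ i, vis (c i)) (s : ℕ) :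
    ∃ i, s ≤ i ∧ i < s + m ∧ ¬ (par (c (i + 1)) = c i ∨ par (c i) = c (i + 1)) := by
  have hm := hc.three
  suffices H : ∃ i, ¬ (par (c (i + 1)) = c i ∨ par (c i) = c (i + 1)) by
    obtain ⟨i, hi⟩ := H
    obtain ⟨t, h1, h2, h3, h4⟩ := hc.exists_shift s i
    exact ⟨t, h1, h2, by rwa [h3, h4]⟩
  by_contra! H
  -- At a vertex of the cycle with the greatest tree distance, both neighbours on the cycle have to
  -- be its parent. They would coincide, which is impossible with at least three vertices.
  obtain ⟨t, ht, hmax⟩ := Finset.exists_max_image (Finset.range m) (fun t => d (c t))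
    ⟨0, by simp; omega⟩
  have hmax' : ∀ j, d (c j) ≤ d (c t) := fun j => by
    rw [← hc.mod j]
    exact hmax _ (Finset.mem_range.2 (Nat.mod_lt _ (by omega)))
  have e : c (t + (m - 1) + 1) = c t := by rw [show t + (m - 1) + 1 = t + m by omega, hc.per]
  have h1 : par (c t) = c (t + 1) := by
    rcases H t with h' | h'
    · exact absurd (hmax' (t + 1)) (not_le.2 (h.d_lt_of_par (hv _) (hc.adj _) h'))
    · exact h'
  have h2 : par (c t) = c (t + (m - 1)) := by
    rcases H (t + (m - 1)) with h' | h'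
    · rwa [e] at h'
    · rw [e] at h'
      have := hc.adj (t + (m - 1))
      rw [e] at this
      exact absurd (hmax' (t + (m - 1))) (not_le.2 (h.d_lt_of_par (hv _) (G.symm this) h'))
  rw [h1, ← hc.mod (t + 1), ← hc.mod (t + (m - 1))] at h2
  have h3 := hc.inj _ (Nat.mod_lt _ (by omega)) _ (Nat.mod_lt _ (by omega)) h2
  simp at ht
  rcases Nat.lt_or_ge (t + 1) m with h4 | h4
  · rw [Nat.mod_eq_of_lt h4] at h3
    rcases Nat.lt_or_ge (t + (m - 1)) m with h5 | h5
    · rw [Nat.mod_eq_of_lt h5] at h3; omega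
    · rw [Nat.mod_eq_sub_mod h5, Nat.mod_eq_of_lt (by omega)] at h3; omega
  · rw [Nat.mod_eq_sub_mod h4, Nat.mod_eq_of_lt (by omega)] at h3
    rw [Nat.mod_eq_sub_mod (by omega), Nat.mod_eq_of_lt (by omega)] at h3
    omega

end Cyc

/-! ### Approaching a cycle level by level -/

/-- If the vertices of level at least `i` are near a cycle, then so are those of level at least
`i + 1`, in a quantitative sense that depends on whether the cycle has a heavy edge. -/
def Step (G : Net) (lev : ℕ → ℕ) (i : ℕ) (B : ℝ) : Prop :=
  ∀ c m, G.Cyc c m → ∀ δ, 2 * (δ + 2 * G.pathLen c m / 3) < B →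
    ((∀ j, G.len (c j) (c (j + 1)) ≤ G.pathLen c m / 3) → ∀ p, G.Near lev i (c p) δ →
      ∃ p', G.Near lev (i + 1) (c p') (δ + 2 * G.pathLen c m / 3)) ∧
    (∀ j, G.pathLen c m / 3 ≤ G.len (c j) (c (j + 1)) →
      G.Near lev i (c j) δ ∨ G.Near lev i (c (j + 1)) δ →
      G.Near lev (i + 1) (c j) (δ + 2 * G.pathLen c m / 3) ∨
        G.Near lev (i + 1) (c (j + 1)) (δ + 2 * G.pathLen c m / 3))

theorem Step.mono {B B' : ℝ} (h : G.Step lev i B) (hB : B' ≤ B) : G.Step lev i B' :=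
  fun c m hc δ hδ => h c m hc δ (hδ.trans_le hB)

/-- Both halves assume that no vertex of higher level is that near. By `hdh` no search from level i
is then pruned along the relevant parts of the cycle, so these become tree edges. In the light case
this is the whole cycle. In the heavy case it is all but the heavy edge, for which the second clause
of `hruns` bounds B; `hpw` provides a search in which this clause applies. -/
theorem step_of_runs {dh : ℕ → ℝ} {B : ℝ} {pw : ℕ → ℕ}
    (hdh : ∀ x r, x < G.n → dh x ≤ r → 2 * r < B → G.Near lev (i + 1) x r)
    (hruns : ∀ a < G.n, lev a = i → ∃ vis par d, G.IsRun dh a B vis par d ∧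
      ∀ u y, vis u → pw u = a → vis y → G.Adj u y → par u ≠ y → par y ≠ u →
        B ≤ d u + G.len u y + d y)
    (hpw : ∀ a < G.n, lev a = i → ∀ x r, G.Walk a x r → 2 * r < B →
      (pw x < G.n ∧ lev (pw x) = i ∧ ∃ r' ≤ r, G.Walk (pw x) x r') ∨ G.Near lev (i + 1) x r) :
    G.Step lev i B := by
  intro c m hc δ hδ
  set g := G.pathLen c m with hg
  have hgm : ∀ t, G.pathLen c (t + m) = G.pathLen c t + g := hc.pathLen_add
  have hg0 : 0 ≤ g := by
    have := (hc.walk (Nat.zero_le m)).nonneg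
    simpa [pathLen, hg] using this
  constructor
  · rintro hlight p ⟨a, ha, hai, δ', hδ', hap⟩
    by_contra! hno
    have hno' : ∀ t r, r ≤ δ + 2 * g / 3 → ¬ G.Near lev (i + 1) (c t) r :=
      fun t r hr hn => hno t (hn.mono hr)
    have hlev : lev a = i := by
      by_contra hne
      exact hno' p δ' (by linarith) ⟨a, ha, by omega, δ', le_rfl, hap⟩
    obtain ⟨vis, par, d, hrun, -⟩ := hruns a ha hlev
    have hp : vis (c p) ∧ d (c p) ≤ δ := by
      rcases hrun.reach hdh hrun.root hrun.d_root.le hap (by linarith) with h | h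
      · exact ⟨h.1, by linarith [h.2]⟩
      · exact absurd h (hno' _ _ (by linarith))
    have hedge : ∀ t, p ≤ t → t < p + m →
        vis (c t) ∧ (par (c (t + 1)) = c t ∨ par (c t) = c (t + 1)) := by
      intro t h1 h2
      have hl := hlight t
      have e := G.pathLen_succ c t
      have hcp : c (p + m) = c p := hc.per p
      -- If going forward through the edge takes more than 2g/3, then the way backwards from `c p`
      -- to `c (t + 1)` is shorter than g/3, and the edge, being light, adds at most g/3.
      by_cases hs : G.pathLen c t - G.pathLen c p + G.len (c t) (c (t + 1)) ≤ 2 * g / 3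
      · rcases hrun.along hdh hp.1 hp.2 (hc.walk h1) (hc.adj t) Walk.nil (by linarith)
          with h | h
        · exact ⟨h.1, h.2.2.2⟩
        · exact absurd h (hno' _ _ (by linarith))
      · have hw := (hc.walk (show t + 1 ≤ p + m by omega)).symm
        rw [hcp, hgm] at hw
        have hl2 := G.len_symm (c t) (c (t + 1))
        rcases hrun.along hdh hp.1 hp.2 hw (G.symm (hc.adj t)) Walk.nil (by linarith)
          with h | h
        · exact ⟨h.2.1, h.2.2.2.symm⟩
        · exact absurd h (hno' _ _ (by linarith))
    have hvis : ∀ t, vis (c t) := by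
      intro t
      obtain ⟨t', h1, h2, h3, -⟩ := hc.exists_shift p t
      rw [← h3]
      exact (hedge t' h1 h2).1
    obtain ⟨t, h1, h2, h3⟩ := hc.exists_nontree hrun hvis p
    exact h3 (hedge t h1 h2).2
  · intro j hheavy hnear
    by_contra! hno
    have hcj : c (j + m) = c j := hc.per j
    have hm := hc.three
    have ej := G.pathLen_succ c j
    -- the argument for one end `b` of the heavy edge, where `b'` is the other end
    have main : ∀ b b' : ℕ, (b = c j ∧ b' = c (j + 1)) ∨ (b = c (j + 1) ∧ b' = c j) →
        (∀ t, j + 1 ≤ t → t < j + m → ∃ x y r q, (x = c t ∧ y = c (t + 1) ∨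
          x = c (t + 1) ∧ y = c t) ∧ G.Walk b x r ∧ G.Adj x y ∧ G.Walk y b' q ∧
          r + G.len x y + q = g - G.len (c j) (c (j + 1))) → ¬ G.Near lev i b δ := by
      rintro b b' hbb hpath ⟨a, ha, hai, δ', hδ', hab⟩
      have hlow : ∀ r, r ≤ δ + 2 * g / 3 → ¬ G.Near lev (i + 1) b r := by
        intro r hr hn
        rcases hbb with ⟨rfl, rfl⟩ | ⟨rfl, rfl⟩
        · exact hno.1 (hn.mono hr)
        · exact hno.2 (hn.mono hr)
      have hlow' : ∀ r, r ≤ δ + 2 * g / 3 → ¬ G.Near lev (i + 1) b' r := by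
        intro r hr hn
        rcases hbb with ⟨rfl, rfl⟩ | ⟨rfl, rfl⟩
        · exact hno.2 (hn.mono hr)
        · exact hno.1 (hn.mono hr)
      have hlev : lev a = i := by
        by_contra hne
        exact hlow δ' (by linarith) ⟨a, ha, by omega, δ', le_rfl, hab⟩
      -- The list of b is read only in the search from its pivot, so the start a is exchanged for
      -- `pw b`, which is within δ' of b as well.
      obtain ⟨hpn, hpl, r', hr', hwb⟩ : pw b < G.n ∧ lev (pw b) = i ∧
          ∃ r' ≤ δ', G.Walk (pw b) b r' := by
        rcases hpw a ha hlev b δ' hab (by linarith) with h | h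
        · exact h
        · exact absurd h (hlow _ (by linarith))
      obtain ⟨vis, par, d, hrun, hcheck⟩ := hruns (pw b) hpn hpl
      have hp : vis b ∧ d b ≤ δ := by
        rcases hrun.reach hdh hrun.root hrun.d_root.le hwb (by linarith) with h | h
        · exact ⟨h.1, by linarith [h.2]⟩
        · exact absurd h (hlow _ (by linarith))
      have hedge : ∀ t, j + 1 ≤ t → t < j + m → vis (c t) ∧ vis (c (t + 1)) ∧
          (par (c (t + 1)) = c t ∨ par (c t) = c (t + 1)) := by
        intro t h1 h2
        obtain ⟨x, y, r, q, hxy, hbx, he, hyb, hsum⟩ := hpath t h1 h2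
        rcases hrun.along hdh hp.1 hp.2 hbx he hyb (by linarith) with h | h
        · rcases hxy with ⟨rfl, rfl⟩ | ⟨rfl, rfl⟩
          · exact ⟨h.1, h.2.1, h.2.2.2⟩
          · exact ⟨h.2.1, h.1, h.2.2.2.symm⟩
        · exact absurd h (hlow' _ (by linarith))
      have hvb' : vis b' ∧ d b' ≤ δ + (g - G.len (c j) (c (j + 1))) := by
        have hw : G.Walk b b' (g - G.len (c j) (c (j + 1))) := by
          obtain ⟨x, y, r, q, hxy, hbx, he, hyb, hsum⟩ := hpath (j + 1) le_rfl (by omega)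
          rw [← hsum]
          exact (hbx.snoc he).trans hyb
        rcases hrun.reach hdh hp.1 hp.2 hw (by linarith) with h | h
        · exact h
        · exact absurd h (hlow' _ (by linarith))
      have hvis : ∀ t, vis (c t) := by
        intro t
        obtain ⟨t', h1, h2, h3, -⟩ := hc.exists_shift (j + 1) t
        rw [← h3]
        rcases Nat.lt_or_ge t' (j + m) with h4 | h4
        · exact (hedge t' h1 h4).1
        · obtain rfl : t' = j + m := by omega
          have := (hedge (j + m - 1) (by omega) (by omega)).2.1
          rwa [show j + m - 1 + 1 = j + m by omega] at this
      obtain ⟨t, h1, h2, h3⟩ := hc.exists_nontree hrun hvis j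
      rcases Nat.lt_or_ge j t with h4 | h4
      · exact h3 (hedge t h4 h2).2.2
      · obtain rfl : t = j := by omega
        push Not at h3
        -- Here d b ≤ δ and d b' ≤ δ + g - len, so B ≤ 2δ + g, and this is at most 2(δ + 2g/3).
        have : B ≤ d b + G.len (c t) (c (t + 1)) + d b' := by
          rcases hbb with ⟨rfl, rfl⟩ | ⟨rfl, rfl⟩
          · exact hcheck _ _ hp.1 rfl hvb'.1 (hc.adj t) h3.2 h3.1
          · rw [G.len_symm (c t)]
            exact hcheck _ _ hp.1 rfl hvb'.1 (G.symm (hc.adj t)) h3.1 h3.2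
        linarith
    rcases hnear with hn | hn
    · refine main _ _ (.inl ⟨rfl, rfl⟩) (fun t h1 h2 => ?_) hn
      have hw := (hc.walk (show t + 1 ≤ j + m by omega)).symm
      rw [hcj, hgm] at hw
      refine ⟨_, _, _, _, .inr ⟨rfl, rfl⟩, hw, G.symm (hc.adj t), (hc.walk h1).symm, ?_⟩
      have e := G.pathLen_succ c t
      have hl2 := G.len_symm (c t) (c (t + 1))
      linarith
    · refine main _ _ (.inr ⟨rfl, rfl⟩) (fun t h1 h2 => ?_) hn
      have hw := hc.walk (show t + 1 ≤ j + m by omega)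
      rw [hcj, hgm] at hw
      refine ⟨_, _, _, _, .inl ⟨rfl, rfl⟩, hc.walk h1, hc.adj t, hw, ?_⟩
      have e := G.pathLen_succ c t
      linarith

/-- The level-0 vertices of the cycle itself start the chain with δ = 0, and each step adds 2g/3. If
B exceeded twice the final distance K · 2g/3, all K steps would be available and would lead to a
vertex of level at least K. In the light case the near point may move along the cycle; in the heavy
case it stays at the ends of one fixed edge. -/
theorem le_of_steps {B : ℝ} {K : ℕ} (hlev : ∀ a < G.n, lev a < K)
    (hstep : ∀ i < K, G.Step lev i B) {c : ℕ → ℕ} {m : ℕ} (hc : G.Cyc c m) :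
    B ≤ 4 * K / 3 * G.pathLen c m := by
  by_contra! hB
  set g := G.pathLen c m with hg
  have hg0 : 0 ≤ g := by
    have := (hc.walk (Nat.zero_le m)).nonneg
    simpa [pathLen, hg] using this
  have hbound : ∀ i : ℕ, i < K → 2 * (i * (2 * g / 3) + 2 * g / 3) < B := by
    intro i hi
    have h1 : ((i + 1 : ℕ) : ℝ) ≤ K := by exact_mod_cast hi
    push_cast at h1
    nlinarith
  have hfalse : ∀ x r, ¬ G.Near lev K x r := by
    rintro x r ⟨a, ha, h, -⟩
    have := hlev a ha
    omega
  have hzero : G.Near lev 0 (c 0) ((0 : ℕ) * (2 * g / 3)) :=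
    ⟨c 0, hc.lt 0, Nat.zero_le _, 0, by simp, Walk.nil⟩
  by_cases hl : ∀ j, G.len (c j) (c (j + 1)) ≤ g / 3
  · have : ∀ i ≤ K, ∃ p, G.Near lev i (c p) (i * (2 * g / 3)) := by
      intro i
      induction i with
      | zero => exact fun _ => ⟨0, hzero⟩
      | succ i ih =>
        intro hi
        obtain ⟨p, hp⟩ := ih (by omega)
        obtain ⟨p', hp'⟩ := (hstep i (by omega) c m hc _ (hbound i (by omega))).1 hl p hp
        exact ⟨p', by push_cast; rwa [add_mul, one_mul]⟩
    obtain ⟨p, hp⟩ := this K le_rfl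
    exact hfalse _ _ hp
  · push Not at hl
    obtain ⟨j, hj⟩ := hl
    have : ∀ i ≤ K, 1 ≤ i → G.Near lev i (c j) (i * (2 * g / 3)) ∨
        G.Near lev i (c (j + 1)) (i * (2 * g / 3)) := by
      intro i
      induction i with
      | zero => intro _ h; omega
      | succ i ih =>
        intro hi _
        have h0 : G.Near lev i (c j) (i * (2 * g / 3)) ∨
            G.Near lev i (c (j + 1)) (i * (2 * g / 3)) := by
          rcases Nat.eq_zero_or_pos i with rfl | h
          · exact .inl ⟨c j, hc.lt j, Nat.zero_le _, 0, by simp, Walk.nil⟩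
          · exact ih (by omega) h
        have := (hstep i (by omega) c m hc _ (hbound i (by omega))).2 j hj.le h0
        push_cast
        rwa [add_mul, one_mul]
    have hK : 1 ≤ K := by have := hlev (c 0) (hc.lt 0); omega
    rcases this K le_rfl hK with h | h <;> exact hfalse _ _ h

end Net

/-! ### Sorted adjacency arrays and the search for the next admissible entry -/

/-- Adjacency arrays: the entries `off x ≤ p < off (x + 1)` list the edges from `x`, by increasing
length. -/
structure Net.CSR (G : Net) (M : ℕ) (off adj : ℕ → ℕ) (len : ℕ → ℝ) : Prop where
  zero : off 0 = 0
  last : off G.n = M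
  mono : ∀ x < G.n, off x ≤ off (x + 1)
  edge : ∀ x < G.n, ∀ p, off x ≤ p → p < off (x + 1) → G.Adj x (adj p) ∧ len p = G.len x (adj p)
  inj : ∀ x < G.n, ∀ p q, off x ≤ p → p < off (x + 1) → off x ≤ q → q < off (x + 1) →
    adj p = adj q → p = q
  surj : ∀ x y, G.Adj x y → ∃ p, off x ≤ p ∧ p < off (x + 1) ∧ adj p = y
  sorted : ∀ x < G.n, ∀ p q, off x ≤ p → p ≤ q → q < off (x + 1) → len p ≤ len q

theorem Net.CSR.le_last {G : Net} {M : ℕ} {off adj : ℕ → ℕ} {len : ℕ → ℝ}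
    (h : G.CSR M off adj len) : ∀ x ≤ G.n, off x ≤ M := by
  intro x hx
  induction hx using Nat.decreasingInduction with
  | self => exact h.last.le
  | of_succ x hx ih => exact (h.mono x hx).trans ih

namespace RealRAM

variable {G : Net} {W H M : ℕ}

/-- The data that stay fixed during the main part of the program. -/
structure Env (G : Net) (W H M : ℕ) (s : State) : Prop where
  n : s.wreg 0 = G.n
  zero : s.wreg 2 = 0
  one : s.wreg 3 = 1
  two : s.wreg 4 = 2
  entries : s.wreg 5 = M
  leaves : s.wreg 6 = 2 ^ H
  rzero : s.rreg 0 = 0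
  big : 0 < s.rreg 1
  cap : 4 * 2 ^ H + 8 ≤ W
  room : M + G.n < 2 ^ H
  csr : G.CSR M (s.warr 0) (s.warr 3) (s.rarr 1)

/-- `P` writes to the data of `Env`. -/
def Prog.writesEnv (P : Prog) : Bool :=
  P.writesW 0 || P.writesW 2 || P.writesW 3 || P.writesW 4 || P.writesW 5 || P.writesW 6 ||
    P.writesR 0 || P.writesR 1 || P.writesWA 0 || P.writesWA 3 || P.writesRA 1

theorem Env.frame {P : Prog} {s s' : State} (h : Env G W H M s) (hF : Frame P s s')
    (hP : P.writesEnv = false := by rfl) : Env G W H M s' := by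
  simp only [Prog.writesEnv, Bool.or_eq_false_iff] at hP
  obtain ⟨⟨⟨⟨⟨⟨⟨⟨⟨⟨h0, h2⟩, h3⟩, h4⟩, h5⟩, h6⟩, hr0⟩, hr1⟩, ha0⟩, ha3⟩, hra1⟩ := hP
  constructor
  · rw [hF.w 0 h0, h.n]
  · rw [hF.w 2 h2, h.zero]
  · rw [hF.w 3 h3, h.one]
  · rw [hF.w 4 h4, h.two]
  · rw [hF.w 5 h5, h.entries]
  · rw [hF.w 6 h6, h.leaves]
  · rw [hF.r 0 hr0, h.rzero]
  · rw [hF.r 1 hr1]; exact h.big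
  · exact h.cap
  · exact h.room
  · rw [hF.wa 0 ha0, hF.wa 3 ha3, hF.ra 1 hra1]; exact h.csr

/-- The tree in the real array `3` holds the slacks of the entries, with a sentinel. -/
structure KeyTree (H M : ℕ) (big : ℝ) (adj : ℕ → ℕ) (len dh key : ℕ → ℝ) : Prop where
  tree : IsMinTree (2 ^ H) key
  leaf : ∀ p < M, key (2 ^ H + p) = len p - dh (adj p)
  sentinel : key (2 ^ H + M) = -big

/-- Find the next entry from `50` on that is admissible for the vertex `45`. -/
def advanceFind : Prog :=
  .seq findNext
    (.ite (.wlt 50 47) (.seq (block [.wload 49 3 50])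
      (.ite (.weq 49 48) (.seq (block [.wop .add 50 50 3]) findNext) (block [.skip])))
    (block [.skip]))

/-- Find the next admissible event of the vertex `45`, from the entry `50` on. -/
def advance : Prog :=
  .seq (block [.rload 25 4 45, .wop .add 46 45 3, .wload 47 0 46, .wload 48 6 45])
  (.seq advanceFind
  (.seq (.ite (.wlt 50 47) (block [.wstore 7 45 50, .rload 20 1 50, .radd 20 20 25])
    (block [.rmove 20 1]))
  (.seq (block [.wmove 40 45]) heapUpdate)))

/-- The entry `p` of the list of `x` is admissible. -/
def Admits (adj : ℕ → ℕ) (len dh : ℕ → ℝ) (dx : ℝ) (px : ℕ) (p : ℕ) : Prop :=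
  dx + len p < dh (adj p) ∧ adj p ≠ px

/-- The slack of an entry plus d x is negative exactly if the entry passes the test against `dh`, so
`findNext` jumps over all entries that fail it. Besides these, only the entry of the parent has to
be rejected; lists have no repetitions, so a second `findNext` is enough. In a sorted list the entry
found is the earliest event left for x. -/
theorem wp_advance {s : State} (hE : Env G W H M s)
    (hK : KeyTree H M (s.rreg 1) (s.warr 3) (s.rarr 1) (s.rarr 5) (s.rarr 3))
    (hT : IsMinTree (2 ^ H) (s.rarr 2)) {x fr hi : ℕ} (hx : s.wreg 45 = x) (hxn : x < G.n)
    (hfr : s.wreg 50 = fr) (hhi : s.warr 0 (x + 1) = hi) (hlo : s.warr 0 x ≤ fr) (hle : fr ≤ hi)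
    (hd : s.rarr 4 x < s.rreg 1) :
    wp W advance (fun t s' => t ≤ 70 * H + 90 ∧ IsMinTree (2 ^ H) (s'.rarr 2) ∧
      ∃ v, (∀ p < 2 ^ H, s'.rarr 2 (2 ^ H + p) = if p = x then v else s.rarr 2 (2 ^ H + p)) ∧
      ((v = s.rreg 1 ∧ s'.warr 7 = s.warr 7 ∧ ∀ p, fr ≤ p → p < hi →
          ¬ Admits (s.warr 3) (s.rarr 1) (s.rarr 5) (s.rarr 4 x) (s.warr 6 x) p) ∨
        ∃ q, fr ≤ q ∧ q < hi ∧ v = s.rarr 4 x + s.rarr 1 q ∧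
          s'.warr 7 = Function.update (s.warr 7) x q ∧
          Admits (s.warr 3) (s.rarr 1) (s.rarr 5) (s.rarr 4 x) (s.warr 6 x) q ∧
          ∀ p, fr ≤ p → p < q →
            ¬ Admits (s.warr 3) (s.rarr 1) (s.rarr 5) (s.rarr 4 x) (s.warr 6 x) p)) s := by
  have hcap := hE.cap
  have hroom := hE.room
  have hhiM : hi ≤ M := by rw [← hhi]; exact hE.csr.le_last _ hxn
  -- what the tree says about admissibility
  have hkey : ∀ p, p < hi → (s.rarr 3 (2 ^ H + p) + s.rarr 4 x < 0 ↔
      s.rarr 4 x + s.rarr 1 p < s.rarr 5 (s.warr 3 p)) := by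
    intro p hp
    rw [hK.leaf p (by omega)]
    constructor <;> intro h <;> linarith
  -- Since d x < big, the sentinel at M always counts as good; an answer at or beyond `hi` means
  -- that the list is exhausted.
  have hsent : s.rarr 3 (2 ^ H + M) + s.rarr 4 x < 0 := by rw [hK.sentinel]; linarith
  unfold advance
  simp only [wp_seq, wp_ite, wp_block_one, wp_block_cons, Instr.Fits, Instr.apply, WordOp.eval,
    Test.Holds, Function.update_apply, Nat.reduceEqDiff, OfNat.ofNat_ne_zero, OfNat.zero_ne_ofNat,
    OfNat.ofNat_ne_one, OfNat.one_ne_ofNat, one_ne_zero, zero_ne_one, reduceIte, true_and, hx,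
    hE.one, hhi]
  refine ⟨by omega, ?_⟩
  set s₁ : State := _
  change wp W _ _ s₁
  -- after the searches
  have mid : wp W advanceFind (fun t s' => t ≤ 60 * H + 70 ∧
        ((hi ≤ s'.wreg 50 ∧ ∀ p, fr ≤ p → p < hi →
          ¬ Admits (s.warr 3) (s.rarr 1) (s.rarr 5) (s.rarr 4 x) (s.warr 6 x) p) ∨
        (fr ≤ s'.wreg 50 ∧ s'.wreg 50 < hi ∧
          Admits (s.warr 3) (s.rarr 1) (s.rarr 5) (s.rarr 4 x) (s.warr 6 x) (s'.wreg 50) ∧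
          ∀ p, fr ≤ p → p < s'.wreg 50 →
            ¬ Admits (s.warr 3) (s.rarr 1) (s.rarr 5) (s.rarr 4 x) (s.warr 6 x) p))) s₁ := by
    rw [advanceFind, wp_seq]
    refine wp.mono (wp_findNext (H := H) (M := M) (by simp [s₁, hE.zero]) (by simp [s₁, hE.one])
      (by simp [s₁, hE.two]) (by simp [s₁, hE.leaves]) (by simp [s₁, hE.rzero]) hcap hK.tree
      (by simp [s₁, hfr]; omega) (by omega) (by simpa [s₁] using hsent)) ?_
    rintro t s₂ hF ⟨ht, h1, h2, h3, h4⟩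
    have a50 : s₁.wreg 50 = fr := by simp [s₁, hfr]
    have a25 : s₁.rreg 25 = s.rarr 4 x := by simp [s₁]
    rw [a50] at h1
    rw [a25] at h3
    rw [a25, a50] at h4
    change s.rarr 3 _ + _ < 0 at h3
    change ∀ p, _ → _ → ¬ s.rarr 3 _ + _ < 0 at h4
    have b47 : s₂.wreg 47 = hi := by rw [hF.w 47]; simp [s₁]
    have b48 : s₂.wreg 48 = s.warr 6 x := by rw [hF.w 48]; simp [s₁]
    have b3 : s₂.wreg 3 = 1 := by rw [hF.w 3]; simp [s₁, hE.one]
    have bA : s₂.warr 3 = s.warr 3 := by rw [hF.wa 3]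
    set q := s₂.wreg 50 with hq
    have hbad : ∀ p, fr ≤ p → p < q → p < hi →
        ¬ Admits (s.warr 3) (s.rarr 1) (s.rarr 5) (s.rarr 4 x) (s.warr 6 x) p :=
      fun p e1 e2 e3 h => h4 p e1 e2 ((hkey p e3).2 h.1)
    simp only [wp_seq, wp_ite, wp_block_one, wp_block_cons, Instr.Fits, Instr.apply,
      WordOp.eval, Test.Holds, Function.update_apply, Nat.reduceEqDiff, OfNat.ofNat_ne_zero,
      OfNat.zero_ne_ofNat, OfNat.ofNat_ne_one, OfNat.one_ne_ofNat, one_ne_zero, zero_ne_one,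
      reduceIte, true_and, b47, b48, b3, bA, ← hq]
    refine ⟨fun hqh => ⟨fun hpar => ⟨by omega, ?_⟩, fun hpar => ?_⟩, fun hqh => ?_⟩
    · set s₃ : State := _
      change wp W _ _ s₃
      refine wp.mono (wp_findNext (H := H) (M := M) (s := s₃)
        (by simp [s₃, hF.w 2, s₁, hE.zero]) (by simp [s₃, b3])
        (by simp [s₃, hF.w 4, s₁, hE.two]) (by simp [s₃, hF.w 6, s₁, hE.leaves])
        (by simp [s₃, hF.r 0, s₁, hE.rzero]) hcap (by simpa [s₃, hF.ra 3] using hK.tree)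
        (by simp [s₃]; omega) (by omega) (by simpa [s₃, hF.ra 3, hF.r 25, s₁] using hsent)) ?_
      rintro u s₄ hF' ⟨hu, g1, g2, g3, g4⟩
      have c50 : s₃.wreg 50 = q + 1 := by simp [s₃]
      have c25 : s₃.rreg 25 = s.rarr 4 x := by simp [s₃, hF.r 25, s₁]
      have cT : s₃.rarr 3 = s.rarr 3 := by simp [s₃, hF.ra 3, s₁]
      rw [c50] at g1
      rw [c25, cT] at g3
      rw [c25, c50, cT] at g4
      have hbad' : ∀ p, fr ≤ p → p < s₄.wreg 50 → p < hi →
          ¬ Admits (s.warr 3) (s.rarr 1) (s.rarr 5) (s.rarr 4 x) (s.warr 6 x) p := by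
        intro p e1 e2 e3 h
        rcases lt_trichotomy p q with e | e | e
        · exact hbad p e1 e e3 h
        · rw [e] at h; exact h.2 hpar
        · exact g4 p e e2 ((hkey p e3).2 h.1)
      refine ⟨by omega, ?_⟩
      rcases Nat.lt_or_ge (s₄.wreg 50) hi with e | e
      · refine .inr ⟨by omega, e, ⟨(hkey _ e).1 g3, fun h => ?_⟩, fun p e1 e2 =>
          hbad' p e1 e2 (by omega)⟩
        have := hE.csr.inj x hxn q (s₄.wreg 50) (by omega) (by omega) (by omega) (by omega)
          (by rw [h, hpar])
        omega
      · exact .inl ⟨e, fun p e1 e2 => hbad' p e1 (by omega) e2⟩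
    · exact ⟨by omega, .inr ⟨h1, hqh, ⟨(hkey _ hqh).1 h3, hpar⟩, fun p e1 e2 =>
        hbad p e1 e2 (by omega)⟩⟩
    · exact ⟨by omega, .inl ⟨by omega, fun p e1 e2 => hbad p e1 (by omega) e2⟩⟩
  refine wp.mono mid ?_
  rintro t s₃ hF₃ ⟨ht, hq⟩
  set q := s₃.wreg 50 with hqdef
  have b47 : s₃.wreg 47 = hi := by rw [hF₃.w 47]; simp [s₁]
  have b45 : s₃.wreg 45 = x := by rw [hF₃.w 45]; simp [s₁, hx]
  have b3 : s₃.wreg 3 = 1 := by rw [hF₃.w 3]; simp [s₁, hE.one]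
  have b4 : s₃.wreg 4 = 2 := by rw [hF₃.w 4]; simp [s₁, hE.two]
  have b6 : s₃.wreg 6 = 2 ^ H := by rw [hF₃.w 6]; simp [s₁, hE.leaves]
  have b25 : s₃.rreg 25 = s.rarr 4 x := by rw [hF₃.r 25]; simp [s₁]
  have br1 : s₃.rreg 1 = s.rreg 1 := by rw [hF₃.r 1]; simp [s₁]
  have bA1 : s₃.rarr 1 = s.rarr 1 := by rw [hF₃.ra 1]
  have bA2 : s₃.rarr 2 = s.rarr 2 := by rw [hF₃.ra 2]
  have bA7 : s₃.warr 7 = s.warr 7 := by rw [hF₃.wa 7]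
  simp only [wp_seq, wp_ite, wp_block_one, wp_block_cons, Instr.Fits, Instr.apply, WordOp.eval,
    Test.Holds, Function.update_apply, Nat.reduceEqDiff, OfNat.ofNat_ne_zero, OfNat.zero_ne_ofNat,
    OfNat.ofNat_ne_one, OfNat.one_ne_ofNat, one_ne_zero, zero_ne_one, reduceIte, true_and, b47,
    b45, b25, br1, bA1, ← hqdef]
  constructor
  · intro hlt
    set s₄ : State := _
    change wp W _ _ s₄
    refine wp.mono (wp_heapUpdate (H := H) (s := s₄) (by simp [s₄, b3]) (by simp [s₄, b4])
      (by simp [s₄, b6]) hcap (by simpa [s₄, bA2] using hT) (by simp [s₄]; omega)) ?_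
    rintro u s₅ hF₅ ⟨hu, hT', hleaf⟩
    refine ⟨by omega, hT', s.rarr 4 x + s.rarr 1 q, ?_, .inr ⟨q, ?_⟩⟩
    · intro p hp
      rw [hleaf p hp]
      simp [s₄, bA2, add_comm]
    · rcases hq with h | h
      · omega
      · refine ⟨h.1, hlt, rfl, ?_, h.2.2.1, h.2.2.2⟩
        rw [hF₅.wa 7]
        simp [s₄, bA7]
  · intro hlt
    set s₄ : State := _
    change wp W _ _ s₄
    refine wp.mono (wp_heapUpdate (H := H) (s := s₄) (by simp [s₄, b3]) (by simp [s₄, b4])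
      (by simp [s₄, b6]) hcap (by simpa [s₄, bA2] using hT) (by simp [s₄]; omega)) ?_
    rintro u s₅ hF₅ ⟨hu, hT', hleaf⟩
    refine ⟨by omega, hT', s.rreg 1, ?_, .inl ⟨rfl, ?_, ?_⟩⟩
    · intro p hp
      rw [hleaf p hp]
      simp [s₄, bA2]
    · rw [hF₅.wa 7]
      simp [s₄, bA7]
    · rcases hq with h | h
      · exact h.2
      · omega

end RealRAM

/-! ### The state of a running search -/

namespace RealRAM

variable {G : Net} {W H M : ℕ}

/-- For states that are explicit record updates, where all the equalities hold by `rfl`; `Env.frame`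
serves states that are known only through a frame. -/
theorem Env.of_eq {s s' : State} (h : Env G W H M s) (h0 : s'.wreg 0 = s.wreg 0 := by rfl)
    (h2 : s'.wreg 2 = s.wreg 2 := by rfl) (h3 : s'.wreg 3 = s.wreg 3 := by rfl)
    (h4 : s'.wreg 4 = s.wreg 4 := by rfl) (h5 : s'.wreg 5 = s.wreg 5 := by rfl)
    (h6 : s'.wreg 6 = s.wreg 6 := by rfl) (hr0 : s'.rreg 0 = s.rreg 0 := by rfl)
    (hr1 : s'.rreg 1 = s.rreg 1 := by rfl) (ha0 : s'.warr 0 = s.warr 0 := by rfl)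
    (ha3 : s'.warr 3 = s.warr 3 := by rfl) (hra1 : s'.rarr 1 = s.rarr 1 := by rfl) :
    Env G W H M s' := by
  constructor
  · rw [h0, h.n]
  · rw [h2, h.zero]
  · rw [h3, h.one]
  · rw [h4, h.two]
  · rw [h5, h.entries]
  · rw [h6, h.leaves]
  · rw [hr0, h.rzero]
  · rw [hr1]; exact h.big
  · exact h.cap
  · exact h.room
  · rw [ha0, ha3, hra1]; exact h.csr

theorem IsMinTree.le_root {H : ℕ} {T : ℕ → ℝ} (hT : IsMinTree (2 ^ H) T) {a : ℝ}
    (h : ∀ p < 2 ^ H, a ≤ T (2 ^ H + p)) : a ≤ T 1 := by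
  have hpos := Nat.one_le_two_pow (n := H)
  suffices H' : ∀ k v, 1 ≤ v → v < 2 * 2 ^ H → 2 * 2 ^ H - v = k → a ≤ T v from
    H' _ 1 le_rfl (by omega) rfl
  intro k
  induction k using Nat.strong_induction_on with
  | _ k ih =>
    intro v h1 h2 h3
    rcases Nat.lt_or_ge v (2 ^ H) with h4 | h4
    · rw [hT v h1 h4]
      exact le_min (ih _ (by omega) (2 * v) (by omega) (by omega) rfl)
        (ih _ (by omega) (2 * v + 1) (by omega) (by omega) rfl)
    · have := h (v - 2 ^ H) (by omega)
      rwa [show 2 ^ H + (v - 2 ^ H) = v by omega] at this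

/-- The tree of visited vertices of a search from `w`; `vl` lists the `cnt` visited vertices in the
order of their discovery. -/
structure IsTree (G : Net) (dh : ℕ → ℝ) (w : ℕ) (B : ℝ) (cnt : ℕ) (vis par vl : ℕ → ℕ)
    (d : ℕ → ℝ) : Prop where
  root : vl 0 = w
  pos : 0 < cnt
  vis_vl : ∀ t < cnt, vis (vl t) = 1
  vis_or : ∀ x, vis x = 0 ∨ vis x = 1 ∧ ∃ t < cnt, vl t = x
  inj : ∀ t < cnt, ∀ t' < cnt, vl t = vl t' → t = t'
  lt : ∀ t < cnt, vl t < G.n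
  par_root : par w = w
  d_root : d w = 0
  walk : ∀ x, vis x = 1 → G.Walk w x (d x)
  tree : ∀ x, vis x = 1 → x ≠ w →
    vis (par x) = 1 ∧ G.Adj (par x) x ∧ d x = d (par x) + G.len (par x) x
  adm : ∀ x, vis x = 1 → x ≠ w → d x < dh x ∧ 2 * d x < B
  rank : ∀ t, 0 < t → t < cnt → ∃ t' < t, vl t' = par (vl t)

theorem IsTree.vis_lt {dh : ℕ → ℝ} {w : ℕ} {B : ℝ} {cnt : ℕ} {vis par vl : ℕ → ℕ} {d : ℕ → ℝ}
    (h : IsTree G dh w B cnt vis par vl d) {x : ℕ} (hx : vis x = 1) : x < G.n := by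
  rcases h.vis_or x with h0 | ⟨-, t, ht, rfl⟩
  · omega
  · exact h.lt t ht

theorem IsTree.cnt_le {dh : ℕ → ℝ} {w : ℕ} {B : ℝ} {cnt : ℕ} {vis par vl : ℕ → ℕ} {d : ℕ → ℝ}
    (h : IsTree G dh w B cnt vis par vl d) : cnt ≤ G.n := by
  have := Finset.card_le_card_of_injOn (s := Finset.range cnt) (t := Finset.range G.n) vl
    (fun t ht => by simpa using h.lt t (by simpa using ht))
    (fun t ht t' ht' e => h.inj t (by simpa using ht) t' (by simpa using ht') e)
  simpa using this

theorem IsTree.singleton (G : Net) {dh : ℕ → ℝ} {w : ℕ} {B : ℝ} {vis par vl : ℕ → ℕ} {d : ℕ → ℝ}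
    (hw : w < G.n) (h0 : ∀ x, vis x = 0) :
    IsTree G dh w B 1 (Function.update vis w 1) (Function.update par w w)
      (Function.update vl 0 w) (Function.update d w 0) := by
  have key : ∀ x, Function.update vis w 1 x = 1 → x = w := by
    intro x hx
    by_contra hne
    rw [Function.update_of_ne hne, h0] at hx
    omega
  refine ⟨by simp, by omega, ?_, ?_, ?_, ?_, by simp, by simp, ?_, ?_, ?_, ?_⟩
  · intro t ht
    obtain rfl : t = 0 := by omega
    simp
  · intro x
    by_cases hx : x = w
    · exact .inr ⟨by simp [hx], 0, by omega, by simp [hx]⟩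
    · exact .inl (by rw [Function.update_of_ne hx, h0])
  · intros; omega
  · intro t ht
    obtain rfl : t = 0 := by omega
    simpa using hw
  · intro x hx
    rw [key x hx]
    simpa using Net.Walk.nil
  · intro x hx hne; exact absurd (key x hx) hne
  · intro x hx hne; exact absurd (key x hx) hne
  · intros; omega

theorem IsTree.insert {dh : ℕ → ℝ} {w : ℕ} {B : ℝ} {cnt : ℕ} {vis par vl : ℕ → ℕ} {d : ℕ → ℝ}
    (h : IsTree G dh w B cnt vis par vl d) {x y : ℕ} (hx : vis x = 1) (hy : vis y ≠ 1)
    (hxy : G.Adj x y) (hdh : d x + G.len x y < dh y) (hB : 2 * (d x + G.len x y) < B) :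
    IsTree G dh w B (cnt + 1) (Function.update vis y 1) (Function.update par y x)
      (Function.update vl cnt y) (Function.update d y (d x + G.len x y)) := by
  have hvw : vis w = 1 := by rw [← h.root]; exact h.vis_vl 0 h.pos
  have hwy : w ≠ y := by rintro rfl; exact hy hvw
  have hxy' : x ≠ y := by rintro rfl; exact hy hx
  have hvne : ∀ t < cnt, vl t ≠ y := fun t ht e => hy (e ▸ h.vis_vl t ht)
  have hvn : ∀ z, vis z = 1 → z ≠ y := by rintro z hz rfl; exact hy hz
  refine ⟨?_, by omega, ?_, ?_, ?_, ?_, ?_, ?_, ?_, ?_, ?_, ?_⟩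
  · rw [Function.update_of_ne h.pos.ne, h.root]
  · intro t ht
    by_cases e : t = cnt
    · simp [e]
    · rw [Function.update_of_ne e, Function.update_of_ne (hvne t (by omega)),
        h.vis_vl t (by omega)]
  · intro z
    by_cases e : z = y
    · exact .inr ⟨by simp [e], cnt, by omega, by simp [e]⟩
    · rw [Function.update_of_ne e]
      rcases h.vis_or z with h' | ⟨h', t, ht, h''⟩
      · exact .inl h'
      · exact .inr ⟨h', t, by omega, by rw [Function.update_of_ne (by omega), h'']⟩
  · intro t ht t' ht' e
    by_cases e1 : t = cnt <;> by_cases e2 : t' = cnt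
    · omega
    · subst e1
      rw [Function.update_self, Function.update_of_ne e2] at e
      exact absurd e.symm (hvne t' (by omega))
    · subst e2
      rw [Function.update_self, Function.update_of_ne e1] at e
      exact absurd e (hvne t (by omega))
    · rw [Function.update_of_ne e1, Function.update_of_ne e2] at e
      exact h.inj t (by omega) t' (by omega) e
  · intro t ht
    by_cases e : t = cnt
    · rw [e, Function.update_self]; exact G.lt (G.symm hxy)
    · rw [Function.update_of_ne e]; exact h.lt t (by omega)
  · rw [Function.update_of_ne hwy, h.par_root]
  · rw [Function.update_of_ne hwy, h.d_root]
  · intro z hz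
    by_cases e : z = y
    · rw [e, Function.update_self]; exact (h.walk x hx).snoc hxy
    · rw [Function.update_of_ne e] at hz ⊢; exact h.walk z hz
  · intro z hz hzw
    by_cases e : z = y
    · rw [e, Function.update_self, Function.update_self, Function.update_of_ne hxy',
        Function.update_of_ne hxy']
      exact ⟨hx, hxy, rfl⟩
    · rw [Function.update_of_ne e] at hz
      obtain ⟨h1, h2, h3⟩ := h.tree z hz hzw
      rw [Function.update_of_ne e, Function.update_of_ne (hvn _ h1), Function.update_of_ne e,
        Function.update_of_ne (hvn _ h1)]
      exact ⟨h1, h2, h3⟩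
  · intro z hz hzw
    by_cases e : z = y
    · rw [e, Function.update_self]; exact ⟨hdh, hB⟩
    · rw [Function.update_of_ne e] at hz ⊢; exact h.adm z hz hzw
  · intro t ht0 ht
    by_cases e : t = cnt
    · rw [e, Function.update_self, Function.update_self]
      rcases h.vis_or x with h' | ⟨-, t', ht', h''⟩
      · omega
      · exact ⟨t', ht', by rw [Function.update_of_ne (by omega), h'']⟩
    · obtain ⟨t', ht', h'⟩ := h.rank t ht0 (by omega)
      exact ⟨t', ht', by rw [Function.update_of_ne e, Function.update_of_ne (by omega),
        Function.update_of_ne (hvne t (by omega)), h']⟩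

/-- The entry `p` of the list of `x` has been used as a tree edge. -/
def Done (adj vis par : ℕ → ℕ) (x p : ℕ) : Prop := vis (adj p) = 1 ∧ par (adj p) = x

/-- `v` is the time of the next event of `x`. -/
def IsEvent (off adj : ℕ → ℕ) (len dh : ℕ → ℝ) (big : ℝ) (vis par ptr : ℕ → ℕ) (d : ℕ → ℝ) (x : ℕ)
    (v : ℝ) : Prop :=
  (v = big ∧ ∀ p, off x ≤ p → p < off (x + 1) → Admits adj len dh (d x) (par x) p →
      Done adj vis par x p) ∨
    (off x ≤ ptr x ∧ ptr x < off (x + 1) ∧ v = d x + len (ptr x) ∧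
      Admits adj len dh (d x) (par x) (ptr x) ∧
      (∀ p, off x ≤ p → p < ptr x → Admits adj len dh (d x) (par x) p → Done adj vis par x p) ∧
      ∀ p, ptr x ≤ p → p < off (x + 1) → ¬ Done adj vis par x p)

/-- The invariant of a search from `w`, as long as no cycle has been closed. -/
structure Running (G : Net) (H w : ℕ) (B : ℝ) (s : State) : Prop where
  tree : IsTree G (s.rarr 5) w B (s.wreg 13) (s.warr 5) (s.warr 6) (s.warr 8) (s.rarr 4)
  heap : IsMinTree (2 ^ H) (s.rarr 2)
  time : s.rreg 4 = s.rarr 2 1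
  time2 : s.rreg 3 = s.rarr 2 1 + s.rarr 2 1
  flag : s.wreg 14 = 0
  bound : s.rreg 2 = B
  idle : ∀ x < 2 ^ H, s.warr 5 x ≠ 1 → s.rarr 2 (2 ^ H + x) = s.rreg 1
  event : ∀ x, s.warr 5 x = 1 → IsEvent (s.warr 0) (s.warr 3) (s.rarr 1) (s.rarr 5) (s.rreg 1)
    (s.warr 5) (s.warr 6) (s.warr 7) (s.rarr 4) x (s.rarr 2 (2 ^ H + x))
  le : ∀ x, s.warr 5 x = 1 → s.rarr 4 x ≤ s.rarr 2 1

/-- Visit the vertex `19` by the entry `18` of the list of the vertex `17`. -/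
def visit : Prog :=
  .seq (block [.wstore 5 19 3, .wstore 6 19 17, .rstore 4 19 4, .wstore 8 13 19, .wop .add 13 13 3,
    .wmove 45 19, .wload 50 0 19])
  (.seq advance (.seq (block [.wmove 45 17, .wop .add 50 18 3])
  (.seq advance (block [.rload 4 2 3, .radd 3 4 4]))))

/-- Connects `wp_advance` with the invariant: the entries before `fr` are settled by `hdone`, and
those between `fr` and the new pointer are inadmissible. -/
theorem IsEvent.of_admits {off adj : ℕ → ℕ} {len dh : ℕ → ℝ} {big : ℝ} {vis par ptr ptr' : ℕ → ℕ}
    {d : ℕ → ℝ} {x fr : ℕ} {v : ℝ}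
    (hdone : ∀ p, off x ≤ p → p < fr → Admits adj len dh (d x) (par x) p → Done adj vis par x p)
    (hlo : off x ≤ fr) (hfresh : ∀ p, fr ≤ p → p < off (x + 1) → ¬ Done adj vis par x p)
    (h : (v = big ∧ ptr' = ptr ∧ ∀ p, fr ≤ p → p < off (x + 1) → ¬ Admits adj len dh (d x) (par x) p) ∨
      ∃ q, fr ≤ q ∧ q < off (x + 1) ∧ v = d x + len q ∧ ptr' = Function.update ptr x q ∧
        Admits adj len dh (d x) (par x) q ∧
        ∀ p, fr ≤ p → p < q → ¬ Admits adj len dh (d x) (par x) p) :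
    IsEvent off adj len dh big vis par ptr' d x v := by
  rcases h with ⟨rfl, -, h⟩ | ⟨q, h1, h2, rfl, rfl, h3, h4⟩
  · refine .inl ⟨rfl, fun p e1 e2 e3 => ?_⟩
    rcases Nat.lt_or_ge p fr with e | e
    · exact hdone p e1 e e3
    · exact absurd e3 (h p e e2)
  · refine .inr ?_
    rw [Function.update_self]
    refine ⟨by omega, h2, rfl, h3, fun p e1 e2 e3 => ?_, fun p e1 => hfresh p (by omega)⟩
    rcases Nat.lt_or_ge p fr with e | e
    · exact hdone p e1 e e3
    · exact absurd e3 (h4 p e e2)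

/-- Only two vertices need a new event: y starts at the head of its list, and x resumes after p. The
other events stay valid because the sole new tree edge is the one from x to y. -/
theorem wp_visit {s : State} {w x p y : ℕ} {B : ℝ} (hE : Env G W H M s)
    (hK : KeyTree H M (s.rreg 1) (s.warr 3) (s.rarr 1) (s.rarr 5) (s.rarr 3))
    (hR : Running G H w B s) (hB : B ≤ s.rreg 1) (h17 : s.wreg 17 = x) (h18 : s.wreg 18 = p)
    (h19 : s.wreg 19 = y) (hx : s.warr 5 x = 1) (hy : s.warr 5 y ≠ 1) (hlo : s.warr 0 x ≤ p)
    (hhi : p < s.warr 0 (x + 1)) (hpy : s.warr 3 p = y)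
    (hroot : s.rarr 2 1 = s.rarr 4 x + s.rarr 1 p) (hlt : 2 * s.rarr 2 1 < B)
    (hadm : Admits (s.warr 3) (s.rarr 1) (s.rarr 5) (s.rarr 4 x) (s.warr 6 x) p)
    (hdone : ∀ p', s.warr 0 x ≤ p' → p' < p →
      Admits (s.warr 3) (s.rarr 1) (s.rarr 5) (s.rarr 4 x) (s.warr 6 x) p' →
      Done (s.warr 3) (s.warr 5) (s.warr 6) x p')
    (hfresh : ∀ q, p ≤ q → q < s.warr 0 (x + 1) →
      ¬ Done (s.warr 3) (s.warr 5) (s.warr 6) x q) :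
    wp W visit (fun t s' => t ≤ 140 * H + 200 ∧ Running G H w B s' ∧
      s'.wreg 13 = s.wreg 13 + 1) s := by
  have hcap := hE.cap
  have hroom := hE.room
  have hcsr := hE.csr
  have hxn : x < G.n := hR.tree.vis_lt hx
  obtain ⟨hxy, hlen⟩ := hcsr.edge x hxn p hlo hhi
  rw [hpy] at hxy hlen
  have hyn : y < G.n := G.lt (G.symm hxy)
  have hxy' : x ≠ y := by rintro rfl; exact G.irrefl _ hxy
  have hpos := G.pos hxy
  have hpM := hcsr.le_last (x + 1) hxn
  have hbig := hE.big
  have hdx : 0 ≤ s.rarr 4 x := (hR.tree.walk x hx).nonneg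
  have hbig2 : s.rarr 2 1 < s.rreg 1 := by
    have : 0 ≤ s.rarr 2 1 := by rw [hroot, hlen]; linarith
    linarith
  have hcnt := hR.tree.cnt_le
  have hτ : s.rarr 2 1 = s.rarr 4 x + G.len x y := by rw [hroot, hlen]
  have htree := hR.tree.insert hx hy hxy (by rw [← hlen, ← hpy]; exact hadm.1)
    (by rw [← hτ]; exact hlt)
  unfold visit
  simp only [wp_seq, wp_ite, wp_block_one, wp_block_cons, Instr.Fits, Instr.apply, WordOp.eval,
    Test.Holds, Function.update_apply, Nat.reduceEqDiff, OfNat.ofNat_ne_zero, OfNat.zero_ne_ofNat,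
    OfNat.ofNat_ne_one, OfNat.one_ne_ofNat, one_ne_zero, zero_ne_one, reduceIte, true_and, h17,
    h18, h19, hE.one]
  refine ⟨by omega, ?_⟩
  set s₁ : State := _
  change wp W _ _ s₁
  have hE₁ : Env G W H M s₁ := hE.of_eq
  have hmem : s₁.rarr 4 = Function.update (s.rarr 4) y (s.rarr 4 x + G.len x y) := by
    simp [s₁, hR.time, hτ]
  have m5 : s₁.warr 5 = Function.update (s.warr 5) y 1 := by simp [s₁]
  have m6 : s₁.warr 6 = Function.update (s.warr 6) y x := by simp [s₁]
  have m8 : s₁.warr 8 = Function.update (s.warr 8) (s.wreg 13) y := by simp [s₁]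
  refine wp.mono (wp_advance (s := s₁) hE₁ hK hR.heap (x := y) (fr := s.warr 0 y)
    (hi := s.warr 0 (y + 1)) (by simp [s₁]) hyn (by simp [s₁]) rfl le_rfl (hcsr.mono y hyn)
    (by rw [hmem, Function.update_self, ← hτ]; exact hbig2)) ?_
  rintro t s₂ hF₂ ⟨ht, hT₂, v, hleaf₂, hv⟩
  have n17 : s₂.wreg 17 = x := by rw [hF₂.w 17]; simp [s₁, h17]
  have n18 : s₂.wreg 18 = p := by rw [hF₂.w 18]; simp [s₁, h18]
  have hE₂ : Env G W H M s₂ := hE₁.frame hF₂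
  simp only [wp_seq, wp_ite, wp_block_one, wp_block_cons, Instr.Fits, Instr.apply, WordOp.eval,
    Test.Holds, Function.update_apply, Nat.reduceEqDiff, OfNat.ofNat_ne_zero, OfNat.zero_ne_ofNat,
    OfNat.ofNat_ne_one, OfNat.one_ne_ofNat, one_ne_zero, zero_ne_one, reduceIte, true_and, n17,
    n18, hE₂.one]
  refine ⟨by omega, ?_⟩
  set s₃ : State := _
  change wp W _ _ s₃
  have hE₃ : Env G W H M s₃ := hE₂.of_eq
  have e0 : s₃.warr 0 = s.warr 0 := hF₂.wa 0
  have e3 : s₃.warr 3 = s.warr 3 := hF₂.wa 3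
  have e1 : s₃.rarr 1 = s.rarr 1 := hF₂.ra 1
  have e5 : s₃.rarr 5 = s.rarr 5 := hF₂.ra 5
  have eK : s₃.rarr 3 = s.rarr 3 := hF₂.ra 3
  have er1 : s₃.rreg 1 = s.rreg 1 := hF₂.r 1
  have e4 : s₃.rarr 4 = s₁.rarr 4 := hF₂.ra 4
  have ew5 : s₃.warr 5 = s₁.warr 5 := hF₂.wa 5
  have ew6 : s₃.warr 6 = s₁.warr 6 := hF₂.wa 6
  have ew8 : s₃.warr 8 = s₁.warr 8 := hF₂.wa 8
  have e4x : s₃.rarr 4 x = s.rarr 4 x := by rw [e4, hmem, Function.update_of_ne hxy']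
  have e6x : s₃.warr 6 x = s.warr 6 x := by rw [ew6, m6, Function.update_of_ne hxy']
  refine wp.mono (wp_advance (s := s₃) hE₃ (by rw [er1, e3, e1, e5, eK]; exact hK) hT₂ (x := x)
    (fr := p + 1) (hi := s.warr 0 (x + 1)) (by simp [s₃]) hxn (by simp [s₃]) (by rw [e0])
    (by rw [e0]; omega) hhi (by rw [e4x, er1]; linarith)) ?_
  rintro u s₄ hF₄ ⟨hu, hT₄, v', hleaf₄, hv'⟩
  have hE₄ : Env G W H M s₄ := hE₃.frame hF₄
  simp only [wp_seq, wp_ite, wp_block_one, wp_block_cons, Instr.Fits, Instr.apply, WordOp.eval,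
    Test.Holds, Function.update_apply, Nat.reduceEqDiff, OfNat.ofNat_ne_zero, OfNat.zero_ne_ofNat,
    OfNat.ofNat_ne_one, OfNat.one_ne_ofNat, one_ne_zero, zero_ne_one, reduceIte, true_and,
    hE₄.one]
  refine ⟨by omega, ?_⟩
  have f13 : s₄.wreg 13 = s.wreg 13 + 1 := by rw [hF₄.w 13]; simp [s₃, hF₂.w 13, s₁, hE.one]
  have f0 : s₄.warr 0 = s.warr 0 := by rw [hF₄.wa 0, e0]
  have f3 : s₄.warr 3 = s.warr 3 := by rw [hF₄.wa 3, e3]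
  have f1 : s₄.rarr 1 = s.rarr 1 := by rw [hF₄.ra 1, e1]
  have f5 : s₄.rarr 5 = s.rarr 5 := by rw [hF₄.ra 5, e5]
  have fr1 : s₄.rreg 1 = s.rreg 1 := by rw [hF₄.r 1, er1]
  have f4 : s₄.rarr 4 = Function.update (s.rarr 4) y (s.rarr 4 x + G.len x y) := by
    rw [hF₄.ra 4, e4, hmem]
  have fw5 : s₄.warr 5 = Function.update (s.warr 5) y 1 := by rw [hF₄.wa 5, ew5, m5]
  have fw6 : s₄.warr 6 = Function.update (s.warr 6) y x := by rw [hF₄.wa 6, ew6, m6]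
  have fw8 : s₄.warr 8 = Function.update (s.warr 8) (s.wreg 13) y := by rw [hF₄.wa 8, ew8, m8]
  have hleaf : ∀ z < 2 ^ H, s₄.rarr 2 (2 ^ H + z) =
      if z = x then v' else if z = y then v else s.rarr 2 (2 ^ H + z) := by
    intro z hz
    rw [hleaf₄ z hz]
    congr 1
    exact hleaf₂ z hz
  have hd : ∀ z, s.warr 5 z = 1 → z ≠ y := by rintro z hz rfl; exact hy hz
  have hp7 : ∀ z, z ≠ x → z ≠ y → s₄.warr 7 z = s.warr 7 z := by
    intro z hzx hzy
    have h1 : s₄.warr 7 z = s₃.warr 7 z := by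
      rcases hv' with ⟨-, h, -⟩ | ⟨q, -, -, -, h, -⟩
      · rw [h]
      · rw [h, Function.update_of_ne hzx]
    have h2 : s₂.warr 7 z = s.warr 7 z := by
      rcases hv with ⟨-, h, -⟩ | ⟨q, -, -, -, h, -⟩
      · rw [h]; rfl
      · rw [h, Function.update_of_ne hzy]; rfl
    rw [h1]; exact h2
  have hp7y : s₄.warr 7 y = s₂.warr 7 y := by
    rcases hv' with ⟨-, h, -⟩ | ⟨q, -, -, -, h, -⟩
    · rw [h]
    · rw [h, Function.update_of_ne hxy'.symm]
  have hge : ∀ q, p ≤ q → q < s.warr 0 (x + 1) → s.rarr 1 p ≤ s.rarr 1 q :=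
    fun q h1 h2 => hcsr.sorted x hxn p q hlo h1 h2
  have hdone' : ∀ z q, Done (s.warr 3) (s.warr 5) (s.warr 6) z q →
      Done (s.warr 3) (Function.update (s.warr 5) y 1) (Function.update (s.warr 6) y x) z q := by
    rintro z q ⟨h1, h2⟩
    have := hd _ h1
    exact ⟨by rw [Function.update_of_ne this, h1], by rw [Function.update_of_ne this, h2]⟩
  -- The parent of y is x, so a vertex other than x gains no settled entry.
  have hfresh' : ∀ z q, z ≠ x → z ≠ y → ¬ Done (s.warr 3) (s.warr 5) (s.warr 6) z q →
      ¬ Done (s.warr 3) (Function.update (s.warr 5) y 1) (Function.update (s.warr 6) y x) z q := by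
    rintro z q hzx hzy hn ⟨h1, h2⟩
    by_cases e : s.warr 3 q = y
    · rw [e, Function.update_self] at h2
      exact hzx h2.symm
    · rw [Function.update_of_ne e] at h1 h2
      exact hn ⟨h1, h2⟩
  have hfreshx : ∀ q, p + 1 ≤ q → q < s.warr 0 (x + 1) →
      ¬ Done (s.warr 3) (Function.update (s.warr 5) y 1) (Function.update (s.warr 6) y x) x q := by
    rintro q hq1 hq2 ⟨h1, h2⟩
    by_cases e : s.warr 3 q = y
    · have := hcsr.inj x hxn p q hlo hhi (by omega) hq2 (by rw [e, hpy])
      omega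
    · rw [Function.update_of_ne e] at h1 h2
      exact hfresh q (by omega) hq2 ⟨h1, h2⟩
  -- Before its visit y cannot have been the parent of a visited vertex, because parents are
  -- visited.
  have hfreshy : ∀ q,
      ¬ Done (s.warr 3) (Function.update (s.warr 5) y 1) (Function.update (s.warr 6) y x) y q := by
    rintro q ⟨h1, h2⟩
    by_cases e : s.warr 3 q = y
    · rw [e, Function.update_self] at h2
      exact hxy' h2
    · rw [Function.update_of_ne e] at h1 h2
      by_cases ew : s.warr 3 q = w
      · rw [ew, hR.tree.par_root, ← ew] at h2
        exact e h2
      · exact hy (h2 ▸ (hR.tree.tree _ h1 ew).1)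
  -- Time does not run backwards: x continues with entries that are no shorter, the events of y come
  -- after its own discovery, and the other leaves are unchanged.
  have hrun : ∀ T1 : ℝ, T1 = s₄.rarr 2 1 → s.rarr 2 1 ≤ T1 := by
    rintro _ rfl
    refine hT₄.le_root fun z hz => ?_
    rw [hleaf z hz]
    split_ifs with h1 h2
    · rcases hv' with ⟨h, -, -⟩ | ⟨q, hq1, hq2, h, -⟩
      · rw [h, er1]; exact hbig2.le
      · rw [h, e4x, e1, hroot]
        linarith [hge q (by omega) hq2]
    · rcases hv with ⟨h, -, -⟩ | ⟨q, hq1, hq2, h, -⟩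
      · rw [h]; exact hbig2.le
      · rw [h, hmem, Function.update_self, ← hτ]
        obtain ⟨h3, h4⟩ := hcsr.edge y hyn q hq1 hq2
        have := G.pos h3
        change _ ≤ _ + s.rarr 1 q
        rw [h4]
        linarith
    · have hT := hR.heap
      exact hT.root_le hz
  refine ⟨⟨?_, hT₄, ?_, ?_, ?_, ?_, ?_, ?_, ?_⟩, ?_⟩
  · change IsTree G (s₄.rarr 5) w B (s₄.wreg 13) (s₄.warr 5) (s₄.warr 6) (s₄.warr 8) (s₄.rarr 4)
    rw [f5, f13, fw5, fw6, fw8, f4]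
    exact htree
  · simp
  · simp
  · change s₄.wreg 14 = 0
    rw [hF₄.w 14]; simp [s₃, hF₂.w 14, s₁, hR.flag]
  · change s₄.rreg 2 = B
    rw [hF₄.r 2]; simp [s₃, hF₂.r 2, s₁, hR.bound]
  · intro z hz hzv
    change s₄.warr 5 z ≠ 1 at hzv
    change s₄.rarr 2 _ = s₄.rreg 1
    rw [fw5] at hzv
    have hzy : z ≠ y := by rintro rfl; simp at hzv
    rw [Function.update_of_ne hzy] at hzv
    have hzx : z ≠ x := by rintro rfl; exact hzv hx
    rw [hleaf z hz, if_neg hzx, if_neg hzy, hR.idle z hz hzv, fr1]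
  · intro z hz
    change s₄.warr 5 z = 1 at hz
    change IsEvent (s₄.warr 0) (s₄.warr 3) (s₄.rarr 1) (s₄.rarr 5) (s₄.rreg 1) (s₄.warr 5)
      (s₄.warr 6) (s₄.warr 7) (s₄.rarr 4) z (s₄.rarr 2 (2 ^ H + z))
    have hzn : z < 2 ^ H := by
      have : z < G.n := by
        have := htree.vis_lt (x := z) (by rw [← fw5]; exact hz)
        exact this
      omega
    rw [hleaf z hzn, f0, f3, f1, f5, fr1, fw5, fw6, f4]
    by_cases hzx : z = x
    · rw [if_pos hzx]
      subst hzx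
      refine IsEvent.of_admits (ptr := s₃.warr 7) (fr := p + 1) ?_ (by omega) hfreshx ?_
      · intro q h1 h2 h3
        rw [Function.update_of_ne hxy', Function.update_of_ne hxy'] at h3
        rcases Nat.lt_or_ge q p with h4 | h4
        · exact hdone' _ _ (hdone q h1 h4 h3)
        · obtain rfl : q = p := by omega
          exact ⟨by rw [hpy, Function.update_self], by rw [hpy, Function.update_self]⟩
      · rw [Function.update_of_ne hxy', Function.update_of_ne hxy']
        rw [er1, e3, e1, e5, e4x, e6x] at hv'
        exact hv'
    · rw [if_neg hzx]
      by_cases hzy : z = y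
      · rw [if_pos hzy]
        subst hzy
        have := IsEvent.of_admits (vis := Function.update (s.warr 5) z 1) (par := s₁.warr 6)
          (x := z) (d := s₁.rarr 4) (off := s.warr 0) (fun q h1 h2 => by omega) le_rfl
          (by rw [m6]; exact fun q _ _ => hfreshy q) hv
        rw [m6, hmem] at this
        unfold IsEvent at this ⊢
        rw [hp7y]
        exact this
      · rw [if_neg hzy]
        rw [fw5, Function.update_of_ne hzy] at hz
        have hev := hR.event z hz
        unfold IsEvent at hev ⊢
        rw [hp7 z hzx hzy, Function.update_of_ne hzy, Function.update_of_ne hzy]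
        rcases hev with ⟨h1, h2⟩ | ⟨h1, h2, h3, h4, h5, h6⟩
        · exact .inl ⟨h1, fun q g1 g2 g3 => hdone' _ _ (h2 q g1 g2 g3)⟩
        · exact .inr ⟨h1, h2, h3, h4, fun q g1 g2 g3 => hdone' _ _ (h5 q g1 g2 g3),
            fun q g1 g2 => hfresh' z q hzx hzy (h6 q g1 g2)⟩
  · intro z hz
    change s₄.warr 5 z = 1 at hz
    change s₄.rarr 4 z ≤ s₄.rarr 2 1
    refine le_trans ?_ (hrun _ rfl)
    rw [f4]
    by_cases hzy : z = y
    · rw [hzy, Function.update_self, hτ]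
    · rw [fw5, Function.update_of_ne hzy] at hz
      rw [Function.update_of_ne hzy]
      exact hR.le z hz
  · exact f13

end RealRAM

/-! ### Closing edges and the main loop of a search -/

namespace RealRAM

variable {G : Net} {W H M : ℕ}

/-- The edge from `bx` to `by'` closes a cycle of length at most `B` with the tree. -/
structure IsCand (G : Net) (B : ℝ) (bx by' : ℕ) (vis par : ℕ → ℕ) (d : ℕ → ℝ) : Prop where
  vis_left : vis bx = 1
  vis_right : vis by' = 1
  adj : G.Adj bx by'
  left : par bx ≠ by'
  right : par by' ≠ bx
  eq : B = d bx + G.len bx by' + d by'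

/-- The situation after a search from `w` that was started with the bound `B`. -/
structure Searched (G : Net) (H w : ℕ) (B : ℝ) (s : State) : Prop where
  tree : IsTree G (s.rarr 5) w B (s.wreg 13) (s.warr 5) (s.warr 6) (s.warr 8) (s.rarr 4)
  heap : IsMinTree (2 ^ H) (s.rarr 2)
  idle : ∀ x < 2 ^ H, s.warr 5 x ≠ 1 → s.rarr 2 (2 ^ H + x) = s.rreg 1
  le : s.rreg 2 ≤ B
  closed : ∀ x y, s.warr 5 x = 1 → G.Adj x y → s.rarr 4 x + G.len x y < s.rarr 5 y →
    2 * (s.rarr 4 x + G.len x y) < s.rreg 2 →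
    s.warr 5 y = 1 ∧ (s.warr 6 y = x ∨ s.warr 6 x = y)
  cand : (s.wreg 14 = 0 ∧ s.rreg 2 = B) ∨ (s.wreg 14 = 1 ∧ s.rreg 2 < B ∧
    IsCand G (s.rreg 2) (s.wreg 15) (s.wreg 16) (s.warr 5) (s.warr 6) (s.rarr 4))

theorem Searched.of_eq {s s' : State} {w : ℕ} {B : ℝ} (h : Searched G H w B s)
    (h13 : s'.wreg 13 = s.wreg 13 := by rfl) (h14 : s'.wreg 14 = s.wreg 14 := by rfl)
    (h15 : s'.wreg 15 = s.wreg 15 := by rfl) (h16 : s'.wreg 16 = s.wreg 16 := by rfl)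
    (hr1 : s'.rreg 1 = s.rreg 1 := by rfl) (hr2 : s'.rreg 2 = s.rreg 2 := by rfl)
    (ha5 : s'.warr 5 = s.warr 5 := by rfl) (ha6 : s'.warr 6 = s.warr 6 := by rfl)
    (ha8 : s'.warr 8 = s.warr 8 := by rfl) (hra2 : s'.rarr 2 = s.rarr 2 := by rfl)
    (hra4 : s'.rarr 4 = s.rarr 4 := by rfl) (hra5 : s'.rarr 5 = s.rarr 5 := by rfl) :
    Searched G H w B s' := by
  obtain ⟨h1, h2, h3, h4, h5, h6⟩ := h
  constructor
  · rw [hra5, h13, ha5, ha6, ha8, hra4]; exact h1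
  · rw [hra2]; exact h2
  · rw [ha5, hra2, hr1]; exact h3
  · rw [hr2]; exact h4
  · rw [ha5, ha6, hra4, hra5, hr2]; exact h5
  · rw [h14, hr2, h15, h16, ha5, ha6, hra4]; exact h6

/-- Consider the cycle that is closed by the entry `18`, which leads from `17` to `19`. -/
def cand : Prog :=
  .seq (block [.rload 5 4 17, .rload 6 1 18, .radd 5 5 6, .rload 6 4 19, .radd 5 5 6])
    (.ite (.rlt 5 2) (block [.rmove 2 5, .wmove 14 3, .wmove 15 17, .wmove 16 19])
      (block [.skip]))

theorem wp_cand {s : State} {x p y w : ℕ} {B : ℝ} (hE : Env G W H M s)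
    (h17 : s.wreg 17 = x) (h18 : s.wreg 18 = p) (h19 : s.wreg 19 = y)
    (hlen : s.rarr 1 p = G.len x y) (hxy : G.Adj x y) (hx : s.warr 5 x = 1) (hy : s.warr 5 y = 1)
    (hpx : s.warr 6 x ≠ y) (hpy : s.warr 6 y ≠ x) (hS : Searched G H w B s) :
    wp W cand (fun t s' => t ≤ 10 ∧ Searched G H w B s' ∧ s'.rreg 2 ≤ s.rreg 2 ∧
      s'.rreg 2 ≤ s.rarr 4 x + G.len x y + s.rarr 4 y) s := by
  unfold cand
  simp only [wp_seq, wp_ite, wp_block_one, wp_block_cons, Instr.Fits, Instr.apply, WordOp.eval,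
    Test.Holds, Function.update_apply, Nat.reduceEqDiff, OfNat.ofNat_ne_zero, OfNat.zero_ne_ofNat,
    OfNat.ofNat_ne_one, OfNat.one_ne_ofNat, one_ne_zero, zero_ne_one, reduceIte, true_and, h17,
    h18, h19, hlen, hE.one]
  refine ⟨fun hlt => ⟨by omega, ?_, hlt.le, le_rfl⟩, fun hge =>
    ⟨by omega, hS.of_eq, le_rfl, by linarith⟩⟩
  have hS' := hS
  obtain ⟨h1, h2, h3, h4, h5, h6⟩ := hS
  refine ⟨h1, h2, h3, hlt.le.trans h4, fun a b e1 e2 e3 e4 => h5 a b e1 e2 e3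
    (e4.trans hlt), .inr ⟨rfl, hlt.trans_le h4, ⟨hx, hy, hxy, hpx, hpy, ?_⟩⟩⟩
  simp

/-- Suppose that the entry of an admissible edge from x lies at or after the pointer of x. By the
sorting, the event of x is then no later than this edge, and the root is no later than that event,
so the edge does not satisfy the bound `B'`. All admissible entries before the pointer are tree
edges. -/
theorem Running.closed {s : State} {w : ℕ} {B B' : ℝ} (hE : Env G W H M s)
    (hR : Running G H w B s) (hB' : B' ≤ 2 * s.rarr 2 1) :
    ∀ x y, s.warr 5 x = 1 → G.Adj x y → s.rarr 4 x + G.len x y < s.rarr 5 y →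
      2 * (s.rarr 4 x + G.len x y) < B' →
      s.warr 5 y = 1 ∧ (s.warr 6 y = x ∨ s.warr 6 x = y) := by
  intro x y hx hxy hdh hB
  have hroom := hE.room
  have hxn := G.lt hxy
  have hroot := hR.heap.root_le (p := x) (by omega)
  obtain ⟨p, h1, h2, rfl⟩ := hE.csr.surj x y hxy
  obtain ⟨-, hlen⟩ := hE.csr.edge x hxn p h1 h2
  by_cases hpar : s.warr 3 p = s.warr 6 x
  · refine ⟨?_, .inr hpar.symm⟩
    by_cases hxw : x = w
    · rw [hxw, hR.tree.par_root] at hpar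
      rw [hpar, ← hxw]
      exact hx
    · rw [hpar]
      exact (hR.tree.tree x hx hxw).1
  · have hadm : Admits (s.warr 3) (s.rarr 1) (s.rarr 5) (s.rarr 4 x) (s.warr 6 x) p :=
      ⟨by rw [hlen]; exact hdh, hpar⟩
    rcases hR.event x hx with ⟨-, h⟩ | ⟨h3, h4, h5, -, h6, -⟩
    · exact ⟨(h p h1 h2 hadm).1, .inl (h p h1 h2 hadm).2⟩
    · rcases Nat.lt_or_ge p (s.warr 7 x) with h | h
      · exact ⟨(h6 p h1 h hadm).1, .inl (h6 p h1 h hadm).2⟩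
      · have := hE.csr.sorted x hxn _ p h3 h h2
        rw [h5] at hroot
        rw [← hlen] at hB
        linarith

def searchLoop : Prog :=
  .loop (.rlt 3 2) (.seq heapMin (.seq (block [.wmove 17 40, .wload 18 7 17, .wload 19 3 18,
    .wload 21 5 19]) (.ite (.weq 21 2) visit (.seq cand (block [.rmove 3 2])))))

/-- The pruned Dijkstra search from the vertex `12`. -/
def search : Prog :=
  .seq (block [.wstore 5 12 3, .wstore 6 12 12, .rstore 4 12 0, .wstore 8 2 12, .wmove 13 3,
    .wmove 14 2, .wmove 45 12, .wload 50 0 12])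
  (.seq advance (.seq (block [.rload 4 2 3, .radd 3 4 4]) searchLoop))

/-- A round either visits a vertex or closes a cycle at the current time τ. In the second case both
ends have distance at most τ, so the candidate d x + len + d y is at most 2τ < B. It replaces B, and
the search may stop: `Running.closed` covers everything below the new bound. So there are at most as
many rounds as visited vertices. -/
theorem wp_searchLoop {s : State} {w : ℕ} {B : ℝ} (hE : Env G W H M s)
    (hK : KeyTree H M (s.rreg 1) (s.warr 3) (s.rarr 1) (s.rarr 5) (s.rarr 3))
    (hR : Running G H w B s) (hB : B ≤ s.rreg 1) (hcnt : s.wreg 13 = 1) :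
    wp W searchLoop (fun t s' => t ≤ 250 * (H + 1) * s'.wreg 13 + 1 ∧ Searched G H w B s') s := by
  have hn : 1 ≤ G.n := by rw [← hcnt]; exact hR.tree.cnt_le
  refine wp.mono (wp_loop (fun φ s' =>
    (Running G H w B s' ∧ ∃ k, s'.wreg 13 + k = G.n ∧ φ = 250 * (H + 1) * (k + 1)) ∨
    (Searched G H w B s' ∧ s'.rreg 3 = s'.rreg 2 ∧
      ∃ k, s'.wreg 13 + k = G.n ∧ φ = 250 * (H + 1) * k)) (250 * (H + 1) * G.n)
    (.inl ⟨hR, G.n - 1, by omega, by rw [Nat.sub_add_cancel hn]⟩) ?_) ?_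
  · rintro φ s' (⟨hR', k, hk, rfl⟩ | ⟨-, h, -⟩) hF hs
    · have hE' : Env G W H M s' := hE.frame hF
      have hroom := hE.room
      have e1 : s'.rreg 1 = s.rreg 1 := hF.r 1
      have hK' : KeyTree H M (s'.rreg 1) (s'.warr 3) (s'.rarr 1) (s'.rarr 5) (s'.rarr 3) := by
        rw [e1, hF.wa 3, hF.ra 1, hF.ra 5, hF.ra 3]; exact hK
      have hbig := hE'.big
      simp only [Test.Holds, hR'.time2, hR'.bound] at hs
      rw [wp_seq]
      refine wp.mono (wp_heapMin hE'.one hE'.leaves hE'.cap hR'.heap) ?_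
      rintro t s₁ hF₁ ⟨ht, hx, hroot⟩
      have f5 := hF₁.wa 5
      have f6 := hF₁.wa 6
      have f7 := hF₁.wa 7
      have f8 := hF₁.wa 8
      have f3 := hF₁.wa 3
      have f0 := hF₁.wa 0
      have g1 := hF₁.ra 1
      have g2 := hF₁.ra 2
      have g3 := hF₁.ra 3
      have g4 := hF₁.ra 4
      have g5 := hF₁.ra 5
      set x := s₁.wreg 40 with hxdef
      -- The root value is below B / 2, whereas unvisited leaves hold the positive number `big`,
      -- which is at least B.
      have hvx : s'.warr 5 x = 1 := by
        by_contra hne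
        rw [hR'.idle x hx hne] at hroot
        rw [← hroot, e1] at hs
        rw [e1] at hbig
        linarith
      have hxn := hR'.tree.vis_lt hvx
      have hev := hR'.event x hvx
      rcases hev with ⟨h, -⟩ | ⟨h1, h2, h3, h4, h5, h6⟩
      · rw [hroot] at h
        rw [h, e1] at hs
        rw [e1] at hbig
        linarith
      set p := s'.warr 7 x with hpdef
      set y := s'.warr 3 p with hydef
      obtain ⟨hxy, hlen⟩ := hE'.csr.edge x hxn p h1 h2
      rw [← hydef] at hxy hlen
      have hE₁ : Env G W H M s₁ := hE'.frame hF₁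
      simp only [wp_seq, wp_ite, wp_block_one, wp_block_cons, Instr.Fits, Instr.apply,
        WordOp.eval, Test.Holds, Function.update_apply, Nat.reduceEqDiff, OfNat.ofNat_ne_zero,
        OfNat.zero_ne_ofNat, OfNat.ofNat_ne_one, OfNat.one_ne_ofNat, one_ne_zero, zero_ne_one,
        reduceIte, true_and, f5, f7, f3, hE₁.zero, ← hxdef, ← hpdef, ← hydef]
      set s₂ : State := State.mk (Function.update (Function.update (Function.update
        (Function.update s₁.wreg 17 x) 18 p) 19 y) 21 (s'.warr 5 y)) s₁.rreg s₁.warr s₁.rarr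
        s₁.coins with hs₂
      have hE₂ : Env G W H M s₂ := hE₁.of_eq
      have hR₂ : Running G H w B s₂ := by
        obtain ⟨r1, r2, r3, r4, r5, r6, r7, r8, r9⟩ := hR'
        have w13 : s₂.wreg 13 = s'.wreg 13 := hF₁.w 13
        constructor
        · rw [w13]; change IsTree G (s₁.rarr 5) w B _ (s₁.warr 5) (s₁.warr 6) (s₁.warr 8) (s₁.rarr 4)
          rw [g5, f5, f6, f8, g4]; exact r1
        · change IsMinTree _ (s₁.rarr 2); rw [g2]; exact r2
        · change s₁.rreg 4 = s₁.rarr 2 1; rw [g2, hF₁.r 4]; exact r3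
        · change s₁.rreg 3 = s₁.rarr 2 1 + s₁.rarr 2 1; rw [g2, hF₁.r 3]; exact r4
        · change s₁.wreg 14 = 0; rw [hF₁.w 14]; exact r5
        · change s₁.rreg 2 = B; rw [hF₁.r 2]; exact r6
        · change ∀ z < 2 ^ H, s₁.warr 5 z ≠ 1 → s₁.rarr 2 _ = s₁.rreg 1
          rw [g2, f5, hF₁.r 1]; exact r7
        · change ∀ z, s₁.warr 5 z = 1 → IsEvent (s₁.warr 0) (s₁.warr 3) (s₁.rarr 1) (s₁.rarr 5)
            (s₁.rreg 1) (s₁.warr 5) (s₁.warr 6) (s₁.warr 7) (s₁.rarr 4) z (s₁.rarr 2 (2 ^ H + z))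
          rw [g1, g2, g4, g5, f0, f3, f5, f6, f7, hF₁.r 1]; exact r8
        · change ∀ z, s₁.warr 5 z = 1 → s₁.rarr 4 z ≤ s₁.rarr 2 1
          rw [g2, g4, f5]; exact r9
      have hT1 : s₂.rarr 2 1 = s'.rarr 2 1 := by change s₁.rarr 2 1 = _; rw [g2]
      constructor
      · intro hvy
        have hK₂ : KeyTree H M (s₂.rreg 1) (s₂.warr 3) (s₂.rarr 1) (s₂.rarr 5) (s₂.rarr 3) := by
          change KeyTree H M (s₁.rreg 1) (s₁.warr 3) (s₁.rarr 1) (s₁.rarr 5) (s₁.rarr 3)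
          rw [hF₁.r 1, f3, g1, g5, g3]; exact hK'
        refine wp.mono (wp_visit (s := s₂) (x := x) (p := p) (y := y) hE₂ hK₂ hR₂ ?_ rfl rfl rfl
          ?_ ?_ ?_ ?_ ?_ ?_ ?_ ?_ ?_ ?_) ?_
        · change B ≤ s₁.rreg 1; rw [hF₁.r 1, e1]; exact hB
        · change s₁.warr 5 x = 1; rw [f5]; exact hvx
        · change s₁.warr 5 y ≠ 1; rw [f5]; omega
        · change s₁.warr 0 x ≤ p; rw [f0]; exact h1
        · change p < s₁.warr 0 (x + 1); rw [f0]; exact h2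
        · change s₁.warr 3 p = y; rw [f3]
        · rw [hT1, ← hroot, h3]; change _ = s₁.rarr 4 x + s₁.rarr 1 p; rw [g4, g1]
        · rw [hT1]; linarith
        · change Admits (s₁.warr 3) (s₁.rarr 1) (s₁.rarr 5) (s₁.rarr 4 x) (s₁.warr 6 x) p
          rw [f3, g1, g5, g4, f6]; exact h4
        · change ∀ q, s₁.warr 0 x ≤ q → q < p →
            Admits (s₁.warr 3) (s₁.rarr 1) (s₁.rarr 5) (s₁.rarr 4 x) (s₁.warr 6 x) q →
            Done (s₁.warr 3) (s₁.warr 5) (s₁.warr 6) x q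
          rw [f3, g1, g5, g4, f6, f5, f0]; exact h5
        · change ∀ q, p ≤ q → q < s₁.warr 0 (x + 1) →
            ¬ Done (s₁.warr 3) (s₁.warr 5) (s₁.warr 6) x q
          rw [f3, f6, f5, f0]; exact h6
        · rintro u s₃ hF₃ ⟨hu, hR₃, hc₃⟩
          have w13 : s₂.wreg 13 = s'.wreg 13 := hF₁.w 13
          have hc := hR₃.tree.cnt_le
          rw [w13] at hc₃
          obtain ⟨k', rfl⟩ : ∃ k', k = k' + 1 := ⟨k - 1, by omega⟩
          refine ⟨_, .inl ⟨hR₃, k', by omega, rfl⟩, ?_⟩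
          have : 250 * (H + 1) * (k' + 1 + 1) = 250 * (H + 1) * (k' + 1) + 250 * H + 250 := by ring
          omega
      · intro hvy
        have hvy' : s'.warr 5 y = 1 := by
          rcases hR'.tree.vis_or y with h | h
          · exact absurd h hvy
          · exact h.1
        have hpx : s'.warr 6 x ≠ y := fun h => h4.2 h.symm
        -- The pointer of x never rests on an entry that is already a tree edge to a child of x.
        have hpy : s'.warr 6 y ≠ x := fun hp => h6 p le_rfl h2 ⟨hvy', hp⟩
        have hdy : s'.rarr 4 y ≤ s'.rarr 2 1 := hR'.le y hvy'
        have hroot' : s'.rarr 2 1 = s'.rarr 4 x + G.len x y := by rw [← hroot, h3, hlen]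
        have hclosed := hR₂.closed (B' := s'.rarr 4 x + G.len x y + s'.rarr 4 y) hE₂
          (by rw [hT1]; linarith)
        unfold cand
        simp only [hs₂]
        simp only [wp_seq, wp_ite, wp_block_one, wp_block_cons, Instr.Fits, Instr.apply,
          WordOp.eval, Test.Holds, Function.update_apply, Nat.reduceEqDiff, OfNat.ofNat_ne_zero,
          OfNat.zero_ne_ofNat, OfNat.ofNat_ne_one, OfNat.one_ne_ofNat, one_ne_zero, zero_ne_one,
          reduceIte, true_and, g4, g1, hlen, hE₁.one, hF₁.r 2, hR'.bound]
        refine ⟨fun hlt => ?_, fun hge => ?_⟩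
        · refine ⟨_, .inr ⟨⟨hR₂.tree, hR₂.heap, hR₂.idle, ?_, ?_, .inr ⟨rfl, ?_, ?_⟩⟩,
            k, ?_, rfl⟩, ?_⟩
          · simp; linarith
          · simpa [hlen] using hclosed
          · simp; linarith
          · refine ⟨?_, ?_, ?_, ?_, ?_, ?_⟩ <;>
              simp [f5, f6, g4, hvx, hvy', hxy, hpx, hpy]
          · rw [hF₁.w 13, hk]
          · have : 250 * (H + 1) * (k + 1) = 250 * (H + 1) * k + 250 * H + 250 := by ring
            omega
        -- The candidate is always an improvement, being at most 2τ < B, so this branch is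
        -- contradictory.
        · linarith
    · simp only [Test.Holds, h] at hs
      exact absurd hs (lt_irrefl _)
  · rintro t s' hF ⟨φ', (⟨hR', k, hk, rfl⟩ | ⟨hS, -, k, hk, rfl⟩), hn', ht⟩
    · have hE' : Env G W H M s' := hE.frame hF
      simp only [Test.Holds, hR'.time2, hR'.bound, not_lt] at hn'
      refine ⟨?_, hR'.tree, hR'.heap, hR'.idle, hR'.bound.le, ?_, .inl ⟨hR'.flag, hR'.bound⟩⟩
      · have e1 : 250 * (H + 1) * G.n = 250 * (H + 1) * s'.wreg 13 + 250 * (H + 1) * k := by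
          rw [← hk]; ring
        have e2 : 250 * (H + 1) * (k + 1) = 250 * (H + 1) * k + 250 * (H + 1) := by ring
        linarith
      · exact hR'.closed hE' (by rw [hR'.bound]; linarith)
    · refine ⟨?_, hS⟩
      have e1 : 250 * (H + 1) * G.n = 250 * (H + 1) * s'.wreg 13 + 250 * (H + 1) * k := by
        rw [← hk]; ring
      linarith

theorem wp_search {s : State} {w : ℕ} {B : ℝ} (hE : Env G W H M s)
    (hK : KeyTree H M (s.rreg 1) (s.warr 3) (s.rarr 1) (s.rarr 5) (s.rarr 3))
    (hT : IsMinTree (2 ^ H) (s.rarr 2)) (hleaf : ∀ p < 2 ^ H, s.rarr 2 (2 ^ H + p) = s.rreg 1)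
    (hvis : ∀ x, s.warr 5 x = 0) (hw : s.wreg 12 = w) (hwn : w < G.n) (hB : s.rreg 2 = B)
    (hle : B ≤ s.rreg 1) :
    wp W search (fun t s' => t ≤ 250 * (H + 1) * (s'.wreg 13 + 1) ∧ Searched G H w B s') s := by
  have hcap := hE.cap
  have hroom := hE.room
  have hcsr := hE.csr
  unfold search
  simp only [wp_seq, wp_ite, wp_block_one, wp_block_cons, Instr.Fits, Instr.apply, WordOp.eval,
    Test.Holds, Function.update_apply, Nat.reduceEqDiff, OfNat.ofNat_ne_zero, OfNat.zero_ne_ofNat,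
    OfNat.ofNat_ne_one, OfNat.one_ne_ofNat, one_ne_zero, zero_ne_one, reduceIte, true_and, hw,
    hE.zero, hE.one, hE.rzero]
  set s₁ : State := _
  change wp W _ _ s₁
  have hE₁ : Env G W H M s₁ := hE.of_eq
  have htree := IsTree.singleton G (dh := s.rarr 5) (B := B) (par := s.warr 6) (vl := s.warr 8)
    (d := s.rarr 4) hwn hvis
  have m4 : s₁.rarr 4 = Function.update (s.rarr 4) w 0 := by simp [s₁]
  have m5 : s₁.warr 5 = Function.update (s.warr 5) w 1 := by simp [s₁]
  have m6 : s₁.warr 6 = Function.update (s.warr 6) w w := by simp [s₁]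
  have m8 : s₁.warr 8 = Function.update (s.warr 8) 0 w := by simp [s₁]
  have hvw : ∀ x, s₁.warr 5 x = 1 → x = w := by
    intro x hx
    by_contra hne
    rw [m5, Function.update_of_ne hne, hvis] at hx
    omega
  refine wp.mono (wp_advance (s := s₁) hE₁ hK hT (x := w) (fr := s.warr 0 w)
    (hi := s.warr 0 (w + 1)) (by simp [s₁]) hwn (by simp [s₁]) rfl le_rfl (hcsr.mono w hwn)
    (by rw [m4, Function.update_self]; exact hE.big)) ?_
  rintro t s₂ hF₂ ⟨ht, hT₂, v, hleaf₂, hv⟩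
  have hE₂ : Env G W H M s₂ := hE₁.frame hF₂
  simp only [wp_seq, wp_ite, wp_block_one, wp_block_cons, Instr.Fits, Instr.apply, WordOp.eval,
    Test.Holds, Function.update_apply, Nat.reduceEqDiff, OfNat.ofNat_ne_zero, OfNat.zero_ne_ofNat,
    OfNat.ofNat_ne_one, OfNat.one_ne_ofNat, one_ne_zero, zero_ne_one, reduceIte, true_and,
    hE₂.one]
  set s₃ : State := _
  change wp W _ _ s₃
  have hE₃ : Env G W H M s₃ := hE₂.of_eq
  have f0 : s₂.warr 0 = s.warr 0 := hF₂.wa 0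
  have f3 : s₂.warr 3 = s.warr 3 := hF₂.wa 3
  have f1 : s₂.rarr 1 = s.rarr 1 := hF₂.ra 1
  have f5 : s₂.rarr 5 = s.rarr 5 := hF₂.ra 5
  have fK : s₂.rarr 3 = s.rarr 3 := hF₂.ra 3
  have fr1 : s₂.rreg 1 = s.rreg 1 := hF₂.r 1
  have f4 : s₂.rarr 4 = s₁.rarr 4 := hF₂.ra 4
  have fw5 : s₂.warr 5 = s₁.warr 5 := hF₂.wa 5
  have fw6 : s₂.warr 6 = s₁.warr 6 := hF₂.wa 6
  have fw8 : s₂.warr 8 = s₁.warr 8 := hF₂.wa 8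
  have f13 : s₂.wreg 13 = 1 := by rw [hF₂.w 13]; simp [s₁]
  have hev : IsEvent (s₂.warr 0) (s₂.warr 3) (s₂.rarr 1) (s₂.rarr 5) (s₂.rreg 1) (s₂.warr 5)
      (s₂.warr 6) (s₂.warr 7) (s₂.rarr 4) w v := by
    rw [f0, f3, f1, f5, fr1, f4, fw5, fw6]
    refine IsEvent.of_admits (fun q h1 h2 => by omega) le_rfl ?_ hv
    rintro q h1 h2 ⟨h3, h4⟩
    have hq := (hcsr.edge w hwn q h1 h2).1
    have := hvw _ h3
    change s.warr 3 q = w at this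
    rw [this] at hq
    exact G.irrefl _ hq
  have hR : Running G H w B s₃ := by
    refine ⟨?_, hT₂, ?_, ?_, ?_, ?_, ?_, ?_, ?_⟩
    · change IsTree G (s₂.rarr 5) w B (s₂.wreg 13) (s₂.warr 5) (s₂.warr 6) (s₂.warr 8) (s₂.rarr 4)
      rw [f5, f13, fw5, fw6, fw8, f4, m4, m5, m6, m8]
      exact htree
    · simp [s₃]
    · simp [s₃]
    · change s₂.wreg 14 = 0
      rw [hF₂.w 14]; simp [s₁]
    · change s₂.rreg 2 = B
      rw [hF₂.r 2]; simp [s₁, hB]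
    · intro z hz hzv
      change s₂.warr 5 z ≠ 1 at hzv
      change s₂.rarr 2 _ = s₂.rreg 1
      rw [fw5, m5] at hzv
      have hzw : z ≠ w := by rintro rfl; simp at hzv
      rw [hleaf₂ z hz, if_neg hzw, fr1]
      exact hleaf z hz
    · intro z hz
      change s₂.warr 5 z = 1 at hz
      change IsEvent (s₂.warr 0) (s₂.warr 3) (s₂.rarr 1) (s₂.rarr 5) (s₂.rreg 1) (s₂.warr 5)
        (s₂.warr 6) (s₂.warr 7) (s₂.rarr 4) z (s₂.rarr 2 (2 ^ H + z))
      rw [fw5] at hz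
      obtain rfl := hvw z hz
      rw [hleaf₂ z (by omega), if_pos rfl]
      exact hev
    · intro z hz
      change s₂.warr 5 z = 1 at hz
      change s₂.rarr 4 z ≤ s₂.rarr 2 1
      rw [fw5] at hz
      obtain rfl := hvw z hz
      rw [f4, m4, Function.update_self]
      refine hT₂.le_root fun q hq => ?_
      rw [hleaf₂ q hq]
      split_ifs with h1
      · rcases hv with ⟨h, -⟩ | ⟨q, h1, h2, h3, -⟩
        · rw [h]; exact hE₁.big.le
        · rw [h3, m4, Function.update_self]
          obtain ⟨h5, h6⟩ := hcsr.edge z hwn q h1 h2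
          have := G.pos h5
          change 0 ≤ 0 + s.rarr 1 q
          rw [h6]
          linarith
      · change 0 ≤ s.rarr 2 _
        rw [hleaf q hq]; exact hE.big.le
  refine wp.mono (wp_searchLoop (s := s₃) hE₃ ?_ hR ?_ f13) ?_
  · change KeyTree H M (s₂.rreg 1) (s₂.warr 3) (s₂.rarr 1) (s₂.rarr 5) (s₂.rarr 3)
    rw [fr1, f3, f1, f5, fK]; exact hK
  · change B ≤ s₂.rreg 1
    rw [fr1]; exact hle
  · rintro u s' hF ⟨hu, hS⟩
    refine ⟨?_, hS⟩
    have : 250 * (H + 1) * (s'.wreg 13 + 1) = 250 * (H + 1) * s'.wreg 13 + 250 * H + 250 := by ring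
    omega

end RealRAM

/-! ### From a closing edge to a simple cycle -/

namespace RealRAM

variable {G : Net} {W H M : ℕ}

/-- The path `f pa, …, f pb` that is obtained from the edge from `bx` to `by'` by climbing in the
tree from both ends. -/
structure Climb (G : Net) (n bx by' : ℕ) (B : ℝ) (vis par : ℕ → ℕ) (d : ℕ → ℝ) (f : ℕ → ℕ)
    (pa pb : ℕ) : Prop where
  left : pa ≤ n
  right : n < pb
  vis : ∀ i, pa ≤ i → i ≤ pb → vis (f i) = 1
  adj : ∀ i, pa ≤ i → i < pb → G.Adj (f i) (f (i + 1))
  sum : ∑ i ∈ Finset.Ico pa pb, G.len (f i) (f (i + 1)) + d (f pa) + d (f pb) = B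
  sep : ∀ i, pa < i → i < pb → d (f pa) < d (f i) ∧ d (f pb) ≤ d (f i) ∧ f i ≠ f pb
  inj : ∀ i, pa < i → i < pb → ∀ j, pa < j → j < pb → f i = f j → i = j
  small : (pb = pa + 1 ∧ f pa = bx ∧ f pb = by') ∨ (pb = pa + 2 ∧ f pa = par bx ∧ f pb = by') ∨
    (pb = pa + 2 ∧ f pa = bx ∧ f pb = par by') ∨ pa + 3 ≤ pb

section Climb

variable {n bx by' w cnt pa pb : ℕ} {B B' : ℝ} {dh d : ℕ → ℝ} {vis par vl f : ℕ → ℕ}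

theorem IsTree.d_nonneg (hT : IsTree G dh w B' cnt vis par vl d) {x : ℕ} (hx : vis x = 1) :
    0 ≤ d x := (hT.walk x hx).nonneg

theorem IsTree.d_pos (hT : IsTree G dh w B' cnt vis par vl d) {x : ℕ} (hx : vis x = 1)
    (hxw : x ≠ w) : 0 < d x := by
  obtain ⟨h1, h2, h3⟩ := hT.tree x hx hxw
  have := hT.d_nonneg h1
  have := G.pos h2
  linarith

theorem Climb.init (hc : IsCand G B bx by' vis par d) (h1 : f n = bx) (h2 : f (n + 1) = by') :
    Climb G n bx by' B vis par d f n (n + 1) := by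
  refine ⟨le_rfl, by omega, ?_, ?_, ?_, ?_, ?_, .inl ⟨rfl, h1, h2⟩⟩
  · intro i hi1 hi2
    obtain rfl | rfl : i = n ∨ i = n + 1 := by omega
    · rw [h1, hc.vis_left]
    · rw [h2, hc.vis_right]
  · intro i hi1 hi2
    obtain rfl : i = n := by omega
    rw [h1, h2]; exact hc.adj
  · simp only [Nat.Ico_succ_singleton, Finset.sum_singleton, h1, h2, hc.eq]
    ring
  · intros; omega
  · intros; omega

/-- The end with the strictly larger distance climbs. It is not the root, and its parent is strictly
closer, so the vertices passed remain separated from the new end. The path grows by exactly the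
amount that the distance of the end loses, which keeps `sum`. -/
theorem Climb.right_step (hT : IsTree G dh w B' cnt vis par vl d)
    (h : Climb G n bx by' B vis par d f pa pb) (hlt : d (f pa) < d (f pb)) :
    Climb G n bx by' B vis par d (Function.update f (pb + 1) (par (f pb))) pa (pb + 1) := by
  have hl := h.left
  have hr := h.right
  have hvb := h.vis pb (by omega) le_rfl
  have hva := h.vis pa le_rfl (by omega)
  have hbw : f pb ≠ w := by
    intro e
    have := hT.d_nonneg hva
    rw [e, hT.d_root] at hlt
    linarith
  obtain ⟨t1, t2, t3⟩ := hT.tree _ hvb hbw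
  have hpos := G.pos t2
  have e : ∀ i, i ≤ pb → Function.update f (pb + 1) (par (f pb)) i = f i := fun i hi =>
    Function.update_of_ne (by omega) _ _
  have e' : Function.update f (pb + 1) (par (f pb)) (pb + 1) = par (f pb) :=
    Function.update_self _ _ _
  refine ⟨hl, by omega, ?_, ?_, ?_, ?_, ?_, ?_⟩
  · intro i h1 h2
    rcases Nat.lt_or_ge pb i with h3 | h3
    · obtain rfl : i = pb + 1 := by omega
      rw [e']; exact t1
    · rw [e i h3]; exact h.vis i h1 h3
  · intro i h1 h2
    rcases Nat.lt_or_ge i pb with h3 | h3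
    · rw [e i h3.le, e _ h3]; exact h.adj i h1 h3
    · obtain rfl : i = pb := by omega
      rw [e i le_rfl, e']; exact G.symm t2
  · rw [Finset.sum_Ico_succ_top (by omega), e pa (by omega), e', e pb le_rfl, G.len_symm]
    have : ∑ i ∈ Finset.Ico pa pb, G.len (Function.update f (pb + 1) (par (f pb)) i)
        (Function.update f (pb + 1) (par (f pb)) (i + 1)) =
        ∑ i ∈ Finset.Ico pa pb, G.len (f i) (f (i + 1)) := by
      refine Finset.sum_congr rfl fun i hi => ?_
      rw [Finset.mem_Ico] at hi
      rw [e i (by omega), e (i + 1) (by omega)]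
    have := h.sum
    linarith
  · intro i h1 h2
    rw [e pa (by omega), e', e i (by omega)]
    rcases Nat.lt_or_ge i pb with h3 | h3
    · obtain ⟨g1, g2, g3⟩ := h.sep i h1 h3
      refine ⟨g1, by linarith, ?_⟩
      intro e3
      rw [e3] at g2
      linarith
    · obtain rfl : i = pb := by omega
      refine ⟨hlt, by linarith, ?_⟩
      intro e3
      rw [← e3] at t3 hpos
      linarith
  · intro i h1 h2 j h3 h4 hij
    rw [e i (by omega), e j (by omega)] at hij
    rcases Nat.lt_or_ge i pb with h5 | h5 <;> rcases Nat.lt_or_ge j pb with h6 | h6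
    · exact h.inj i h1 h5 j h3 h6 hij
    · obtain rfl : j = pb := by omega
      exact absurd hij (h.sep i h1 h5).2.2
    · obtain rfl : i = pb := by omega
      exact absurd hij.symm (h.sep j h3 h6).2.2
    · omega
  · rw [e pa (by omega), e']
    rcases h.small with ⟨s1, s2, s3⟩ | ⟨s1, -⟩ | ⟨s1, -⟩ | s1
    · exact .inr (.inr (.inl ⟨by omega, s2, by rw [s3]⟩))
    all_goals exact .inr (.inr (.inr (by omega)))

/-- All positions except the last carry distinct visited vertices. This limits the number of rounds,
and it keeps the left position from running out of the array. -/
theorem Climb.card_le (hT : IsTree G dh w B' cnt vis par vl d)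
    (h : Climb G n bx by' B vis par d f pa pb) : pb ≤ pa + cnt := by
  have h1 : ((Finset.Ico pa pb).image f).card = pb - pa := by
    rw [Finset.card_image_of_injOn, Nat.card_Ico]
    intro i hi j hj hij
    simp only [Finset.coe_Ico, Set.mem_Ico] at hi hj
    rcases hi.1.eq_or_lt with rfl | hi' <;> rcases hj.1.eq_or_lt with rfl | hj'
    · rfl
    · exact absurd (hij ▸ (h.sep j hj' hj.2).1) (lt_irrefl _)
    · exact absurd (hij ▸ (h.sep i hi' hi.2).1) (lt_irrefl _)
    · exact h.inj i hi' hi.2 j hj' hj.2 hij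
  have h2 : (Finset.Ico pa pb).image f ⊆ (Finset.range cnt).image vl := by
    intro x hx
    simp only [Finset.mem_image, Finset.mem_Ico, Finset.mem_range] at hx ⊢
    obtain ⟨i, hi, rfl⟩ := hx
    rcases hT.vis_or (f i) with h0 | h0
    · rw [h.vis i hi.1 hi.2.le] at h0; omega
    · exact h0.2
  have h3 := Finset.card_le_card h2
  have h4 := Finset.card_image_le (s := Finset.range cnt) (f := vl)
  rw [Finset.card_range] at h4
  omega

/-- Ties climb on the left, hence the asymmetry of `Climb.sep`. If the left end were the root, the
right end would be a different vertex and so at a positive distance, against `hle`. -/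
theorem Climb.left_step (hT : IsTree G dh w B' cnt vis par vl d)
    (h : Climb G n bx by' B vis par d f (pa + 1) pb) (hle : d (f pb) ≤ d (f (pa + 1)))
    (hne : f (pa + 1) ≠ f pb) :
    Climb G n bx by' B vis par d (Function.update f pa (par (f (pa + 1)))) pa pb := by
  have hl := h.left
  have hr := h.right
  have hvb := h.vis pb (by omega) le_rfl
  have hva := h.vis (pa + 1) le_rfl (by omega)
  have hbw : f (pa + 1) ≠ w := by
    intro e
    rw [e] at hne
    have := hT.d_pos hvb hne.symm
    rw [e, hT.d_root] at hle
    linarith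
  obtain ⟨t1, t2, t3⟩ := hT.tree _ hva hbw
  have hpos := G.pos t2
  have e : ∀ i, pa < i → Function.update f pa (par (f (pa + 1))) i = f i := fun i hi =>
    Function.update_of_ne (by omega) _ _
  have e' : Function.update f pa (par (f (pa + 1))) pa = par (f (pa + 1)) :=
    Function.update_self _ _ _
  refine ⟨by omega, hr, ?_, ?_, ?_, ?_, ?_, ?_⟩
  · intro i h1 h2
    rcases Nat.lt_or_ge pa i with h3 | h3
    · rw [e i h3]; exact h.vis i h3 h2
    · obtain rfl : i = pa := by omega
      rw [e']; exact t1
  · intro i h1 h2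
    rw [e (i + 1) (by omega)]
    rcases Nat.lt_or_ge pa i with h3 | h3
    · rw [e i h3]; exact h.adj i h3 h2
    · obtain rfl : i = pa := by omega
      rw [e']; exact t2
  · rw [Finset.sum_eq_sum_Ico_succ_bot (by omega), e pb (by omega), e', e (pa + 1) (by omega)]
    have : ∑ i ∈ Finset.Ico (pa + 1) pb, G.len (Function.update f pa (par (f (pa + 1))) i)
        (Function.update f pa (par (f (pa + 1))) (i + 1)) =
        ∑ i ∈ Finset.Ico (pa + 1) pb, G.len (f i) (f (i + 1)) := by
      refine Finset.sum_congr rfl fun i hi => ?_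
      rw [Finset.mem_Ico] at hi
      rw [e i (by omega), e (i + 1) (by omega)]
    have := h.sum
    linarith
  · intro i h1 h2
    rw [e pb (by omega), e', e i (by omega)]
    rcases Nat.lt_or_ge (pa + 1) i with h3 | h3
    · obtain ⟨g1, g2, g3⟩ := h.sep i h3 h2
      exact ⟨by linarith, g2, g3⟩
    · obtain rfl : i = pa + 1 := by omega
      exact ⟨by linarith, hle, hne⟩
  · intro i h1 h2 j h3 h4 hij
    rw [e i (by omega), e j (by omega)] at hij
    rcases Nat.lt_or_ge (pa + 1) i with h5 | h5 <;> rcases Nat.lt_or_ge (pa + 1) j with h6 | h6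
    · exact h.inj i h5 h2 j h6 h4 hij
    · obtain rfl : j = pa + 1 := by omega
      have := (h.sep i h5 h2).1
      rw [hij] at this
      exact absurd this (lt_irrefl _)
    · obtain rfl : i = pa + 1 := by omega
      have := (h.sep j h6 h4).1
      rw [hij] at this
      exact absurd this (lt_irrefl _)
    · omega
  · rw [e pb (by omega), e']
    rcases h.small with ⟨s1, s2, s3⟩ | ⟨s1, -⟩ | ⟨s1, -⟩ | s1
    · exact .inr (.inl ⟨by omega, by rw [s2], s3⟩)
    all_goals exact .inr (.inr (.inr (by omega)))

/-- When the ends meet at z, the closed path has length B - 2 d z ≤ B. One or two vertices are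
excluded by `small`: the closing edge would be a loop or a tree edge. -/
theorem Climb.cyc (hT : IsTree G dh w B' cnt vis par vl d) (hc : IsCand G B bx by' vis par d)
    (h : Climb G n bx by' B vis par d f pa pb) (he : f pa = f pb) :
    G.Cyc (fun i => f (pa + i % (pb - pa))) (pb - pa) ∧
      G.pathLen (fun i => f (pa + i % (pb - pa))) (pb - pa) ≤ B := by
  have hl := h.left
  have hr := h.right
  have hva := h.vis pa le_rfl (by omega)
  have h3 : pa + 3 ≤ pb := by
    rcases h.small with ⟨s1, s2, s3⟩ | ⟨s1, s2, s3⟩ | ⟨s1, s2, s3⟩ | s1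
    · have := hc.adj
      rw [← s2, ← s3, he] at this
      exact absurd this (G.irrefl _)
    · exact absurd (by rw [← s2, ← s3, he]) hc.left
    · exact absurd (by rw [← s2, ← s3, he]) hc.right
    · exact s1
  set m := pb - pa with hm
  have hsucc : ∀ i, f (pa + (i + 1) % m) = f (pa + i % m + 1) := by
    intro i
    rw [Nat.add_mod, Nat.mod_eq_of_lt (show 1 < m by omega)]
    have := Nat.mod_lt i (show 0 < m by omega)
    rcases Nat.lt_or_ge (i % m + 1) m with h4 | h4
    · rw [Nat.mod_eq_of_lt h4, add_assoc]
    · have : i % m + 1 = m := by omega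
      rw [add_assoc, this, Nat.mod_self, Nat.add_zero, he]
      congr 1
      omega
  refine ⟨⟨by omega, fun i => by simp, fun i => ?_, fun i hi j hj hij => ?_⟩, ?_⟩
  · have := Nat.mod_lt i (show 0 < m by omega)
    simp only [hsucc]
    exact h.adj _ (by omega) (by omega)
  · simp only [Nat.mod_eq_of_lt hi, Nat.mod_eq_of_lt hj] at hij
    rcases Nat.eq_zero_or_pos i with rfl | hi0 <;> rcases Nat.eq_zero_or_pos j with rfl | hj0
    · rfl
    · have := (h.sep (pa + j) (by omega) (by omega)).1
      rw [← hij, Nat.add_zero] at this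
      exact absurd this (lt_irrefl _)
    · have := (h.sep (pa + i) (by omega) (by omega)).1
      rw [hij, Nat.add_zero] at this
      exact absurd this (lt_irrefl _)
    · have := h.inj _ (by omega) (by omega) _ (by omega) (by omega) hij
      omega
  · have h1 := hT.d_nonneg hva
    have h2 := h.sum
    rw [← he] at h2
    rw [Finset.sum_Ico_eq_sum_range, ← hm] at h2
    have : G.pathLen (fun i => f (pa + i % m)) m =
        ∑ i ∈ Finset.range m, G.len (f (pa + i)) (f (pa + i + 1)) := by
      refine Finset.sum_congr rfl fun i hi => ?_
      rw [Finset.mem_range] at hi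
      simp only [hsucc, Nat.mod_eq_of_lt hi]
    linarith

end Climb

/-- Climb from both ends of the last candidate to their common ancestor. -/
def climbLoop : Prog :=
  .loop (.wlt 22 3) (.seq (block [.rload 5 4 17, .rload 6 4 19])
    (.seq (.ite (.rlt 5 6) (block [.wload 19 6 19, .wop .add 24 24 3, .wstore 10 24 19])
      (block [.wload 17 6 17, .wop .sub 23 23 3, .wstore 10 23 17]))
    (.ite (.weq 17 19) (block [.wmove 22 3]) (block [.skip]))))

/-- Write down the cycle that the last candidate closes, if there is one. -/
def extract : Prog :=
  .ite (.weq 14 3) (.seq (block [.wmove 17 15, .wmove 19 16, .wmove 22 2, .wmove 23 0,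
    .wop .add 24 0 3, .wstore 10 23 17, .wstore 10 24 19])
    (.seq climbLoop (block [.wmove 28 23, .wop .sub 10 24 23]))) (block [.skip])

/-- The bound in the real register `2` is trivial, or it is realized by the cycle in the word
array `10`. -/
def Found (G : Net) (s : State) : Prop :=
  (s.wreg 10 = 0 ∧ s.rreg 2 = s.rreg 1) ∨ ∃ c, G.Cyc c (s.wreg 10) ∧
    (∀ i < s.wreg 10, s.warr 10 (s.wreg 28 + i) = c i) ∧ G.pathLen c (s.wreg 10) ≤ s.rreg 2 ∧
    s.wreg 28 + s.wreg 10 ≤ 2 * G.n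

theorem Found.of_eq {s s' : State} (h : Found G s) (h10 : s'.wreg 10 = s.wreg 10 := by rfl)
    (h28 : s'.wreg 28 = s.wreg 28 := by rfl) (hr1 : s'.rreg 1 = s.rreg 1 := by rfl)
    (hr2 : s'.rreg 2 = s.rreg 2 := by rfl) (ha10 : s'.warr 10 = s.warr 10 := by rfl) :
    Found G s' := by
  unfold Found at h ⊢
  rw [h10, h28, hr1, hr2, ha10]
  exact h

theorem wp_climbLoop {s : State} {w cnt n bx by' : ℕ} {B B' : ℝ} {dh : ℕ → ℝ} {vl : ℕ → ℕ}
    (hE : Env G W H M s) (hT : IsTree G dh w B' cnt (s.warr 5) (s.warr 6) vl (s.rarr 4))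
    (hn : cnt ≤ n) (hW : 2 * n + 2 < W)
    (hc : IsCand G B bx by' (s.warr 5) (s.warr 6) (s.rarr 4)) (h17 : s.wreg 17 = bx)
    (h19 : s.wreg 19 = by') (h22 : s.wreg 22 = 0) (h23 : s.wreg 23 = n) (h24 : s.wreg 24 = n + 1)
    (hfa : s.warr 10 n = bx) (hfb : s.warr 10 (n + 1) = by') :
    wp W climbLoop (fun t s' => t ≤ 12 * cnt + 1 ∧ ∃ pa pb, s'.wreg 23 = pa ∧ s'.wreg 24 = pb ∧
      Climb G n bx by' B (s.warr 5) (s.warr 6) (s.rarr 4) (s'.warr 10) pa pb ∧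
      s'.warr 10 pa = s'.warr 10 pb) s := by
  have hne : bx ≠ by' := by
    intro e
    have := hc.adj
    rw [e] at this
    exact G.irrefl _ this
  refine wp.mono (wp_loop (fun φ s' => ∃ pa pb k, s'.wreg 23 = pa ∧ s'.wreg 24 = pb ∧
    Climb G n bx by' B (s.warr 5) (s.warr 6) (s.rarr 4) (s'.warr 10) pa pb ∧
    s'.wreg 17 = s'.warr 10 pa ∧ s'.wreg 19 = s'.warr 10 pb ∧
    ((s'.wreg 22 = 0 ∧ s'.warr 10 pa ≠ s'.warr 10 pb) ∨
      (s'.wreg 22 = 1 ∧ s'.warr 10 pa = s'.warr 10 pb)) ∧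
    pb + k = pa + cnt + 1 ∧ φ = 12 * k) (12 * cnt)
    ⟨n, n + 1, cnt, h23, h24, Climb.init hc hfa hfb, by rw [h17, hfa], by rw [h19, hfb],
      .inl ⟨h22, by rw [hfa, hfb]; exact hne⟩, by omega, rfl⟩ ?_) ?_
  · rintro φ s' ⟨pa, pb, k, a23, a24, hC, a17, a19, hflag, hk, rfl⟩ hF hs
    have e3 : s'.wreg 3 = 1 := by rw [hF.w 3, hE.one]
    have e4 : s'.rarr 4 = s.rarr 4 := hF.ra 4
    have e6 : s'.warr 6 = s.warr 6 := hF.wa 6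
    simp only [Test.Holds, e3] at hs
    rcases hflag with ⟨h0, hab⟩ | ⟨h, -⟩
    swap
    · omega
    have hl := hC.left
    have hr := hC.right
    simp only [wp_seq, wp_ite, wp_block_one, wp_block_cons, Instr.Fits, Instr.apply,
      WordOp.eval, Test.Holds, Function.update_apply, Nat.reduceEqDiff, OfNat.ofNat_ne_zero,
      OfNat.zero_ne_ofNat, OfNat.ofNat_ne_one, OfNat.one_ne_ofNat, one_ne_zero, zero_ne_one,
      reduceIte, true_and, e3, e4, e6, a17, a19, a23, a24]
    constructor
    · intro hlt
      have hC' := hC.right_step hT hlt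
      have hk' := hC'.card_le hT
      obtain ⟨k, rfl⟩ : ∃ k', k = k' + 1 := ⟨k - 1, by omega⟩
      have g1 : pa ≠ pb + 1 := by omega
      refine ⟨by omega, fun hm => ⟨_, ⟨pa, pb + 1, k, rfl, rfl, hC', ?_, ?_, .inr ?_,
        by omega, rfl⟩, by omega⟩, fun hm => ⟨_, ⟨pa, pb + 1, k, rfl, rfl, hC', ?_, ?_,
        .inl ⟨h0, ?_⟩, by omega, rfl⟩, by omega⟩⟩ <;> simp [g1, hm]
    · intro hge
      rw [not_lt] at hge
      -- A left position 0 would force n < pb ≤ cnt ≤ n.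
      obtain ⟨pa, rfl⟩ : ∃ p, pa = p + 1 := by
        have := hC.card_le hT
        refine ⟨pa - 1, ?_⟩
        by_contra h0
        have h0 : pa = 0 := by omega
        omega
      have hC' := hC.left_step hT hge hab
      have hk' := hC'.card_le hT
      obtain ⟨k, rfl⟩ : ∃ k', k = k' + 1 := ⟨k - 1, by omega⟩
      have g1 : pb ≠ pa := by omega
      simp only [Nat.add_sub_cancel]
      refine ⟨by omega, fun hm => ⟨_, ⟨pa, pb, k, rfl, rfl, hC', ?_, ?_, .inr ?_,
        by omega, rfl⟩, by omega⟩, fun hm => ⟨_, ⟨pa, pb, k, rfl, rfl, hC', ?_, ?_,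
        .inl ⟨h0, ?_⟩, by omega, rfl⟩, by omega⟩⟩ <;> simp [g1, hm]
  · rintro t s' hF ⟨φ', ⟨pa, pb, k, a23, a24, hC, a17, a19, hflag, hk, rfl⟩, hn', ht⟩
    have e3 : s'.wreg 3 = 1 := by rw [hF.w 3, hE.one]
    simp only [Test.Holds, e3] at hn'
    refine ⟨by omega, pa, pb, a23, a24, hC, ?_⟩
    rcases hflag with ⟨h, -⟩ | ⟨-, h⟩
    · omega
    · exact h

theorem wp_extract {s : State} {w : ℕ} {B : ℝ} (hE : Env G W H M s) (hS : Searched G H w B s)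
    (hfound : s.wreg 14 = 0 → Found G s) :
    wp W extract (fun t s' => t ≤ 12 * s.wreg 13 + 14 ∧ Found G s') s := by
  have hcap := hE.cap
  have hroom := hE.room
  have hcnt := hS.tree.cnt_le
  unfold extract
  simp only [wp_seq, wp_ite, wp_block_one, wp_block_cons, Instr.Fits, Instr.apply, WordOp.eval,
    Test.Holds, Function.update_apply, Nat.reduceEqDiff, OfNat.ofNat_ne_zero, OfNat.zero_ne_ofNat,
    OfNat.ofNat_ne_one, OfNat.one_ne_ofNat, one_ne_zero, zero_ne_one, reduceIte, true_and,
    hE.zero, hE.one, hE.n]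
  constructor
  · intro h14
    rcases hS.cand with ⟨h, -⟩ | ⟨-, hlt, hc⟩
    · omega
    refine ⟨by omega, ?_⟩
    set s₁ : State := _
    change wp W _ _ s₁
    have hE₁ : Env G W H M s₁ := hE.of_eq
    refine wp.mono (wp_climbLoop (s := s₁) (n := G.n) hE₁ hS.tree hcnt (by omega) hc ?_ ?_ ?_ ?_
      ?_ ?_ ?_) ?_
    iterate 7 simp [s₁]
    rintro t s₂ hF₂ ⟨ht, pa, pb, h23, h24, hC, he⟩
    simp only [wp_seq, wp_ite, wp_block_one, wp_block_cons, Instr.Fits, Instr.apply,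
      WordOp.eval, Test.Holds, Function.update_apply, Nat.reduceEqDiff, OfNat.ofNat_ne_zero,
      OfNat.zero_ne_ofNat, OfNat.ofNat_ne_one, OfNat.one_ne_ofNat, one_ne_zero, zero_ne_one,
      reduceIte, true_and, h23, h24]
    have hl := hC.left
    have hr := hC.right
    have hcard := hC.card_le hS.tree
    obtain ⟨g1, g2⟩ := hC.cyc hS.tree hc he
    have f2 : s₂.rreg 2 = s.rreg 2 := hF₂.r 2
    refine ⟨by omega, by omega, .inr ⟨_, g1, ?_, ?_, ?_⟩⟩
    · intro i hi
      change i < pb - pa at hi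
      change s₂.warr 10 (pa + i) = _
      simp only [Nat.mod_eq_of_lt hi]
    · change _ ≤ s₂.rreg 2
      rw [f2]
      exact g2
    · change pa + (pb - pa) ≤ _
      omega
  · intro h14
    refine ⟨by omega, hfound ?_⟩
    rcases hS.cand with ⟨h, -⟩ | ⟨h, -⟩
    · exact h
    · exact absurd h h14

end RealRAM

/-! ### After a search: recording distances, trying closing edges, cleaning up -/

namespace RealRAM

variable {G : Net} {W H M : ℕ}

/-- Record for the visited vertices that they have been reached from the vertex `12`. -/
def recordDist : Prog :=
  forTo 20 13 (.seq (block [.wload 17 8 20, .rload 5 4 17, .rload 6 6 17])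
    (.ite (.rlt 5 6) (block [.rstore 6 17 5, .wstore 9 17 12]) (block [.skip])))

theorem wp_recordDist {s : State} {w : ℕ} {B : ℝ} (hE : Env G W H M s) (hS : Searched G H w B s)
    (h12 : s.wreg 12 = w) (h20 : s.wreg 20 = 0) :
    wp W recordDist (fun t s' => t ≤ 9 * s.wreg 13 + 1 ∧
      (∀ x, (s'.rarr 6 x = s.rarr 6 x ∧ s'.warr 9 x = s.warr 9 x) ∨
        (s.warr 5 x = 1 ∧ s'.rarr 6 x = s.rarr 4 x ∧ s'.warr 9 x = w)) ∧
      (∀ x, s'.rarr 6 x ≤ s.rarr 6 x) ∧ ∀ x, s.warr 5 x = 1 → s'.rarr 6 x ≤ s.rarr 4 x) s := by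
  have hcap := hE.cap
  have hroom := hE.room
  have hcnt := hS.tree.cnt_le
  refine wp.mono (wp_forTo (lo := 0) (hi := s.wreg 13) (fun t s' =>
    (∀ x, (s'.rarr 6 x = s.rarr 6 x ∧ s'.warr 9 x = s.warr 9 x) ∨
        (s.warr 5 x = 1 ∧ s'.rarr 6 x = s.rarr 4 x ∧ s'.warr 9 x = w)) ∧
    (∀ x, s'.rarr 6 x ≤ s.rarr 6 x) ∧
    ∀ t' < t, s'.rarr 6 (s.warr 8 t') ≤ s.rarr 4 (s.warr 8 t')) (fun _ => 7)
    h20 rfl hE.one (Nat.zero_le _) (by omega)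
    ⟨fun x => .inl ⟨rfl, rfl⟩, fun x => le_rfl, fun t h => by omega⟩ ?_) ?_
  · rintro t s' - ht h20' hF ⟨h1, h2, h3⟩
    have e8 : s'.warr 8 = s.warr 8 := hF.wa 8
    have e4 : s'.rarr 4 = s.rarr 4 := hF.ra 4
    have e12 : s'.wreg 12 = w := by rw [hF.w 12, h12]
    set x := s.warr 8 t with hx
    have hvx := hS.tree.vis_vl t ht
    simp only [wp_seq, wp_ite, wp_block_one, wp_block_cons, Instr.Fits, Instr.apply,
      WordOp.eval, Test.Holds, Function.update_apply, Nat.reduceEqDiff, OfNat.ofNat_ne_zero,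
      OfNat.zero_ne_ofNat, OfNat.ofNat_ne_one, OfNat.one_ne_ofNat, one_ne_zero, zero_ne_one,
      reduceIte, true_and, h20', e8, e4, e12, ← hx]
    refine ⟨fun hlt => ⟨by omega, fun y => ?_, fun y => ?_, fun t' ht' => ?_⟩,
      fun hge => ⟨by omega, h1, h2, fun t' ht' => ?_⟩⟩
    · by_cases hy : y = x
      · subst hy
        exact .inr ⟨hvx, by simp [State.setW], by simp [State.setW]⟩
      · simp only [State.setW, Function.update_apply, hy, reduceIte]
        exact h1 y
    · by_cases hy : y = x
      · subst hy
        simpa [State.setW] using hlt.le.trans (h2 _)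
      · simpa [State.setW, Function.update_apply, hy] using h2 y
    · by_cases hy : s.warr 8 t' = x
      · rw [hy]; simp [State.setW]
      · have : t' ≠ t := by rintro rfl; exact hy rfl
        simpa [State.setW, Function.update_apply, hy] using h3 t' (by omega)
    · rcases Nat.lt_succ_iff_lt_or_eq.1 ht' with h | rfl
      · exact h3 t' h
      · exact not_lt.1 hge
  · rintro t s' hF ⟨ht, ⟨h1, h2, h3⟩, -⟩
    simp only [Finset.sum_const, Nat.card_Ico, smul_eq_mul] at ht
    refine ⟨by omega, h1, h2, fun x hx => ?_⟩
    rcases hS.tree.vis_or x with h | ⟨-, t', ht', rfl⟩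
    · omega
    · exact h3 t' ht'

/-- Consider all candidates at the edges from the vertex `17`. -/
def scanVertex : Prog :=
  .seq (block [.wload 18 0 17, .wop .add 22 17 3, .wload 23 0 22])
    (forTo 18 23 (.seq (block [.wload 19 3 18, .wload 21 5 19, .wload 22 6 17, .wload 24 6 19])
      (.ite (.weq 21 3) (.ite (.weq 22 19) (block [.skip]) (.ite (.weq 24 17) (block [.skip]) cand))
        (block [.skip]))))

theorem wp_scanVertex {s : State} {w u : ℕ} {B : ℝ} (hE : Env G W H M s)
    (hS : Searched G H w B s) (h17 : s.wreg 17 = u) (hu : s.warr 5 u = 1) :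
    wp W scanVertex (fun t s' => t ≤ 22 * (s.warr 0 (u + 1) - s.warr 0 u) + 5 ∧
      Searched G H w B s' ∧ s'.rreg 2 ≤ s.rreg 2 ∧
      ∀ y, G.Adj u y → s.warr 5 y = 1 → s.warr 6 u ≠ y → s.warr 6 y ≠ u →
        s'.rreg 2 ≤ s.rarr 4 u + G.len u y + s.rarr 4 y) s := by
  have hcap := hE.cap
  have hroom := hE.room
  have hun := hS.tree.vis_lt hu
  have hM := hE.csr.le_last (u + 1) hun
  unfold scanVertex
  simp only [wp_seq, wp_ite, wp_block_one, wp_block_cons, Instr.Fits, Instr.apply, WordOp.eval,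
    Test.Holds, Function.update_apply, Nat.reduceEqDiff, OfNat.ofNat_ne_zero, OfNat.zero_ne_ofNat,
    OfNat.ofNat_ne_one, OfNat.one_ne_ofNat, one_ne_zero, zero_ne_one, reduceIte, true_and, h17,
    hE.one]
  refine ⟨by omega, ?_⟩
  set s₁ : State := _
  change wp W _ _ s₁
  have hE₁ : Env G W H M s₁ := hE.of_eq
  have hS₁ : Searched G H w B s₁ := hS.of_eq
  refine wp.mono (wp_forTo (lo := s.warr 0 u) (hi := s.warr 0 (u + 1)) (fun p s' =>
    Searched G H w B s' ∧ s'.rreg 2 ≤ s.rreg 2 ∧ ∀ q, s.warr 0 u ≤ q → q < p →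
      s.warr 5 (s.warr 3 q) = 1 → s.warr 6 u ≠ s.warr 3 q → s.warr 6 (s.warr 3 q) ≠ u →
        s'.rreg 2 ≤ s.rarr 4 u + G.len u (s.warr 3 q) + s.rarr 4 (s.warr 3 q)) (fun _ => 20)
    (by simp [s₁]) (by simp [s₁]) hE₁.one (hE.csr.mono u hun) (by omega)
    ⟨hS₁, le_rfl, fun q _ _ => by omega⟩ ?_) ?_
  · rintro p s' hp1 hp2 h18 hF ⟨h1, h2, h3⟩
    have hE' : Env G W H M s' := hE₁.frame hF
    have e3 : s'.warr 3 = s.warr 3 := hF.wa 3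
    have e5 : s'.warr 5 = s.warr 5 := hF.wa 5
    have e6 : s'.warr 6 = s.warr 6 := hF.wa 6
    have e4 : s'.rarr 4 = s.rarr 4 := hF.ra 4
    have e1 : s'.rarr 1 = s.rarr 1 := hF.ra 1
    have e17 : s'.wreg 17 = u := by rw [hF.w 17]; simp [s₁, h17]
    obtain ⟨huy, hlen⟩ := hE.csr.edge u hun p hp1 hp2
    set y := s.warr 3 p with hy
    have skip : ∀ s'' : State, s''.rreg = s'.rreg →
        (s.warr 5 y = 1 → s.warr 6 u ≠ y → s.warr 6 y ≠ u → False) →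
        ∀ q, s.warr 0 u ≤ q → q < p + 1 → s.warr 5 (s.warr 3 q) = 1 → s.warr 6 u ≠ s.warr 3 q →
        s.warr 6 (s.warr 3 q) ≠ u →
        s''.rreg 2 ≤ s.rarr 4 u + G.len u (s.warr 3 q) + s.rarr 4 (s.warr 3 q) := by
      intro s'' he hno q g1 g2 g3 g4 g5
      rw [he]
      rcases Nat.lt_succ_iff_lt_or_eq.1 g2 with h | rfl
      · exact h3 q g1 h g3 g4 g5
      · exact (hno g3 g4 g5).elim
    simp only [wp_seq, wp_ite, wp_block_one, wp_block_cons, Instr.Fits, Instr.apply,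
      WordOp.eval, Test.Holds, Function.update_apply, Nat.reduceEqDiff, OfNat.ofNat_ne_zero,
      OfNat.zero_ne_ofNat, OfNat.ofNat_ne_one, OfNat.one_ne_ofNat, one_ne_zero, zero_ne_one,
      reduceIte, true_and, h18, e3, e5, e6, e17, hE'.one, ← hy]
    refine ⟨fun k1 => ⟨fun k2 => ⟨by omega, h1.of_eq, h2, ?_⟩, fun k2 =>
      ⟨fun k3 => ⟨by omega, h1.of_eq, h2, ?_⟩, fun k3 => ?_⟩⟩, fun k1 =>
      ⟨by omega, h1.of_eq, h2, ?_⟩⟩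
    · exact skip (State.setW _ _ _) rfl fun _ h _ => h k2
    · exact skip (State.setW _ _ _) rfl fun _ _ h => h k3
    · set s₂ : State := _
      change wp W _ _ s₂
      have hE₂ : Env G W H M s₂ := hE'.of_eq
      refine wp.mono (wp_cand (s := s₂) (x := u) (p := p) (y := y) (w := w) (B := B) hE₂
        (by simp [s₂, e17]) (by simp [s₂, h18]) (by simp [s₂]) (by simp [s₂, e1, hlen]) huy
        (by simp [s₂, e5, hu]) (by simp [s₂, e5, k1]) (by simpa [s₂, e6] using k2)
        (by simpa [s₂, e6] using k3) h1.of_eq) ?_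
      rintro t s₃ hF₃ ⟨ht, g1, g2, g3⟩
      change s₃.rreg 2 ≤ s'.rreg 2 at g2
      change s₃.rreg 2 ≤ s'.rarr 4 u + _ + s'.rarr 4 y at g3
      rw [e4] at g3
      refine ⟨by omega, g1.of_eq, g2.trans h2, fun q f1 f2 f3 f4 f5 => ?_⟩
      rcases Nat.lt_succ_iff_lt_or_eq.1 f2 with h | rfl
      · exact g2.trans (h3 q f1 h f3 f4 f5)
      · exact g3
    · exact skip (State.setW _ _ _) rfl fun h _ _ => k1 h
  · rintro t s' hF ⟨ht, ⟨h1, h2, h3⟩, -⟩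
    simp only [Finset.sum_const, Nat.card_Ico, smul_eq_mul] at ht
    refine ⟨by omega, h1, h2, fun y g1 g2 g3 g4 => ?_⟩
    obtain ⟨p, p1, p2, rfl⟩ := hE.csr.surj u y g1
    exact h3 p p1 p2 g2 g3 g4

/-- Consider all candidates at the vertices that belong to the vertex `12`. -/
def scan : Prog :=
  forTo 20 13 (.seq (block [.wload 17 8 20, .wload 21 9 17])
    (.ite (.weq 21 12) scanVertex (block [.skip])))

/-- The list of visited vertices has no repetitions, so the lengths of the lists read sum to at most
the degree sum over the vertices assigned to w. The condition on the assignment makes these sums add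
up to at most M over all w. -/
theorem wp_scan {s : State} {w : ℕ} {B : ℝ} (hE : Env G W H M s) (hS : Searched G H w B s)
    (h12 : s.wreg 12 = w) (h20 : s.wreg 20 = 0) :
    wp W scan (fun t s' => t ≤ 12 * s.wreg 13 + 1 +
        22 * ∑ u ∈ Finset.range G.n, (if s.warr 9 u = w then s.warr 0 (u + 1) - s.warr 0 u else 0) ∧
      Searched G H w B s' ∧ s'.rreg 2 ≤ s.rreg 2 ∧
      ∀ u y, s.warr 5 u = 1 → s.warr 9 u = w → G.Adj u y → s.warr 5 y = 1 → s.warr 6 u ≠ y →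
        s.warr 6 y ≠ u → s'.rreg 2 ≤ s.rarr 4 u + G.len u y + s.rarr 4 y) s := by
  have hcap := hE.cap
  have hroom := hE.room
  have hcnt := hS.tree.cnt_le
  set deg : ℕ → ℕ := fun u => if s.warr 9 u = w then s.warr 0 (u + 1) - s.warr 0 u else 0 with hdeg
  refine wp.mono (wp_forTo (lo := 0) (hi := s.wreg 13) (fun t s' =>
    Searched G H w B s' ∧ s'.rreg 2 ≤ s.rreg 2 ∧ ∀ t' < t, ∀ y, s.warr 9 (s.warr 8 t') = w →
      G.Adj (s.warr 8 t') y → s.warr 5 y = 1 → s.warr 6 (s.warr 8 t') ≠ y →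
        s.warr 6 y ≠ s.warr 8 t' →
        s'.rreg 2 ≤ s.rarr 4 (s.warr 8 t') + G.len (s.warr 8 t') y + s.rarr 4 y)
    (fun t => 22 * deg (s.warr 8 t) + 10)
    h20 rfl hE.one (Nat.zero_le _) (by omega) ⟨hS, le_rfl, fun t h => by omega⟩ ?_) ?_
  · rintro t s' - ht h20' hF ⟨h1, h2, h3⟩
    have hE' : Env G W H M s' := hE.frame hF
    have e0 : s'.warr 0 = s.warr 0 := hF.wa 0
    have e8 : s'.warr 8 = s.warr 8 := hF.wa 8
    have e9 : s'.warr 9 = s.warr 9 := hF.wa 9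
    have e5 : s'.warr 5 = s.warr 5 := hF.wa 5
    have e6 : s'.warr 6 = s.warr 6 := hF.wa 6
    have e4 : s'.rarr 4 = s.rarr 4 := hF.ra 4
    have e12 : s'.wreg 12 = w := by rw [hF.w 12, h12]
    set x := s.warr 8 t with hx
    have hvx := hS.tree.vis_vl t ht
    simp only [wp_seq, wp_ite, wp_block_one, wp_block_cons, Instr.Fits, Instr.apply,
      WordOp.eval, Test.Holds, Function.update_apply, Nat.reduceEqDiff, OfNat.ofNat_ne_zero,
      OfNat.zero_ne_ofNat, OfNat.ofNat_ne_one, OfNat.one_ne_ofNat, one_ne_zero, zero_ne_one,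
      reduceIte, true_and, h20', e8, e9, e12, ← hx]
    constructor
    · intro hpw
      set s₁ : State := _
      change wp W _ _ s₁
      have hE₁ : Env G W H M s₁ := hE'.of_eq
      refine wp.mono (wp_scanVertex (s := s₁) (u := x) hE₁ h1.of_eq (by simp [s₁])
        (by simp [s₁, e5, hx, hvx])) ?_
      rintro u s₂ hF₂ ⟨hu, g1, g2, g3⟩
      change u ≤ 22 * (s'.warr 0 _ - s'.warr 0 _) + 5 at hu
      change s₂.rreg 2 ≤ s'.rreg 2 at g2
      change ∀ y, _ → s'.warr 5 _ = 1 → s'.warr 6 _ ≠ y → s'.warr 6 _ ≠ _ →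
        s₂.rreg 2 ≤ s'.rarr 4 _ + _ + s'.rarr 4 _ at g3
      rw [e5, e6, e4] at g3
      rw [e0] at hu
      refine ⟨?_, g1.of_eq, g2.trans h2, fun t' ht' y f1 f2 f3 f4 f5 => ?_⟩
      · simp only [hdeg, hpw, reduceIte]
        omega
      · rcases Nat.lt_succ_iff_lt_or_eq.1 ht' with h | rfl
        · exact g2.trans (h3 t' h y f1 f2 f3 f4 f5)
        · exact g3 y f2 f3 f4 f5
    · intro hpw
      refine ⟨by omega, h1.of_eq, h2, fun t' ht' y f1 f2 f3 f4 f5 => ?_⟩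
      rcases Nat.lt_succ_iff_lt_or_eq.1 ht' with h | rfl
      · exact h3 t' h y f1 f2 f3 f4 f5
      · exact absurd f1 hpw
  · rintro t s' hF ⟨ht, ⟨h1, h2, h3⟩, -⟩
    have hsum : ∑ i ∈ Finset.Ico 0 (s.wreg 13), (22 * deg (s.warr 8 i) + 10 + 2) =
        22 * ∑ i ∈ Finset.range (s.wreg 13), deg (s.warr 8 i) + 12 * s.wreg 13 := by
      rw [Finset.range_eq_Ico, Finset.mul_sum]
      simp only [add_assoc, Finset.sum_add_distrib, Finset.sum_const, Nat.card_Ico, smul_eq_mul]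
      omega
    have hinj : ∑ i ∈ Finset.range (s.wreg 13), deg (s.warr 8 i) ≤
        ∑ u ∈ Finset.range G.n, deg u := by
      rw [← Finset.sum_image (g := s.warr 8) (f := deg) (fun i hi j hj => hS.tree.inj i
        (by simpa using hi) j (by simpa using hj))]
      refine Finset.sum_le_sum_of_subset fun u hu => ?_
      simp only [Finset.mem_image, Finset.mem_range] at hu ⊢
      obtain ⟨i, hi, rfl⟩ := hu
      exact hS.tree.lt i hi
    rw [hsum] at ht
    refine ⟨?_, h1, h2, fun u y g0 g1 g2 g3 g4 g5 => ?_⟩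
    · change t ≤ 12 * _ + 1 + 22 * ∑ u ∈ Finset.range G.n, deg u
      omega
    rcases hS.tree.vis_or u with h | ⟨-, t', ht', rfl⟩
    · omega
    · exact h3 t' ht' y g1 g2 g3 g4 g5

/-- No search is going on. -/
structure Clean (H : ℕ) (s : State) : Prop where
  tree : IsMinTree (2 ^ H) (s.rarr 2)
  leaf : ∀ p < 2 ^ H, s.rarr 2 (2 ^ H + p) = s.rreg 1
  vis : ∀ x, s.warr 5 x = 0

/-- Undo the effects of a search. -/
def cleanup : Prog :=
  forTo 20 13 (.seq (block [.wload 17 8 20, .wstore 5 17 2, .wmove 40 17, .rmove 20 1]) heapUpdate)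

/-- Only the visited vertices are reset, so the cost is proportional to their number. Reinitializing
the arrays for each search would cost n every time. -/
theorem wp_cleanup {s : State} {w : ℕ} {B : ℝ} (hE : Env G W H M s) (hS : Searched G H w B s)
    (h20 : s.wreg 20 = 0) :
    wp W cleanup (fun t s' => t ≤ (10 * H + 9) * s.wreg 13 + 1 ∧ Clean H s') s := by
  have hcap := hE.cap
  have hroom := hE.room
  have hcnt := hS.tree.cnt_le
  refine wp.mono (wp_forTo (lo := 0) (hi := s.wreg 13) (fun t s' =>
    IsMinTree (2 ^ H) (s'.rarr 2) ∧
    (∀ x, s'.warr 5 x = 0 ∨ (s'.warr 5 x = 1 ∧ ∃ t', t ≤ t' ∧ t' < s.wreg 13 ∧ s.warr 8 t' = x)) ∧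
    ∀ p < 2 ^ H, s'.warr 5 p ≠ 1 → s'.rarr 2 (2 ^ H + p) = s.rreg 1) (fun _ => 10 * H + 7)
    h20 rfl hE.one (Nat.zero_le _) (by omega) ⟨hS.heap, fun x => ?_, hS.idle⟩ ?_) ?_
  · rcases hS.tree.vis_or x with h | ⟨h, t, ht, rfl⟩
    · exact .inl h
    · exact .inr ⟨h, t, Nat.zero_le _, ht, rfl⟩
  · rintro t s' - ht h20' hF ⟨h1, h2, h3⟩
    have hE' : Env G W H M s' := hE.frame hF
    have e8 : s'.warr 8 = s.warr 8 := hF.wa 8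
    have er1 : s'.rreg 1 = s.rreg 1 := hF.r 1
    set x := s.warr 8 t with hx
    have hxn := hS.tree.lt t ht
    simp only [wp_seq, wp_ite, wp_block_one, wp_block_cons, Instr.Fits, Instr.apply,
      WordOp.eval, Test.Holds, Function.update_apply, Nat.reduceEqDiff, OfNat.ofNat_ne_zero,
      OfNat.zero_ne_ofNat, OfNat.ofNat_ne_one, OfNat.one_ne_ofNat, one_ne_zero, zero_ne_one,
      reduceIte, true_and, h20', e8, er1, hE'.zero, ← hx]
    set s₁ : State := _
    change wp W _ _ s₁
    refine wp.mono (wp_heapUpdate (H := H) (s := s₁) hE'.one hE'.two hE'.leaves hcap h1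
      (by simp [s₁]; omega)) ?_
    rintro u s₂ hF₂ ⟨hu, hT, hleaf⟩
    have f5 : s₂.warr 5 = Function.update (s'.warr 5) x 0 := by rw [hF₂.wa 5]; simp [s₁]
    refine ⟨by omega, hT, fun z => ?_, fun p hp hv => ?_⟩
    · change s₂.warr 5 z = 0 ∨ s₂.warr 5 z = 1 ∧ _
      rw [f5]
      by_cases hz : z = x
      · exact .inl (by simp [hz])
      · rw [Function.update_of_ne hz]
        refine (h2 z).imp id ?_
        rintro ⟨g1, t', g2, g3, g4⟩
        refine ⟨g1, t', ?_, g3, g4⟩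
        rcases g2.eq_or_lt with rfl | g2
        · exact absurd g4.symm hz
        · exact g2
    · change s₂.warr 5 p ≠ 1 at hv
      change s₂.rarr 2 _ = _
      rw [hleaf p hp]
      have c40 : s₁.wreg 40 = x := by simp [s₁]
      have c20 : s₁.rreg 20 = s.rreg 1 := by simp [s₁]
      rw [c40, c20]
      split_ifs with hz
      · rfl
      · rw [f5, Function.update_of_ne hz] at hv
        exact h3 p hp hv
  · rintro t s' hF ⟨ht, ⟨h1, h2, h3⟩, -⟩
    simp only [Finset.sum_const, Nat.card_Ico, smul_eq_mul] at ht
    have hv : ∀ x, s'.warr 5 x = 0 := by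
      intro x
      rcases h2 x with h | ⟨-, t', g1, g2, -⟩
      · exact h
      · omega
    refine ⟨by rw [mul_comm]; exact ht, h1, fun p hp => ?_, hv⟩
    rw [h3 p hp (by rw [hv]; omega), hF.r 1]

end RealRAM

/-! ### The cost of a search and the two passes over a level -/

/-- The vertices that a pruned search from `w` can reach. -/
def Net.reach (G : Net) (dh : ℕ → ℝ) (w : ℕ) (B : ℝ) : Finset ℕ :=
  open Classical in
  (Finset.range G.n).filter fun x => ∃ r, G.Walk w x r ∧ r < dh x ∧ 2 * r < B

theorem Net.reach_mono (G : Net) {dh : ℕ → ℝ} {w : ℕ} {B B' : ℝ} (h : B ≤ B') :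
    G.reach dh w B ⊆ G.reach dh w B' := by
  intro x hx
  simp only [Net.reach, Finset.mem_filter] at hx ⊢
  obtain ⟨h1, r, h2, h3, h4⟩ := hx
  exact ⟨h1, r, h2, h3, h4.trans_le h⟩

namespace RealRAM

variable {G : Net} {W H M : ℕ}

/-- The `+ 1` stands for the root, which is visited without any test. -/
theorem IsTree.cnt_le_reach {dh : ℕ → ℝ} {w : ℕ} {B : ℝ} {cnt : ℕ} {vis par vl : ℕ → ℕ} {d : ℕ → ℝ}
    (h : IsTree G dh w B cnt vis par vl d) : cnt ≤ (G.reach dh w B).card + 1 := by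
  have h1 := Finset.card_le_card_of_injOn (s := Finset.range cnt)
    (t := Insert.insert w (G.reach dh w B)) vl (fun t ht => ?_)
    (fun t ht t' ht' e => h.inj t (by simpa using ht) t' (by simpa using ht') e)
  · rw [Finset.card_range] at h1
    exact h1.trans (Finset.card_insert_le _ _)
  · rw [Finset.coe_range, Set.mem_Iio] at ht
    rw [Finset.mem_coe, Finset.mem_insert]
    by_cases hw : vl t = w
    · exact .inl hw
    · refine .inr ?_
      have hv := h.vis_vl t ht
      simp only [Net.reach, Finset.mem_filter, Finset.mem_range]
      obtain ⟨h2, h3⟩ := h.adm _ hv hw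
      exact ⟨h.lt t ht, _, h.walk _ hv, h2, h3⟩

theorem Searched.isRun {s : State} {w : ℕ} {B : ℝ} (h : Searched G H w B s) :
    G.IsRun (s.rarr 5) w (s.rreg 2) (fun x => s.warr 5 x = 1) (s.warr 6) (s.rarr 4) where
  root := by rw [← h.tree.root]; exact h.tree.vis_vl 0 h.tree.pos
  d_root := h.tree.d_root
  par_root := h.tree.par_root
  walk := h.tree.walk
  tree := h.tree.tree
  closed := h.closed

/-- What has to be done after a search. -/
def finish : Prog := .seq extract (.seq (block [.wmove 20 2]) cleanup)

theorem wp_finish {s : State} {w : ℕ} {B : ℝ} (hE : Env G W H M s) (hS : Searched G H w B s)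
    (hfound : s.wreg 14 = 0 → Found G s) :
    wp W finish (fun t s' => t ≤ (10 * H + 21) * s.wreg 13 + 16 ∧ Clean H s' ∧ Found G s') s := by
  unfold finish
  rw [wp_seq]
  refine wp.mono (wp_extract hE hS hfound) ?_
  rintro t s₁ hF₁ ⟨ht, hf⟩
  have hE₁ : Env G W H M s₁ := hE.frame hF₁
  simp only [wp_seq, wp_ite, wp_block_one, wp_block_cons, Instr.Fits, Instr.apply, WordOp.eval,
    Test.Holds, Function.update_apply, Nat.reduceEqDiff, OfNat.ofNat_ne_zero, OfNat.zero_ne_ofNat,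
    OfNat.ofNat_ne_one, OfNat.one_ne_ofNat, one_ne_zero, zero_ne_one, reduceIte, true_and,
    hE₁.zero]
  set s₂ : State := _
  change wp W _ _ s₂
  have hE₂ : Env G W H M s₂ := hE₁.of_eq
  have hS₂ : Searched G H w B s₂ := by
    refine hS.of_eq ?_ ?_ ?_ ?_ ?_ ?_ ?_ ?_ ?_ ?_ ?_ ?_
    · exact hF₁.w 13
    · exact hF₁.w 14
    · exact hF₁.w 15
    · exact hF₁.w 16
    · exact hF₁.r 1
    · exact hF₁.r 2
    · exact hF₁.wa 5
    · exact hF₁.wa 6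
    · exact hF₁.wa 8
    · exact hF₁.ra 2
    · exact hF₁.ra 4
    · exact hF₁.ra 5
  refine wp.mono (wp_cleanup (s := s₂) hE₂ hS₂ (by simp [s₂])) ?_
  rintro u s₃ hF₃ ⟨hu, hC⟩
  have h13 : s₂.wreg 13 = s.wreg 13 := hF₁.w 13
  rw [h13] at hu
  refine ⟨?_, hC, hf.of_eq ?_ ?_ ?_ ?_ ?_⟩
  · have : (10 * H + 21) * s.wreg 13 = (10 * H + 9) * s.wreg 13 + 12 * s.wreg 13 := by ring
    omega
  · exact hF₃.w 10
  · exact hF₃.w 28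
  · exact hF₃.r 1
  · exact hF₃.r 2
  · exact hF₃.wa 10

theorem Found.of_search {s s' : State} {w : ℕ} {B : ℝ} (h : Found G s) (hB : s.rreg 2 = B)
    (hS : Searched G H w B s') (h10 : s'.wreg 10 = s.wreg 10)
    (h28 : s'.wreg 28 = s.wreg 28) (hr1 : s'.rreg 1 = s.rreg 1)
    (ha10 : s'.warr 10 = s.warr 10) : s'.wreg 14 = 0 → Found G s' := by
  intro h0
  refine h.of_eq h10 h28 hr1 ?_ ha10
  rcases hS.cand with ⟨-, h⟩ | ⟨h, -⟩
  · rw [h, hB]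
  · omega

/-- With c visited vertices: the search, the final work, the larger of the costs per vertex of
recording (9) and scanning (12), and a constant for the instructions in between. -/
theorem run_cost (H c : ℕ) :
    250 * (H + 1) * (c + 1) + (10 * H + 21) * c + 12 * c + 19 ≤ 300 * (H + 1) * (c + 1) := by
  nlinarith [Nat.zero_le (H * c)]

/-- Search from the vertex `12` and record the distances. -/
def runRecord : Prog :=
  .seq search (.seq (block [.wmove 20 2]) (.seq recordDist finish))

theorem wp_runRecord {s : State} {w : ℕ} (hE : Env G W H M s)
    (hK : KeyTree H M (s.rreg 1) (s.warr 3) (s.rarr 1) (s.rarr 5) (s.rarr 3))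
    (hC : Clean H s) (hFd : Found G s) (hle : s.rreg 2 ≤ s.rreg 1) (hw : s.wreg 12 = w)
    (hwn : w < G.n) :
    wp W runRecord (fun t s' =>
      t ≤ 300 * (H + 1) * ((G.reach (s.rarr 5) w (s.rreg 2)).card + 2) ∧ Clean H s' ∧ Found G s' ∧
      s'.rreg 2 ≤ s.rreg 2 ∧ ∃ vis par d, G.IsRun (s.rarr 5) w (s'.rreg 2) vis par d ∧
      (∀ x, (s'.rarr 6 x = s.rarr 6 x ∧ s'.warr 9 x = s.warr 9 x) ∨
        (vis x ∧ s'.rarr 6 x = d x ∧ s'.warr 9 x = w)) ∧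
      (∀ x, s'.rarr 6 x ≤ s.rarr 6 x) ∧ ∀ x, vis x → s'.rarr 6 x ≤ d x) s := by
  unfold runRecord
  rw [wp_seq]
  refine wp.mono (wp_search hE hK hC.tree hC.leaf hC.vis hw hwn rfl hle) ?_
  rintro t₁ s₁ hF₁ ⟨ht₁, hS₁⟩
  have hE₁ : Env G W H M s₁ := hE.frame hF₁
  simp only [wp_seq, wp_ite, wp_block_one, wp_block_cons, Instr.Fits, Instr.apply, WordOp.eval,
    Test.Holds, Function.update_apply, Nat.reduceEqDiff, OfNat.ofNat_ne_zero, OfNat.zero_ne_ofNat,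
    OfNat.ofNat_ne_one, OfNat.one_ne_ofNat, one_ne_zero, zero_ne_one, reduceIte, true_and,
    hE₁.zero]
  set s₂ : State := _
  change wp W _ _ s₂
  have hE₂ : Env G W H M s₂ := hE₁.of_eq
  have hS₂ : Searched G H w (s.rreg 2) s₂ := hS₁.of_eq
  have e5 : s₁.rarr 5 = s.rarr 5 := hF₁.ra 5
  have e6 : s₂.rarr 6 = s.rarr 6 := hF₁.ra 6
  have e9 : s₂.warr 9 = s.warr 9 := hF₁.wa 9
  have hrun : G.IsRun (s₁.rarr 5) w (s₁.rreg 2) _ _ _ := hS₁.isRun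
  rw [e5] at hrun
  refine wp.mono (wp_recordDist (s := s₂) hE₂ hS₂ (by simp [s₂, hF₁.w 12, hw]) (by simp [s₂])) ?_
  rintro t₃ s₃ hF₃ ⟨ht₃, h1, h2, h3⟩
  have hE₃ : Env G W H M s₃ := hE₂.frame hF₃
  have hS₃ : Searched G H w (s.rreg 2) s₃ := by
    refine hS₂.of_eq ?_ ?_ ?_ ?_ ?_ ?_ ?_ ?_ ?_ ?_ ?_ ?_
    · exact hF₃.w 13
    · exact hF₃.w 14
    · exact hF₃.w 15
    · exact hF₃.w 16
    · exact hF₃.r 1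
    · exact hF₃.r 2
    · exact hF₃.wa 5
    · exact hF₃.wa 6
    · exact hF₃.wa 8
    · exact hF₃.ra 2
    · exact hF₃.ra 4
    · exact hF₃.ra 5
  refine wp.mono (wp_finish hE₃ hS₃ (hFd.of_search rfl hS₃ ?_ ?_ ?_ ?_)) ?_
  · rw [hF₃.w 10]; exact hF₁.w 10
  · rw [hF₃.w 28]; exact hF₁.w 28
  · rw [hF₃.r 1]; exact hF₁.r 1
  · rw [hF₃.wa 10]; exact hF₁.wa 10
  rintro t₄ s₄ hF₄ ⟨ht₄, hC₄, hFd₄⟩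
  have g2 : s₄.rreg 2 = s₁.rreg 2 := by rw [hF₄.r 2, hF₃.r 2]
  have g6 : s₄.rarr 6 = s₃.rarr 6 := hF₄.ra 6
  have g9 : s₄.warr 9 = s₃.warr 9 := hF₄.wa 9
  have h13 : s₃.wreg 13 = s₁.wreg 13 := hF₃.w 13
  have hcnt := hS₁.tree.cnt_le_reach
  rw [e5] at hcnt
  rw [e6] at h1 h2
  rw [e9] at h1
  refine ⟨?_, hC₄, hFd₄, by rw [g2]; exact hS₁.le, fun x => s₁.warr 5 x = 1, s₁.warr 6, s₁.rarr 4,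
    by rw [g2]; exact hrun, by rw [g6, g9]; exact h1, by rw [g6]; exact h2, by rw [g6]; exact h3⟩
  change t₃ ≤ 9 * s₁.wreg 13 + 1 at ht₃
  rw [h13] at ht₄
  generalize s₁.wreg 13 = c at ht₁ ht₃ ht₄ hcnt
  have : 300 * (H + 1) * (c + 1) ≤
      300 * (H + 1) * ((G.reach (s.rarr 5) w (s.rreg 2)).card + 2) :=
    Nat.mul_le_mul_left _ (by omega)
  have := run_cost H c
  omega

/-- Search from the vertex `12` and look for candidates. -/
def runScan : Prog :=
  .seq search (.seq (block [.wmove 20 2]) (.seq scan finish))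

theorem wp_runScan {s : State} {w : ℕ} (hE : Env G W H M s)
    (hK : KeyTree H M (s.rreg 1) (s.warr 3) (s.rarr 1) (s.rarr 5) (s.rarr 3))
    (hC : Clean H s) (hFd : Found G s) (hle : s.rreg 2 ≤ s.rreg 1) (hw : s.wreg 12 = w)
    (hwn : w < G.n) :
    wp W runScan (fun t s' =>
      t ≤ 300 * (H + 1) * ((G.reach (s.rarr 5) w (s.rreg 2)).card + 2) + 22 *
        ∑ u ∈ Finset.range G.n, (if s.warr 9 u = w then s.warr 0 (u + 1) - s.warr 0 u else 0) ∧
      Clean H s' ∧ Found G s' ∧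
      s'.rreg 2 ≤ s.rreg 2 ∧ ∃ vis par d, G.IsRun (s.rarr 5) w (s'.rreg 2) vis par d ∧
      ∀ u y, vis u → s.warr 9 u = w → vis y → G.Adj u y → par u ≠ y → par y ≠ u →
        s'.rreg 2 ≤ d u + G.len u y + d y) s := by
  unfold runScan
  rw [wp_seq]
  refine wp.mono (wp_search hE hK hC.tree hC.leaf hC.vis hw hwn rfl hle) ?_
  rintro t₁ s₁ hF₁ ⟨ht₁, hS₁⟩
  have hE₁ : Env G W H M s₁ := hE.frame hF₁
  simp only [wp_seq, wp_ite, wp_block_one, wp_block_cons, Instr.Fits, Instr.apply, WordOp.eval,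
    Test.Holds, Function.update_apply, Nat.reduceEqDiff, OfNat.ofNat_ne_zero, OfNat.zero_ne_ofNat,
    OfNat.ofNat_ne_one, OfNat.one_ne_ofNat, one_ne_zero, zero_ne_one, reduceIte, true_and,
    hE₁.zero]
  set s₂ : State := _
  change wp W _ _ s₂
  have hE₂ : Env G W H M s₂ := hE₁.of_eq
  have hS₂ : Searched G H w (s.rreg 2) s₂ := hS₁.of_eq
  have e5 : s₁.rarr 5 = s.rarr 5 := hF₁.ra 5
  have e9 : s₂.warr 9 = s.warr 9 := hF₁.wa 9
  have e0 : s₂.warr 0 = s.warr 0 := hF₁.wa 0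
  have hrun : G.IsRun (s₁.rarr 5) w (s₁.rreg 2) _ _ _ := hS₁.isRun
  rw [e5] at hrun
  refine wp.mono (wp_scan (s := s₂) hE₂ hS₂ (by simp [s₂, hF₁.w 12, hw]) (by simp [s₂])) ?_
  rintro t₃ s₃ hF₃ ⟨ht₃, hS₃, h2, h3⟩
  have hE₃ : Env G W H M s₃ := hE₂.frame hF₃
  refine wp.mono (wp_finish hE₃ hS₃ (hFd.of_search rfl hS₃ ?_ ?_ ?_ ?_)) ?_
  · rw [hF₃.w 10]; exact hF₁.w 10
  · rw [hF₃.w 28]; exact hF₁.w 28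
  · rw [hF₃.r 1]; exact hF₁.r 1
  · rw [hF₃.wa 10]; exact hF₁.wa 10
  rintro t₄ s₄ hF₄ ⟨ht₄, hC₄, hFd₄⟩
  have g2 : s₄.rreg 2 = s₃.rreg 2 := hF₄.r 2
  change s₃.rreg 2 ≤ s₁.rreg 2 at h2
  have h13 : s₃.wreg 13 = s₁.wreg 13 := hF₃.w 13
  have hcnt := hS₁.tree.cnt_le_reach
  rw [e5] at hcnt
  rw [e9] at h3 ht₃
  rw [e0] at ht₃
  refine ⟨?_, hC₄, hFd₄, by rw [g2]; exact h2.trans hS₁.le, fun x => s₁.warr 5 x = 1, s₁.warr 6,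
    s₁.rarr 4, by rw [g2]; exact hrun.mono h2, fun u y a1 a2 a3 a4 a5 a6 => ?_⟩
  swap
  · rw [g2]; exact h3 u y a1 a2 a4 a3 a5 a6
  change t₃ ≤ 12 * s₁.wreg 13 + 1 + _ at ht₃
  rw [h13] at ht₄
  generalize s₁.wreg 13 = c at ht₁ ht₃ ht₄ hcnt
  have : 300 * (H + 1) * (c + 1) ≤
      300 * (H + 1) * ((G.reach (s.rarr 5) w (s.rreg 2)).card + 2) :=
    Nat.mul_le_mul_left _ (by omega)
  have := run_cost H c
  omega

/-- Run `P` for all vertices `12` of the level `11`. -/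
def forLevel (P : Prog) : Prog :=
  .seq (block [.wmove 12 2]) (forTo 12 0 (.seq (block [.wload 21 4 12])
    (.ite (.weq 21 11) P (block [.skip]))))

/-- The cost of the searches from the vertices of level `i`. -/
def searchCost (G : Net) (H : ℕ) (lev : ℕ → ℕ) (i : ℕ) (dh : ℕ → ℝ) (B : ℝ) : ℕ :=
  ∑ w ∈ Finset.range G.n,
    (if lev w = i then 300 * (H + 1) * ((G.reach dh w B).card + 2) else 0)

/-- All searches of the pass are pruned by the same `dh` in the real array `5`, while the new
distances collect in the real array `6`. B only decreases, so earlier runs stay valid for the final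
bound, and every cost can be charged to the bound at the start of the pass. -/
theorem wp_passRecord {s : State} {i : ℕ} {lev : ℕ → ℕ} (hE : Env G W H M s)
    (hK : KeyTree H M (s.rreg 1) (s.warr 3) (s.rarr 1) (s.rarr 5) (s.rarr 3))
    (hC : Clean H s) (hFd : Found G s) (hle : s.rreg 2 ≤ s.rreg 1) (h11 : s.wreg 11 = i)
    (hlev : ∀ x < G.n, s.warr 4 x = lev x) (hdn : ∀ x < G.n, s.rarr 6 x = s.rarr 5 x) :
    wp W (forLevel runRecord) (fun t s' =>
      t ≤ searchCost G H lev i (s.rarr 5) (s.rreg 2) + 10 * G.n + 2 ∧ Clean H s' ∧ Found G s' ∧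
      s'.rreg 2 ≤ s.rreg 2 ∧
      (∀ x < G.n, s'.rarr 6 x ≤ s.rarr 5 x) ∧
      (∀ x < G.n, s'.rarr 6 x = s.rarr 5 x ∨
        (s'.warr 9 x < G.n ∧ lev (s'.warr 9 x) = i ∧ G.Walk (s'.warr 9 x) x (s'.rarr 6 x))) ∧
      ∀ a < G.n, lev a = i → ∃ vis par d, G.IsRun (s.rarr 5) a (s'.rreg 2) vis par d ∧
        ∀ x, vis x → s'.rarr 6 x ≤ d x) s := by
  have hcap := hE.cap
  have hroom := hE.room
  unfold forLevel
  simp only [wp_seq, wp_ite, wp_block_one, wp_block_cons, Instr.Fits, Instr.apply, WordOp.eval,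
    Test.Holds, Function.update_apply, Nat.reduceEqDiff, OfNat.ofNat_ne_zero, OfNat.zero_ne_ofNat,
    OfNat.ofNat_ne_one, OfNat.one_ne_ofNat, one_ne_zero, zero_ne_one, reduceIte, true_and,
    hE.zero]
  set s₁ : State := _
  change wp W _ _ s₁
  have hE₁ : Env G W H M s₁ := hE.of_eq
  refine wp.mono (wp_forTo (lo := 0) (hi := G.n) (fun w s' => Clean H s' ∧ Found G s' ∧
      s'.rreg 2 ≤ s.rreg 2 ∧
      (∀ x < G.n, s'.rarr 6 x ≤ s.rarr 5 x) ∧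
      (∀ x < G.n, s'.rarr 6 x = s.rarr 5 x ∨
        (s'.warr 9 x < G.n ∧ lev (s'.warr 9 x) = i ∧ G.Walk (s'.warr 9 x) x (s'.rarr 6 x))) ∧
      ∀ a < w, lev a = i → ∃ vis par d, G.IsRun (s.rarr 5) a (s'.rreg 2) vis par d ∧
        ∀ x, vis x → s'.rarr 6 x ≤ d x)
    (fun w => (if lev w = i then 300 * (H + 1) * ((G.reach (s.rarr 5) w (s.rreg 2)).card + 2)
      else 0) + 8)
    (by simp [s₁]) hE₁.n hE₁.one (Nat.zero_le _) (by omega)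
    ⟨⟨hC.tree, hC.leaf, hC.vis⟩, hFd.of_eq, le_rfl, fun x hx => (hdn x hx).le,
      fun x hx => .inl (hdn x hx), fun a h => by omega⟩ ?_) ?_
  · rintro w s' - hw h12 hF ⟨h1, h2, h3, h4, h5, h6⟩
    have hE' : Env G W H M s' := hE₁.frame hF
    have e4 : s'.warr 4 = s.warr 4 := hF.wa 4
    have e11 : s'.wreg 11 = i := by rw [hF.w 11]; simp [s₁, h11]
    simp only [wp_seq, wp_ite, wp_block_one, wp_block_cons, Instr.Fits, Instr.apply,
      WordOp.eval, Test.Holds, Function.update_apply, Nat.reduceEqDiff, OfNat.ofNat_ne_zero,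
      OfNat.zero_ne_ofNat, OfNat.ofNat_ne_one, OfNat.one_ne_ofNat, one_ne_zero, zero_ne_one,
      reduceIte, true_and, h12, e4, e11, hlev w hw]
    refine ⟨fun hl => ?_, fun hl => ?_⟩
    · set s₂ : State := _
      change wp W _ _ s₂
      have hE₂ : Env G W H M s₂ := hE'.of_eq
      have f5 : s₂.rarr 5 = s.rarr 5 := hF.ra 5
      have f1 : s₂.rreg 1 = s.rreg 1 := hF.r 1
      have f3 : s₂.warr 3 = s.warr 3 := hF.wa 3
      have fr1 : s₂.rarr 1 = s.rarr 1 := hF.ra 1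
      have fK : s₂.rarr 3 = s.rarr 3 := hF.ra 3
      refine wp.mono (wp_runRecord (s := s₂) (w := w) hE₂ (by rw [f5, f1, f3, fr1, fK]; exact hK)
        ⟨h1.tree, h1.leaf, h1.vis⟩ h2.of_eq (by rw [f1]; exact h3.trans hle)
        (by simp [s₂, h12]) hw) ?_
      rintro t s₃ hF₃ ⟨ht, g1, g2, g3, vis, par, d, g4, g5, g6, g7⟩
      rw [f5] at g4 ht
      change ∀ x, (_ = s'.rarr 6 x ∧ _ = s'.warr 9 x) ∨ _ at g5
      change ∀ x, _ ≤ s'.rarr 6 x at g6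
      change _ ≤ s'.rreg 2 at g3
      have hcard := Finset.card_le_card (G.reach_mono (dh := s.rarr 5) (w := w)
        (B := s₂.rreg 2) (B' := s.rreg 2) h3)
      have hmul : 300 * (H + 1) * ((G.reach (s.rarr 5) w (s₂.rreg 2)).card + 2) ≤
        300 * (H + 1) * ((G.reach (s.rarr 5) w (s.rreg 2)).card + 2) :=
        Nat.mul_le_mul_left _ (by omega)
      refine ⟨by rw [if_pos hl]; omega, ⟨g1.tree, g1.leaf, g1.vis⟩, g2.of_eq, g3.trans h3,
        fun x hx => (g6 x).trans (h4 x hx), fun x hx => ?_, fun a ha hal => ?_⟩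
      · change s₃.rarr 6 x = _ ∨ s₃.warr 9 x < _ ∧ lev (s₃.warr 9 x) = i ∧
          G.Walk (s₃.warr 9 x) x (s₃.rarr 6 x)
        rcases g5 x with ⟨k1, k2⟩ | ⟨k1, k2, k3⟩
        · rw [k1, k2]; exact h5 x hx
        · rw [k2, k3]; exact .inr ⟨hw, hl, g4.walk x k1⟩
      · change ∃ vis par d, G.IsRun _ _ (s₃.rreg 2) vis par d ∧ ∀ x, _ → s₃.rarr 6 x ≤ d x
        rcases Nat.lt_succ_iff_lt_or_eq.1 ha with ha | rfl
        · obtain ⟨vis', par', d', k1, k2⟩ := h6 a ha hal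
          exact ⟨vis', par', d', k1.mono g3, fun x hx => (g6 x).trans (k2 x hx)⟩
        · exact ⟨vis, par, d, g4, g7⟩
    · refine ⟨by omega, ⟨h1.tree, h1.leaf, h1.vis⟩, h2.of_eq, h3, h4, h5, fun a ha hal => ?_⟩
      rcases Nat.lt_succ_iff_lt_or_eq.1 ha with ha | rfl
      · exact h6 a ha hal
      · exact absurd hal hl
  · rintro t s' hF ⟨ht, ⟨h1, h2, h3, h4, h5, h6⟩, -⟩
    refine ⟨?_, h1, h2, h3, h4, h5, h6⟩
    rw [← Finset.range_eq_Ico] at ht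
    simp only [add_assoc, Finset.sum_add_distrib, Finset.sum_const, Finset.card_range,
      smul_eq_mul] at ht
    change t ≤ searchCost G H lev i (s.rarr 5) (s.rreg 2) + _ at ht
    omega

theorem wp_passScan {s : State} {i : ℕ} {lev : ℕ → ℕ} (hE : Env G W H M s)
    (hK : KeyTree H M (s.rreg 1) (s.warr 3) (s.rarr 1) (s.rarr 5) (s.rarr 3))
    (hC : Clean H s) (hFd : Found G s) (hle : s.rreg 2 ≤ s.rreg 1) (h11 : s.wreg 11 = i)
    (hlev : ∀ x < G.n, s.warr 4 x = lev x) :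
    wp W (forLevel runScan) (fun t s' =>
      t ≤ searchCost G H lev i (s.rarr 5) (s.rreg 2) + 22 * M + 10 * G.n + 2 ∧ Clean H s' ∧
      Found G s' ∧ s'.rreg 2 ≤ s.rreg 2 ∧
      ∀ a < G.n, lev a = i → ∃ vis par d, G.IsRun (s.rarr 5) a (s'.rreg 2) vis par d ∧
        ∀ u y, vis u → s.warr 9 u = a → vis y → G.Adj u y → par u ≠ y → par y ≠ u →
          s'.rreg 2 ≤ d u + G.len u y + d y) s := by
  have hcap := hE.cap
  have hroom := hE.room
  unfold forLevel
  simp only [wp_seq, wp_ite, wp_block_one, wp_block_cons, Instr.Fits, Instr.apply, WordOp.eval,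
    Test.Holds, Function.update_apply, Nat.reduceEqDiff, OfNat.ofNat_ne_zero, OfNat.zero_ne_ofNat,
    OfNat.ofNat_ne_one, OfNat.one_ne_ofNat, one_ne_zero, zero_ne_one, reduceIte, true_and,
    hE.zero]
  set s₁ : State := _
  change wp W _ _ s₁
  have hE₁ : Env G W H M s₁ := hE.of_eq
  refine wp.mono (wp_forTo (lo := 0) (hi := G.n) (fun w s' => Clean H s' ∧ Found G s' ∧
      s'.rreg 2 ≤ s.rreg 2 ∧
      ∀ a < w, lev a = i → ∃ vis par d, G.IsRun (s.rarr 5) a (s'.rreg 2) vis par d ∧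
        ∀ u y, vis u → s.warr 9 u = a → vis y → G.Adj u y → par u ≠ y → par y ≠ u →
          s'.rreg 2 ≤ d u + G.len u y + d y)
    (fun w => (if lev w = i then 300 * (H + 1) * ((G.reach (s.rarr 5) w (s.rreg 2)).card + 2)
      else 0) + (22 * (∑ u ∈ Finset.range G.n,
        (if s.warr 9 u = w then s.warr 0 (u + 1) - s.warr 0 u else 0)) + 8))
    (by simp [s₁]) hE₁.n hE₁.one (Nat.zero_le _) (by omega)
    ⟨⟨hC.tree, hC.leaf, hC.vis⟩, hFd.of_eq, le_rfl, fun a h => by omega⟩ ?_) ?_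
  · rintro w s' - hw h12 hF ⟨h1, h2, h3, h6⟩
    have hE' : Env G W H M s' := hE₁.frame hF
    have e4 : s'.warr 4 = s.warr 4 := hF.wa 4
    have e11 : s'.wreg 11 = i := by rw [hF.w 11]; simp [s₁, h11]
    simp only [wp_seq, wp_ite, wp_block_one, wp_block_cons, Instr.Fits, Instr.apply,
      WordOp.eval, Test.Holds, Function.update_apply, Nat.reduceEqDiff, OfNat.ofNat_ne_zero,
      OfNat.zero_ne_ofNat, OfNat.ofNat_ne_one, OfNat.one_ne_ofNat, one_ne_zero, zero_ne_one,
      reduceIte, true_and, h12, e4, e11, hlev w hw]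
    refine ⟨fun hl => ?_, fun hl => ?_⟩
    · set s₂ : State := _
      change wp W _ _ s₂
      have hE₂ : Env G W H M s₂ := hE'.of_eq
      have f5 : s₂.rarr 5 = s.rarr 5 := hF.ra 5
      have f1 : s₂.rreg 1 = s.rreg 1 := hF.r 1
      have f3 : s₂.warr 3 = s.warr 3 := hF.wa 3
      have f9 : s₂.warr 9 = s.warr 9 := hF.wa 9
      have f0 : s₂.warr 0 = s.warr 0 := hF.wa 0
      have fr1 : s₂.rarr 1 = s.rarr 1 := hF.ra 1
      have fK : s₂.rarr 3 = s.rarr 3 := hF.ra 3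
      refine wp.mono (wp_runScan (s := s₂) (w := w) hE₂ (by rw [f5, f1, f3, fr1, fK]; exact hK)
        ⟨h1.tree, h1.leaf, h1.vis⟩ h2.of_eq (by rw [f1]; exact h3.trans hle)
        (by simp [s₂, h12]) hw) ?_
      rintro t s₃ hF₃ ⟨ht, g1, g2, g3, vis, par, d, g4, g5⟩
      rw [f5] at g4 ht
      rw [f9, f0] at ht
      rw [f9] at g5
      change _ ≤ s'.rreg 2 at g3
      have hcard := Finset.card_le_card (G.reach_mono (dh := s.rarr 5) (w := w)
        (B := s₂.rreg 2) (B' := s.rreg 2) h3)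
      have hmul : 300 * (H + 1) * ((G.reach (s.rarr 5) w (s₂.rreg 2)).card + 2) ≤
        300 * (H + 1) * ((G.reach (s.rarr 5) w (s.rreg 2)).card + 2) :=
        Nat.mul_le_mul_left _ (by omega)
      refine ⟨by rw [if_pos hl]; omega, ⟨g1.tree, g1.leaf, g1.vis⟩, g2.of_eq, g3.trans h3,
        fun a ha hal => ?_⟩
      change ∃ vis par d, G.IsRun _ _ (s₃.rreg 2) vis par d ∧ ∀ u y, _ → _ → _ → _ → _ → _ →
        s₃.rreg 2 ≤ _
      rcases Nat.lt_succ_iff_lt_or_eq.1 ha with ha | rfl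
      · obtain ⟨vis', par', d', k1, k2⟩ := h6 a ha hal
        exact ⟨vis', par', d', k1.mono g3, fun u y a1 a2 a3 a4 a5 a6 =>
          g3.trans (k2 u y a1 a2 a3 a4 a5 a6)⟩
      · exact ⟨vis, par, d, g4, g5⟩
    · refine ⟨by omega, ⟨h1.tree, h1.leaf, h1.vis⟩, h2.of_eq, h3, fun a ha hal => ?_⟩
      rcases Nat.lt_succ_iff_lt_or_eq.1 ha with ha | rfl
      · exact h6 a ha hal
      · exact absurd hal hl
  · rintro t s' hF ⟨ht, ⟨h1, h2, h3, h6⟩, -⟩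
    refine ⟨?_, h1, h2, h3, h6⟩
    rw [← Finset.range_eq_Ico] at ht
    simp only [add_assoc, Finset.sum_add_distrib, Finset.sum_const, Finset.card_range,
      smul_eq_mul, ← Finset.mul_sum] at ht
    change t ≤ searchCost G H lev i (s.rarr 5) (s.rreg 2) + _ at ht
    -- Each vertex has one entry in the array of pivots, so its list is counted for at most one w.
    have hdeg : ∑ w ∈ Finset.range G.n, ∑ u ∈ Finset.range G.n,
        (if s.warr 9 u = w then s.warr 0 (u + 1) - s.warr 0 u else 0) ≤ M := by
      rw [Finset.sum_comm]
      calc _ ≤ ∑ u ∈ Finset.range G.n, (s.warr 0 (u + 1) - s.warr 0 u) := by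
            refine Finset.sum_le_sum fun u hu => ?_
            rw [Finset.sum_ite_eq]
            split_ifs <;> omega
        _ = s.warr 0 G.n - s.warr 0 0 := by
            have : ∀ m ≤ G.n, ∑ u ∈ Finset.range m, (s.warr 0 (u + 1) - s.warr 0 u) =
                s.warr 0 m ∧ s.warr 0 0 = 0 := by
              intro m hm
              induction m with
              | zero => simp [hE.csr.zero]
              | succ m ih =>
                rw [Finset.sum_range_succ, (ih (by omega)).1]
                have := hE.csr.mono m hm
                exact ⟨by omega, hE.csr.zero⟩
            obtain ⟨a1, a2⟩ := this G.n le_rfl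
            omega
        _ ≤ M := by rw [hE.csr.last]; omega
    omega

end RealRAM

/-! ### Clusters, and the invariant over the levels -/

/-- The vertices that are closer to `w` than to all vertices of higher levels. -/
def Net.cluster (G : Net) (lev : ℕ → ℕ) (w : ℕ) : Finset ℕ :=
  open Classical in
  (Finset.range G.n).filter fun x => ∃ r, G.Walk w x r ∧
    ∀ a < G.n, lev w < lev a → ∀ q, G.Walk a x q → r < q

/-- `dh` is a correct lower bound only for distances below B / 2. For a higher vertex at a distance
of at least B / 2 the comparison holds anyway, because the search stays within B / 2. -/
theorem Net.reach_subset_cluster {G : Net} {dh : ℕ → ℝ} {w : ℕ} {B : ℝ} {lev : ℕ → ℕ}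
    (h : ∀ a < G.n, lev w < lev a → ∀ x r, G.Walk a x r → 2 * r < B → dh x ≤ r) :
    G.reach dh w B ⊆ G.cluster lev w := by
  intro x hx
  simp only [Net.reach, Net.cluster, Finset.mem_filter] at hx ⊢
  obtain ⟨h1, r, h2, h3, h4⟩ := hx
  refine ⟨h1, r, h2, fun a ha hl q hq => ?_⟩
  by_cases hB : 2 * q < B
  · exact h3.trans_le (h a ha hl x q hq hB)
  · linarith

namespace RealRAM

variable {G : Net} {W H M : ℕ}

/-- Build the tree of slacks. -/
def buildKeys : Prog :=
  .seq (block [.wmove 18 2])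
  (.seq (forTo 18 5 (block [.wload 19 3 18, .rload 5 1 18, .rload 6 5 19, .rsub 5 5 6,
    .wop .add 20 6 18, .rstore 3 20 5]))
  (.seq (block [.rsub 5 0 1, .wop .add 20 6 5, .rstore 3 20 5, .wop .sub 20 6 3])
  (.loop (.wlt 2 20) (.seq (block [.wop .add 21 20 20, .rload 5 3 21, .wop .add 21 21 3,
    .rload 6 3 21]) (.seq (.ite (.rlt 6 5) (block [.rstore 3 20 6]) (block [.rstore 3 20 5]))
    (block [.wop .sub 20 20 3]))))))

theorem wp_buildKeys {s : State} (hE : Env G W H M s) :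
    wp W buildKeys (fun t s' => t ≤ 8 * M + 8 * 2 ^ H + 10 ∧
      KeyTree H M (s.rreg 1) (s.warr 3) (s.rarr 1) (s.rarr 5) (s'.rarr 3)) s := by
  have hcap := hE.cap
  have hroom := hE.room
  have hpos := Nat.one_le_two_pow (n := H)
  unfold buildKeys
  simp only [wp_seq, wp_ite, wp_block_one, wp_block_cons, Instr.Fits, Instr.apply, WordOp.eval,
    Test.Holds, Function.update_apply, Nat.reduceEqDiff, OfNat.ofNat_ne_zero, OfNat.zero_ne_ofNat,
    OfNat.ofNat_ne_one, OfNat.one_ne_ofNat, one_ne_zero, zero_ne_one, reduceIte, true_and,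
    hE.zero]
  set s₁ : State := _
  change wp W _ _ s₁
  have hE₁ : Env G W H M s₁ := hE.of_eq
  refine wp.mono (wp_forTo (lo := 0) (hi := M) (fun p s' => ∀ q < p,
    s'.rarr 3 (2 ^ H + q) = s.rarr 1 q - s.rarr 5 (s.warr 3 q)) (fun _ => 6)
    (by simp [s₁]) hE₁.entries hE₁.one (Nat.zero_le _) (by omega) (fun q h => by omega) ?_) ?_
  · rintro p s' - hp h18 hF hI
    have hE' : Env G W H M s' := hE₁.frame hF
    have e3 : s'.warr 3 = s.warr 3 := hF.wa 3
    have e1 : s'.rarr 1 = s.rarr 1 := hF.ra 1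
    have e5 : s'.rarr 5 = s.rarr 5 := hF.ra 5
    simp only [wp_seq, wp_ite, wp_block_one, wp_block_cons, Instr.Fits, Instr.apply,
      WordOp.eval, Test.Holds, Function.update_apply, Nat.reduceEqDiff, OfNat.ofNat_ne_zero,
      OfNat.zero_ne_ofNat, OfNat.ofNat_ne_one, OfNat.one_ne_ofNat, one_ne_zero, zero_ne_one,
      reduceIte, true_and, h18, e3, e1, e5, hE'.leaves]
    refine ⟨by omega, by omega, fun q hq => ?_⟩
    rcases Nat.lt_succ_iff_lt_or_eq.1 hq with h | rfl
    · have : q ≠ p := by omega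
      simpa [State.setW, Function.update_apply, this] using hI q h
    · simp [State.setW]
  rintro t s₂ hF₂ ⟨ht, hI, -⟩
  simp only [Finset.sum_const, Nat.card_Ico, smul_eq_mul] at ht
  have hE₂ : Env G W H M s₂ := hE₁.frame hF₂
  have e1 : s₂.rreg 1 = s.rreg 1 := hF₂.r 1
  simp only [wp_seq, wp_ite, wp_block_one, wp_block_cons, Instr.Fits, Instr.apply, WordOp.eval,
    Test.Holds, Function.update_apply, Nat.reduceEqDiff, OfNat.ofNat_ne_zero, OfNat.zero_ne_ofNat,
    OfNat.ofNat_ne_one, OfNat.one_ne_ofNat, one_ne_zero, zero_ne_one, reduceIte, true_and,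
    hE₂.leaves, hE₂.entries, hE₂.one, hE₂.rzero, e1]
  refine ⟨by omega, by omega, ?_⟩
  set s₃ : State := _
  change wp W _ _ s₃
  have hE₃ : Env G W H M s₃ := hE₂.of_eq
  have l₃ : ∀ q < M, s₃.rarr 3 (2 ^ H + q) = s.rarr 1 q - s.rarr 5 (s.warr 3 q) := by
    intro q hq
    have : q ≠ M := by omega
    simpa [s₃, Function.update_apply, this] using hI q hq
  have m₃ : s₃.rarr 3 (2 ^ H + M) = - s.rreg 1 := by simp [s₃]
  refine wp.mono (wp_loop (fun φ s' => ∃ v, s'.wreg 20 = v ∧ v < 2 ^ H ∧ φ = 8 * v ∧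
    (∀ q, 2 ^ H ≤ q → s'.rarr 3 q = s₃.rarr 3 q) ∧
    ∀ u, v < u → u < 2 ^ H → s'.rarr 3 u = min (s'.rarr 3 (2 * u)) (s'.rarr 3 (2 * u + 1)))
    (8 * (2 ^ H - 1)) ⟨2 ^ H - 1, by simp [s₃], by omega, rfl, fun _ _ => rfl,
      fun u h1 h2 => by omega⟩ ?_) ?_
  · rintro φ s' ⟨v, h20, hv, rfl, h1, h2⟩ hF hs
    have hE' : Env G W H M s' := hE₃.frame hF
    simp only [Test.Holds, h20, hE'.zero] at hs
    obtain ⟨v, rfl⟩ : ∃ v', v = v' + 1 := ⟨v - 1, by omega⟩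
    have upd : ∀ a : ℝ, a = min (s'.rarr 3 (2 * (v + 1))) (s'.rarr 3 (2 * (v + 1) + 1)) →
        (∀ q, 2 ^ H ≤ q → Function.update (s'.rarr 3) (v + 1) a q = s₃.rarr 3 q) ∧
        ∀ u, v < u → u < 2 ^ H → Function.update (s'.rarr 3) (v + 1) a u =
          min (Function.update (s'.rarr 3) (v + 1) a (2 * u))
            (Function.update (s'.rarr 3) (v + 1) a (2 * u + 1)) := by
      intro a ha
      refine ⟨fun q hq => ?_, fun u g1 g2 => ?_⟩
      · rw [Function.update_of_ne (by omega), h1 q hq]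
      · rw [Function.update_of_ne (show 2 * u ≠ v + 1 by omega),
          Function.update_of_ne (show 2 * u + 1 ≠ v + 1 by omega)]
        by_cases hu : u = v + 1
        · rw [hu, Function.update_self, ha]
        · rw [Function.update_of_ne hu, h2 u (by omega) g2]
    simp only [Function.update_apply, Nat.reduceEqDiff] at upd
    simp only [wp_seq, wp_ite, wp_block_one, wp_block_cons, Instr.Fits, Instr.apply,
      WordOp.eval, Test.Holds, Function.update_apply, Nat.reduceEqDiff, OfNat.ofNat_ne_zero,
      OfNat.zero_ne_ofNat, OfNat.ofNat_ne_one, OfNat.one_ne_ofNat, one_ne_zero, zero_ne_one,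
      reduceIte, true_and, h20, hE'.one]
    refine ⟨by omega, by omega, fun hlt => ⟨by omega, _, ⟨v, rfl, by omega, rfl, upd _ ?_⟩,
      by omega⟩, fun hge => ⟨by omega, _, ⟨v, rfl, by omega, rfl,
      upd (s'.rarr 3 (v + 1 + (v + 1))) ?_⟩, by omega⟩⟩
    · rw [min_eq_right] <;> rw [two_mul]
      exact hlt.le
    · rw [min_eq_left] <;> rw [two_mul]
      exact not_lt.1 hge
  · rintro u s' hF ⟨φ', ⟨v, h20, hv, rfl, h1, h2⟩, hn, hu⟩
    have hE' : Env G W H M s' := hE₃.frame hF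
    simp only [Test.Holds, h20, hE'.zero] at hn
    refine ⟨by omega, ⟨fun u g1 g2 => h2 u (by omega) g2, fun q hq => ?_, ?_⟩⟩
    · rw [h1 _ (by omega), l₃ q hq]
    · rw [h1 _ (by omega), m₃]

/-- The work for the level `11`. -/
def level : Prog :=
  .seq buildKeys (.seq (block [.wmove 18 2])
  (.seq (forTo 18 0 (block [.rload 5 5 18, .rstore 6 18 5]))
  (.seq (forLevel runRecord) (.seq (forLevel runScan) (.seq (block [.wmove 18 2])
  (forTo 18 0 (block [.rload 5 6 18, .rstore 5 18 5])))))))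

/-- The levels from `i` on have been processed. -/
structure LevelInv (G : Net) (W H M K : ℕ) (lev : ℕ → ℕ) (i : ℕ) (s : State) : Prop where
  env : Env G W H M s
  clean : Clean H s
  found : Found G s
  le : s.rreg 2 ≤ s.rreg 1
  level : ∀ x < G.n, s.warr 4 x = lev x
  near : ∀ x < G.n, s.rarr 5 x = s.rreg 1 ∨ ∃ a < G.n, i ≤ lev a ∧ G.Walk a x (s.rarr 5 x)
  dist : ∀ a < G.n, i ≤ lev a → ∀ x r, G.Walk a x r → 2 * r < s.rreg 2 → s.rarr 5 x ≤ r
  steps : ∀ i', i ≤ i' → i' < K → G.Step lev i' (s.rreg 2)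

/-- The cost of the level `i`. -/
def levelCost (G : Net) (H M : ℕ) (lev : ℕ → ℕ) (i : ℕ) : ℕ :=
  2 * (∑ w ∈ Finset.range G.n,
    (if lev w = i then 300 * (H + 1) * ((G.cluster lev w).card + 2) else 0)) +
    (30 * M + 8 * 2 ^ H + 30 * G.n + 30)

/-- The second pass needs final pivots, hence a separate first pass. Both use the `dh` of the levels
above i, and the merged distances replace `dh` only afterwards. -/
theorem wp_level {s : State} {K i : ℕ} {lev : ℕ → ℕ} (hL : LevelInv G W H M K lev (i + 1) s)
    (h11 : s.wreg 11 = i) :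
    wp W level (fun t s' => t ≤ levelCost G H M lev i ∧ LevelInv G W H M K lev i s') s := by
  have hE := hL.env
  have hcap := hE.cap
  have hroom := hE.room
  unfold level
  rw [wp_seq]
  refine wp.mono (wp_buildKeys hE) ?_
  rintro t₁ s₁ hF₁ ⟨ht₁, hK₁⟩
  have hE₁ : Env G W H M s₁ := hE.frame hF₁
  simp only [wp_seq, wp_ite, wp_block_one, wp_block_cons, Instr.Fits, Instr.apply, WordOp.eval,
    Test.Holds, Function.update_apply, Nat.reduceEqDiff, OfNat.ofNat_ne_zero, OfNat.zero_ne_ofNat,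
    OfNat.ofNat_ne_one, OfNat.one_ne_ofNat, one_ne_zero, zero_ne_one, reduceIte, true_and,
    hE₁.zero]
  set s₂ : State := _
  change wp W _ _ s₂
  have hE₂ : Env G W H M s₂ := hE₁.of_eq
  have a5 : s₁.rarr 5 = s.rarr 5 := hF₁.ra 5
  refine wp.mono (wp_forTo (lo := 0) (hi := G.n) (fun x s' => ∀ y < x,
    s'.rarr 6 y = s.rarr 5 y) (fun _ => 2)
    (by simp [s₂]) hE₂.n hE₂.one (Nat.zero_le _) (by omega) (fun q h => by omega) ?_) ?_
  · rintro x s' - hx h18 hF hI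
    have e5 : s'.rarr 5 = s.rarr 5 := by rw [hF.ra 5]; exact a5
    simp only [wp_seq, wp_ite, wp_block_one, wp_block_cons, Instr.Fits, Instr.apply,
      WordOp.eval, Test.Holds, Function.update_apply, Nat.reduceEqDiff, OfNat.ofNat_ne_zero,
      OfNat.zero_ne_ofNat, OfNat.ofNat_ne_one, OfNat.one_ne_ofNat, one_ne_zero, zero_ne_one,
      reduceIte, true_and, h18, e5]
    refine ⟨by omega, fun y hy => ?_⟩
    rcases Nat.lt_succ_iff_lt_or_eq.1 hy with h | rfl
    · simpa [State.setW, Function.update_apply, h.ne] using hI y h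
    · simp [State.setW]
  rintro t₃ s₃ hF₃ ⟨ht₃, hdn, -⟩
  simp only [Finset.sum_const, Nat.card_Ico, smul_eq_mul] at ht₃
  have hE₃ : Env G W H M s₃ := hE₂.frame hF₃
  have b5 : s₃.rarr 5 = s.rarr 5 := by rw [hF₃.ra 5]; exact a5
  have b3 : s₃.rarr 3 = s₁.rarr 3 := hF₃.ra 3
  have b1 : s₃.rarr 1 = s.rarr 1 := by rw [hF₃.ra 1]; exact hF₁.ra 1
  have bw3 : s₃.warr 3 = s.warr 3 := by rw [hF₃.wa 3]; exact hF₁.wa 3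
  have bw4 : s₃.warr 4 = s.warr 4 := by rw [hF₃.wa 4]; exact hF₁.wa 4
  have br1 : s₃.rreg 1 = s.rreg 1 := by rw [hF₃.r 1]; exact hF₁.r 1
  have br2 : s₃.rreg 2 = s.rreg 2 := by rw [hF₃.r 2]; exact hF₁.r 2
  have b11 : s₃.wreg 11 = i := by rw [hF₃.w 11, ← h11]; exact hF₁.w 11
  have b2 : s₃.rarr 2 = s.rarr 2 := by rw [hF₃.ra 2]; exact hF₁.ra 2
  have bv5 : s₃.warr 5 = s.warr 5 := by rw [hF₃.wa 5]; exact hF₁.wa 5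
  have hK₃ : KeyTree H M (s₃.rreg 1) (s₃.warr 3) (s₃.rarr 1) (s₃.rarr 5) (s₃.rarr 3) := by
    rw [br1, bw3, b1, b5, b3]; exact hK₁
  have hC₃ : Clean H s₃ := by
    obtain ⟨c1, c2, c3⟩ := hL.clean
    exact ⟨by rw [b2]; exact c1, by rw [b2, br1]; exact c2, by rw [bv5]; exact c3⟩
  have hFd₃ : Found G s₃ := by
    refine hL.found.of_eq ?_ ?_ br1 br2 ?_
    · rw [hF₃.w 10]; exact hF₁.w 10
    · rw [hF₃.w 28]; exact hF₁.w 28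
    · rw [hF₃.wa 10]; exact hF₁.wa 10
  refine wp.mono (wp_passRecord (i := i) (lev := lev) hE₃ hK₃ hC₃ hFd₃
    (by rw [br1, br2]; exact hL.le) b11 (by rw [bw4]; exact hL.level)
    (by rw [b5]; exact hdn)) ?_
  rintro t₄ s₄ hF₄ ⟨ht₄, hC₄, hFd₄, hB₄, hle₄, hpw₄, hruns₄⟩
  rw [b5, br2] at ht₄
  rw [b5] at hle₄ hpw₄ hruns₄
  rw [br2] at hB₄
  have hE₄ : Env G W H M s₄ := hE₃.frame hF₄
  have c5 : s₄.rarr 5 = s.rarr 5 := by rw [hF₄.ra 5, b5]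
  have c1 : s₄.rreg 1 = s.rreg 1 := by rw [hF₄.r 1, br1]
  refine wp.mono (wp_passScan (i := i) (lev := lev) hE₄
    (by rw [hF₄.r 1, hF₄.wa 3, hF₄.ra 1, hF₄.ra 5, hF₄.ra 3]; exact hK₃) hC₄ hFd₄
    (by rw [c1]; exact hB₄.trans hL.le) (by rw [hF₄.w 11, b11])
    (by rw [hF₄.wa 4, bw4]; exact hL.level)) ?_
  rintro t₅ s₅ hF₅ ⟨ht₅, hC₅, hFd₅, hB₅, hruns₅⟩
  rw [c5] at ht₅ hruns₅
  have hE₅ : Env G W H M s₅ := hE₄.frame hF₅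
  simp only [wp_seq, wp_ite, wp_block_one, wp_block_cons, Instr.Fits, Instr.apply, WordOp.eval,
    Test.Holds, Function.update_apply, Nat.reduceEqDiff, OfNat.ofNat_ne_zero, OfNat.zero_ne_ofNat,
    OfNat.ofNat_ne_one, OfNat.one_ne_ofNat, one_ne_zero, zero_ne_one, reduceIte, true_and,
    hE₅.zero]
  set s₆ : State := _
  change wp W _ _ s₆
  have hE₆ : Env G W H M s₆ := hE₅.of_eq
  have d6 : s₅.rarr 6 = s₄.rarr 6 := hF₅.ra 6
  refine wp.mono (wp_forTo (lo := 0) (hi := G.n) (fun x s' => ∀ y < x,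
    s'.rarr 5 y = s₄.rarr 6 y) (fun _ => 2)
    (by simp [s₆]) hE₆.n hE₆.one (Nat.zero_le _) (by omega) (fun q h => by omega) ?_) ?_
  · rintro x s' - hx h18 hF hI
    have e6 : s'.rarr 6 = s₄.rarr 6 := by rw [hF.ra 6]; exact d6
    simp only [wp_seq, wp_ite, wp_block_one, wp_block_cons, Instr.Fits, Instr.apply,
      WordOp.eval, Test.Holds, Function.update_apply, Nat.reduceEqDiff, OfNat.ofNat_ne_zero,
      OfNat.zero_ne_ofNat, OfNat.ofNat_ne_one, OfNat.one_ne_ofNat, one_ne_zero, zero_ne_one,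
      reduceIte, true_and, h18, e6]
    refine ⟨by omega, fun y hy => ?_⟩
    rcases Nat.lt_succ_iff_lt_or_eq.1 hy with h | rfl
    · simpa [State.setW, Function.update_apply, h.ne] using hI y h
    · simp [State.setW]
  rintro t₇ s₇ hF₇ ⟨ht₇, hnew, -⟩
  simp only [Finset.sum_const, Nat.card_Ico, smul_eq_mul] at ht₇
  have f1 : s₇.rreg 1 = s.rreg 1 := by
    rw [hF₇.r 1]; change s₅.rreg 1 = _; rw [hF₅.r 1, c1]
  have f2 : s₇.rreg 2 = s₅.rreg 2 := hF₇.r 2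
  have hBle : s₅.rreg 2 ≤ s.rreg 2 := hB₅.trans hB₄
  have hbig := hE.big
  -- A value below B / 2 cannot be the default `big`, so it is realized by a walk from a higher
  -- level.
  have hdh : ∀ x r, x < G.n → s.rarr 5 x ≤ r → 2 * r < s₅.rreg 2 →
      G.Near lev (i + 1) x r := by
    intro x r hx hr hB
    rcases hL.near x hx with h | ⟨a, ha, hal, hw⟩
    · have := hL.le
      linarith
    · exact ⟨a, ha, hal, _, hr, hw⟩
  -- The distances recorded in the first pass do not exceed the lengths of short walks from level i,
  -- except where pruning reveals a higher vertex at least as near.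
  have hrec : ∀ a < G.n, lev a = i → ∀ x r, G.Walk a x r → 2 * r < s₅.rreg 2 →
      s₄.rarr 6 x ≤ r ∨ G.Near lev (i + 1) x r := by
    intro a ha hal x r hw hr
    obtain ⟨vis, par, d, hrun, hd⟩ := hruns₄ a ha hal
    have := (hrun.mono hB₅).reach hdh hrun.root hrun.d_root.le hw (by rw [zero_add]; exact hr)
    rw [zero_add] at this
    exact this.imp (fun h => (hd x h.1).trans h.2) id
  refine ⟨?_, hE₆.frame hF₇, ?_, ?_, ?_, ?_, ?_, ?_, ?_⟩
  · have hsub : ∀ w, lev w = i → G.reach (s.rarr 5) w (s.rreg 2) ⊆ G.cluster lev w :=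
      fun w hw => Net.reach_subset_cluster fun a ha hl => hL.dist a ha (by omega)
    -- Both passes are charged to the clusters, which depend on the levels alone and not on B.
    have hcost : ∀ B ≤ s.rreg 2, searchCost G H lev i (s.rarr 5) B ≤ ∑ w ∈ Finset.range G.n,
        (if lev w = i then 300 * (H + 1) * ((G.cluster lev w).card + 2) else 0) := by
      intro B hB
      refine Finset.sum_le_sum fun w _ => ?_
      split_ifs with hw
      · refine Nat.mul_le_mul_left _ (Nat.add_le_add_right (Finset.card_le_card ?_) _)
        exact (G.reach_mono hB).trans (hsub w hw)
      · exact le_rfl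
    have h1 := hcost _ le_rfl
    have h2 := hcost _ hB₄
    unfold levelCost
    omega
  · obtain ⟨c1, c2, c3⟩ := hC₅
    refine ⟨?_, ?_, ?_⟩
    · rw [hF₇.ra 2]; exact c1
    · rw [hF₇.ra 2, hF₇.r 1]; exact c2
    · rw [hF₇.wa 5]; exact c3
  · exact hFd₅.of_eq (hF₇.w 10) (hF₇.w 28) (hF₇.r 1) (hF₇.r 2) (hF₇.wa 10)
  · rw [f1, f2]; exact hBle.trans hL.le
  · rw [hF₇.wa 4]; change ∀ x < G.n, s₅.warr 4 x = _
    rw [hF₅.wa 4, hF₄.wa 4, bw4]; exact hL.level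
  · intro x hx
    rw [hnew x hx, f1]
    rcases hpw₄ x hx with h | ⟨h1, h2, h3⟩
    · rw [h]
      exact (hL.near x hx).imp id fun ⟨a, ha, hal, hw⟩ => ⟨a, ha, by omega, hw⟩
    · exact .inr ⟨_, h1, h2.ge, h3⟩
  · intro a ha hal x r hw hr
    rw [f2] at hr
    have hx : x < G.n := hw.lt ha
    rw [hnew x hx]
    have old : ∀ a' < G.n, i + 1 ≤ lev a' → ∀ r' ≤ r, G.Walk a' x r' → s₄.rarr 6 x ≤ r :=
      fun a' ha' hal' r' hr' hw' => (hle₄ x hx).trans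
        ((hL.dist a' ha' hal' x r' hw' (by linarith)).trans hr')
    rcases hal.eq_or_lt with hal | hal
    · rcases hrec a ha hal.symm x r hw hr with h | ⟨a', ha', hal', r', hr', hw'⟩
      · exact h
      · exact old a' ha' hal' r' hr' hw'
    · exact old a ha hal r le_rfl hw
  · intro i' h1 h2
    rw [f2]
    rcases h1.eq_or_lt with rfl | h1
    · refine Net.step_of_runs (dh := s.rarr 5) (pw := s₄.warr 9) hdh hruns₅ ?_
      intro a ha hal x r hw hr
      have hx : x < G.n := hw.lt ha
      rcases hrec a ha hal x r hw hr with h | h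
      · rcases hpw₄ x hx with h' | ⟨k1, k2, k3⟩
        · exact .inr (hdh x r hx (h' ▸ h) hr)
        · exact .inl ⟨k1, k2, _, h, k3⟩
      · exact .inr h
    · exact (hL.steps i' h1 h2).mono hBle

/-- Process all levels below the word register `11`. -/
def levels : Prog := .loop (.wlt 2 11) (.seq (block [.wop .sub 11 11 3]) level)

theorem wp_levels {s : State} {K : ℕ} {lev : ℕ → ℕ} (hL : LevelInv G W H M K lev K s)
    (h11 : s.wreg 11 = K) (hKW : K < W) :
    wp W levels (fun t s' => t ≤ ∑ i ∈ Finset.range K, (levelCost G H M lev i + 2) + 1 ∧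
      LevelInv G W H M K lev 0 s') s := by
  refine wp.mono (wp_loop (fun φ s' => ∃ i ≤ K, s'.wreg 11 = i ∧ LevelInv G W H M K lev i s' ∧
    φ = ∑ i ∈ Finset.range i, (levelCost G H M lev i + 2)) _ ⟨K, le_rfl, h11, hL, rfl⟩ ?_) ?_
  · rintro φ s' ⟨i, hi, h11', hL', rfl⟩ hF hs
    have hE' := hL'.env
    simp only [Test.Holds, h11', hE'.zero] at hs
    obtain ⟨i, rfl⟩ : ∃ j, i = j + 1 := ⟨i - 1, by omega⟩
    simp only [wp_seq, wp_ite, wp_block_one, wp_block_cons, Instr.Fits, Instr.apply,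
      WordOp.eval, Test.Holds, Function.update_apply, Nat.reduceEqDiff, OfNat.ofNat_ne_zero,
      OfNat.zero_ne_ofNat, OfNat.ofNat_ne_one, OfNat.one_ne_ofNat, one_ne_zero, zero_ne_one,
      reduceIte, true_and, h11', hE'.one, Nat.add_sub_cancel]
    refine ⟨by omega, ?_⟩
    set s₁ : State := _
    change wp W _ _ s₁
    have hL₁ : LevelInv G W H M K lev (i + 1) s₁ := by
      obtain ⟨l1, ⟨c1, c2, c3⟩, l3, l4, l5, l6, l7, l8⟩ := hL'
      exact ⟨l1.of_eq, ⟨c1, c2, c3⟩, l3.of_eq, l4, l5, l6, l7, l8⟩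
    refine wp.mono (wp_level (s := s₁) hL₁ (by simp [s₁])) ?_
    rintro t s₂ hF₂ ⟨ht, hL₂⟩
    refine ⟨_, ⟨i, by omega, ?_, hL₂, rfl⟩, ?_⟩
    · rw [hF₂.w 11]; simp [s₁]
    · rw [Finset.sum_range_succ]
      omega
  · rintro t s' hF ⟨φ', ⟨i, hi, h11', hL', rfl⟩, hn, ht⟩
    simp only [Test.Holds, h11', hL'.env.zero] at hn
    obtain rfl : i = 0 := by omega
    refine ⟨?_, hL'⟩
    simpa using ht

end RealRAM

/-! ### Sorting the adjacency lists -/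

/-- Adjacency arrays in arbitrary order. -/
structure Net.Entries (G : Net) (M : ℕ) (off adj : ℕ → ℕ) (len : ℕ → ℝ) : Prop where
  zero : off 0 = 0
  last : off G.n = M
  mono : ∀ x < G.n, off x ≤ off (x + 1)
  edge : ∀ x < G.n, ∀ p, off x ≤ p → p < off (x + 1) → G.Adj x (adj p) ∧ len p = G.len x (adj p)
  inj : ∀ x < G.n, ∀ p q, off x ≤ p → p < off (x + 1) → off x ≤ q → q < off (x + 1) →
    adj p = adj q → p = q
  surj : ∀ x y, G.Adj x y → ∃ p, off x ≤ p ∧ p < off (x + 1) ∧ adj p = y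

theorem Net.Entries.le_last {G : Net} {M : ℕ} {off adj : ℕ → ℕ} {len : ℕ → ℝ}
    (h : G.Entries M off adj len) : ∀ x ≤ G.n, off x ≤ M := by
  intro x hx
  induction hx using Nat.decreasingInduction with
  | self => exact h.last.le
  | of_succ x hx ih => exact (h.mono x hx).trans ih

/-- The entries `lo ≤ q < m` of the arrays `adj'`, `len'` are the shortest of the entries
`lo ≤ p < hi` of the arrays `adj`, `len`, by increasing length. -/
structure SortedBy (lo hi m : ℕ) (adj : ℕ → ℕ) (len : ℕ → ℝ) (adj' : ℕ → ℕ) (len' : ℕ → ℝ)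
    (π : ℕ → ℕ) : Prop where
  maps : ∀ q, lo ≤ q → q < m → lo ≤ π q ∧ π q < hi
  inj : ∀ q, lo ≤ q → q < m → ∀ q', lo ≤ q' → q' < m → π q = π q' → q = q'
  adj_eq : ∀ q, lo ≤ q → q < m → adj' q = adj (π q)
  len_eq : ∀ q, lo ≤ q → q < m → len' q = len (π q)
  sorted : ∀ q q', lo ≤ q → q ≤ q' → q' < m → len' q ≤ len' q'
  least : ∀ q p, lo ≤ q → q < m → lo ≤ p → p < hi → (∀ q', lo ≤ q' → q' < m → π q' ≠ p) →
    len' q ≤ len p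

theorem SortedBy.congr {lo hi m : ℕ} {adj : ℕ → ℕ} {len : ℕ → ℝ} {adj₁ adj₂ : ℕ → ℕ}
    {len₁ len₂ : ℕ → ℝ} {π : ℕ → ℕ} (h : SortedBy lo hi m adj len adj₁ len₁ π)
    (ha : ∀ q, lo ≤ q → q < m → adj₂ q = adj₁ q) (hl : ∀ q, lo ≤ q → q < m → len₂ q = len₁ q) :
    SortedBy lo hi m adj len adj₂ len₂ π where
  maps := h.maps
  inj := h.inj
  adj_eq q h1 h2 := by rw [ha q h1 h2, h.adj_eq q h1 h2]
  len_eq q h1 h2 := by rw [hl q h1 h2, h.len_eq q h1 h2]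
  sorted q q' h1 h2 h3 := by
    rw [hl q h1 (by omega), hl q' (by omega) h3]; exact h.sorted q q' h1 h2 h3
  least q p h1 h2 h3 h4 h5 := by rw [hl q h1 h2]; exact h.least q p h1 h2 h3 h4 h5

/-- One step of a selection sort: p is a least unused entry, and by `least` the entries chosen
before are no longer than p. -/
theorem SortedBy.step {lo hi m p : ℕ} {adj : ℕ → ℕ} {len : ℕ → ℝ} {adj' : ℕ → ℕ} {len' : ℕ → ℝ}
    {π : ℕ → ℕ} (h : SortedBy lo hi m adj len adj' len' π) (hm : lo ≤ m) (hp1 : lo ≤ p)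
    (hp2 : p < hi) (hnew : ∀ q', lo ≤ q' → q' < m → π q' ≠ p)
    (hmin : ∀ p', lo ≤ p' → p' < hi → (∀ q', lo ≤ q' → q' < m → π q' ≠ p') → len p ≤ len p') :
    SortedBy lo hi (m + 1) adj len (Function.update adj' m (adj p)) (Function.update len' m (len p))
      (Function.update π m p) := by
  have old : ∀ {β : Type} (f : ℕ → β) (v : β) (q : ℕ), q < m → Function.update f m v q = f q :=
    fun f v q hq => Function.update_of_ne (by omega) _ _
  have cases : ∀ q, q < m + 1 → q < m ∨ q = m := fun q hq => by omega
  constructor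
  · intro q h1 h2
    rcases cases q h2 with h3 | rfl
    · rw [old _ _ _ h3]; exact h.maps q h1 h3
    · rw [Function.update_self]; exact ⟨hp1, hp2⟩
  · intro q h1 h2 q' h1' h2' e
    rcases cases q h2 with h3 | rfl <;> rcases cases q' h2' with h3' | rfl
    · rw [old _ _ _ h3, old _ _ _ h3'] at e; exact h.inj q h1 h3 q' h1' h3' e
    · rw [old _ _ _ h3, Function.update_self] at e; exact absurd e (hnew q h1 h3)
    · rw [old _ _ _ h3', Function.update_self] at e; exact absurd e.symm (hnew q' h1' h3')
    · rfl
  · intro q h1 h2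
    rcases cases q h2 with h3 | rfl
    · rw [old _ _ _ h3, old _ _ _ h3]; exact h.adj_eq q h1 h3
    · rw [Function.update_self, Function.update_self]
  · intro q h1 h2
    rcases cases q h2 with h3 | rfl
    · rw [old _ _ _ h3, old _ _ _ h3]; exact h.len_eq q h1 h3
    · rw [Function.update_self, Function.update_self]
  · intro q q' h1 h2 h3
    rcases cases q' h3 with h4 | rfl
    · rw [old _ _ _ h4, old _ _ _ (by omega)]; exact h.sorted q q' h1 h2 h4
    · rcases cases q (by omega) with h4 | rfl
      · rw [old _ _ _ h4, Function.update_self]; exact h.least q p h1 h4 hp1 hp2 hnew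
      · exact le_rfl
  · intro q p' h1 h2 h3 h4 h5
    have h6 : ∀ q', lo ≤ q' → q' < m → π q' ≠ p' := by
      intro q' g1 g2
      have := h5 q' g1 (by omega)
      rwa [old _ _ _ g2] at this
    rcases cases q h2 with h7 | rfl
    · rw [old _ _ _ h7]; exact h.least q p' h1 h7 h3 h4 h6
    · rw [Function.update_self]; exact hmin p' h3 h4 h6

/-- Pigeonhole. It shows that the heap still holds a genuine entry as long as the block is not
exhausted. -/
theorem exists_not_mem_image_Ico {lo hi m : ℕ} {π : ℕ → ℕ} (hm : lo ≤ m) (hlt : m < hi) :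
    ∃ p, lo ≤ p ∧ p < hi ∧ ∀ q', lo ≤ q' → q' < m → π q' ≠ p := by
  by_contra! hno
  have h1 : Finset.Ico lo hi ⊆ (Finset.Ico lo m).image π := by
    intro p hp
    rw [Finset.mem_Ico] at hp
    obtain ⟨q, h1, h2, h3⟩ := hno p hp.1 hp.2
    exact Finset.mem_image.2 ⟨q, Finset.mem_Ico.2 ⟨h1, h2⟩, h3⟩
  have h2 := (Finset.card_le_card h1).trans Finset.card_image_le
  rw [Nat.card_Ico, Nat.card_Ico] at h2
  omega

theorem Net.Entries.csr {G : Net} {M : ℕ} {off adj adj' : ℕ → ℕ} {len len' : ℕ → ℝ}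
    (h : G.Entries M off adj len)
    (hs : ∀ x < G.n, ∃ π, SortedBy (off x) (off (x + 1)) (off (x + 1)) adj len adj' len' π) :
    G.CSR M off adj' len' where
  zero := h.zero
  last := h.last
  mono := h.mono
  edge x hx p h1 h2 := by
    obtain ⟨π, hπ⟩ := hs x hx
    rw [hπ.adj_eq p h1 h2, hπ.len_eq p h1 h2]
    exact h.edge x hx _ (hπ.maps p h1 h2).1 (hπ.maps p h1 h2).2
  inj x hx p q h1 h2 h3 h4 e := by
    obtain ⟨π, hπ⟩ := hs x hx
    rw [hπ.adj_eq p h1 h2, hπ.adj_eq q h3 h4] at e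
    exact hπ.inj p h1 h2 q h3 h4 (h.inj x hx _ _ (hπ.maps p h1 h2).1 (hπ.maps p h1 h2).2
      (hπ.maps q h3 h4).1 (hπ.maps q h3 h4).2 e)
  surj x y hxy := by
    have hx := G.lt hxy
    obtain ⟨π, hπ⟩ := hs x hx
    obtain ⟨p, h1, h2, rfl⟩ := h.surj x y hxy
    -- An injective map of a finite block into itself is onto, so no edge is lost by sorting.
    have h3 : Set.SurjOn π (Finset.Ico (off x) (off (x + 1))) (Finset.Ico (off x) (off (x + 1))) := by
      refine Finset.surjOn_of_injOn_of_card_le π ?_ ?_ le_rfl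
      · intro q hq
        simp only [Finset.coe_Ico, Set.mem_Ico] at hq ⊢
        exact hπ.maps q hq.1 hq.2
      · intro q hq q' hq' e
        simp only [Finset.coe_Ico, Set.mem_Ico] at hq hq'
        exact hπ.inj q hq.1 hq.2 q' hq'.1 hq'.2 e
    obtain ⟨q, hq, rfl⟩ := h3 (by simpa using ⟨h1, h2⟩ : p ∈ _)
    simp only [Finset.coe_Ico, Set.mem_Ico] at hq
    exact ⟨q, hq.1, hq.2, hπ.adj_eq q hq.1 hq.2⟩
  sorted x hx p q h1 h2 h3 := by
    obtain ⟨π, hπ⟩ := hs x hx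
    exact hπ.sorted p q h1 h2 h3

namespace RealRAM

variable {G : Net} {W H M : ℕ}

/-- The data that stay fixed while the lists are being sorted. -/
structure PreEnv (G : Net) (W H M : ℕ) (s : State) : Prop where
  n : s.wreg 0 = G.n
  zero : s.wreg 2 = 0
  one : s.wreg 3 = 1
  two : s.wreg 4 = 2
  entries : s.wreg 5 = M
  leaves : s.wreg 6 = 2 ^ H
  rzero : s.rreg 0 = 0
  big : ∀ p < M, s.rarr 0 p < s.rreg 1
  cap : 4 * 2 ^ H + 8 ≤ W
  room : M + G.n < 2 ^ H
  lists : G.Entries M (s.warr 0) (s.warr 1) (s.rarr 0)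

/-- `P` writes to the data of `PreEnv`. -/
def Prog.writesPreEnv (P : Prog) : Bool :=
  P.writesW 0 || P.writesW 2 || P.writesW 3 || P.writesW 4 || P.writesW 5 || P.writesW 6 ||
    P.writesR 0 || P.writesR 1 || P.writesWA 0 || P.writesWA 1 || P.writesRA 0

theorem PreEnv.frame {P : Prog} {s s' : State} (h : PreEnv G W H M s) (hF : Frame P s s')
    (hP : P.writesPreEnv = false := by rfl) : PreEnv G W H M s' := by
  simp only [Prog.writesPreEnv, Bool.or_eq_false_iff] at hP
  obtain ⟨⟨⟨⟨⟨⟨⟨⟨⟨⟨h0, h2⟩, h3⟩, h4⟩, h5⟩, h6⟩, hr0⟩, hr1⟩, ha0⟩, ha1⟩, hra0⟩ := hP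
  constructor
  · rw [hF.w 0 h0, h.n]
  · rw [hF.w 2 h2, h.zero]
  · rw [hF.w 3 h3, h.one]
  · rw [hF.w 4 h4, h.two]
  · rw [hF.w 5 h5, h.entries]
  · rw [hF.w 6 h6, h.leaves]
  · rw [hF.r 0 hr0, h.rzero]
  · rw [hF.r 1 hr1, hF.ra 0 hra0]; exact h.big
  · exact h.cap
  · exact h.room
  · rw [hF.wa 0 ha0, hF.wa 1 ha1, hF.ra 0 hra0]; exact h.lists

theorem PreEnv.of_eq {s s' : State} (h : PreEnv G W H M s) (h0 : s'.wreg 0 = s.wreg 0 := by rfl)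
    (h2 : s'.wreg 2 = s.wreg 2 := by rfl) (h3 : s'.wreg 3 = s.wreg 3 := by rfl)
    (h4 : s'.wreg 4 = s.wreg 4 := by rfl) (h5 : s'.wreg 5 = s.wreg 5 := by rfl)
    (h6 : s'.wreg 6 = s.wreg 6 := by rfl) (hr0 : s'.rreg 0 = s.rreg 0 := by rfl)
    (hr1 : s'.rreg 1 = s.rreg 1 := by rfl) (ha0 : s'.warr 0 = s.warr 0 := by rfl)
    (ha1 : s'.warr 1 = s.warr 1 := by rfl) (hra0 : s'.rarr 0 = s.rarr 0 := by rfl) :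
    PreEnv G W H M s' := by
  constructor
  · rw [h0, h.n]
  · rw [h2, h.zero]
  · rw [h3, h.one]
  · rw [h4, h.two]
  · rw [h5, h.entries]
  · rw [h6, h.leaves]
  · rw [hr0, h.rzero]
  · rw [hr1, hra0]; exact h.big
  · exact h.cap
  · exact h.room
  · rw [ha0, ha1, hra0]; exact h.lists

/-- Put the entries `18, …, 23 - 1` into the heap. -/
def insertBlock : Prog :=
  forTo 18 23 (.seq (block [.rload 20 0 18, .wmove 40 18]) heapUpdate)

theorem wp_insertBlock {s : State} {lo hi : ℕ} (hE : PreEnv G W H M s)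
    (hT : IsMinTree (2 ^ H) (s.rarr 2)) (hleaf : ∀ p < 2 ^ H, s.rarr 2 (2 ^ H + p) = s.rreg 1)
    (h18 : s.wreg 18 = lo) (h23 : s.wreg 23 = hi) (hle : lo ≤ hi) (hM : hi ≤ M) :
    wp W insertBlock (fun t s' => t ≤ (10 * H + 7) * (hi - lo) + 1 ∧ IsMinTree (2 ^ H) (s'.rarr 2) ∧
      ∀ p < 2 ^ H, s'.rarr 2 (2 ^ H + p) = if lo ≤ p ∧ p < hi then s.rarr 0 p else s.rreg 1) s := by
  have hcap := hE.cap
  have hroom := hE.room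
  refine wp.mono (wp_forTo (lo := lo) (hi := hi) (fun m s' => IsMinTree (2 ^ H) (s'.rarr 2) ∧
      ∀ p < 2 ^ H, s'.rarr 2 (2 ^ H + p) = if lo ≤ p ∧ p < m then s.rarr 0 p else s.rreg 1)
    (fun _ => 10 * H + 5) h18 h23 hE.one hle (by omega) ⟨hT, fun p hp => ?_⟩ ?_) ?_
  · rw [if_neg (by omega), hleaf p hp]
  · rintro m s' hm1 hm2 h18' hF ⟨h1, h2⟩
    have hE' : PreEnv G W H M s' := hE.frame hF
    have e0 : s'.rarr 0 = s.rarr 0 := hF.ra 0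
    simp only [wp_seq, wp_ite, wp_block_one, wp_block_cons, Instr.Fits, Instr.apply,
      WordOp.eval, Test.Holds, Function.update_apply, Nat.reduceEqDiff, OfNat.ofNat_ne_zero,
      OfNat.zero_ne_ofNat, OfNat.ofNat_ne_one, OfNat.one_ne_ofNat, one_ne_zero, zero_ne_one,
      reduceIte, true_and, h18', e0]
    set s₁ : State := _
    change wp W _ _ s₁
    refine wp.mono (wp_heapUpdate (H := H) (s := s₁) hE'.one hE'.two hE'.leaves hcap h1
      (by simp [s₁]; omega)) ?_
    rintro t s₂ hF₂ ⟨ht, hT₂, hl₂⟩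
    refine ⟨by omega, hT₂, fun p hp => ?_⟩
    change s₂.rarr 2 _ = _
    rw [hl₂ p hp]
    have c40 : s₁.wreg 40 = m := by simp [s₁]
    have c20 : s₁.rreg 20 = s.rarr 0 m := by simp [s₁]
    rw [c40, c20]
    by_cases hpm : p = m
    · subst hpm
      rw [if_pos rfl, if_pos (by omega)]
    · rw [if_neg hpm]
      change s'.rarr 2 _ = _
      rw [h2 p hp]
      congr 1
      simp only [eq_iff_iff]
      omega
  · rintro t s' hF ⟨ht, ⟨h1, h2⟩, -⟩
    simp only [Finset.sum_const, Nat.card_Ico, smul_eq_mul] at ht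
    exact ⟨by rw [mul_comm]; exact ht, h1, h2⟩

/-- Take the entries out of the heap by increasing length. -/
def extractBlock : Prog :=
  forTo 18 23 (.seq heapMin (.seq (block [.wload 19 1 40, .wstore 3 18 19, .rload 20 0 40,
    .rstore 1 18 20, .rmove 20 1]) heapUpdate))

/-- The unused entries of the block hold their lengths, and all other leaves hold `big`, which
exceeds every length. So the root always identifies a least unused entry of this block. -/
theorem wp_extractBlock {s : State} {lo hi : ℕ} (hE : PreEnv G W H M s)
    (hT : IsMinTree (2 ^ H) (s.rarr 2))
    (hleaf : ∀ p < 2 ^ H, s.rarr 2 (2 ^ H + p) = if lo ≤ p ∧ p < hi then s.rarr 0 p else s.rreg 1)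
    (h18 : s.wreg 18 = lo) (h23 : s.wreg 23 = hi) (hle : lo ≤ hi) (hM : hi ≤ M) :
    wp W extractBlock (fun t s' => t ≤ (17 * H + 20) * (hi - lo) + 1 ∧
      IsMinTree (2 ^ H) (s'.rarr 2) ∧ (∀ p < 2 ^ H, s'.rarr 2 (2 ^ H + p) = s.rreg 1) ∧
      (∀ q < lo, s'.warr 3 q = s.warr 3 q ∧ s'.rarr 1 q = s.rarr 1 q) ∧
      ∃ π, SortedBy lo hi hi (s.warr 1) (s.rarr 0) (s'.warr 3) (s'.rarr 1) π) s := by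
  have hcap := hE.cap
  have hroom := hE.room
  refine wp.mono (wp_forTo (lo := lo) (hi := hi) (fun m s' => IsMinTree (2 ^ H) (s'.rarr 2) ∧
      (∀ q < lo, s'.warr 3 q = s.warr 3 q ∧ s'.rarr 1 q = s.rarr 1 q) ∧
      ∃ π, SortedBy lo hi m (s.warr 1) (s.rarr 0) (s'.warr 3) (s'.rarr 1) π ∧
      (∀ q, lo ≤ q → q < m → s'.rarr 2 (2 ^ H + π q) = s.rreg 1) ∧
      (∀ p < 2 ^ H, ¬ (lo ≤ p ∧ p < hi) → s'.rarr 2 (2 ^ H + p) = s.rreg 1) ∧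
      ∀ p, lo ≤ p → p < hi → (∀ q, lo ≤ q → q < m → π q ≠ p) →
        s'.rarr 2 (2 ^ H + p) = s.rarr 0 p)
    (fun _ => 17 * H + 18) h18 h23 hE.one hle (by omega)
    ⟨hT, fun q _ => ⟨rfl, rfl⟩, id, ⟨fun q _ _ => by omega, fun q _ _ => by omega,
      fun q _ _ => by omega, fun q _ _ => by omega, fun q q' _ _ _ => by omega,
      fun q p _ _ => by omega⟩, fun q _ _ => by omega, fun p hp hn => ?_, fun p h1 h2 _ => ?_⟩ ?_) ?_
  · rw [hleaf p hp, if_neg hn]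
  · rw [hleaf p (by omega), if_pos ⟨h1, h2⟩]
  · rintro m s' hm1 hm2 h18' hF ⟨h1, h2, π, hπ, h3, h4, h5⟩
    have hE' : PreEnv G W H M s' := hE.frame hF
    have e0 : s'.rarr 0 = s.rarr 0 := hF.ra 0
    have e1 : s'.warr 1 = s.warr 1 := hF.wa 1
    have er1 : s'.rreg 1 = s.rreg 1 := hF.r 1
    have hbig := hE.big
    rw [wp_seq]
    refine wp.mono (wp_heapMin hE'.one hE'.leaves hcap h1) ?_
    rintro t s₁ hF₁ ⟨ht, hx, hroot⟩
    set x := s₁.wreg 40 with hxdef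
    have hE₁ : PreEnv G W H M s₁ := hE'.frame hF₁
    have f18 : s₁.wreg 18 = m := by rw [hF₁.w 18, h18']
    have f1 : s₁.warr 1 = s.warr 1 := by rw [hF₁.wa 1, e1]
    have f0 : s₁.rarr 0 = s.rarr 0 := by rw [hF₁.ra 0, e0]
    have fr1 : s₁.rreg 1 = s.rreg 1 := by rw [hF₁.r 1, er1]
    have f2 : s₁.rarr 2 = s'.rarr 2 := hF₁.ra 2
    have f3 : s₁.warr 3 = s'.warr 3 := hF₁.wa 3
    have fr : s₁.rarr 1 = s'.rarr 1 := hF₁.ra 1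
    have hmin : ∀ p', lo ≤ p' → p' < hi → (∀ q', lo ≤ q' → q' < m → π q' ≠ p') →
        s'.rarr 2 (2 ^ H + x) ≤ s.rarr 0 p' := by
      intro p' k1 k2 k3
      rw [hroot, ← h5 p' k1 k2 k3]
      exact h1.root_le (by omega)
    have hxlt : s'.rarr 2 (2 ^ H + x) < s.rreg 1 := by
      obtain ⟨p', k1, k2, k3⟩ := exists_not_mem_image_Ico (π := π) hm1 hm2
      exact (hmin p' k1 k2 k3).trans_lt (hbig p' (by omega))
    have hxin : lo ≤ x ∧ x < hi := by
      by_contra hno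
      exact hxlt.ne (h4 x hx hno)
    have hxnew : ∀ q, lo ≤ q → q < m → π q ≠ x := fun q k1 k2 k3 =>
      hxlt.ne (by rw [← k3]; exact h3 q k1 k2)
    have hxv := h5 x hxin.1 hxin.2 hxnew
    rw [hxv] at hmin
    simp only [wp_seq, wp_ite, wp_block_one, wp_block_cons, Instr.Fits, Instr.apply,
      WordOp.eval, Test.Holds, Function.update_apply, Nat.reduceEqDiff, OfNat.ofNat_ne_zero,
      OfNat.zero_ne_ofNat, OfNat.ofNat_ne_one, OfNat.one_ne_ofNat, one_ne_zero, zero_ne_one,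
      reduceIte, true_and, f18, f1, f0, fr1, ← hxdef]
    set s₂ : State := _
    change wp W _ _ s₂
    refine wp.mono (wp_heapUpdate (H := H) (s := s₂) hE₁.one hE₁.two hE₁.leaves hcap
      (by change IsMinTree _ (s₁.rarr 2); rw [f2]; exact h1) hx) ?_
    rintro u s₃ hF₃ ⟨hu, hT₃, hl₃⟩
    have c40 : s₂.wreg 40 = x := by simp [s₂, hxdef]
    have c20 : s₂.rreg 20 = s.rreg 1 := by simp [s₂]
    have c2 : s₂.rarr 2 = s'.rarr 2 := f2
    rw [c40, c20, c2] at hl₃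
    have d3 : s₃.warr 3 = Function.update (s'.warr 3) m (s.warr 1 x) := by
      rw [hF₃.wa 3]; simp [s₂, f3]
    have d1 : s₃.rarr 1 = Function.update (s'.rarr 1) m (s.rarr 0 x) := by
      rw [hF₃.ra 1]; simp [s₂, fr]
    refine ⟨by omega, hT₃, fun q hq => ?_, Function.update π m x, ?_, fun q k1 k2 => ?_,
      fun p hp hn => ?_, fun p k1 k2 k3 => ?_⟩
    · change s₃.warr 3 q = _ ∧ s₃.rarr 1 q = _
      rw [d3, d1, Function.update_of_ne (by omega), Function.update_of_ne (by omega)]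
      exact h2 q hq
    · change SortedBy _ _ _ _ _ (s₃.warr 3) (s₃.rarr 1) _
      rw [d3, d1]
      exact hπ.step hm1 hxin.1 hxin.2 hxnew hmin
    · change s₃.rarr 2 _ = _
      rcases Nat.lt_succ_iff_lt_or_eq.1 k2 with k3 | rfl
      · rw [Function.update_of_ne (by omega), hl₃ _ (by have := hπ.maps q k1 k3; omega),
          if_neg (hxnew q k1 k3), h3 q k1 k3]
      · rw [Function.update_self, hl₃ _ hx, if_pos rfl]
    · change s₃.rarr 2 _ = _
      rw [hl₃ p hp]
      split_ifs
      · rfl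
      · exact h4 p hp hn
    · change s₃.rarr 2 _ = _
      have hne := k3 m hm1 (by omega)
      rw [Function.update_self] at hne
      rw [hl₃ p (by omega), if_neg hne.symm]
      refine h5 p k1 k2 fun q g1 g2 => ?_
      have := k3 q g1 (by omega)
      rwa [Function.update_of_ne (by omega)] at this
  · rintro t s' hF ⟨ht, ⟨h1, h2, π, hπ, h3, h4, h5⟩, -⟩
    simp only [Finset.sum_const, Nat.card_Ico, smul_eq_mul] at ht
    refine ⟨by rw [mul_comm]; exact ht, h1, fun p hp => ?_, h2, π, hπ⟩
    by_cases hin : lo ≤ p ∧ p < hi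
    · by_cases hused : ∃ q, lo ≤ q ∧ q < hi ∧ π q = p
      · obtain ⟨q, k1, k2, rfl⟩ := hused
        exact h3 q k1 k2
      · push Not at hused
        have : Set.SurjOn π (Finset.Ico lo hi) (Finset.Ico lo hi) := by
          refine Finset.surjOn_of_injOn_of_card_le π ?_ ?_ le_rfl
          · intro q hq
            simp only [Finset.coe_Ico, Set.mem_Ico] at hq ⊢
            exact hπ.maps q hq.1 hq.2
          · intro q hq q' hq' e
            simp only [Finset.coe_Ico, Set.mem_Ico] at hq hq'
            exact hπ.inj q hq.1 hq.2 q' hq'.1 hq'.2 e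
        obtain ⟨q, hq, e⟩ := this (by simpa using hin : p ∈ _)
        simp only [Finset.coe_Ico, Set.mem_Ico] at hq
        exact absurd e (hused q hq.1 hq.2)
    · exact h4 p hp hin

/-- Sort all lists. -/
def sortLists : Prog :=
  .seq (block [.wmove 12 2]) (forTo 12 0
    (.seq (block [.wload 18 0 12, .wop .add 22 12 3, .wload 23 0 22])
    (.seq insertBlock (.seq (block [.wload 18 0 12]) extractBlock))))

theorem wp_sortLists {s : State} (hE : PreEnv G W H M s) (hT : IsMinTree (2 ^ H) (s.rarr 2))
    (hleaf : ∀ p < 2 ^ H, s.rarr 2 (2 ^ H + p) = s.rreg 1) :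
    wp W sortLists (fun t s' => t ≤ 30 * (H + 1) * (M + G.n) + 2 ∧ IsMinTree (2 ^ H) (s'.rarr 2) ∧
      (∀ p < 2 ^ H, s'.rarr 2 (2 ^ H + p) = s.rreg 1) ∧
      G.CSR M (s'.warr 0) (s'.warr 3) (s'.rarr 1)) s := by
  have hcap := hE.cap
  have hroom := hE.room
  unfold sortLists
  simp only [wp_seq, wp_ite, wp_block_one, wp_block_cons, Instr.Fits, Instr.apply, WordOp.eval,
    Test.Holds, Function.update_apply, Nat.reduceEqDiff, OfNat.ofNat_ne_zero, OfNat.zero_ne_ofNat,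
    OfNat.ofNat_ne_one, OfNat.one_ne_ofNat, one_ne_zero, zero_ne_one, reduceIte, true_and,
    hE.zero]
  set s₁ : State := _
  change wp W _ _ s₁
  have hE₁ : PreEnv G W H M s₁ := hE.of_eq
  refine wp.mono (wp_forTo (lo := 0) (hi := G.n) (fun x s' => IsMinTree (2 ^ H) (s'.rarr 2) ∧
      (∀ p < 2 ^ H, s'.rarr 2 (2 ^ H + p) = s.rreg 1) ∧
      ∀ y < x, ∃ π, SortedBy (s.warr 0 y) (s.warr 0 (y + 1)) (s.warr 0 (y + 1)) (s.warr 1) (s.rarr 0)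
        (s'.warr 3) (s'.rarr 1) π)
    (fun x => 27 * (H + 1) * (s.warr 0 (x + 1) - s.warr 0 x) + 6)
    (by simp [s₁]) hE₁.n hE₁.one (Nat.zero_le _) (by omega) ⟨hT, hleaf, fun y h => by omega⟩ ?_) ?_
  · rintro x s' - hx h12 hF ⟨h1, h2, h3⟩
    have hE' : PreEnv G W H M s' := hE₁.frame hF
    have e0 : s'.warr 0 = s.warr 0 := hF.wa 0
    have e1 : s'.warr 1 = s.warr 1 := hF.wa 1
    have er0 : s'.rarr 0 = s.rarr 0 := hF.ra 0
    have er1 : s'.rreg 1 = s.rreg 1 := hF.r 1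
    have hM := hE.lists.le_last (x + 1) hx
    have hmono := hE.lists.mono x hx
    simp only [wp_seq, wp_ite, wp_block_one, wp_block_cons, Instr.Fits, Instr.apply,
      WordOp.eval, Test.Holds, Function.update_apply, Nat.reduceEqDiff, OfNat.ofNat_ne_zero,
      OfNat.zero_ne_ofNat, OfNat.ofNat_ne_one, OfNat.one_ne_ofNat, one_ne_zero, zero_ne_one,
      reduceIte, true_and, h12, e0, hE'.one]
    refine ⟨by omega, ?_⟩
    set s₂ : State := _
    change wp W _ _ s₂
    have hE₂ : PreEnv G W H M s₂ := hE'.of_eq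
    refine wp.mono (wp_insertBlock (s := s₂) (lo := s.warr 0 x) (hi := s.warr 0 (x + 1)) hE₂ h1
      (by change ∀ p < _, s'.rarr 2 _ = s'.rreg 1; rw [er1]; exact h2) (by simp [s₂])
      (by simp [s₂]) hmono hM) ?_
    rintro t s₃ hF₃ ⟨ht, hT₃, hl₃⟩
    have hE₃ : PreEnv G W H M s₃ := hE₂.frame hF₃
    have f12 : s₃.wreg 12 = x := by rw [hF₃.w 12]; simp [s₂, h12]
    have f0 : s₃.warr 0 = s.warr 0 := by rw [hF₃.wa 0]; exact e0
    have f23 : s₃.wreg 23 = s.warr 0 (x + 1) := by rw [hF₃.w 23]; simp [s₂]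
    have fr0 : s₃.rarr 0 = s.rarr 0 := by rw [hF₃.ra 0]; exact er0
    have fr1 : s₃.rreg 1 = s.rreg 1 := by rw [hF₃.r 1]; exact er1
    have f1 : s₃.warr 1 = s.warr 1 := by rw [hF₃.wa 1]; exact e1
    have f3 : s₃.warr 3 = s'.warr 3 := hF₃.wa 3
    have fra1 : s₃.rarr 1 = s'.rarr 1 := hF₃.ra 1
    simp only [wp_seq, wp_ite, wp_block_one, wp_block_cons, Instr.Fits, Instr.apply,
      WordOp.eval, Test.Holds, Function.update_apply, Nat.reduceEqDiff, OfNat.ofNat_ne_zero,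
      OfNat.zero_ne_ofNat, OfNat.ofNat_ne_one, OfNat.one_ne_ofNat, one_ne_zero, zero_ne_one,
      reduceIte, true_and, f12, f0]
    set s₄ : State := _
    change wp W _ _ s₄
    have hE₄ : PreEnv G W H M s₄ := hE₃.of_eq
    refine wp.mono (wp_extractBlock (s := s₄) (lo := s.warr 0 x) (hi := s.warr 0 (x + 1)) hE₄ hT₃
      ?_ (by simp [s₄]) (by simp [s₄, f23]) hmono hM) ?_
    · change ∀ p < _, s₃.rarr 2 _ = if s.warr 0 x ≤ p ∧ p < s.warr 0 (x + 1) then s₃.rarr 0 p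
        else s₃.rreg 1
      rw [fr0, fr1]
      change ∀ p < _, s₃.rarr 2 _ = if s.warr 0 x ≤ p ∧ p < s.warr 0 (x + 1) then s'.rarr 0 p
        else s'.rreg 1 at hl₃
      rw [er0, er1] at hl₃
      exact hl₃
    · rintro u s₅ hF₅ ⟨hu, hT₅, hl₅, hold, π, hπ⟩
      change SortedBy _ _ _ (s₃.warr 1) (s₃.rarr 0) _ _ _ at hπ
      change ∀ q < _, _ = s₃.warr 3 q ∧ _ = s₃.rarr 1 q at hold
      change ∀ p < _, _ = s₃.rreg 1 at hl₅
      rw [f3, fra1] at hold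
      rw [f1, fr0] at hπ
      rw [fr1] at hl₅
      refine ⟨?_, hT₅, hl₅, fun y hy => ?_⟩
      · have : 27 * (H + 1) * (s.warr 0 (x + 1) - s.warr 0 x) =
          (10 * H + 7) * (s.warr 0 (x + 1) - s.warr 0 x) +
          (17 * H + 20) * (s.warr 0 (x + 1) - s.warr 0 x) := by ring
        omega
      · rcases Nat.lt_succ_iff_lt_or_eq.1 hy with hy | rfl
        · obtain ⟨π', hπ'⟩ := h3 y hy
          have hoff : s.warr 0 (y + 1) ≤ s.warr 0 x := by
            have : ∀ z, y + 1 ≤ z → z ≤ x → s.warr 0 (y + 1) ≤ s.warr 0 z := by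
              intro z hz
              induction z, hz using Nat.le_induction with
              | base => exact fun _ => le_rfl
              | succ z hz ih =>
                exact fun hzx => (ih (by omega)).trans (hE.lists.mono z (by omega))
            exact this x hy le_rfl
          exact ⟨π', hπ'.congr (fun q _ hq => (hold q (by omega)).1)
            fun q _ hq => (hold q (by omega)).2⟩
        · exact ⟨π, hπ⟩
  · rintro t s' hF ⟨ht, ⟨h1, h2, h3⟩, -⟩
    have e0 : s'.warr 0 = s.warr 0 := hF.wa 0
    refine ⟨?_, h1, h2, by rw [e0]; exact hE.lists.csr h3⟩
    have hsum : ∀ m ≤ G.n, ∑ x ∈ Finset.Ico 0 m,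
        (27 * (H + 1) * (s.warr 0 (x + 1) - s.warr 0 x) + 6 + 2) =
        27 * (H + 1) * s.warr 0 m + 8 * m := by
      intro m hm
      induction m with
      | zero => simp [hE.lists.zero]
      | succ m ih =>
        rw [Finset.sum_Ico_succ_top (Nat.zero_le _), ih (by omega)]
        obtain ⟨e, he⟩ := Nat.exists_eq_add_of_le (hE.lists.mono m hm)
        rw [he, Nat.add_sub_cancel_left]
        ring
    rw [hsum _ le_rfl, hE.lists.last] at ht
    have : 27 * (H + 1) * M + 8 * G.n ≤ 30 * (H + 1) * (M + G.n) := by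
      nlinarith [Nat.zero_le (H * M), Nat.zero_le (H * G.n)]
    omega

end RealRAM

/-! ### Levels from coin flips -/

/-- The number of initial heads among the first `J` coin flips. -/
def lead (J : ℕ) (a : ℕ → Bool) : ℕ :=
  ((Finset.range J).filter fun t => ∀ u ≤ t, a u = true).card

theorem lead_succ (J : ℕ) (a : ℕ → Bool) :
    lead (J + 1) a = lead J a + if ∀ u ≤ J, a u = true then 1 else 0 := by
  unfold lead
  rw [Finset.range_add_one, Finset.filter_insert]
  split_ifs
  · rw [Finset.card_insert_of_notMem (by simp)]
  · rfl

theorem lead_le (J : ℕ) (a : ℕ → Bool) : lead J a ≤ J :=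
  (Finset.card_filter_le _ _).trans (Finset.card_range J).le

theorem le_lead_iff {J : ℕ} {a : ℕ → Bool} {i : ℕ} (hi : i ≤ J) :
    i ≤ lead J a ↔ ∀ t < i, a t = true := by
  induction J generalizing i with
  | zero =>
    obtain rfl : i = 0 := by omega
    simp
  | succ J ih =>
    rw [lead_succ]
    have hle := lead_le J a
    split_ifs with h
    · have hJ : J ≤ lead J a := (ih le_rfl).2 fun t ht => h t ht.le
      exact ⟨fun _ t ht => h t (by omega), fun _ => by omega⟩
    · rcases hi.eq_or_lt with rfl | hi
      · refine ⟨fun h' => by omega, fun h' => (h fun u hu => h' u (by omega)).elim⟩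
      · rw [Nat.add_zero, ih (by omega)]

/-- The number of levels. -/
def numLevels (n k : ℕ) : ℕ := min k (Nat.log 2 n + 1)

/-- The number of coin flips for each level. -/
def flipsPerLevel (n k : ℕ) : ℕ := (Nat.log 2 n + 1) / numLevels n k + 1

/-- The number of coin flips for each vertex. -/
def numFlips (n k : ℕ) : ℕ := (numLevels n k - 1) * flipsPerLevel n k

/-- The level of the vertex `v`. -/
def coinLevel (n k : ℕ) (ω : ℕ → Bool) (v : ℕ) : ℕ :=
  lead (numFlips n k) (fun t => ω (v * numFlips n k + t)) / flipsPerLevel n k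

theorem flipsPerLevel_pos (n k : ℕ) : 0 < flipsPerLevel n k := Nat.succ_pos _

theorem numLevels_pos {n k : ℕ} (hk : 1 ≤ k) : 1 ≤ numLevels n k := by
  unfold numLevels; omega

theorem coinLevel_lt {n k : ℕ} (hk : 1 ≤ k) (ω : ℕ → Bool) (v : ℕ) :
    coinLevel n k ω v < numLevels n k := by
  have h1 := numLevels_pos (n := n) hk
  unfold coinLevel
  rw [Nat.div_lt_iff_lt_mul (flipsPerLevel_pos n k)]
  have h2 := lead_le (numFlips n k) fun t => ω (v * numFlips n k + t)
  have h3 : numLevels n k * flipsPerLevel n k = numFlips n k + flipsPerLevel n k := by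
    obtain ⟨j, hj⟩ := Nat.exists_eq_add_of_le h1
    unfold numFlips
    rw [hj, Nat.add_sub_cancel_left]
    ring
  have := flipsPerLevel_pos n k
  omega

/-- Expresses the level by heads at prescribed positions, the form in which probabilities are
computed. For i < K the required heads lie within the flips of v. -/
theorem le_coinLevel_iff {n k i : ℕ} (hi : i < numLevels n k) (ω : ℕ → Bool) (v : ℕ) :
    i ≤ coinLevel n k ω v ↔ ∀ t < i * flipsPerLevel n k, ω (v * numFlips n k + t) = true := by
  unfold coinLevel
  rw [Nat.le_div_iff_mul_le (flipsPerLevel_pos n k), le_lead_iff]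
  exact Nat.mul_le_mul_right _ (by omega)

theorem numFlips_le {n k : ℕ} (hk : 1 ≤ k) : numFlips n k ≤ 2 * (Nat.log 2 n + 1) := by
  have h1 := numLevels_pos (n := n) hk
  have h2 : numLevels n k ≤ Nat.log 2 n + 1 := min_le_right _ _
  have h3 := Nat.div_mul_le_self (Nat.log 2 n + 1) (numLevels n k)
  unfold numFlips flipsPerLevel
  calc (numLevels n k - 1) * ((Nat.log 2 n + 1) / numLevels n k + 1)
      ≤ numLevels n k * ((Nat.log 2 n + 1) / numLevels n k + 1) :=
        Nat.mul_le_mul_right _ (by omega)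
    _ = (Nat.log 2 n + 1) / numLevels n k * numLevels n k + numLevels n k := by ring
    _ ≤ _ := by omega

/-! ### Parameters, initialization and sampling -/

namespace RealRAM

variable {G : Net} {W H M : ℕ}

/-- Compute the size of the trees, the number of levels and the numbers of coin flips. -/
def sizes : Prog :=
  .seq (block [.wop .add 20 0 5, .wop .add 20 20 3, .wmove 6 3])
  (.seq (.loop (.wlt 6 20) (block [.wop .add 6 6 6]))
  (.seq (block [.wmove 7 2, .wmove 20 3, .wop .add 21 0 3])
  (.seq (.loop (.wlt 20 21) (block [.wop .add 20 20 20, .wop .add 7 7 3]))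
  (.seq (.ite (.wlt 7 1) (block [.wmove 1 7]) (block [.skip]))
  (block [.wop .div 8 7 1, .wop .add 8 8 3, .wop .sub 9 1 3, .wop .mul 9 9 8])))))

/-- Powers of two and the logarithm are found by doubling. The potentials pay far more than the
logarithmic number of rounds requires, but a linear bound suffices here. -/
theorem wp_sizes {s : State} {n k : ℕ} (h0 : s.wreg 0 = n) (h1 : s.wreg 1 = k)
    (h2 : s.wreg 2 = 0) (h3 : s.wreg 3 = 1) (h5 : s.wreg 5 = M) (hn : 1 ≤ n) (hk : 1 ≤ k)
    (hW : 8 * (M + n + 1) + 8 ≤ W) :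
    wp W sizes (fun t s' => t ≤ 10 * (M + n + 1) + 30 ∧ (∃ H, s'.wreg 6 = 2 ^ H ∧
      M + n + 1 ≤ 2 ^ H ∧ 2 ^ H ≤ 2 * (M + n + 1)) ∧ s'.wreg 1 = numLevels n k ∧
      s'.wreg 8 = flipsPerLevel n k ∧ s'.wreg 9 = numFlips n k) s := by
  unfold sizes
  simp only [wp_seq, wp_ite, wp_block_one, wp_block_cons, Instr.Fits, Instr.apply, WordOp.eval,
    Test.Holds, Function.update_apply, Nat.reduceEqDiff, OfNat.ofNat_ne_zero, OfNat.zero_ne_ofNat,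
    OfNat.ofNat_ne_one, OfNat.one_ne_ofNat, one_ne_zero, zero_ne_one, reduceIte, true_and, h0, h2,
    h3, h5]
  refine ⟨by omega, by omega, ?_⟩
  set s₁ : State := _
  change wp W _ _ s₁
  refine wp.mono (wp_loop (fun φ s' => ∃ a, s'.wreg 6 = 2 ^ a ∧ 2 ^ a ≤ 2 * (M + n + 1) ∧
    φ + 2 * 2 ^ a = 4 * (M + n + 1)) (4 * (M + n) + 2) ⟨0, by simp [s₁], by omega, by omega⟩ ?_) ?_
  · rintro φ s' ⟨a, e6, ha, hφ⟩ hF hs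
    have e20 : s'.wreg 20 = M + n + 1 := by rw [hF.w 20]; simp [s₁]; omega
    simp only [Test.Holds, e6, e20] at hs
    have := Nat.one_le_two_pow (n := a)
    have hp : 2 ^ (a + 1) = 2 * 2 ^ a := by ring
    simp only [wp_seq, wp_ite, wp_block_one, wp_block_cons, Instr.Fits, Instr.apply,
      WordOp.eval, Test.Holds, Function.update_apply, Nat.reduceEqDiff, OfNat.ofNat_ne_zero,
      OfNat.zero_ne_ofNat, OfNat.ofNat_ne_one, OfNat.one_ne_ofNat, one_ne_zero, zero_ne_one,
      reduceIte, true_and, e6]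
    refine ⟨by omega, φ - 2 * 2 ^ a, ⟨a + 1, ?_, ?_, ?_⟩, ?_⟩ <;>
      omega
  rintro t₂ s₂ hF₂ ⟨φ, ⟨H, e6, hH, hφ⟩, hn₂, ht₂⟩
  have e20 : s₂.wreg 20 = M + n + 1 := by rw [hF₂.w 20]; simp [s₁]; omega
  simp only [Test.Holds, e6, e20, not_lt] at hn₂
  have f0 : s₂.wreg 0 = n := by rw [hF₂.w 0]; simp [s₁, h0]
  have f2 : s₂.wreg 2 = 0 := by rw [hF₂.w 2]; simp [s₁, h2]
  have f3 : s₂.wreg 3 = 1 := by rw [hF₂.w 3]; simp [s₁, h3]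
  simp only [wp_seq, wp_ite, wp_block_one, wp_block_cons, Instr.Fits, Instr.apply, WordOp.eval,
    Test.Holds, Function.update_apply, Nat.reduceEqDiff, OfNat.ofNat_ne_zero, OfNat.zero_ne_ofNat,
    OfNat.ofNat_ne_one, OfNat.one_ne_ofNat, one_ne_zero, zero_ne_one, reduceIte, true_and, f0, f2,
    f3]
  refine ⟨by omega, ?_⟩
  set s₃ : State := _
  change wp W _ _ s₃
  refine wp.mono (wp_loop (fun φ s' => ∃ a, s'.wreg 20 = 2 ^ a ∧ s'.wreg 7 = a ∧
    2 ^ a ≤ 2 * n ∧ φ + 3 * 2 ^ a = 6 * n + 3) (6 * n)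
    ⟨0, by simp [s₃], by simp [s₃], by omega, by omega⟩ ?_) ?_
  · rintro φ s' ⟨a, g20, g7, ha, hφ⟩ hF hs
    have g3 : s'.wreg 3 = 1 := by rw [hF.w 3]; simp [s₃, f3]
    have e21 : s'.wreg 21 = n + 1 := by rw [hF.w 21]; simp [s₃]
    simp only [Test.Holds, g20, e21] at hs
    have := Nat.one_le_two_pow (n := a)
    have hp : 2 ^ (a + 1) = 2 * 2 ^ a := by ring
    have := Nat.lt_two_pow_self (n := a)
    simp only [wp_seq, wp_ite, wp_block_one, wp_block_cons, Instr.Fits, Instr.apply,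
      WordOp.eval, Test.Holds, Function.update_apply, Nat.reduceEqDiff, OfNat.ofNat_ne_zero,
      OfNat.zero_ne_ofNat, OfNat.ofNat_ne_one, OfNat.one_ne_ofNat, one_ne_zero, zero_ne_one,
      reduceIte, true_and, g20, g7, g3]
    refine ⟨by omega, by omega, φ - 3 * 2 ^ a, ⟨a + 1, ?_, rfl, ?_, ?_⟩, ?_⟩ <;>
      omega
  rintro t₄ s₄ hF₄ ⟨φ', ⟨L, g20, g7, hL, hφ'⟩, hn₄, ht₄⟩
  have g21 : s₄.wreg 21 = n + 1 := by rw [hF₄.w 21]; simp [s₃]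
  simp only [Test.Holds, g20, g21, not_lt] at hn₄
  have hLlog : L = Nat.log 2 n + 1 := by
    obtain ⟨a, rfl⟩ : ∃ a, L = a + 1 := by
      refine ⟨L - 1, ?_⟩
      by_contra h
      obtain rfl : L = 0 := by omega
      simp at hn₄
      omega
    rw [pow_succ] at hL
    rw [Nat.log_eq_of_pow_le_of_lt_pow (b := 2) (m := a) (by omega) (by omega)]
  have k1 : s₄.wreg 1 = k := by
    rw [hF₄.w 1]; change s₂.wreg 1 = k; rw [hF₂.w 1]; simp [s₁, h1]
  have k3 : s₄.wreg 3 = 1 := by rw [hF₄.w 3]; simp [s₃, f3]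
  have k6 : s₄.wreg 6 = 2 ^ H := by rw [hF₄.w 6]; exact e6
  have hlt := Nat.lt_two_pow_self (n := L)
  have hLn : Nat.log 2 n < n := Nat.log_lt_self 2 (by omega)
  have hflips := numFlips_le (n := n) hk
  have hper : flipsPerLevel n k ≤ Nat.log 2 n + 2 := by
    unfold flipsPerLevel
    have := Nat.div_le_self (Nat.log 2 n + 1) (numLevels n k)
    omega
  rw [hLlog] at g7
  simp only [wp_seq, wp_ite, wp_block_one, wp_block_cons, Instr.Fits, Instr.apply, WordOp.eval,
    Test.Holds, Function.update_apply, Nat.reduceEqDiff, OfNat.ofNat_ne_zero, OfNat.zero_ne_ofNat,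
    OfNat.ofNat_ne_one, OfNat.one_ne_ofNat, one_ne_zero, zero_ne_one, reduceIte, true_and, g7, k1,
    k3, k6]
  constructor
  · intro hlt
    have hnum : numLevels n k = Nat.log 2 n + 1 := min_eq_right hlt.le
    have h8 : flipsPerLevel n k = (Nat.log 2 n + 1) / (Nat.log 2 n + 1) + 1 := by
      rw [flipsPerLevel, hnum]
    have h9 : numFlips n k = (Nat.log 2 n + 1 - 1) * flipsPerLevel n k := by
      rw [numFlips, hnum]
    rw [← h8, ← h9]
    refine ⟨?_, ?_, ?_, ?_, ?_, ⟨H, rfl, by omega, hH⟩, hnum.symm, rfl, rfl⟩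
    all_goals omega
  · intro hge
    have hnum : numLevels n k = k := min_eq_left (not_lt.1 hge)
    have h8 : flipsPerLevel n k = (Nat.log 2 n + 1) / k + 1 := by
      rw [flipsPerLevel, hnum]
    have h9 : numFlips n k = (k - 1) * flipsPerLevel n k := by
      rw [numFlips, hnum]
    rw [← h8, ← h9]
    refine ⟨?_, ?_, ?_, ?_, ?_, ⟨H, rfl, by omega, hH⟩, hnum.symm, rfl, rfl⟩
    all_goals omega

/-- Compute an upper bound for the length of the cycle that will be found. -/
def trivialBound : Prog :=
  .seq (block [.rmove 7 0, .wmove 18 2])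
  (.seq (forTo 18 5 (block [.rload 5 0 18, .radd 7 7 5]))
  (.seq (block [.wmove 18 2, .rmove 1 7])
  (.seq (forTo 18 1 (block [.radd 1 1 7, .radd 1 1 7])) (block [.rmove 2 1]))))

/-- The machine cannot multiply reals, so (2K + 1) S is built by additions. The factor only has to
exceed 4K / 3, and the value has to exceed every single length for the sorting. -/
theorem wp_trivialBound {s : State} {K : ℕ} (h1 : s.wreg 1 = K) (h2 : s.wreg 2 = 0)
    (h3 : s.wreg 3 = 1) (h5 : s.wreg 5 = M) (hr0 : s.rreg 0 = 0) (hM : M < W) (hK : K < W) :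
    wp W trivialBound (fun t s' => t ≤ 4 * M + 4 * K + 7 ∧ s'.rreg 2 = s'.rreg 1 ∧
      s'.rreg 1 = (2 * K + 1) * ∑ p ∈ Finset.range M, s.rarr 0 p) s := by
  unfold trivialBound
  simp only [wp_seq, wp_ite, wp_block_one, wp_block_cons, Instr.Fits, Instr.apply, WordOp.eval,
    Test.Holds, Function.update_apply, Nat.reduceEqDiff, OfNat.ofNat_ne_zero, OfNat.zero_ne_ofNat,
    OfNat.ofNat_ne_one, OfNat.one_ne_ofNat, one_ne_zero, zero_ne_one, reduceIte, true_and, h2,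
    hr0]
  set s₁ : State := _
  change wp W _ _ s₁
  refine wp.mono (wp_forTo (lo := 0) (hi := M) (fun p s' =>
    s'.rreg 7 = ∑ q ∈ Finset.range p, s.rarr 0 q) (fun _ => 2)
    (by simp [s₁]) (by simp [s₁, h5]) (by simp [s₁, h3]) (Nat.zero_le _) hM (by simp [s₁]) ?_) ?_
  · rintro p s' - hp h18 hF hI
    have e0 : s'.rarr 0 = s.rarr 0 := hF.ra 0
    simp only [wp_seq, wp_ite, wp_block_one, wp_block_cons, Instr.Fits, Instr.apply,
      WordOp.eval, Test.Holds, Function.update_apply, Nat.reduceEqDiff, OfNat.ofNat_ne_zero,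
      OfNat.zero_ne_ofNat, OfNat.ofNat_ne_one, OfNat.one_ne_ofNat, one_ne_zero, zero_ne_one,
      reduceIte, true_and, h18, e0, hI]
    refine ⟨by omega, ?_⟩
    rw [Finset.sum_range_succ]
    rfl
  rintro t₂ s₂ hF₂ ⟨ht₂, h7, -⟩
  simp only [Finset.sum_const, Nat.card_Ico, smul_eq_mul] at ht₂
  have f2 : s₂.wreg 2 = 0 := by rw [hF₂.w 2]; simp [s₁, h2]
  simp only [wp_seq, wp_ite, wp_block_one, wp_block_cons, Instr.Fits, Instr.apply, WordOp.eval,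
    Test.Holds, Function.update_apply, Nat.reduceEqDiff, OfNat.ofNat_ne_zero, OfNat.zero_ne_ofNat,
    OfNat.ofNat_ne_one, OfNat.one_ne_ofNat, one_ne_zero, zero_ne_one, reduceIte, true_and, f2, h7]
  set s₃ : State := _
  change wp W _ _ s₃
  set S := ∑ q ∈ Finset.range M, s.rarr 0 q with hS
  refine wp.mono (wp_forTo (lo := 0) (hi := K) (fun i s' =>
    s'.rreg 1 = (2 * i + 1) * S) (fun _ => 2)
    (by simp [s₃]) (by change s₂.wreg 1 = K; rw [hF₂.w 1]; simp [s₁, h1])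
    (by change s₂.wreg 3 = 1; rw [hF₂.w 3]; simp [s₁, h3]) (Nat.zero_le _) hK
    (by simp [s₃, hS]) ?_) ?_
  · rintro p s' - hp h18 hF hI
    have e7 : s'.rreg 7 = S := by rw [hF.r 7]; exact h7
    simp only [wp_seq, wp_ite, wp_block_one, wp_block_cons, Instr.Fits, Instr.apply,
      WordOp.eval, Test.Holds, Function.update_apply, Nat.reduceEqDiff, OfNat.ofNat_ne_zero,
      OfNat.zero_ne_ofNat, OfNat.ofNat_ne_one, OfNat.one_ne_ofNat, one_ne_zero, zero_ne_one,
      reduceIte, true_and, h18, e7, hI]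
    refine ⟨by omega, ?_⟩
    change (2 * (p : ℝ) + 1) * S + S + S = _
    push_cast
    ring
  rintro t₄ s₄ hF₄ ⟨ht₄, h1', -⟩
  simp only [Finset.sum_const, Nat.card_Ico, smul_eq_mul] at ht₄
  simp only [wp_seq, wp_ite, wp_block_one, wp_block_cons, Instr.Fits, Instr.apply, WordOp.eval,
    Test.Holds, Function.update_apply, Nat.reduceEqDiff, OfNat.ofNat_ne_zero, OfNat.zero_ne_ofNat,
    OfNat.ofNat_ne_one, OfNat.one_ne_ofNat, one_ne_zero, zero_ne_one, reduceIte, true_and, h1']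
  exact ⟨by omega, trivial⟩

/-- Initialize the heap. -/
def fillHeap : Prog :=
  .seq (block [.wop .add 22 6 6, .wmove 18 2]) (forTo 18 22 (block [.rstore 2 18 1]))

theorem wp_fillHeap {s : State} (hE : PreEnv G W H M s) :
    wp W fillHeap (fun t s' => t ≤ 6 * 2 ^ H + 3 ∧ IsMinTree (2 ^ H) (s'.rarr 2) ∧
      ∀ p < 2 ^ H, s'.rarr 2 (2 ^ H + p) = s.rreg 1) s := by
  have hcap := hE.cap
  unfold fillHeap
  simp only [wp_seq, wp_ite, wp_block_one, wp_block_cons, Instr.Fits, Instr.apply, WordOp.eval,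
    Test.Holds, Function.update_apply, Nat.reduceEqDiff, OfNat.ofNat_ne_zero, OfNat.zero_ne_ofNat,
    OfNat.ofNat_ne_one, OfNat.one_ne_ofNat, one_ne_zero, zero_ne_one, reduceIte, true_and,
    hE.zero, hE.leaves]
  refine ⟨by omega, ?_⟩
  set s₁ : State := _
  change wp W _ _ s₁
  have hE₁ : PreEnv G W H M s₁ := hE.of_eq
  refine wp.mono (wp_forTo (lo := 0) (hi := 2 ^ H + 2 ^ H) (fun p s' =>
    ∀ q < p, s'.rarr 2 q = s.rreg 1) (fun _ => 1)
    (by simp [s₁]) (by simp [s₁]) hE₁.one (Nat.zero_le _) (by omega) (fun q h => by omega) ?_) ?_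
  · rintro p s' - hp h18 hF hI
    have e1 : s'.rreg 1 = s.rreg 1 := hF.r 1
    simp only [wp_seq, wp_ite, wp_block_one, wp_block_cons, Instr.Fits, Instr.apply,
      WordOp.eval, Test.Holds, Function.update_apply, Nat.reduceEqDiff, OfNat.ofNat_ne_zero,
      OfNat.zero_ne_ofNat, OfNat.ofNat_ne_one, OfNat.one_ne_ofNat, one_ne_zero, zero_ne_one,
      reduceIte, true_and, h18, e1]
    refine ⟨by omega, fun q hq => ?_⟩
    rcases Nat.lt_succ_iff_lt_or_eq.1 hq with h | rfl
    · simpa [State.setW, Function.update_apply, h.ne] using hI q h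
    · simp [State.setW]
  · rintro t s' hF ⟨ht, hI, -⟩
    simp only [Finset.sum_const, Nat.card_Ico, smul_eq_mul] at ht
    refine ⟨by omega, fun v h1 h2 => ?_, fun p hp => hI _ (by omega)⟩
    rw [hI v (by omega), hI _ (by omega), hI _ (by omega), min_self]

/-- Initialize the distances. -/
def fillDist : Prog :=
  .seq (block [.wmove 18 2]) (forTo 18 0 (block [.rstore 5 18 1]))

theorem wp_fillDist {s : State} (hE : Env G W H M s) :
    wp W fillDist (fun t s' => t ≤ 3 * G.n + 2 ∧ ∀ x < G.n, s'.rarr 5 x = s.rreg 1) s := by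
  have hcap := hE.cap
  have hroom := hE.room
  unfold fillDist
  simp only [wp_seq, wp_ite, wp_block_one, wp_block_cons, Instr.Fits, Instr.apply, WordOp.eval,
    Test.Holds, Function.update_apply, Nat.reduceEqDiff, OfNat.ofNat_ne_zero, OfNat.zero_ne_ofNat,
    OfNat.ofNat_ne_one, OfNat.one_ne_ofNat, one_ne_zero, zero_ne_one, reduceIte, true_and,
    hE.zero]
  set s₁ : State := _
  change wp W _ _ s₁
  have hE₁ : Env G W H M s₁ := hE.of_eq
  refine wp.mono (wp_forTo (lo := 0) (hi := G.n) (fun p s' =>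
    ∀ q < p, s'.rarr 5 q = s.rreg 1) (fun _ => 1)
    (by simp [s₁]) hE₁.n hE₁.one (Nat.zero_le _) (by omega) (fun q h => by omega) ?_) ?_
  · rintro p s' - hp h18 hF hI
    have e1 : s'.rreg 1 = s.rreg 1 := hF.r 1
    simp only [wp_seq, wp_ite, wp_block_one, wp_block_cons, Instr.Fits, Instr.apply,
      WordOp.eval, Test.Holds, Function.update_apply, Nat.reduceEqDiff, OfNat.ofNat_ne_zero,
      OfNat.zero_ne_ofNat, OfNat.ofNat_ne_one, OfNat.one_ne_ofNat, one_ne_zero, zero_ne_one,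
      reduceIte, true_and, h18, e1]
    refine ⟨by omega, fun q hq => ?_⟩
    rcases Nat.lt_succ_iff_lt_or_eq.1 hq with h | rfl
    · simpa [State.setW, Function.update_apply, h.ne] using hI q h
    · simp [State.setW]
  · rintro t s' hF ⟨ht, hI, -⟩
    simp only [Finset.sum_const, Nat.card_Ico, smul_eq_mul] at ht
    exact ⟨by omega, hI⟩

/-- Flip the coins for one vertex. -/
def sampleVertex : Prog :=
  .seq (block [.wmove 18 2, .wmove 19 2, .wmove 22 3])
  (.seq (forTo 18 9 (block [.flip 21, .wop .mul 22 22 21, .wop .add 19 19 22]))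
  (block [.wop .div 19 19 8, .wstore 4 12 19]))

/-- Register `22` stays 1 exactly as long as all flips have been heads, so adding it up counts the
initial heads. All J coins are consumed even after a tail, so that each vertex owns a fixed block of
positions. -/
theorem wp_sampleVertex {s : State} {J : ℕ} (hE : Env G W H M s) (h9 : s.wreg 9 = J)
    (hJ : J + 1 < W) :
    wp W sampleVertex (fun t s' => t ≤ 5 * J + 6 ∧
      s'.warr 4 = Function.update (s.warr 4) (s.wreg 12) (lead J s.coins / s.wreg 8) ∧
      s'.coins = fun t => s.coins (J + t)) s := by
  have hcap := hE.cap
  have hroom := hE.room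
  unfold sampleVertex
  simp only [wp_seq, wp_ite, wp_block_one, wp_block_cons, Instr.Fits, Instr.apply, WordOp.eval,
    Test.Holds, Function.update_apply, Nat.reduceEqDiff, OfNat.ofNat_ne_zero, OfNat.zero_ne_ofNat,
    OfNat.ofNat_ne_one, OfNat.one_ne_ofNat, one_ne_zero, zero_ne_one, reduceIte, true_and,
    hE.zero, hE.one]
  set s₁ : State := _
  change wp W _ _ s₁
  refine wp.mono (wp_forTo (lo := 0) (hi := J) (fun t s' =>
    (s'.coins = fun u => s.coins (t + u)) ∧ s'.wreg 19 = lead t s.coins ∧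
    s'.wreg 22 = if ∀ u < t, s.coins u = true then 1 else 0) (fun _ => 3)
    (by simp [s₁]) (by simp [s₁, h9]) (by simp [s₁, hE.one]) (Nat.zero_le _) (by omega)
    ⟨by simp [s₁], by simp [s₁, lead], by simp [s₁]⟩ ?_) ?_
  · rintro t s' - ht h18 hF ⟨i1, i2, i3⟩
    have hlead := lead_le t s.coins
    have hc : s'.coins 0 = s.coins t := by rw [i1]; rfl
    -- The product of the indicator of heads so far and the new coin is the indicator that includes
    -- the new coin.
    have hmul : (if ∀ u < t, s.coins u = true then 1 else 0) * (s.coins t).toNat =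
        if ∀ u ≤ t, s.coins u = true then 1 else 0 := by
      by_cases h1 : ∀ u < t, s.coins u = true
      · rw [if_pos h1, one_mul]
        cases h2 : s.coins t
        · rw [if_neg]
          · rfl
          · intro h
            rw [h t le_rfl] at h2
            cases h2
        · rw [if_pos]
          · rfl
          · intro u hu
            rcases hu.eq_or_lt with rfl | hu
            · exact h2
            · exact h1 u hu
      · rw [if_neg h1, zero_mul, if_neg fun h => h1 fun u hu => h u hu.le]
    simp only [wp_seq, wp_ite, wp_block_one, wp_block_cons, Instr.Fits, Instr.apply,
      WordOp.eval, Test.Holds, Function.update_apply, Nat.reduceEqDiff, OfNat.ofNat_ne_zero,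
      OfNat.zero_ne_ofNat, OfNat.ofNat_ne_one, OfNat.one_ne_ofNat, one_ne_zero, zero_ne_one,
      reduceIte, true_and, i2, i3, hc, hmul, ← lead_succ]
    have := lead_le (t + 1) s.coins
    refine ⟨by omega, by split_ifs <;> omega, by omega, by omega, ?_, rfl, ?_⟩
    · change (fun j => s'.coins (j + 1)) = _
      rw [i1]
      funext u
      exact congrArg s.coins (by omega : t + (u + 1) = t + 1 + u)
    · simp only [Nat.lt_succ_iff]
      rfl
  · rintro t s₂ hF ⟨ht, ⟨i1, i2, i3⟩, -⟩
    simp only [Finset.sum_const, Nat.card_Ico, smul_eq_mul] at ht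
    have e8 : s₂.wreg 8 = s.wreg 8 := hF.w 8
    have e12 : s₂.wreg 12 = s.wreg 12 := hF.w 12
    have e4 : s₂.warr 4 = s.warr 4 := hF.wa 4
    have := lead_le J s.coins
    have := Nat.div_le_self (lead J s.coins) (s.wreg 8)
    simp only [wp_seq, wp_ite, wp_block_one, wp_block_cons, Instr.Fits, Instr.apply,
      WordOp.eval, Test.Holds, Function.update_apply, Nat.reduceEqDiff, OfNat.ofNat_ne_zero,
      OfNat.zero_ne_ofNat, OfNat.ofNat_ne_one, OfNat.one_ne_ofNat, one_ne_zero, zero_ne_one,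
      reduceIte, true_and, i2, e8, e12]
    exact ⟨by omega, by omega, by rw [e4], i1⟩

/-- Choose the levels of the vertices. -/
def sample : Prog := .seq (block [.wmove 12 2]) (forTo 12 0 sampleVertex)

theorem wp_sample {s : State} {J : ℕ} (hE : Env G W H M s) (h9 : s.wreg 9 = J) (hJ : J + 1 < W) :
    wp W sample (fun t s' => t ≤ G.n * (5 * J + 8) + 2 ∧
      ∀ v < G.n, s'.warr 4 v = lead J (fun t => s.coins (v * J + t)) / s.wreg 8) s := by
  have hcap := hE.cap
  have hroom := hE.room
  unfold sample
  simp only [wp_seq, wp_ite, wp_block_one, wp_block_cons, Instr.Fits, Instr.apply, WordOp.eval,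
    Test.Holds, Function.update_apply, Nat.reduceEqDiff, OfNat.ofNat_ne_zero, OfNat.zero_ne_ofNat,
    OfNat.ofNat_ne_one, OfNat.one_ne_ofNat, one_ne_zero, zero_ne_one, reduceIte, true_and,
    hE.zero]
  set s₁ : State := _
  change wp W _ _ s₁
  have hE₁ : Env G W H M s₁ := hE.of_eq
  refine wp.mono (wp_forTo (lo := 0) (hi := G.n) (fun v s' =>
    (s'.coins = fun t => s.coins (v * J + t)) ∧
    ∀ u < v, s'.warr 4 u = lead J (fun t => s.coins (u * J + t)) / s.wreg 8) (fun _ => 5 * J + 6)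
    (by simp [s₁]) hE₁.n hE₁.one (Nat.zero_le _) (by omega)
    ⟨by simp [s₁], fun q h => by omega⟩ ?_) ?_
  · rintro v s' - hv h12 hF ⟨i1, i2⟩
    have hE' : Env G W H M s' := hE₁.frame hF
    have e8 : s'.wreg 8 = s.wreg 8 := hF.w 8
    refine wp.mono (wp_sampleVertex (J := J) hE' (by rw [hF.w 9]; exact h9) hJ) ?_
    rintro t s₂ hF₂ ⟨ht, g4, gc⟩
    rw [h12, i1, e8] at g4
    rw [i1] at gc
    refine ⟨ht, ?_, fun u hu => ?_⟩
    · change s₂.coins = _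
      have : ∀ t, v * J + (J + t) = (v + 1) * J + t := fun t => by ring
      simp only [gc, this]
    · change s₂.warr 4 u = _
      rw [g4]
      rcases Nat.lt_succ_iff_lt_or_eq.1 hu with h | rfl
      · rw [Function.update_of_ne h.ne, i2 u h]
      · rw [Function.update_self]
  · rintro t s₂ hF ⟨ht, ⟨-, i2⟩, -⟩
    simp only [Finset.sum_const, Nat.card_Ico, smul_eq_mul] at ht
    simp only [Nat.sub_zero, add_assoc, Nat.reduceAdd] at ht
    exact ⟨by omega, i2⟩

end RealRAM

/-! ### Blocks, number and total length of the entries -/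

namespace Net

variable {G : Net} {M : ℕ} {off adj : ℕ → ℕ} {len : ℕ → ℝ}

theorem Entries.off_le (h : G.Entries M off adj len) {x y : ℕ} (hxy : x ≤ y) (hy : y ≤ G.n) :
    off x ≤ off y := by
  induction y, hxy using Nat.le_induction with
  | base => exact le_rfl
  | succ y hxy ih => exact (ih (by omega)).trans (h.mono y hy)

theorem Entries.block_unique (h : G.Entries M off adj len) {x y p : ℕ} (hx : x < G.n) (hy : y < G.n)
    (h1 : off x ≤ p) (h2 : p < off (x + 1)) (h3 : off y ≤ p) (h4 : p < off (y + 1)) : x = y := by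
  rcases lt_trichotomy x y with hlt | heq | hlt
  · have := h.off_le (x := x + 1) hlt hy.le
    omega
  · exact heq
  · have := h.off_le (x := y + 1) hlt hx.le
    omega

theorem Entries.exists_block (h : G.Entries M off adj len) {p : ℕ} (hp : p < M) :
    ∃ x < G.n, off x ≤ p ∧ p < off (x + 1) := by
  have key : ∀ m ≤ G.n, p < off m → ∃ x < m, off x ≤ p ∧ p < off (x + 1) := by
    intro m
    induction m with
    | zero => intro _ h0; rw [h.zero] at h0; omega
    | succ m ih =>
      intro hm hlt
      rcases Nat.lt_or_ge p (off m) with h1 | h1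
      · obtain ⟨x, hx, h2⟩ := ih (by omega) h1
        exact ⟨x, by omega, h2⟩
      · exact ⟨m, by omega, h1, hlt⟩
  exact key G.n le_rfl (by rw [h.last]; exact hp)

theorem Entries.len_pos (h : G.Entries M off adj len) {p : ℕ} (hp : p < M) : 0 < len p := by
  obtain ⟨x, hx, h1, h2⟩ := h.exists_block hp
  obtain ⟨h3, h4⟩ := h.edge x hx p h1 h2
  rw [h4]
  exact G.pos h3

/-- Lists without repetitions have at most n entries. The quadratic bound makes the height H of the
trees O(log n) and lets the addresses fit into words. -/
theorem Entries.le_sq (h : G.Entries M off adj len) : M ≤ G.n * G.n := by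
  have key : ∀ m ≤ G.n, off m ≤ m * G.n := by
    intro m
    induction m with
    | zero => intro _; rw [h.zero]; omega
    | succ m ih =>
      intro hm
      have h1 := Finset.card_le_card_of_injOn (s := Finset.Ico (off m) (off (m + 1)))
        (t := Finset.range G.n) adj
        (fun p hp => by
          simp only [Finset.coe_Ico, Set.mem_Ico] at hp
          simpa using G.lt (G.symm (h.edge m hm p hp.1 hp.2).1))
        (fun p hp q hq e => by
          simp only [Finset.coe_Ico, Set.mem_Ico] at hp hq
          exact h.inj m hm p q hp.1 hp.2 hq.1 hq.2 e)
      rw [Nat.card_Ico, Finset.card_range] at h1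
      have := ih (by omega)
      have : (m + 1) * G.n = m * G.n + G.n := by ring
      omega
  have := key G.n le_rfl
  rwa [h.last] at this

/-- A simple cycle leaves its vertices through entries of different blocks, so its edges use
distinct entries of the sum. -/
theorem Entries.pathLen_le (h : G.Entries M off adj len) {c : ℕ → ℕ} {m : ℕ} (hc : G.Cyc c m) :
    G.pathLen c m ≤ ∑ p ∈ Finset.range M, len p := by
  choose f h1 h2 h3 using fun t => h.surj (c t) (c (t + 1)) (hc.adj t)
  have hlen : ∀ t, G.len (c t) (c (t + 1)) = len (f t) := fun t => by
    rw [(h.edge _ (hc.lt t) _ (h1 t) (h2 t)).2, h3]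
  unfold pathLen
  rw [Finset.sum_congr rfl fun t _ => hlen t,
    ← Finset.sum_image (g := f) (f := len) (s := Finset.range m)]
  · refine Finset.sum_le_sum_of_subset_of_nonneg (fun p hp => ?_) fun p hp _ => ?_
    · obtain ⟨t, -, rfl⟩ := Finset.mem_image.1 hp
      have := h.le_last (c t + 1) (hc.lt t)
      rw [Finset.mem_range]
      exact (h2 t).trans_le this
    · exact (h.len_pos (Finset.mem_range.1 hp)).le
  · intro t ht t' ht' e
    simp only [Finset.coe_range, Set.mem_Iio] at ht ht'
    refine hc.inj t ht t' ht' (h.block_unique (hc.lt t) (hc.lt t') (h1 t) (h2 t) ?_ ?_)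
    · rw [e]; exact h1 t'
    · rw [e]; exact h2 t'

end Net

/-! ### The complete program -/

namespace RealRAM

variable {G : Net} {W H M : ℕ}

/-- Write the output. -/
def output : Prog :=
  .seq (block [.wmove 18 2]) (.seq (forTo 18 10 (block [.wop .add 19 28 18, .wload 20 10 19,
    .wstore 0 18 20])) (block [.wmove 0 10]))

theorem wp_output {s : State} (hE : Env G W H M s)
    (h : s.wreg 10 = 0 ∨ s.wreg 28 + s.wreg 10 ≤ 2 * G.n) :
    wp W output (fun t s' => t ≤ 10 * G.n + 3 ∧ s'.wreg 0 = s.wreg 10 ∧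
      ∀ i < s.wreg 10, s'.warr 0 i = s.warr 10 (s.wreg 28 + i)) s := by
  have hcap := hE.cap
  have hroom := hE.room
  unfold output
  simp only [wp_seq, wp_ite, wp_block_one, wp_block_cons, Instr.Fits, Instr.apply, WordOp.eval,
    Test.Holds, Function.update_apply, Nat.reduceEqDiff, OfNat.ofNat_ne_zero, OfNat.zero_ne_ofNat,
    OfNat.ofNat_ne_one, OfNat.one_ne_ofNat, one_ne_zero, zero_ne_one, reduceIte, true_and,
    hE.zero]
  set s₁ : State := _
  change wp W _ _ s₁
  refine wp.mono (wp_forTo (lo := 0) (hi := s.wreg 10) (fun v s' =>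
    ∀ i < v, s'.warr 0 i = s.warr 10 (s.wreg 28 + i)) (fun _ => 3)
    (by simp [s₁]) (by simp [s₁]) (by simp [s₁, hE.one]) (Nat.zero_le _) (by omega)
    (fun q h => by omega) ?_) ?_
  · rintro v s' - hv h18 hF hI
    have e28 : s'.wreg 28 = s.wreg 28 := hF.w 28
    have e10 : s'.warr 10 = s.warr 10 := hF.wa 10
    simp only [wp_seq, wp_ite, wp_block_one, wp_block_cons, Instr.Fits, Instr.apply,
      WordOp.eval, Test.Holds, Function.update_apply, Nat.reduceEqDiff, OfNat.ofNat_ne_zero,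
      OfNat.zero_ne_ofNat, OfNat.ofNat_ne_one, OfNat.one_ne_ofNat, one_ne_zero, zero_ne_one,
      reduceIte, true_and, h18, e28, e10]
    refine ⟨by omega, by omega, fun i hi => ?_⟩
    rcases Nat.lt_succ_iff_lt_or_eq.1 hi with h | rfl
    · simpa [State.setW, Function.update_apply, h.ne] using hI i h
    · simp [State.setW]
  · rintro t s₂ hF ⟨ht, hI, -⟩
    simp only [Finset.sum_const, Nat.card_Ico, smul_eq_mul] at ht
    have e10 : s₂.wreg 10 = s.wreg 10 := hF.w 10
    simp only [wp_seq, wp_ite, wp_block_one, wp_block_cons, Instr.Fits, Instr.apply,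
      WordOp.eval, Test.Holds, Function.update_apply, Nat.reduceEqDiff, OfNat.ofNat_ne_zero,
      OfNat.zero_ne_ofNat, OfNat.ofNat_ne_one, OfNat.one_ne_ofNat, one_ne_zero, zero_ne_one,
      reduceIte, true_and, e10]
    exact ⟨by omega, hI⟩

/-- The program for graphs with at least one edge. -/
def main : Prog :=
  .seq sizes (.seq trivialBound (.seq fillHeap (.seq sortLists (.seq sample (.seq fillDist
    (.seq (block [.wmove 11 1]) (.seq levels output)))))))

/-- Each vertex belongs to one level, so the costs of the searches collapse to a single sum over all
clusters. -/
theorem sum_levelCost {K : ℕ} {lev : ℕ → ℕ} (hlev : ∀ w, lev w < K) :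
    ∑ i ∈ Finset.range K, (levelCost G H M lev i + 2) =
      600 * (H + 1) * (∑ w ∈ Finset.range G.n, (G.cluster lev w).card + 2 * G.n) +
        K * (30 * M + 8 * 2 ^ H + 30 * G.n + 32) := by
  simp only [levelCost, add_assoc, Finset.sum_add_distrib, Finset.sum_const, Finset.card_range,
    smul_eq_mul, ← Finset.mul_sum]
  rw [Finset.sum_comm]
  have : ∀ w ∈ Finset.range G.n, ∑ i ∈ Finset.range K,
      (if lev w = i then 300 * (H + 1) * ((G.cluster lev w).card + 2) else 0) =
      300 * (H + 1) * ((G.cluster lev w).card + 2) := fun w _ => by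
    rw [Finset.sum_ite_eq, if_pos (Finset.mem_range.2 (hlev w))]
  rw [Finset.sum_congr rfl this, ← Finset.mul_sum, Finset.sum_add_distrib, Finset.sum_const,
    Finset.card_range, smul_eq_mul]
  ring

/-- To be read with L = ⌊log₂ n⌋ + 1, N = 2^H and S the total size of the clusters. K ≤ L is what
allows linear work per level. -/
theorem total_cost {n M N L K J H S : ℕ} (hL : 1 ≤ L) (hn : 1 ≤ n) (hK : K ≤ L) (hJ : J ≤ 2 * L)
    (hN : N ≤ 2 * (M + n + 1)) (hH : H + 1 ≤ 4 * L) :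
    10 * (M + n + 1) + 4 * M + 4 * K + 6 * N + 30 * (H + 1) * (M + n) + n * (5 * J + 8) +
      3 * n + (600 * (H + 1) * (S + 2 * n) + K * (30 * M + 8 * N + 30 * n + 32)) + 10 * n + 60 ≤
      6000 * L * (M + n + S) := by
  have e1 : M ≤ L * M := Nat.le_mul_of_pos_left _ hL
  have e2 : n ≤ L * n := Nat.le_mul_of_pos_left _ hL
  have e3 : L ≤ L * n := Nat.le_mul_of_pos_right _ hn
  have e4 : (H + 1) * (M + n) ≤ 4 * (L * M) + 4 * (L * n) := by nlinarith
  have e5 : (H + 1) * (S + 2 * n) ≤ 4 * (L * S) + 8 * (L * n) := by nlinarith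
  have e6 : n * (5 * J + 8) ≤ 10 * (L * n) + 8 * n := by nlinarith
  have e7 : K * (30 * M + 8 * N + 30 * n + 32) ≤ L * (46 * M + 46 * n + 48) :=
    Nat.mul_le_mul hK (by omega)
  have e8 : L * (46 * M + 46 * n + 48) = 46 * (L * M) + 46 * (L * n) + 48 * L := by ring
  have e9 : 6000 * L * (M + n + S) = 6000 * (L * M) + 6000 * (L * n) + 6000 * (L * S) := by ring
  have e10 : 30 * (H + 1) * (M + n) = 30 * ((H + 1) * (M + n)) := by ring
  have e11 : 600 * (H + 1) * (S + 2 * n) = 600 * ((H + 1) * (S + 2 * n)) := by ring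
  omega

/-- Holds for every sequence of coins: the time is bounded through the clusters that these coins
determine, and the quality of the cycle does not depend on them. -/
theorem wp_main {s : State} {n k : ℕ} (hn : G.n = n) (hn2 : 2 ≤ n) (hk : 1 ≤ k) (hM : 0 < M)
    (hW : 8 * (M + n + 1) + 8 ≤ W) (h0 : s.wreg 0 = n) (h1 : s.wreg 1 = k) (h2 : s.wreg 2 = 0)
    (h3 : s.wreg 3 = 1) (h4 : s.wreg 4 = 2) (h5 : s.wreg 5 = M) (h10 : s.wreg 10 = 0)
    (hr0 : s.rreg 0 = 0) (hvis : ∀ x, s.warr 5 x = 0)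
    (hL : G.Entries M (s.warr 0) (s.warr 1) (s.rarr 0)) :
    wp W main (fun t s' => t ≤ 6000 * (Nat.log 2 n + 1) *
        (M + n + ∑ w ∈ Finset.range n, (G.cluster (coinLevel n k s.coins) w).card) ∧
      ∀ c m, G.Cyc c m → ∃ c', G.Cyc c' (s'.wreg 0) ∧ (∀ i < s'.wreg 0, s'.warr 0 i = c' i) ∧
        G.pathLen c' (s'.wreg 0) ≤ 4 * numLevels n k / 3 * G.pathLen c m) s := by
  have hlogn : Nat.log 2 n < n := Nat.log_lt_self 2 (by omega)
  have hKL : numLevels n k ≤ Nat.log 2 n + 1 := min_le_right _ _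
  have hK1 := numLevels_pos (n := n) hk
  have hJ := numFlips_le (n := n) hk
  have hsq := hL.le_sq
  rw [hn] at hsq
  unfold main
  rw [wp_seq]
  refine wp.mono (wp_sizes h0 h1 h2 h3 h5 (by omega) hk hW) ?_
  rintro t₁ s₁ hF₁ ⟨ht₁, ⟨H, h6, hH1, hH2⟩, g1, g8, g9⟩
  rw [wp_seq]
  refine wp.mono (wp_trivialBound (s := s₁) (M := M) g1 (by rw [hF₁.w 2, h2]) (by rw [hF₁.w 3, h3])
    (by rw [hF₁.w 5, h5]) (by rw [hF₁.r 0, hr0]) (by omega) (by omega)) ?_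
  rintro t₂ s₂ hF₂ ⟨ht₂, hr2, hr1⟩
  rw [hF₁.ra 0] at hr1
  set S := ∑ p ∈ Finset.range M, s.rarr 0 p with hS
  have hSpos : 0 < S := Finset.sum_pos (fun p hp => hL.len_pos (Finset.mem_range.1 hp))
    ⟨0, Finset.mem_range.2 hM⟩
  have hKr : (1 : ℝ) ≤ numLevels n k := by exact_mod_cast hK1
  have hbig : S < s₂.rreg 1 := by rw [hr1]; nlinarith
  have hP₂ : PreEnv G W H M s₂ := by
    constructor
    · rw [hF₂.w 0, hF₁.w 0, h0, hn]
    · rw [hF₂.w 2, hF₁.w 2, h2]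
    · rw [hF₂.w 3, hF₁.w 3, h3]
    · rw [hF₂.w 4, hF₁.w 4, h4]
    · rw [hF₂.w 5, hF₁.w 5, h5]
    · rw [hF₂.w 6, h6]
    · rw [hF₂.r 0, hF₁.r 0, hr0]
    · intro p hp
      rw [hF₂.ra 0, hF₁.ra 0]
      refine lt_of_le_of_lt ?_ hbig
      exact Finset.single_le_sum (f := s.rarr 0)
        (fun q hq => (hL.len_pos (Finset.mem_range.1 hq)).le) (Finset.mem_range.2 hp)
    · omega
    · omega
    · rw [hF₂.wa 0, hF₁.wa 0, hF₂.wa 1, hF₁.wa 1, hF₂.ra 0, hF₁.ra 0]; exact hL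
  rw [wp_seq]
  refine wp.mono (wp_fillHeap hP₂) ?_
  rintro t₃ s₃ hF₃ ⟨ht₃, hT₃, hl₃⟩
  have hP₃ : PreEnv G W H M s₃ := hP₂.frame hF₃
  rw [wp_seq]
  refine wp.mono (wp_sortLists hP₃ hT₃ (by rw [hF₃.r 1]; exact hl₃)) ?_
  rintro t₄ s₄ hF₄ ⟨ht₄, hT₄, hl₄, hcsr⟩
  have hP₄ : PreEnv G W H M s₄ := hP₃.frame hF₄
  have r1₄ : s₄.rreg 1 = s₂.rreg 1 := by rw [hF₄.r 1, hF₃.r 1]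
  have hE₄ : Env G W H M s₄ :=
    ⟨hP₄.n, hP₄.zero, hP₄.one, hP₄.two, hP₄.entries, hP₄.leaves, hP₄.rzero,
      by rw [r1₄]; linarith, hP₄.cap, hP₄.room, hcsr⟩
  have w9₄ : s₄.wreg 9 = numFlips n k := by rw [hF₄.w 9, hF₃.w 9, hF₂.w 9, g9]
  have w8₄ : s₄.wreg 8 = flipsPerLevel n k := by rw [hF₄.w 8, hF₃.w 8, hF₂.w 8, g8]
  have c₄ : s₄.coins = s.coins := by rw [hF₄.coins, hF₃.coins, hF₂.coins, hF₁.coins]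
  rw [wp_seq]
  refine wp.mono (wp_sample hE₄ w9₄ (by omega)) ?_
  rintro t₅ s₅ hF₅ ⟨ht₅, hlev₅⟩
  rw [w8₄, c₄] at hlev₅
  have hE₅ : Env G W H M s₅ := hE₄.frame hF₅
  rw [wp_seq]
  refine wp.mono (wp_fillDist hE₅) ?_
  rintro t₆ s₆ hF₆ ⟨ht₆, hd₆⟩
  have hE₆ : Env G W H M s₆ := hE₅.frame hF₆
  have r1₆ : s₆.rreg 1 = s₂.rreg 1 := by rw [hF₆.r 1, hF₅.r 1, r1₄]
  have r2₆ : s₆.rreg 2 = s₂.rreg 2 := by rw [hF₆.r 2, hF₅.r 2, hF₄.r 2, hF₃.r 2]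
  have w10₆ : s₆.wreg 10 = 0 := by
    rw [hF₆.w 10, hF₅.w 10, hF₄.w 10, hF₃.w 10, hF₂.w 10, hF₁.w 10, h10]
  have w1₆ : s₆.wreg 1 = numLevels n k := by
    rw [hF₆.w 1, hF₅.w 1, hF₄.w 1, hF₃.w 1, hF₂.w 1, g1]
  have a4₆ : s₆.warr 4 = s₅.warr 4 := hF₆.wa 4
  have a2₆ : s₆.rarr 2 = s₄.rarr 2 := by rw [hF₆.ra 2, hF₅.ra 2]
  have a5₆ : s₆.warr 5 = s.warr 5 := by
    rw [hF₆.wa 5, hF₅.wa 5, hF₄.wa 5, hF₃.wa 5, hF₂.wa 5, hF₁.wa 5]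
  simp only [wp_seq, wp_ite, wp_block_one, wp_block_cons, Instr.Fits, Instr.apply, WordOp.eval,
    Test.Holds, Function.update_apply, Nat.reduceEqDiff, OfNat.ofNat_ne_zero, OfNat.zero_ne_ofNat,
    OfNat.ofNat_ne_one, OfNat.one_ne_ofNat, one_ne_zero, zero_ne_one, reduceIte, true_and, w1₆]
  set s₇ : State := _
  change wp W _ _ s₇
  set lev := coinLevel n k s.coins with hlevdef
  have hlevlt : ∀ w, lev w < numLevels n k := coinLevel_lt hk s.coins
  have hI : LevelInv G W H M (numLevels n k) lev (numLevels n k) s₇ := by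
    refine ⟨hE₆.of_eq, ⟨?_, ?_, ?_⟩, .inl ⟨w10₆, ?_⟩, ?_, fun x hx => ?_, fun x hx => .inl ?_,
      fun a _ ha => ?_, fun i h1 h2 => ?_⟩
    · change IsMinTree _ (s₆.rarr 2); rw [a2₆]; exact hT₄
    · change ∀ p < _, s₆.rarr 2 _ = s₆.rreg 1
      rw [a2₆, r1₆, ← hF₃.r 1]
      intro p hp
      rw [hl₄ p hp]
    · change ∀ x, s₆.warr 5 x = 0; rw [a5₆]; exact hvis
    · change s₆.rreg 2 = s₆.rreg 1; rw [r2₆, r1₆, hr2]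
    · change s₆.rreg 2 ≤ s₆.rreg 1; rw [r2₆, r1₆, hr2]
    · change s₆.warr 4 x = _; rw [a4₆, hlev₅ x hx]; rfl
    · change s₆.rarr 5 x = s₆.rreg 1
      rw [hd₆ x hx, hF₆.r 1]
    · have := hlevlt a; omega
    · omega
  refine wp.mono (wp_levels (s := s₇) hI (by simp [s₇]) (by omega)) ?_
  rintro t₈ s₈ hF₈ ⟨ht₈, hI₈⟩
  have r1₈ : s₈.rreg 1 = s₂.rreg 1 := by rw [hF₈.r 1]; exact r1₆
  have hcyc : ∀ c m, G.Cyc c m → s₈.rreg 2 ≤ 4 * numLevels n k / 3 * G.pathLen c m :=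
    fun c m hc => Net.le_of_steps (fun a _ => hlevlt a)
      (fun i hi => hI₈.steps i (Nat.zero_le _) hi) hc
  have hfound : s₈.wreg 10 = 0 ∨ s₈.wreg 28 + s₈.wreg 10 ≤ 2 * G.n := by
    rcases hI₈.found with ⟨h, -⟩ | ⟨c, -, -, -, h⟩
    · exact .inl h
    · exact .inr h
  refine wp.mono (wp_output hI₈.env hfound) ?_
  rintro t₉ s₉ - ⟨ht₉, h0₉, ho₉⟩
  refine ⟨?_, fun c m hc => ?_⟩
  -- With L = ⌊log₂ n⌋ + 1 and n < 2^L one has 2^H ≤ 2(n² + n + 1) < 2^(2L + 2), hence H + 1 ≤ 2L +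
  -- 2 ≤ 4L.
  · have hHL : H + 1 ≤ 4 * (Nat.log 2 n + 1) := by
      have hlt : n < 2 ^ (Nat.log 2 n + 1) := Nat.lt_pow_succ_log_self (by norm_num) n
      have e1 : n * n < 2 ^ (Nat.log 2 n + 1) * 2 ^ (Nat.log 2 n + 1) := Nat.mul_self_lt_mul_self hlt
      have e2 : 2 ^ H < 2 ^ (2 * (Nat.log 2 n + 1) + 2) := by
        rw [pow_add, two_mul, pow_add]
        have : 2 * n ≤ n * n := Nat.mul_le_mul_right n hn2
        omega
      have := (Nat.pow_lt_pow_iff_right (by norm_num : 1 < 2)).1 e2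
      omega
    have hc := total_cost (n := n) (M := M) (N := 2 ^ H) (H := H) (by omega : 1 ≤ Nat.log 2 n + 1)
      (by omega) hKL hJ hH2 hHL (S := ∑ w ∈ Finset.range n, (G.cluster lev w).card)
    rw [sum_levelCost hlevlt, hn] at ht₈
    rw [hn] at ht₄ ht₅ ht₆ ht₉
    generalize 6000 * (Nat.log 2 n + 1) * (M + n + _) = X at hc ⊢
    generalize 600 * (H + 1) * _ + _ = Y at hc ht₈
    omega
  · rw [h0₉]
    rcases hI₈.found with ⟨-, h⟩ | ⟨c', h1, h2, h3, -⟩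
    -- If no cycle is stored, B still is (2K + 1) S, although (4K/3) times a length of at most S
    -- bounds it; this is absurd as S > 0.
    · have e1 := hcyc c m hc
      have e2 := hL.pathLen_le hc
      rw [h, r1₈, hr1] at e1
      have e3 : 4 * (numLevels n k : ℝ) / 3 * G.pathLen c m ≤ 4 * (numLevels n k : ℝ) / 3 * S :=
        mul_le_mul_of_nonneg_left e2 (by positivity)
      nlinarith
    · exact ⟨c', h1, fun i hi => by rw [ho₉ i hi, h2 i hi], h3.trans (hcyc c m hc)⟩

/-- The whole program. -/
def program : Prog :=
  .seq (block [.wconst 3 1, .wconst 4 2, .wload 5 0 0])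
    (.ite (.weq 5 2) (block [.skip]) main)

theorem wp_program {s : State} {n k : ℕ} (hn : G.n = n) (hn2 : 2 ≤ n) (hk : 1 ≤ k)
    (hW : 8 * (M + n + 1) + 8 ≤ W) (h0 : s.wreg 0 = n) (h1 : s.wreg 1 = k) (h2 : s.wreg 2 = 0)
    (h10 : s.wreg 10 = 0) (hr0 : s.rreg 0 = 0) (hvis : ∀ x, s.warr 5 x = 0)
    (hL : G.Entries M (s.warr 0) (s.warr 1) (s.rarr 0)) :
    wp W program (fun t s' => t ≤ 6010 * (Nat.log 2 n + 1) *
        (M + n + ∑ w ∈ Finset.range n, (G.cluster (coinLevel n k s.coins) w).card) ∧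
      ∀ c m, G.Cyc c m → ∃ c', G.Cyc c' (s'.wreg 0) ∧ (∀ i < s'.wreg 0, s'.warr 0 i = c' i) ∧
        G.pathLen c' (s'.wreg 0) ≤ 4 * numLevels n k / 3 * G.pathLen c m) s := by
  have hlast : s.warr 0 n = M := by rw [← hn]; exact hL.last
  have hpos : 10 ≤ 10 * (Nat.log 2 n + 1) *
      (M + n + ∑ w ∈ Finset.range n, (G.cluster (coinLevel n k s.coins) w).card) := by
    rw [mul_assoc]
    exact Nat.le_mul_of_pos_right 10 (Nat.mul_pos (Nat.succ_pos _) (by omega))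
  have hsplit : 6010 * (Nat.log 2 n + 1) *
      (M + n + ∑ w ∈ Finset.range n, (G.cluster (coinLevel n k s.coins) w).card) =
      6000 * (Nat.log 2 n + 1) *
      (M + n + ∑ w ∈ Finset.range n, (G.cluster (coinLevel n k s.coins) w).card) +
      10 * (Nat.log 2 n + 1) *
      (M + n + ∑ w ∈ Finset.range n, (G.cluster (coinLevel n k s.coins) w).card) := by ring
  unfold program
  simp only [wp_seq, wp_ite, wp_block_one, wp_block_cons, Instr.Fits, Instr.apply, WordOp.eval,
    Test.Holds, Function.update_apply, Nat.reduceEqDiff, OfNat.ofNat_ne_zero, OfNat.zero_ne_ofNat,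
    OfNat.ofNat_ne_one, OfNat.one_ne_ofNat, one_ne_zero, zero_ne_one, reduceIte, true_and, h0,
    hlast, h2]
  refine ⟨by omega, by omega, ?_⟩
  -- The case without entries is separate because the initial bound would be 0; there is then no
  -- cycle to account for.
  refine ⟨fun hM => ⟨by omega, fun c m hc => ?_⟩, fun hM => ?_⟩
  · obtain ⟨p, h1, h2, -⟩ := hL.surj _ _ (hc.adj 0)
    have := hL.le_last (c 0 + 1) (hc.lt 0)
    omega
  · set s₁ : State := _
    change wp W _ _ s₁
    refine wp.mono (wp_main (s := s₁) (M := M) hn hn2 hk (by omega) hW (by simp [s₁, h0])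
      (by simp [s₁, h1]) (by simp [s₁, h2]) (by simp [s₁]) (by simp [s₁]) (by simp [s₁, h0, hlast])
      (by simp [s₁, h10]) hr0 hvis hL) ?_
    rintro t s' - ⟨ht, hC⟩
    refine ⟨?_, hC⟩
    change t ≤ 6000 * (Nat.log 2 n + 1) *
      (M + n + ∑ w ∈ Finset.range n, (G.cluster (coinLevel n k s.coins) w).card) at ht
    omega

end RealRAM

/-! ### Expected sizes of the clusters -/

namespace RealRAM

instance : IsProbabilityMeasure coinMeasure := by
  unfold coinMeasure; infer_instance

/-- Negation preserves the fair coin, so negating one coordinate preserves the product. -/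
theorem coinMeasure_map_flip (t : ℕ) :
    coinMeasure.map (fun (ω : ℕ → Bool) i => if i = t then !ω i else ω i) = coinMeasure := by
  have hf : ∀ i, Measurable fun b : Bool => if i = t then !b else b := fun i =>
    measurable_of_countable _
  have := Measure.infinitePi_map_pi (fun _ : ℕ => (PMF.uniformOfFintype Bool).toMeasure) hf
  unfold coinMeasure
  rw [this]
  congr 1
  funext i
  split_ifs with h
  · refine Measure.ext_of_singleton fun b => ?_
    rw [Measure.map_apply (measurable_of_countable _) (measurableSet_singleton _)]
    have : (fun b : Bool => !b) ⁻¹' {b} = {!b} := by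
      ext x; cases x <;> cases b <;> simp
    rw [this, PMF.toMeasure_apply_singleton _ _ (measurableSet_singleton _),
      PMF.toMeasure_apply_singleton _ _ (measurableSet_singleton _)]
    simp
  · exact Measure.map_id

theorem measurableSet_coin (t : ℕ) : MeasurableSet {ω : ℕ → Bool | ω t = true} :=
  (measurable_pi_apply (X := fun _ : ℕ => Bool) t) (measurableSet_singleton true)

theorem measurableSet_heads (p : ℕ → ℕ) (m : ℕ) :
    MeasurableSet {ω : ℕ → Bool | ∀ t < m, ω (p t) = true} := by
  have : {ω : ℕ → Bool | ∀ t < m, ω (p t) = true} = ⋂ t, ⋂ _ : t < m, {ω | ω (p t) = true} := by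
    ext; simp
  rw [this]
  exact MeasurableSet.iInter fun t => MeasurableSet.iInter fun _ => measurableSet_coin _

/-- C does not depend on the coin t, so flipping this coin exchanges the two halves of C. -/
theorem coinMeasure_flip {C : Set (ℕ → Bool)} (hC : MeasurableSet C) {t : ℕ}
    (h : ∀ ω ω' : ℕ → Bool, (∀ i, i ≠ t → ω i = ω' i) → ω ∈ C → ω' ∈ C) :
    coinMeasure C = 2 * coinMeasure (C ∩ {ω | ω t = true}) := by
  have hf : Measurable (fun (ω : ℕ → Bool) i => if i = t then !ω i else ω i) := by
    refine measurable_pi_lambda _ fun i => ?_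
    split_ifs
    · exact (measurable_of_countable (fun b : Bool => !b)).comp (measurable_pi_apply i)
    · exact measurable_pi_apply i
  have h1 : coinMeasure (C \ {ω | ω t = true}) = coinMeasure (C ∩ {ω | ω t = true}) := by
    conv_rhs => rw [← coinMeasure_map_flip t]
    rw [Measure.map_apply hf (hC.inter (measurableSet_coin t))]
    congr 1
    ext ω
    simp only [Set.mem_sdiff, Set.mem_ofPred_eq, Set.mem_preimage, Set.mem_inter_iff, if_true,
      Bool.not_eq_true, Bool.not_eq_true']
    refine and_congr_left fun _ => ⟨h _ _ fun i hi => by simp [hi], h _ _ fun i hi => by simp [hi]⟩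
  rw [← measure_inter_add_sdiff C (measurableSet_coin t), h1, two_mul]

/-- The only form of independence that is needed: m coins on which C does not depend are all heads
with conditional probability 2^(-m). -/
theorem coinMeasure_heads {C : Set (ℕ → Bool)} (hC : MeasurableSet C) (s m : ℕ)
    (h : ∀ ω ω' : ℕ → Bool, (∀ i, ¬ (s ≤ i ∧ i < s + m) → ω i = ω' i) → ω ∈ C → ω' ∈ C) :
    coinMeasure C = 2 ^ m * coinMeasure (C ∩ {ω | ∀ t < m, ω (s + t) = true}) := by
  induction m with
  | zero => simp
  | succ m ih =>
    rw [ih fun ω ω' hi => h ω ω' fun i hh => hi i (by omega),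
      coinMeasure_flip (t := s + m) (hC.inter (measurableSet_heads _ _)), pow_succ, mul_assoc]
    · rw [Set.inter_assoc]
      congr 4
      ext ω
      simp only [Set.mem_inter_iff, Set.mem_ofPred_eq, Nat.forall_lt_succ_right]
    · rintro ω ω' hi ⟨h1, h2⟩
      refine ⟨h ω ω' (fun i hh => hi i (by omega)) h1, fun t ht => ?_⟩
      rw [← hi _ (by omega)]
      exact h2 t ht

section Levels

variable {J j : ℕ}

/-- Only the top vertices of `S` among those with `i + 1` levels of heads. -/
def topSet (S : ℕ → ℕ → Prop) (N J j i w : ℕ) : Set (ℕ → Bool) :=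
  {ω | (∀ t < i * j, ω (w * J + t) = true) ∧
    ∀ a < N, S a w → ¬ ∀ t < (i + 1) * j, ω (a * J + t) = true}

theorem measurableSet_topSet (S : ℕ → ℕ → Prop) (N J j i w : ℕ) :
    MeasurableSet (topSet S N J j i w) := by
  have : topSet S N J j i w = {ω | ∀ t < i * j, ω (w * J + t) = true} ∩
      ⋂ a, ⋂ _ : a < N, ⋂ _ : S a w, {ω | ∀ t < (i + 1) * j, ω (a * J + t) = true}ᶜ := by
    ext; simp [topSet]
  rw [this]
  exact (measurableSet_heads _ _).inter (MeasurableSet.iInter fun a => MeasurableSet.iInter fun _ =>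
    MeasurableSet.iInter fun _ => (measurableSet_heads _ _).compl)

/-- Demand in addition that the next j coins of w be heads. This divides each probability by 2^j,
and the events become disjoint: w is then the first vertex, in the order S, with (i + 1) j heads.
Disjoint events have total probability at most 1. -/
theorem sum_topSet_le {S : ℕ → ℕ → Prop} (hirr : ∀ a, ¬ S a a) (htot : ∀ a b, a ≠ b → S a b ∨ S b a)
    (N : ℕ) {i : ℕ} (hi : (i + 1) * j ≤ J) :
    ∑ w ∈ Finset.range N, coinMeasure (topSet S N J j i w) ≤ 2 ^ j := by
  have hij : (i + 1) * j = i * j + j := by ring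
  -- The j new positions lie in the block of w, after those that `topSet` requires to be heads. Its
  -- second condition concerns blocks of other vertices only, because S is irreflexive.
  have h1 : ∀ w ∈ Finset.range N, coinMeasure (topSet S N J j i w) = 2 ^ j *
      coinMeasure (topSet S N J j i w ∩ {ω | ∀ t < j, ω (w * J + i * j + t) = true}) := by
    intro w _
    refine coinMeasure_heads (measurableSet_topSet ..) _ _ ?_
    rintro ω ω' hω ⟨h1, h2⟩
    refine ⟨fun t ht => ?_, fun a ha has h3 => h2 a ha has fun t ht => ?_⟩
    · rw [← hω _ (by omega)]
      exact h1 t ht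
    · rw [hω _ ?_]
      · exact h3 t ht
      · rintro ⟨h4, h5⟩
        rcases lt_trichotomy a w with h | rfl | h
        · have : (a + 1) * J ≤ w * J := Nat.mul_le_mul_right _ h
          rw [add_mul] at this
          omega
        · exact hirr _ has
        · have : (w + 1) * J ≤ a * J := Nat.mul_le_mul_right _ h
          rw [add_mul] at this
          omega
  rw [Finset.sum_congr rfl h1, ← Finset.mul_sum, ← measure_biUnion_finset]
  · exact mul_le_of_le_one_right' prob_le_one
  · have key : ∀ a b, a < N → b < N → S a b →
        Disjoint (topSet S N J j i a ∩ {ω | ∀ t < j, ω (a * J + i * j + t) = true})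
          (topSet S N J j i b ∩ {ω | ∀ t < j, ω (b * J + i * j + t) = true}) := by
      intro a b ha hb hab
      rw [Set.disjoint_left]
      rintro ω ⟨⟨h1, -⟩, h2⟩ ⟨⟨-, h3⟩, -⟩
      refine h3 a ha hab fun t ht => ?_
      rcases Nat.lt_or_ge t (i * j) with h | h
      · exact h1 t h
      · have := h2 (t - i * j) (by omega)
        rwa [add_assoc, Nat.add_sub_cancel' h] at this
    intro a ha b hb hne
    rcases htot a b hne with h | h
    · exact key a b (by simpa using ha) (by simpa using hb) h
    · exact (key b a (by simpa using hb) (by simpa using ha) h).symm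
  · exact fun w _ => (measurableSet_topSet ..).inter (measurableSet_heads _ _)

theorem coinMeasure_all_heads (s m : ℕ) :
    2 ^ m * coinMeasure {ω | ∀ t < m, ω (s + t) = true} = 1 := by
  have := coinMeasure_heads MeasurableSet.univ s m (by simp)
  rw [Set.univ_inter, measure_univ] at this
  exact this.symm

end Levels

end RealRAM

/-! ### The order of the vertices by distance from a given vertex -/

namespace Net

variable (G : Net)

/-- `a` is at least as close to `x` as `w`. -/
def AsNear (x a w : ℕ) : Prop := ∀ r, G.Walk w x r → ∃ q ≤ r, G.Walk a x q

/-- `a` precedes `w` in the order by distance from `x`. -/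
def Before (x a w : ℕ) : Prop := G.AsNear x a w ∧ (¬ G.AsNear x w a ∨ a < w)

variable {G}

/-- Sets of reals are comparable through their upward closures, so the order needs no shortest
walks, and it also covers unreachable vertices. -/
theorem asNear_total (x a w : ℕ) : G.AsNear x a w ∨ G.AsNear x w a := by
  by_contra! h
  obtain ⟨h1, h2⟩ := h
  unfold AsNear at h1 h2
  push Not at h1 h2
  obtain ⟨r, h3, h4⟩ := h1
  obtain ⟨q, h5, h6⟩ := h2
  rcases le_total r q with h | h
  · exact h6 r h h3
  · exact h4 q h h5

theorem before_irrefl (x a : ℕ) : ¬ G.Before x a a := by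
  rintro ⟨h, h' | h'⟩
  · exact h' h
  · exact lt_irrefl _ h'

theorem before_total (x a b : ℕ) (hab : a ≠ b) : G.Before x a b ∨ G.Before x b a := by
  unfold Before
  have := asNear_total (G := G) x a b
  rcases hab.lt_or_gt with h | h <;> tauto

theorem le_of_mem_cluster {lev : ℕ → ℕ} {w x a : ℕ} (hx : x ∈ G.cluster lev w) (ha : a < G.n)
    (h : G.AsNear x a w) : lev a ≤ lev w := by
  simp only [cluster, Finset.mem_filter] at hx
  obtain ⟨-, r, h1, h2⟩ := hx
  by_contra! hlt
  obtain ⟨q, h3, h4⟩ := h r h1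
  exact (h2 a ha hlt q h4).not_ge h3

end Net

namespace RealRAM

variable {G : Net}

/-- `x` can be in the cluster of the vertex `w` of level `i`. -/
def clusterEvent (G : Net) (n k x i w : ℕ) : Set (ℕ → Bool) :=
  if i + 1 < numLevels n k then
    topSet (G.Before x) G.n (numFlips n k) (flipsPerLevel n k) i w
  else {ω | ∀ t < i * flipsPerLevel n k, ω (w * numFlips n k + t) = true}

theorem measurableSet_clusterEvent (n k x i w : ℕ) :
    MeasurableSet (clusterEvent G n k x i w) := by
  unfold clusterEvent
  split_ifs
  · exact measurableSet_topSet ..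
  · exact measurableSet_heads _ _

/-- A vertex before w with one more level of heads would have a higher level and be at least as near
to x, so x would not be in the cluster of w. At the top level there is nothing above, and only the
heads of w are kept. -/
theorem mem_clusterEvent {n k : ℕ} (hk : 1 ≤ k) {ω : ℕ → Bool} {x w : ℕ}
    (hx : x ∈ G.cluster (coinLevel n k ω) w) :
    ω ∈ clusterEvent G n k x (coinLevel n k ω w) w := by
  have hlt := coinLevel_lt (n := n) hk ω w
  have h0 := (le_coinLevel_iff hlt ω w).1 le_rfl
  unfold clusterEvent
  split_ifs with h
  · refine ⟨h0, fun a ha hb h' => ?_⟩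
    have := G.le_of_mem_cluster hx ha hb.1
    have := (le_coinLevel_iff h ω a).2 h'
    omega
  · exact h0

/-- The `+ 1` in `flipsPerLevel` rounds the quotient up, so that K levels together need more than
⌊log₂ n⌋ + 1 heads. -/
theorem le_two_pow_flips {n k : ℕ} (hk : 1 ≤ k) : n ≤ 2 ^ (numLevels n k * flipsPerLevel n k) := by
  have h := numLevels_pos (n := n) hk
  refine (Nat.lt_pow_succ_log_self (by norm_num) n).le.trans
    (Nat.pow_le_pow_right (by norm_num) ?_)
  unfold flipsPerLevel
  have := Nat.lt_mul_div_succ (Nat.log 2 n + 1) h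
  exact this.le

/-- Below the top this is `sum_topSet_le`. At the top, n events of probability 2^(-(K - 1) j) sum to
at most 2^j by `le_two_pow_flips`. -/
theorem sum_clusterEvent_le {n k : ℕ} (hk : 1 ≤ k) (hn : G.n = n) (x : ℕ) {i : ℕ}
    (hi : i < numLevels n k) :
    ∑ w ∈ Finset.range n, coinMeasure (clusterEvent G n k x i w) ≤ 2 ^ flipsPerLevel n k := by
  unfold clusterEvent
  split_ifs with h
  · rw [hn]
    exact sum_topSet_le (G.before_irrefl x) (G.before_total x) n
      (Nat.mul_le_mul_right _ (by omega))
  · obtain rfl : i = numLevels n k - 1 := by omega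
    set m := (numLevels n k - 1) * flipsPerLevel n k with hm
    have e : ∀ w, coinMeasure {ω | ∀ t < m, ω (w * numFlips n k + t) = true} = (2 ^ m)⁻¹ :=
      fun w => ENNReal.eq_inv_of_mul_eq_one_left (by rw [mul_comm]; exact coinMeasure_all_heads _ m)
    simp only [e, Finset.sum_const, Finset.card_range, nsmul_eq_mul]
    rw [← div_eq_mul_inv]
    refine ENNReal.div_le_of_le_mul ?_
    rw [← pow_add]
    have h1 := le_two_pow_flips (n := n) hk
    have h2 : flipsPerLevel n k + m = numLevels n k * flipsPerLevel n k := by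
      obtain ⟨K, hK⟩ : ∃ K, numLevels n k = K + 1 := ⟨numLevels n k - 1, by omega⟩
      rw [hm, hK]
      simp; ring
    rw [h2]
    exact_mod_cast h1

/-- Only the term with i equal to the random level of w is used; summing over all i leaves events
with deterministic indices, which can be integrated. -/
theorem card_cluster_le {n k : ℕ} (hk : 1 ≤ k) (ω : ℕ → Bool) (hn : G.n = n) (w : ℕ) :
    ((G.cluster (coinLevel n k ω) w).card : ENNReal) ≤
      ∑ x ∈ Finset.range n, ∑ i ∈ Finset.range (numLevels n k),
        (clusterEvent G n k x i w).indicator 1 ω := by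
  have h1 : ((G.cluster (coinLevel n k ω) w).card : ENNReal) =
      ∑ x ∈ G.cluster (coinLevel n k ω) w, 1 := by simp
  have hsub : G.cluster (coinLevel n k ω) w ⊆ Finset.range n := by
    intro x hx
    simp only [Net.cluster, Finset.mem_filter, hn] at hx
    exact hx.1
  rw [h1]
  refine (Finset.sum_le_sum fun x hx => ?_).trans (Finset.sum_le_sum_of_subset hsub)
  refine le_trans ?_ (Finset.single_le_sum (fun _ _ => zero_le)
    (Finset.mem_range.2 (coinLevel_lt (n := n) hk ω w)))
  rw [Set.indicator_of_mem (mem_clusterEvent hk hx)]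
  rfl

/-- The expected total size of the clusters. -/
theorem lintegral_sum_card_cluster_le {n k : ℕ} (hk : 1 ≤ k) (hn : G.n = n) :
    ∫⁻ ω, ((∑ w ∈ Finset.range n, (G.cluster (coinLevel n k ω) w).card : ℕ) : ENNReal)
      ∂coinMeasure ≤ n * (numLevels n k * 2 ^ flipsPerLevel n k) := by
  have hmeas : ∀ x i w, Measurable ((clusterEvent G n k x i w).indicator (1 : (ℕ → Bool) → ENNReal)) :=
    fun x i w => measurable_one.indicator (measurableSet_clusterEvent n k x i w)
  calc
    _ ≤ ∫⁻ ω, ∑ w ∈ Finset.range n, ∑ x ∈ Finset.range n, ∑ i ∈ Finset.range (numLevels n k),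
        (clusterEvent G n k x i w).indicator 1 ω ∂coinMeasure := by
      refine lintegral_mono fun ω => ?_
      push_cast
      exact Finset.sum_le_sum fun w _ => card_cluster_le hk ω hn w
    _ = ∑ w ∈ Finset.range n, ∑ x ∈ Finset.range n, ∑ i ∈ Finset.range (numLevels n k),
        coinMeasure (clusterEvent G n k x i w) := by
      rw [lintegral_finsetSum _ fun w _ => Finset.measurable_sum _ fun x _ =>
        Finset.measurable_sum _ fun i _ => hmeas x i w]
      refine Finset.sum_congr rfl fun w _ => ?_
      rw [lintegral_finsetSum _ fun x _ => Finset.measurable_sum _ fun i _ => hmeas x i w]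
      refine Finset.sum_congr rfl fun x _ => ?_
      rw [lintegral_finsetSum _ fun i _ => hmeas x i w]
      exact Finset.sum_congr rfl fun i _ => lintegral_indicator_one
        (measurableSet_clusterEvent n k x i w)
    _ = ∑ x ∈ Finset.range n, ∑ i ∈ Finset.range (numLevels n k), ∑ w ∈ Finset.range n,
        coinMeasure (clusterEvent G n k x i w) := by
      rw [Finset.sum_comm]
      exact Finset.sum_congr rfl fun x _ => Finset.sum_comm
    _ ≤ ∑ x ∈ Finset.range n, ∑ i ∈ Finset.range (numLevels n k), 2 ^ flipsPerLevel n k :=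
      Finset.sum_le_sum fun x _ => Finset.sum_le_sum fun i hi =>
        sum_clusterEvent_le hk hn x (Finset.mem_range.1 hi)
    _ = _ := by simp

end RealRAM

/-! ### From graphs to networks -/

section Flatten

variable {α β γ : Type*}

theorem List.getElem?_flatMap (l : List α) (f : α → List β) {x t : ℕ} (hx : x < l.length)
    (ht : t < (f l[x]).length) :
    (l.flatMap f)[((l.take x).flatMap f).length + t]? = (f l[x])[t]? := by
  conv_lhs => rw [← List.take_append_drop x l, List.drop_eq_getElem_cons hx]
  rw [List.flatMap_append, List.flatMap_cons]
  have : (l.take x ++ l[x] :: l.drop (x + 1)).take x = l.take x := by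
    rw [List.take_append_of_le_length (by simp; omega)]
    simp
  rw [this, List.getElem?_append_right (by omega), Nat.add_sub_cancel_left,
    List.getElem?_append_left ht]

theorem List.length_flatMap_take_succ (l : List α) (f : α → List β) {x : ℕ} (hx : x < l.length) :
    ((l.take (x + 1)).flatMap f).length = ((l.take x).flatMap f).length + (f l[x]).length := by
  rw [List.take_add_one, List.getElem?_eq_getElem hx, List.flatMap_append, List.length_append]
  simp

theorem List.length_flatMap_map (l : List α) (f : α → List β) (g : α → β → γ) :
    (l.flatMap fun a => (f a).map (g a)).length = (l.flatMap f).length := by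
  simp [List.length_flatMap]

end Flatten

namespace WeightedGraph

variable {n : ℕ}

/-- The network of a graph on the vertices `0, …, n - 1`. -/
def net (G : SimpleGraph (Fin n)) (ℓ : Sym2 (Fin n) → ℝ) (hℓ : ∀ e ∈ G.edgeSet, 0 < ℓ e) : Net where
  n := n
  Adj x y := ∃ u v : Fin n, u.val = x ∧ v.val = y ∧ G.Adj u v
  len x y := if h : x < n ∧ y < n then ℓ s(⟨x, h.1⟩, ⟨y, h.2⟩) else 0
  symm := by
    rintro x y ⟨u, v, h1, h2, h⟩
    exact ⟨v, u, h2, h1, h.symm⟩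
  lt := by
    rintro x y ⟨u, v, h1, h2, h⟩
    omega
  irrefl := by
    rintro x ⟨u, v, h1, h2, h⟩
    exact h.ne (Fin.ext (h1.trans h2.symm))
  len_symm x y := by
    by_cases h : x < n ∧ y < n
    · rw [dif_pos h, dif_pos h.symm, Sym2.eq_swap]
    · rw [dif_neg h, dif_neg (fun h' => h h'.symm)]
  pos := by
    rintro x y ⟨u, v, rfl, rfl, h⟩
    rw [dif_pos ⟨u.2, v.2⟩]
    exact hℓ _ h

variable {G : SimpleGraph (Fin n)} {ℓ : Sym2 (Fin n) → ℝ} {hℓ : ∀ e ∈ G.edgeSet, 0 < ℓ e}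

theorem net_len (u v : Fin n) : (net G ℓ hℓ).len u v = ℓ s(u, v) := dif_pos ⟨u.2, v.2⟩

theorem net_adj {u v : Fin n} : (net G ℓ hℓ).Adj u v ↔ G.Adj u v := by
  constructor
  · rintro ⟨u', v', h1, h2, h⟩
    rwa [← Fin.ext h1, ← Fin.ext h2]
  · exact fun h => ⟨u, v, rfl, rfl, h⟩

theorem input_entries {nbrs : Fin n → List (Fin n)} (hN : IsAdjacencyList G nbrs) (k : ℕ)
    (ω : ℕ → Bool) :
    (net G ℓ hℓ).Entries ((List.finRange n).flatMap nbrs).length ((input n k ℓ nbrs ω).warr 0)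
      ((input n k ℓ nbrs ω).warr 1) ((input n k ℓ nbrs ω).rarr 0) := by
  set L := List.finRange n with hL
  set off : ℕ → ℕ := (input n k ℓ nbrs ω).warr 0 with hoff
  have hlen : L.length = n := List.length_finRange
  have hget : ∀ x : Fin n, L[x.val]'(by rw [hlen]; exact x.2) = x := fun x => by simp [hL]
  have off_eq : ∀ i ≤ n, off i = ((L.take i).flatMap nbrs).length := fun i hi => by
    simp [hoff, input, hi, hL]
  have off_succ : ∀ x : Fin n, off (x.val + 1) = off x + (nbrs x).length := fun x => by
    rw [off_eq _ x.2, off_eq _ x.2.le, List.length_flatMap_take_succ _ _ (by rw [hlen]; exact x.2),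
      hget]
  have adj_eq : ∀ (x : Fin n) t (ht : t < (nbrs x).length),
      (input n k ℓ nbrs ω).warr 1 (off x + t) = ((nbrs x)[t]).val := fun x t ht => by
    have := List.getElem?_flatMap L nbrs (x := x.val) (t := t) (by rw [hlen]; exact x.2)
      (by rw [hget]; exact ht)
    rw [hget] at this
    simp only [input, Nat.one_ne_zero, if_false, if_true]
    rw [off_eq _ x.2.le, List.getD_eq_getElem?_getD, List.getElem?_map, this,
      List.getElem?_eq_getElem ht]
    rfl
  have len_eq : ∀ (x : Fin n) t (ht : t < (nbrs x).length),
      (input n k ℓ nbrs ω).rarr 0 (off x + t) = ℓ s(x, (nbrs x)[t]) := fun x t ht => by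
    have := List.getElem?_flatMap L (fun u => (nbrs u).map fun v => ℓ s(u, v)) (x := x.val) (t := t)
      (by rw [hlen]; exact x.2) (by rw [hget]; simpa using ht)
    rw [hget, List.length_flatMap_map, ← off_eq _ x.2.le] at this
    simp only [input, if_true]
    rw [List.getD_eq_getElem?_getD, this, List.getElem?_map, List.getElem?_eq_getElem ht]
    rfl
  have block : ∀ x < n, ∀ p, off x ≤ p → p < off (x + 1) →
      ∃ (u : Fin n) (t : ℕ) (_ : t < (nbrs u).length), u.val = x ∧ p = off u + t := by
    intro x hx p h1 h2
    have := off_succ ⟨x, hx⟩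
    exact ⟨⟨x, hx⟩, p - off x, by dsimp only at this; omega, rfl, by dsimp only; omega⟩
  constructor
  · simp [off_eq]
  · change off n = _
    rw [off_eq _ le_rfl, List.take_of_length_le hlen.le]
  · intro x hx
    have := off_succ ⟨x, hx⟩
    dsimp only at this
    omega
  · intro x hx p h1 h2
    obtain ⟨u, t, ht, rfl, rfl⟩ := block x hx p h1 h2
    rw [adj_eq u t ht, len_eq u t ht, net_adj, net_len]
    exact ⟨(hN.mem_iff _ _).1 (List.getElem_mem ht), rfl⟩
  · intro x hx p q h1 h2 h3 h4 he
    obtain ⟨u, t, ht, rfl, rfl⟩ := block x hx p h1 h2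
    obtain ⟨u', t', ht', hu, rfl⟩ := block _ hx q h3 h4
    obtain rfl : u' = u := Fin.ext hu
    rw [adj_eq _ t ht, adj_eq _ t' ht'] at he
    rw [(hN.nodup u').getElem_inj_iff.1 (Fin.ext he)]
  · rintro x y ⟨u, v, rfl, rfl, h⟩
    obtain ⟨t, ht, rfl⟩ := List.mem_iff_getElem.1 ((hN.mem_iff u v).2 h)
    exact ⟨off u + t, by omega, by rw [off_succ]; omega, adj_eq u t ht⟩

/-- The handshake lemma. -/
theorem length_entries {nbrs : Fin n → List (Fin n)} (hN : IsAdjacencyList G nbrs) :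
    ((List.finRange n).flatMap nbrs).length = 2 * G.edgeSet.ncard := by
  classical
  rw [List.length_flatMap, ← Fin.sum_univ_def, Set.ncard_eq_toFinset_card',
    ← SimpleGraph.edgeFinset, ← SimpleGraph.sum_degrees_eq_twice_card_edges]
  refine Finset.sum_congr rfl fun u _ => ?_
  rw [← List.toFinset_card_of_nodup (hN.nodup u), ← SimpleGraph.card_neighborFinset_eq_degree]
  congr 1
  ext v
  simp [hN.mem_iff]

theorem walkLength_eq {u v : Fin n} (p : G.Walk u v) :
    walkLength ℓ p = ∑ t ∈ Finset.range p.length, ℓ s(p.getVert t, p.getVert (t + 1)) := by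
  induction p with
  | nil => simp [walkLength]
  | cons h p ih =>
    rw [SimpleGraph.Walk.length_cons, Finset.sum_range_succ', add_comm]
    simp only [SimpleGraph.Walk.getVert_cons_succ, ← ih]
    simp [walkLength]

theorem cyc_of_isCycle {v : Fin n} {C : G.Walk v v} (hC : C.IsCycle) :
    (net G ℓ hℓ).Cyc (fun i => C.getVert (i % C.length)) C.length ∧
      (net G ℓ hℓ).pathLen (fun i => C.getVert (i % C.length)) C.length = walkLength ℓ C := by
  have h3 := hC.three_le_length
  have hnext : ∀ i, C.getVert ((i + 1) % C.length) = C.getVert (i % C.length + 1) := by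
    intro i
    have hlt := Nat.mod_lt i (by omega : 0 < C.length)
    rcases (show i % C.length + 1 ≤ C.length from hlt).eq_or_lt with h | h
    · rw [h, SimpleGraph.Walk.getVert_length, Nat.add_mod, Nat.mod_eq_of_lt (by omega : 1 < C.length),
        h, Nat.mod_self, SimpleGraph.Walk.getVert_zero]
    · rw [Nat.add_mod, Nat.mod_eq_of_lt (by omega : 1 < C.length), Nat.mod_eq_of_lt h]
  refine ⟨⟨h3, fun i => by simp, fun i => ?_, fun i hi j hj he => ?_⟩, ?_⟩
  · rw [net_adj, hnext]
    exact C.adj_getVert_succ (Nat.mod_lt i (by omega))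
  · rw [Nat.mod_eq_of_lt hi, Nat.mod_eq_of_lt hj] at he
    exact hC.getVert_injOn' (by simp; omega) (by simp; omega) (Fin.ext he)
  · rw [walkLength_eq, Net.pathLen]
    refine Finset.sum_congr rfl fun t ht => ?_
    rw [net_len, hnext, Nat.mod_eq_of_lt (Finset.mem_range.1 ht)]

theorem exists_walk {u : ℕ → Fin n} (h : ∀ i, G.Adj (u i) (u (i + 1))) (m : ℕ) :
    ∃ p : G.Walk (u 0) (u m), p.length = m ∧ ∀ t ≤ m, p.getVert t = u t := by
  induction m with
  | zero => exact ⟨.nil, rfl, fun t ht => by obtain rfl : t = 0 := by omega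
                                             rfl⟩
  | succ m ih =>
    obtain ⟨p, hp, hv⟩ := ih
    refine ⟨p.concat (h m), by simp [hp], fun t ht => ?_⟩
    rw [SimpleGraph.Walk.concat_eq_append, SimpleGraph.Walk.getVert_append, hp]
    split_ifs with hlt
    · exact hv t hlt.le
    · rcases ht.eq_or_lt with rfl | h'
      · simp
      · obtain rfl : t = m := by omega
        simp

theorem exists_isCycle_of_cyc {c : ℕ → ℕ} {m : ℕ} (hc : (net G ℓ hℓ).Cyc c m) :
    ∃ (v : Fin n) (C : G.Walk v v), C.IsCycle ∧ C.length = m ∧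
      (∀ i < m, c i = (C.getVert i : ℕ)) ∧ walkLength ℓ C = (net G ℓ hℓ).pathLen c m := by
  set u : ℕ → Fin n := fun i => ⟨c i, hc.lt i⟩ with hu
  have hadj : ∀ i, G.Adj (u i) (u (i + 1)) := fun i =>
    (net_adj (hℓ := hℓ) (u := u i) (v := u (i + 1))).1 (hc.adj i)
  have h3 := hc.three
  have hm : u m = u 0 := Fin.ext (by simpa using hc.per 0)
  obtain ⟨p, hp, hv⟩ := exists_walk hadj m
  obtain ⟨C, hC, hCv⟩ : ∃ C : G.Walk (u 0) (u 0), C.length = m ∧ ∀ t ≤ m, C.getVert t = u t :=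
    ⟨p.copy rfl hm, by simpa using hp, fun t ht => by simpa using hv t ht⟩
  refine ⟨u 0, C, ?_, hC, fun i hi => by rw [hCv i hi.le], ?_⟩
  · rw [SimpleGraph.Walk.isCycle_iff_isPath_tail_and_le_length, hC]
    refine ⟨?_, h3⟩
    rw [← SimpleGraph.Walk.IsPath.getVert_injOn_iff]
    -- The tail of the walk visits c 1, …, c m with c m = c 0, so the injectivity on 0, …, m - 1 is
    -- shifted by one.
    have hinj : ∀ i, 1 ≤ i → i ≤ m → ∀ j, 1 ≤ j → j ≤ m → c i = c j → i = j := by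
      intro i h1 h2 j h4 h5 he
      have hcm : c m = c 0 := by simpa using hc.per 0
      rcases h2.eq_or_lt with rfl | h2
      · rcases h5.eq_or_lt with rfl | h5
        · rfl
        · have := hc.inj 0 (by omega) j h5 (by rw [← hcm, he])
          omega
      · rcases h5.eq_or_lt with rfl | h5
        · have := hc.inj i h2 0 (by omega) (by rw [← hcm, he])
          omega
        · exact hc.inj i h2 j h5 he
    have hlt := SimpleGraph.Walk.length_tail_add_one (p := C) (by
      rw [← SimpleGraph.Walk.length_eq_zero_iff.not]; omega)
    intro i hi j hj he
    simp only [Set.mem_ofPred_eq] at hi hj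
    rw [SimpleGraph.Walk.getVert_tail, SimpleGraph.Walk.getVert_tail, hCv _ (by omega),
      hCv _ (by omega)] at he
    have := hinj (i + 1) (by omega) (by omega) (j + 1) (by omega) (by omega) (congrArg Fin.val he)
    omega
  · rw [walkLength_eq, Net.pathLen, hC]
    refine Finset.sum_congr rfl fun t ht => ?_
    have ht := Finset.mem_range.1 ht
    rw [hCv t ht.le, hCv (t + 1) ht, ← net_len (hℓ := hℓ)]

/-- A bound on one cycle in terms of all cycles bounds it in terms of the girth. -/
theorem le_girth {a A : ℝ} (hA : 0 < A) (hG : ¬ G.IsAcyclic)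
    (h : ∀ (v : Fin n) (C : G.Walk v v), C.IsCycle → a ≤ A * walkLength ℓ C) :
    a ≤ A * girth G ℓ := by
  rw [← div_le_iff₀' hA]
  refine le_csInf ?_ ?_
  · simp only [SimpleGraph.IsAcyclic] at hG
    push Not at hG
    obtain ⟨v, C, hC⟩ := hG
    exact ⟨_, v, C, hC, rfl⟩
  · rintro _ ⟨v, C, hC, rfl⟩
    rw [div_le_iff₀' hA]
    exact h v C hC

end WeightedGraph

/-! ### The bounds -/

/-- With L = ⌊log₂ n⌋ ≥ 1: L + 1 ≤ 2L ≤ 3 L log 2 ≤ 3 log n, as log 2 > 2/3. -/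
theorem log_two_add_one_le {n : ℕ} (hn : 2 ≤ n) : ((Nat.log 2 n + 1 : ℕ) : ℝ) ≤ 3 * Real.log n := by
  have h1 : 1 ≤ Nat.log 2 n := Nat.log_pos (by norm_num) hn
  have h2 : ((2 : ℝ) ^ Nat.log 2 n) ≤ n := by exact_mod_cast Nat.pow_log_le_self 2 (by omega)
  have h3 := Real.log_le_log (by positivity) h2
  rw [Real.log_pow] at h3
  have h4 := Real.log_two_gt_d9
  have h5 : (1 : ℝ) ≤ Nat.log 2 n := by exact_mod_cast h1
  push_cast
  nlinarith

/-- If k is the number of levels, the k-th power of 2^(j - 1) is at most 2^(⌊log₂ n⌋ + 1) ≤ 2n ≤ 2^k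
n. Otherwise j = 2, and 2^j is the constant 4. -/
theorem numLevels_mul_le {n k : ℕ} (hn : 1 ≤ n) (hk : 1 ≤ k) :
    (numLevels n k : ℝ) * 2 ^ flipsPerLevel n k ≤ 4 * (k * (n : ℝ) ^ (1 / (k : ℝ))) := by
  have hn' : (1 : ℝ) ≤ n := by exact_mod_cast hn
  have hone : (1 : ℝ) ≤ (n : ℝ) ^ (1 / (k : ℝ)) := Real.one_le_rpow hn' (by positivity)
  have hkey : (2 : ℝ) ^ flipsPerLevel n k ≤ 4 * (n : ℝ) ^ (1 / (k : ℝ)) := by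
    unfold flipsPerLevel numLevels
    rcases le_total k (Nat.log 2 n + 1) with h | h
    · rw [min_eq_left h, pow_succ]
      have : (2 : ℝ) ^ ((Nat.log 2 n + 1) / k) ≤ 2 * (n : ℝ) ^ (1 / (k : ℝ)) := by
        rw [← pow_le_pow_iff_left₀ (by positivity) (by positivity) (by omega : k ≠ 0), ← pow_mul,
          mul_pow, one_div, Real.rpow_inv_natCast_pow (by positivity) (by omega)]
        calc (2 : ℝ) ^ ((Nat.log 2 n + 1) / k * k) ≤ 2 ^ (Nat.log 2 n + 1) :=
              pow_le_pow_right₀ (by norm_num) (Nat.div_mul_le_self _ _)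
          _ = 2 * 2 ^ Nat.log 2 n := by ring
          _ ≤ 2 ^ k * n := by
            have h1 : (2 : ℝ) ≤ 2 ^ k := le_self_pow₀ (by norm_num) (by omega)
            have h2 : ((2 : ℝ) ^ Nat.log 2 n) ≤ n := by
              exact_mod_cast Nat.pow_log_le_self 2 (by omega)
            exact mul_le_mul h1 h2 (by positivity) (by positivity)
      linarith
    · rw [min_eq_right h, Nat.div_self (by omega)]
      norm_num
      linarith [one_div (k : ℝ) ▸ hone]
  have hK : (numLevels n k : ℝ) ≤ k := by exact_mod_cast min_le_left _ _
  calc (numLevels n k : ℝ) * 2 ^ flipsPerLevel n k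
      ≤ k * (4 * (n : ℝ) ^ (1 / (k : ℝ))) := mul_le_mul hK hkey (by positivity) (by positivity)
    _ = _ := by ring

theorem Net.Cyc.pathLen_congr {G : Net} {c c' : ℕ → ℕ} {m : ℕ} (hc : G.Cyc c m) (hc' : G.Cyc c' m)
    (h : ∀ i < m, c i = c' i) : G.pathLen c m = G.pathLen c' m := by
  have h3 := hc.three
  have e : ∀ i, c i = c' i := fun i => by
    rw [← hc.mod, ← hc'.mod, h _ (Nat.mod_lt i (by omega))]
  simp [Net.pathLen, e]

theorem capacity_le {n k M c : ℕ} (hn : 2 ≤ n) (hk : 1 ≤ k) (hM : M ≤ n * n) (hc : 6 ≤ c) :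
    8 * (M + n + 1) + 8 ≤ (n + k) ^ c := by
  have h3 : 3 ≤ n + k := by omega
  calc 8 * (M + n + 1) + 8 ≤ 3 ^ 4 * (n * n) := by nlinarith
    _ ≤ (n + k) ^ 4 * ((n + k) * (n + k)) :=
      Nat.mul_le_mul (Nat.pow_le_pow_left h3 4) (Nat.mul_le_mul (by omega) (by omega))
    _ = (n + k) ^ 6 := by ring
    _ ≤ (n + k) ^ c := Nat.pow_le_pow_right (by omega) hc

theorem expected_cost_le {n k m : ℕ} (hn : 2 ≤ n) (hk : 1 ≤ k) :
    ((6010 * (Nat.log 2 n + 1) : ℕ) : ℝ) *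
      (2 * m + n + n * (numLevels n k * 2 ^ flipsPerLevel n k)) ≤
      100000 * (k * (n : ℝ) ^ (1 + 1 / (k : ℝ)) * Real.log n + m * Real.log n) := by
  have hn0 : (0 : ℝ) < n := by exact_mod_cast (by omega : 0 < n)
  have h1 := log_two_add_one_le hn
  have h2 := numLevels_mul_le (n := n) (by omega) hk
  have hone : (1 : ℝ) ≤ (n : ℝ) ^ (1 / (k : ℝ)) :=
    Real.one_le_rpow (by exact_mod_cast (by omega : 1 ≤ n)) (by positivity)
  have hk1 : (1 : ℝ) ≤ k := by exact_mod_cast hk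
  have hlog : 0 ≤ Real.log n := Real.log_natCast_nonneg n
  rw [Real.rpow_add hn0, Real.rpow_one]
  set X : ℝ := k * (n : ℝ) ^ (1 / (k : ℝ)) with hX
  have hX1 : 1 ≤ X := one_le_mul_of_one_le_of_one_le hk1 hone
  have h3 : (2 * m + n + n * (numLevels n k * 2 ^ flipsPerLevel n k) : ℝ) ≤ 2 * m + 5 * (n * X) := by
    have := mul_le_mul_of_nonneg_left h2 hn0.le
    have := mul_le_mul_of_nonneg_left hX1 hn0.le
    linarith
  have hm : (0 : ℝ) ≤ m := Nat.cast_nonneg m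
  have hnX : 0 ≤ n * X := by positivity
  have e : (k * (n * (n : ℝ) ^ (1 / (k : ℝ))) * Real.log n : ℝ) = n * X * Real.log n := by
    rw [hX]; ring
  rw [e]
  have h4 : ((6010 * (Nat.log 2 n + 1) : ℕ) : ℝ) ≤ 18030 * Real.log n := by
    push_cast at h1 ⊢
    linarith
  calc _ ≤ (18030 * Real.log n) * (2 * m + 5 * (n * X)) :=
        mul_le_mul h4 h3 (by positivity) (by positivity)
    _ = 36060 * (m * Real.log n) + 90150 * (n * X * Real.log n) := by ring
    _ ≤ _ := by nlinarith [mul_nonneg hm hlog, mul_nonneg hnX hlog]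

/-- The steps chosen need no measurability of T or S: monotonicity, a finite constant factor, and
addition of a constant hold for all functions. -/
theorem lintegral_cost_le {n k m : ℕ} {T S : (ℕ → Bool) → ℕ} {μ : Measure (ℕ → Bool)}
    [IsProbabilityMeasure μ] (hn : 2 ≤ n) (hk : 1 ≤ k)
    (hT : ∀ ω, T ω ≤ 6010 * (Nat.log 2 n + 1) * (2 * m + n + S ω))
    (hS : ∫⁻ ω, (S ω : ENNReal) ∂μ ≤ n * (numLevels n k * 2 ^ flipsPerLevel n k)) :
    ∫⁻ ω, (T ω : ENNReal) ∂μ ≤ ENNReal.ofReal ((100000 : ℕ) *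
      (k * (n : ℝ) ^ (1 + 1 / (k : ℝ)) * Real.log n + m * Real.log n)) := by
  set A := 6010 * (Nat.log 2 n + 1) with hA
  calc ∫⁻ ω, (T ω : ENNReal) ∂μ
      ≤ ∫⁻ ω, (A : ENNReal) * (((2 * m + n : ℕ) : ENNReal) + S ω) ∂μ :=
        lintegral_mono fun ω => (Nat.cast_le.2 (hT ω)).trans_eq (by push_cast; rfl)
    _ = A * (((2 * m + n : ℕ) : ENNReal) + ∫⁻ ω, (S ω : ENNReal) ∂μ) := by
        rw [lintegral_const_mul' _ _ (ENNReal.natCast_ne_top A), lintegral_add_left measurable_const,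
          lintegral_const, measure_univ, mul_one]
    _ ≤ A * (((2 * m + n : ℕ) : ENNReal) + n * (numLevels n k * 2 ^ flipsPerLevel n k)) := by gcongr
    _ = ((A * (2 * m + n + n * (numLevels n k * 2 ^ flipsPerLevel n k)) : ℕ) : ENNReal) := by
        push_cast; rfl
    _ = ENNReal.ofReal ((A * (2 * m + n + n * (numLevels n k * 2 ^ flipsPerLevel n k)) : ℕ) : ℝ) :=
        (ENNReal.ofReal_natCast _).symm
    _ ≤ _ := by
        refine ENNReal.ofReal_le_ofReal ?_
        have := expected_cost_le (m := m) hn hk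
        rw [← hA] at this
        push_cast at this ⊢
        exact this

end

/-! ### Conclusion -/

/-- There are one program `P` and one constant `c` such that, for all `n ≥ 2`, all `k ≥ 1` and
every graph on `n` vertices with positive real edge lengths, given by adjacency lists: on every
sequence of coin flips `P` halts, and it outputs a simple cycle of length at most `(4k/3)`
times the girth if the graph has a cycle; its number of steps `T` has expectation at most
`c (k n^{1+1/k} log n + m log n)`. Words have `O(log (n + k))` bits. -/
theorem theorem1 :
    ∃ (P : RealRAM.Prog) (c : ℕ), ∀ (n k : ℕ), 2 ≤ n → 1 ≤ k →
      ∀ (G : SimpleGraph (Fin n)) (ℓ : Sym2 (Fin n) → ℝ), (∀ e ∈ G.edgeSet, 0 < ℓ e) →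
      ∀ nbrs : Fin n → List (Fin n), WeightedGraph.IsAdjacencyList G nbrs →
      ∃ T : (ℕ → Bool) → ℕ,
        (∀ ω : ℕ → Bool, ∃ s' : RealRAM.State,
          RealRAM.Exec ((n + k) ^ c) P (WeightedGraph.input n k ℓ nbrs ω) (T ω) s' ∧
          (¬ G.IsAcyclic → ∃ (v : Fin n) (C : G.Walk v v), C.IsCycle ∧
            WeightedGraph.Outputs s' C ∧
            WeightedGraph.walkLength ℓ C ≤ 4 * (k : ℝ) / 3 * WeightedGraph.girth G ℓ)) ∧
        ∫⁻ ω, (T ω : ENNReal) ∂(RealRAM.coinMeasure) ≤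
          ENNReal.ofReal (c * (k * (n : ℝ) ^ (1 + 1 / (k : ℝ)) * Real.log n +
            G.edgeSet.ncard * Real.log n)) := by
  -- One number serves as the factor in the time bound and as the exponent of the word capacity; the
  -- time estimate needs 90150, the capacity only 6.
  refine ⟨RealRAM.program, 100000, fun n k hn hk G ℓ hℓ nbrs hN => ?_⟩
  have hE := fun ω => WeightedGraph.input_entries (hℓ := hℓ) hN k ω
  have hM := (hE fun _ => true).le_sq
  choose T s' hexec hT hC using fun ω => RealRAM.wp_program (s := WeightedGraph.input n k ℓ nbrs ω)
    (W := (n + k) ^ 100000) (k := k) rfl hn hk (capacity_le hn hk hM (by norm_num)) rfl rfl rfl rfl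
    rfl (fun _ => rfl) (hE ω)
  refine ⟨T, fun ω => ⟨s' ω, hexec ω, fun hG => ?_⟩, ?_⟩
  · obtain ⟨v, C, hcyc⟩ : ∃ (v : Fin n) (C : G.Walk v v), C.IsCycle := by
      simpa [SimpleGraph.IsAcyclic] using hG
    obtain ⟨c, hc, hout, -⟩ := hC ω _ _ (WeightedGraph.cyc_of_isCycle hcyc).1
    obtain ⟨v', C', hcyc', hlen, hvert, hwl⟩ := WeightedGraph.exists_isCycle_of_cyc hc
    refine ⟨v', C', hcyc', ⟨hlen.symm, fun i hi => ?_⟩, ?_⟩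
    · rw [hlen] at hi
      rw [hout i hi, hvert i hi]
    · have hk' : (0 : ℝ) < k := by exact_mod_cast hk
      refine WeightedGraph.le_girth (by positivity) hG fun u D hD => ?_
      obtain ⟨hDc, hDl⟩ := WeightedGraph.cyc_of_isCycle (hℓ := hℓ) hD
      -- The cycle provided may formally depend on D, but each one is read off from the same output
      -- cells, so all have the same length.
      obtain ⟨c', hc', hout', hle⟩ := hC ω _ _ hDc
      rw [hwl, hc.pathLen_congr hc' fun i hi => (hout i hi).symm.trans (hout' i hi), ← hDl]
      refine hle.trans (mul_le_mul_of_nonneg_right ?_ ?_)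
      · have : (numLevels n k : ℝ) ≤ k := by exact_mod_cast min_le_left _ _
        change 4 * (numLevels n k : ℝ) / 3 ≤ 4 * (k : ℝ) / 3
        linarith
      · exact Finset.sum_nonneg fun t _ => ((WeightedGraph.net G ℓ hℓ).pos (hDc.adj t)).le
  · refine lintegral_cost_le hn hk (fun ω => ?_)
      (RealRAM.lintegral_sum_card_cluster_le (G := WeightedGraph.net G ℓ hℓ) hk rfl)
    rw [← WeightedGraph.length_entries hN]
    exact hT ω
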